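/- **Setting.** Let $P$ be a convex polygon with vertices $v_1,\dots,v_n$ ($n\ge 3$) in clockwise order, no three of them collinear, and let $e_i$ be the open edge from $v_i$ to $v_{i+1}$ (indices modulo $n$). The vertices and the edges are the *units* of $P$. In a triangle $ABC$ with corners on $\partial P$, listed in clockwise order, the corner $A$ is *stable* if it has the largest distance to the line $BC$ among all points of $P$ on the right of $\overrightarrow{BC}$; likewise for $B$ with respect to $\overrightarrow{CA}$ and for $C$ with respect to $\overrightarrow{AB}$. The triangle is *3-stable* if all its corners are stable and are vertices of $P$. It is *generally 3-stable* if all its corners are stable and, in case exactly two of its corners are vertices, say $B,C$, while the third one, $A$, lies in an edge $e_i$, the point $A$ is an endpoint of the segment of all $A'\in e_i$ for which all corners of $A'BC$ are stable. **Machine model.** A real RAM: a fixed program with integer registers and arrays and real registers, in which every exact real operation ($+,-,\times,\div$), integer operation (including division with remainder), comparison, memory access, assignment, test and output costs one unit. The input is $n$ and the coordinates of $v_1,\dots,v_n$. **Visited pairs.** For distinct vertices $v_j,v_k$ and edges $e_p,e_q$ let $X_{j,k}(p,q)$ be the intersection of the ray from $v_j$ in the direction of $e_q$ with the ray from $v_k$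 in the direction opposite to $e_p$ (at infinite distance if they do not meet; at distance $0$ if they overlap). For a 3-stable triangle $v_rv_sv_t$, a run of the generalized Rotate-and-Kill process with parameters $(r,s,t)$ starts from $(u_1,u_2)=(v_s,v_t)$ and repeats the following until $(u_1,u_2)=(v_t,v_r)$: the current pair is visited; $v_j,v_k$ are the units $u_1,u_2$ or, for edges, their clockwise last endpoints; $A$ is a vertex on the right of $\overrightarrow{v_jv_k}$ farthest from the line $v_jv_k$; and $u_1$ is advanced to its clockwise next unit if $A$ is not farther (in the case $u_1$ a vertex and $u_2$ an edge: if $A$ is strictly closer) than $X_{j,k}(p,q)$, and $u_2$ is advanced otherwise. Here $e_p=e_j$ if $u_1=v_j$ and $e_p=u_1$ if $u_1$ is an edge; likewise $e_q=e_k$ or $e_q=u_2$. The visited pairs are those of the three runs with parameters $(r,s,t)$, $(s,t,r)$, $(t,r,s)$. **Optimized final step (Algorithm 4 with the batch technique).** Let $A_{j,k}$ and $A^*_{j,k}$ be the clockwise first and last vertices on the right of $\overrightarrow{v_jv_k}$ farthest from the line $v_jv_k$. Given the visited pairs, the final step does the following, where testing a unit $u$ with a pair $(u_1,u_2)$ means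 to compute, in $O(1)$ time, and to output the generally 3-stable triangles with corners in $u,u_1,u_2$. 1. For each visited vertex pair $(v_j,v_k)$, it tests all units from $A_{j,k}$ clockwise to $A^*_{j,k}$. 2. It splits the sequence of visited edge pairs into batches of successive pairs with a common first edge or with a common second edge. For a batch from $(e_j,e_k)$ to $(e_{j'},e_{k'})$ it goes through the units between $A_{j,k}$ and $A^*_{j'+1,k'+1}$ in one scan, testing with a pair $(e_a,e_b)$ of the batch only the units that meet the open strip between the parallels to $e_a$ through the endpoints of $e_b$ (common first edge $e_a$), respectively between the parallels to $e_b$ through the endpoints of $e_a$ (common second edge $e_b$). **Theorem.** There is an absolute constant $c$ such that the following holds for every convex $n$-gon $P$ as above. 1. For every 3-stable triangle $v_rv_sv_t$ of $P$, the optimized final step, started with the visited pairs that belong to $(r,s,t)$, halts after at most $c\,n$ steps, and it outputs exactly the generally 3-stable triangles of $P$ (possibly with repetitions). 2. The entire algorithm, which on the input $P$ computes one 3-stable triangle $v_rv_sv_t$ (starting from a largest triangle rooted at a vertex and moving its corners around $P$), then the visited pairs, and then runs the optimized final step, halts after at most $c\,n$ steps, and it outputs exactly the generally 3-stable triangles of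 $P$ (possibly with repetitions). Consequently, all generally 3-stable triangles of a convex $n$-gon can be computed in $O(n)$ time. -/

import Mathlib

noncomputable section

namespace StableTri

/-! ### Convex polygons and generally 3-stable triangles -/

/-- Points of the Euclidean plane. -/
abbrev Point : Type := EuclideanSpace ℝ (Fin 2)

/-- The two-dimensional cross product. -/
def det (a b : Point) : ℝ := a 0 * b 1 - a 1 * b 0

/-- Twice the signed area of `A B C`. It is negative exactly when `A, B, C` are in clockwise order,
equivalently when `C` lies (strictly) on the right of the directed line from `A` to `B`. -/
def orient (A B C : Point) : ℝ := det (B - A) (C - A)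

/-- `v` lists the vertices of a convex `n`-gon in clockwise order, no three of them collinear. -/
def IsConvexPolygon {n : ℕ} (v : Fin n → Point) : Prop :=
  3 ≤ n ∧ ∀ i j k : Fin n, i < j → j < k → orient (v i) (v j) (v k) < 0

/-- The clockwise next index. -/
def nextIdx {n : ℕ} (i : Fin n) : Fin n :=
  ⟨(i.val + 1) % n, Nat.mod_lt _ (Nat.lt_of_le_of_lt (Nat.zero_le _) i.isLt)⟩

/-- The polygon, with its interior. -/
def region {n : ℕ} (v : Fin n → Point) : Set Point := convexHull ℝ (Set.range v)

/-- The `i`-th edge; edges do not contain their endpoints. -/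
def edge {n : ℕ} (v : Fin n → Point) (i : Fin n) : Set Point :=
  openSegment ℝ (v i) (v (nextIdx i))

/-- The boundary of the polygon. -/
def boundary {n : ℕ} (v : Fin n → Point) : Set Point :=
  ⋃ i, segment ℝ (v i) (v (nextIdx i))

/-- The distance from `X` to the line through `B` and `C`. -/
def lineDist (B C X : Point) : ℝ := Metric.infDist X (line[ℝ, B, C] : Set Point)

/-- The corner `A` of the clockwise triangle `A B C` is stable: it has the largest distance to the
line `BC` among all points of the polygon that lie on the right of `BC`. -/
def CornerStable {n : ℕ} (v : Fin n → Point) (A B C : Point) : Prop :=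
  ∀ X ∈ region v, orient B C X < 0 → lineDist B C X ≤ lineDist B C A

/-- `A B C` is a triangle in clockwise order, with its corners on the boundary, all stable. -/
structure AllStable {n : ℕ} (v : Fin n → Point) (A B C : Point) : Prop where
  mem₁ : A ∈ boundary v
  mem₂ : B ∈ boundary v
  mem₃ : C ∈ boundary v
  clockwise : orient A B C < 0
  stable₁ : CornerStable v A B C
  stable₂ : CornerStable v B C A
  stable₃ : CornerStable v C A B

/-- 3-stable triangles. -/
def ThreeStable {n : ℕ} (v : Fin n → Point) (A B C : Point) : Prop :=
  AllStable v A B C ∧ A ∈ Set.range v ∧ B ∈ Set.range v ∧ C ∈ Set.range v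

/-- If `B`, `C` are vertices and `A` lies in an edge, then `A` is an endpoint of the segment that is
formed by the points `A'` of this edge for which all corners of `A' B C` are stable. -/
def Representative {n : ℕ} (v : Fin n → Point) (A B C : Point) : Prop :=
  ∀ i : Fin n, A ∈ edge v i → B ∈ Set.range v → C ∈ Set.range v →
    A ∈ Set.extremePoints ℝ {A' ∈ edge v i | AllStable v A' B C}

/-- Generally 3-stable triangles: all corners are on the boundary and stable and, if exactly two of
the corners are vertices, then the triangle is a representative of its equivalence class. -/
def GenThreeStable {n : ℕ} (v : Fin n → Point) (A B C : Point) : Prop :=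
  AllStable v A B C ∧
    Representative v A B C ∧ Representative v B C A ∧ Representative v C A B

/-! ### The machine: a real RAM

A program is a while-program over integer registers, integer arrays, real registers and read-only
real arrays; every operation costs one unit. -/

/-- The coordinates of three points. -/
abbrev OutTri : Type := (ℝ × ℝ) × (ℝ × ℝ) × (ℝ × ℝ)

structure State where
  ireg : ℕ → ℤ
  iarr : ℕ → ℤ → ℤ
  rreg : ℕ → ℝ
  rarr : ℕ → ℤ → ℝ
  out : List OutTri

inductive IExp where
  | lit (z : ℤ)
  | reg (x : ℕ)
  | arr (a : ℕ) (i : IExp)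
  | add (a b : IExp)
  | sub (a b : IExp)
  | div (a b : IExp)
  | mod (a b : IExp)

inductive RExp where
  | lit (z : ℤ)
  | reg (x : ℕ)
  | arr (a : ℕ) (i : IExp)
  | add (a b : RExp)
  | sub (a b : RExp)
  | mul (a b : RExp)
  | div (a b : RExp)

inductive BExp where
  | ilt (a b : IExp)
  | ieq (a b : IExp)
  | rlt (a b : RExp)
  | req (a b : RExp)
  | not (a : BExp)
  | and (a b : BExp)
  | or (a b : BExp)

inductive Cmd where
  | skip
  | iset (x : ℕ) (e : IExp)
  | istore (a : ℕ) (i e : IExp)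
  | rset (x : ℕ) (e : RExp)
  | emit (x₁ y₁ x₂ y₂ x₃ y₃ : RExp)
  | seq (c d : Cmd)
  | ite (b : BExp) (c d : Cmd)
  | loop (b : BExp) (c : Cmd)

def IExp.eval (σ : State) : IExp → ℤ
  | .lit z => z
  | .reg x => σ.ireg x
  | .arr a i => σ.iarr a (i.eval σ)
  | .add a b => a.eval σ + b.eval σ
  | .sub a b => a.eval σ - b.eval σ
  | .div a b => a.eval σ / b.eval σ
  | .mod a b => a.eval σ % b.eval σ

def RExp.eval (σ : State) : RExp → ℝ
  | .lit z => (z : ℝ)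
  | .reg x => σ.rreg x
  | .arr a i => σ.rarr a (i.eval σ)
  | .add a b => a.eval σ + b.eval σ
  | .sub a b => a.eval σ - b.eval σ
  | .mul a b => a.eval σ * b.eval σ
  | .div a b => a.eval σ / b.eval σ

def BExp.eval (σ : State) : BExp → Prop
  | .ilt a b => a.eval σ < b.eval σ
  | .ieq a b => a.eval σ = b.eval σ
  | .rlt a b => a.eval σ < b.eval σ
  | .req a b => a.eval σ = b.eval σ
  | .not a => ¬ a.eval σ
  | .and a b => a.eval σ ∧ b.eval σ
  | .or a b => a.eval σ ∨ b.eval σ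

/-- The cost of evaluating an expression: its number of operations, reads and constants. -/
def IExp.cost : IExp → ℕ
  | .lit _ => 1
  | .reg _ => 1
  | .arr _ i => i.cost + 1
  | .add a b => a.cost + b.cost + 1
  | .sub a b => a.cost + b.cost + 1
  | .div a b => a.cost + b.cost + 1
  | .mod a b => a.cost + b.cost + 1

def RExp.cost : RExp → ℕ
  | .lit _ => 1
  | .reg _ => 1
  | .arr _ i => i.cost + 1
  | .add a b => a.cost + b.cost + 1
  | .sub a b => a.cost + b.cost + 1
  | .mul a b => a.cost + b.cost + 1
  | .div a b => a.cost + b.cost + 1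

def BExp.cost : BExp → ℕ
  | .ilt a b => a.cost + b.cost + 1
  | .ieq a b => a.cost + b.cost + 1
  | .rlt a b => a.cost + b.cost + 1
  | .req a b => a.cost + b.cost + 1
  | .not a => a.cost + 1
  | .and a b => a.cost + b.cost + 1
  | .or a b => a.cost + b.cost + 1

def State.iset (σ : State) (x : ℕ) (z : ℤ) : State :=
  { σ with ireg := Function.update σ.ireg x z }

def State.rset (σ : State) (x : ℕ) (z : ℝ) : State :=
  { σ with rreg := Function.update σ.rreg x z }

def State.istore (σ : State) (a : ℕ) (i z : ℤ) : State :=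
  { σ with iarr := Function.update σ.iarr a (Function.update (σ.iarr a) i z) }

def State.emit (σ : State) (T : OutTri) : State :=
  { σ with out := σ.out ++ [T] }

/-- `Exec c σ τ σ'`: started in the state `σ`, the program `c` halts in the state `σ'` after exactly
`τ` steps. -/
inductive Exec : Cmd → State → ℕ → State → Prop where
  | skip (σ : State) : Exec .skip σ 1 σ
  | iset (σ : State) (x : ℕ) (e : IExp) :
      Exec (.iset x e) σ (e.cost + 1) (σ.iset x (e.eval σ))
  | istore (σ : State) (a : ℕ) (i e : IExp) :
      Exec (.istore a i e) σ (i.cost + e.cost + 1) (σ.istore a (i.eval σ) (e.eval σ))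
  | rset (σ : State) (x : ℕ) (e : RExp) :
      Exec (.rset x e) σ (e.cost + 1) (σ.rset x (e.eval σ))
  | emit (σ : State) (x₁ y₁ x₂ y₂ x₃ y₃ : RExp) :
      Exec (.emit x₁ y₁ x₂ y₂ x₃ y₃) σ
        (x₁.cost + y₁.cost + x₂.cost + y₂.cost + x₃.cost + y₃.cost + 1)
        (σ.emit ((x₁.eval σ, y₁.eval σ), (x₂.eval σ, y₂.eval σ), (x₃.eval σ, y₃.eval σ)))
  | seq {c d : Cmd} {σ₁ σ₂ σ₃ : State} {τ₁ τ₂ : ℕ} :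
      Exec c σ₁ τ₁ σ₂ → Exec d σ₂ τ₂ σ₃ → Exec (.seq c d) σ₁ (τ₁ + τ₂) σ₃
  | ite_true {b : BExp} {c d : Cmd} {σ₁ σ₂ : State} {τ : ℕ} :
      b.eval σ₁ → Exec c σ₁ τ σ₂ → Exec (.ite b c d) σ₁ (b.cost + 1 + τ) σ₂
  | ite_false {b : BExp} {c d : Cmd} {σ₁ σ₂ : State} {τ : ℕ} :
      ¬ b.eval σ₁ → Exec d σ₁ τ σ₂ → Exec (.ite b c d) σ₁ (b.cost + 1 + τ) σ₂
  | loop_true {b : BExp} {c : Cmd} {σ₁ σ₂ σ₃ : State} {τ₁ τ₂ : ℕ} :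
      b.eval σ₁ → Exec c σ₁ τ₁ σ₂ → Exec (.loop b c) σ₂ τ₂ σ₃ →
        Exec (.loop b c) σ₁ (b.cost + 1 + τ₁ + τ₂) σ₃
  | loop_false {b : BExp} {c : Cmd} {σ : State} :
      ¬ b.eval σ → Exec (.loop b c) σ (b.cost + 1) σ

/-! ### Abbreviations for writing programs -/

instance : Add IExp := ⟨.add⟩
instance : Sub IExp := ⟨.sub⟩
instance : Div IExp := ⟨.div⟩
instance : Mod IExp := ⟨.mod⟩
instance (m : ℕ) : OfNat IExp m := ⟨.lit m⟩
instance : Add RExp := ⟨.add⟩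
instance : Sub RExp := ⟨.sub⟩
instance : Mul RExp := ⟨.mul⟩
instance : Div RExp := ⟨.div⟩
instance (m : ℕ) : OfNat RExp m := ⟨.lit m⟩

/-- Sequential composition of a list of commands. -/
def block : List Cmd → Cmd
  | [] => .skip
  | [c] => c
  | c :: cs => .seq c (block cs)

/-- A conditional command without an `else` branch. -/
def when (b : BExp) (c : Cmd) : Cmd := .ite b c .skip

def ile (a b : IExp) : BExp := .not (.ilt b a)
def rle (a b : RExp) : BExp := .not (.rlt b a)
def even (a : IExp) : BExp := .ieq (a % 2) 0
def odd (a : IExp) : BExp := .ieq (a % 2) 1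

/-- Integer registers. The register `iN` holds the number of vertices. -/
def iN : ℕ := 0
def iR : ℕ := 1
def iS : ℕ := 2
def iT : ℕ := 3
def iA : ℕ := 4
def iB : ℕ := 5
def iC : ℕ := 6
def iDir : ℕ := 7
def iB₀ : ℕ := 8
def iC₀ : ℕ := 9
def iU₁ : ℕ := 10
def iU₂ : ℕ := 11
def iLen : ℕ := 12
def iJ : ℕ := 13
def iK : ℕ := 14
def iM : ℕ := 15
def iNumE : ℕ := 16
def iFst : ℕ := 17
def iLst : ℕ := 18
def iA₁ : ℕ := 19
def iA₂ : ℕ := 20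
def iX : ℕ := 21
def iG₁ : ℕ := 22
def iG₂ : ℕ := 23
def iG₃ : ℕ := 24

/-- Integer arrays: the visited unit pairs, and the visited edge pairs. -/
def aU₁ : ℕ := 0
def aU₂ : ℕ := 1
def aEJ : ℕ := 2
def aEK : ℕ := 3

/-- Real registers. -/
def rBest : ℕ := 0
def rW : ℕ := 1
def rNum : ℕ := 2
def rDist : ℕ := 3
def rLo : ℕ := 4
def rHi : ℕ := 5
def rL₁ : ℕ := 6
def rL₂ : ℕ := 7
def rL₃ : ℕ := 8
def rX₁ : ℕ := 9
def rY₁ : ℕ := 10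
def rX₂ : ℕ := 11
def rY₂ : ℕ := 12
def rX₃ : ℕ := 13
def rY₃ : ℕ := 14

/-- The value of an integer register. -/
abbrev I (x : ℕ) : IExp := .reg x

/-- The value of a real register. -/
abbrev R (x : ℕ) : RExp := .reg x

/-- A point or vector that is given by expressions for its coordinates. -/
abbrev PExp : Type := RExp × RExp

def pdet (p q : PExp) : RExp := p.1 * q.2 - p.2 * q.1
def psub (p q : PExp) : PExp := (p.1 - q.1, p.2 - q.2)

/-- The vertex `v_i`, subscripts taken modulo `n`. -/
def vtx (i : IExp) : PExp := (.arr 0 (i % I iN), .arr 1 (i % I iN))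

/-- The vector from `v_i` to `v_{i+1}`. -/
def evec (i : IExp) : PExp := psub (vtx (i + 1)) (vtx i)

/-- The distance of the point `x` to the line `bc`, times the length of `bc`, with a positive sign
on the right of `bc`. -/
def pdist (b c x : PExp) : RExp := pdet (psub x b) (psub c b)

/-- The same for vertices. -/
def dist (b c x : IExp) : RExp := pdist (vtx b) (vtx c) (vtx x)

/-- Vertex `x` is farther than vertex `y` in the distance to the line `v_b v_c`. -/
def farther (b c x y : IExp) : BExp := .rlt (dist b c y) (dist b c x)

/-! ### Computing one 3-stable triangle -/

/-- The passes over `B` and `C` that follow a move of `A`. -/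
def adjustBC : Cmd := block [
  .loop (farther (I iC) (I iA) (I iB + I iDir) (I iB)) (.iset iB (I iB + I iDir)),
  .loop (farther (I iA) (I iB) (I iC + I iDir) (I iC)) (.iset iC (I iC + I iDir))]

/-- Computes indices `r, s, t` of a 3-stable triangle: start from the largest triangle that is
rooted at `v_0`, then move its corners in one of the two directions around the polygon. -/
def findOne : Cmd := block [
  .rset rBest 0,
  .iset iC 2,
  .iset iB 1,
  .loop (.ilt (I iB) (I iN - 1)) (block [
    when (ile (I iC) (I iB)) (.iset iC (I iB + 1)),
    .loop (farther 0 (I iB) (I iC + 1) (I iC)) (.iset iC (I iC + 1)),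
    when (.rlt (R rBest) (dist 0 (I iB) (I iC))) (block [
      .rset rBest (dist 0 (I iB) (I iC)),
      .iset iB₀ (I iB),
      .iset iC₀ (I iC)]),
    .iset iB (I iB + 1)]),
  .iset iA 0,
  .iset iB (I iB₀),
  .iset iC (I iC₀),
  .ite (farther (I iB) (I iC) (I iA + 1) (I iA)) (.iset iDir 1) (.iset iDir (0 - 1)),
  .loop (farther (I iB) (I iC) (I iA + I iDir) (I iA)) (block [
    .iset iA (I iA + I iDir),
    adjustBC,
    .loop (.or (farther (I iC) (I iA) (I iB + I iDir) (I iB))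
        (farther (I iA) (I iB) (I iC + I iDir) (I iC))) adjustBC]),
  .iset iR (I iA % I iN),
  .iset iS (I iB % I iN),
  .iset iT (I iC % I iN)]

/-! ### The generalized Rotate-and-Kill process

Units are coded by integers: `2 i` is the vertex `v_i` and `2 i + 1` is the edge `e_i` from `v_i` to
`v_{i+1}`. Indices are not reduced modulo `n`, so that clockwise moves increase them. -/

/-- One run of the process, with parameters `(r, s, t)`. Let `p`, `q` be the indices of the edges
that leave the unit pair, or contain it: `e_p, e_q` are `e_j, e_k` at `(v_j, v_k)`,
`e_{j-1}, e_{k-1}` at `(e_{j-1}, e_{k-1})`, and so on. The vertex `A` is compared with the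
intersection `X` of the ray from `v_j` in the direction of `e_q` with the ray from `v_k` in the
direction opposite to `e_p`; so `X` is `I`, `H`, `J` or `K`, according to the kinds of the units.
With `w = det e_p e_q`, `D = v_k - v_j`, `num = det e_p D * det D e_q`, the point `X` is infinite if
`w > 0`, and otherwise its distance to the line `v_j v_k` is `num / (-w)` in the same scale as
`dist` (infinite if this is a positive number divided by zero). Both `w` and `num` vanish only at a
pair `(v_j, e_j)`, where the two rays overlap along `e_j`, at distance zero; the comparison `A < X` is
then false, as it should be. -/
def visitRun (r s t : IExp) : Cmd := block [
  .iset iU₁ (s + s),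
  .iset iU₂ (t + t),
  .iset iA r,
  .loop (.not (.and (.ieq (I iU₁) (t + t)) (.ieq (I iU₂) (r + r)))) (block [
    -- the unit pair is visited
    .istore aU₁ (I iLen) (I iU₁),
    .istore aU₂ (I iLen) (I iU₂),
    .iset iLen (I iLen + 1),
    -- the terminal endpoints of the units
    .iset iJ ((I iU₁ + 1) / 2),
    .iset iK ((I iU₂ + 1) / 2),
    .loop (farther (I iJ) (I iK) (I iA + 1) (I iA)) (.iset iA (I iA + 1)),
    .rset rW (pdet (evec (I iU₁ / 2)) (evec (I iU₂ / 2))),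
    .rset rNum (pdet (evec (I iU₁ / 2)) (psub (vtx (I iK)) (vtx (I iJ))) *
      pdet (psub (vtx (I iK)) (vtx (I iJ))) (evec (I iU₂ / 2))),
    .rset rDist (dist (I iJ) (I iK) (I iA)),
    .ite (.and (even (I iU₁)) (odd (I iU₂)))
      -- vertex-edge pair: `A < X`
      (.ite (.or (.rlt 0 (R rW)) (.rlt (R rDist * (0 - R rW)) (R rNum)))
        (.iset iU₁ (I iU₁ + 1)) (.iset iU₂ (I iU₂ + 1)))
      -- other pairs: `A ≤ X`
      (.ite (.or (.rlt 0 (R rW)) (rle (R rDist * (0 - R rW)) (R rNum)))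
        (.iset iU₁ (I iU₁ + 1)) (.iset iU₂ (I iU₂ + 1)))])]

/-- Computes the visited unit pairs, by three runs with parameters `(r, s, t)`, `(s, t, r)` and
`(t, r, s)`. They are stored in the arrays `aU₁`, `aU₂`, in the order of the visits. -/
def visitPairs : Cmd := block [
  when (.ilt (I iS) (I iR)) (.iset iS (I iS + I iN)),
  when (.ilt (I iT) (I iS)) (.iset iT (I iT + I iN)),
  .iset iLen 0,
  visitRun (I iR + I iN) (I iS) (I iT),
  visitRun (I iS + I iN) (I iT) (I iR + I iN),
  visitRun (I iT + I iN) (I iR + I iN) (I iS + I iN)]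

/-! ### The gadget

The units are given in `iG₁, iG₂, iG₃`. A corner in the unit `g` is the point
`v_i + l (v_{i+1} - v_i)` with `i = g / 2`, where `l = 0` for a vertex and `0 < l < 1` for an edge. -/

def corner (g : IExp) (l : RExp) : PExp :=
  ((vtx (g / 2)).1 + l * (evec (g / 2)).1, (vtx (g / 2)).2 + l * (evec (g / 2)).2)

/-- The parameter is a valid one for the unit. -/
def inUnit (g : IExp) (l : RExp) : BExp := .or (even g) (.and (.rlt 0 l) (.rlt l 1))

/-- `A` is on the right of `BC` and at least as far from it as the vertices that precede and follow
`A` on the boundary, where `g` is the unit of `A`. -/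
def cornerTest (g : IExp) (A B C : PExp) : BExp :=
  .and (.rlt 0 (pdist B C A))
    (.and (rle (pdist B C (vtx ((g - 1) / 2))) (pdist B C A))
      (rle (pdist B C (vtx ((g + 2) / 2))) (pdist B C A)))

/-- Outputs the triangle with the given units and parameters if all its corners are stable. -/
def report : Cmd := block [
  .rset rX₁ (corner (I iG₁) (R rL₁)).1,
  .rset rY₁ (corner (I iG₁) (R rL₁)).2,
  .rset rX₂ (corner (I iG₂) (R rL₂)).1,
  .rset rY₂ (corner (I iG₂) (R rL₂)).2,
  .rset rX₃ (corner (I iG₃) (R rL₃)).1,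
  .rset rY₃ (corner (I iG₃) (R rL₃)).2,
  when (.and (inUnit (I iG₁) (R rL₁)) (.and (inUnit (I iG₂) (R rL₂)) (.and (inUnit (I iG₃) (R rL₃))
      (.and (cornerTest (I iG₁) (R rX₁, R rY₁) (R rX₂, R rY₂) (R rX₃, R rY₃))
        (.and (cornerTest (I iG₂) (R rX₂, R rY₂) (R rX₃, R rY₃) (R rX₁, R rY₁))
          (cornerTest (I iG₃) (R rX₃, R rY₃) (R rX₁, R rY₁) (R rX₂, R rY₂)))))))
    (.emit (R rX₁) (R rY₁) (R rX₂) (R rY₂) (R rX₃) (R rY₃))]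

/-- The parameter, on the line of `e_i`, of its intersection with the parallel to `e_j` through the
point `p`. -/
def param (i : IExp) (p : PExp) (j : IExp) : RExp :=
  pdet (evec j) (psub p (vtx i)) / pdet (evec j) (evec i)

/-- Tries the intersection of the edge `iG₁` with the parallel to `e_q` through `v_p`. -/
def tryLine (p q : IExp) : Cmd :=
  when (.not (.req (pdet (evec q) (evec (I iG₁ / 2))) 0)) (block [
    .rset rL₁ (param (I iG₁ / 2) (vtx p) q),
    report])

/-- The gadget for a unit `iG₁` and two vertices `iG₂ = v_j`, `iG₃ = v_k`. If `iG₁` is an edge, it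
tries the intersections with the four lines that bound `Q_{j,k}`. -/
def gadgetVV : Cmd := block [
  .rset rL₂ 0,
  .rset rL₃ 0,
  .ite (even (I iG₁))
    (block [.rset rL₁ 0, report])
    (block [
      tryLine (I iG₂ / 2) (I iG₃ / 2 - 1),
      tryLine (I iG₂ / 2) (I iG₃ / 2),
      tryLine (I iG₃ / 2) (I iG₂ / 2 - 1),
      tryLine (I iG₃ / 2) (I iG₂ / 2)])]

/-- The parameter, on the line of `e_i`, of the midpoint of its intersections with the lines of `e_j`
and `e_k`. -/
def midParam (i j k : IExp) : RExp := (param i (vtx j) j + param i (vtx k) k) / 2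

def parallel (i j : IExp) : BExp := .req (pdet (evec i) (evec j)) 0

/-- The gadget for a unit `iG₁` and two edges `iG₂`, `iG₃`. -/
def gadgetEE : Cmd :=
  when (.not (parallel (I iG₂ / 2) (I iG₃ / 2)))
    (.ite (even (I iG₁))
      (block [
        .rset rL₁ 0,
        .rset rL₂ (param (I iG₂ / 2) (vtx (I iG₁ / 2)) (I iG₃ / 2)),
        .rset rL₃ (param (I iG₃ / 2) (vtx (I iG₁ / 2)) (I iG₂ / 2)),
        report])
      (when (.not (.or (parallel (I iG₁ / 2) (I iG₂ / 2)) (parallel (I iG₁ / 2) (I iG₃ / 2))))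
        (block [
          .rset rL₁ (midParam (I iG₁ / 2) (I iG₂ / 2) (I iG₃ / 2)),
          .rset rL₂ (midParam (I iG₂ / 2) (I iG₃ / 2) (I iG₁ / 2)),
          .rset rL₃ (midParam (I iG₃ / 2) (I iG₁ / 2) (I iG₂ / 2)),
          report])))

/-! ### The final step, with the batch technique -/

/-- For every visited vertex pair `(v_j, v_k)`, calls the gadget for the units from `A_{j,k}` to
`A*_{j,k}`, the clockwise first and last vertex farthest from the line `v_j v_k` on its right. -/
def vertexPhase : Cmd := block [
  .iset iA 0,
  .iset iM 0,
  .loop (.ilt (I iM) (I iLen)) (block [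
    .iset iG₂ (.arr aU₁ (I iM)),
    .iset iG₃ (.arr aU₂ (I iM)),
    when (.and (even (I iG₂)) (even (I iG₃))) (block [
      .iset iJ (I iG₂ / 2),
      .iset iK (I iG₃ / 2),
      when (.ilt (I iA) (I iK)) (.iset iA (I iK)),
      .loop (farther (I iJ) (I iK) (I iA + 1) (I iA)) (.iset iA (I iA + 1)),
      .iset iG₁ (I iA + I iA),
      gadgetVV,
      when (.req (dist (I iJ) (I iK) (I iA + 1)) (dist (I iJ) (I iK) (I iA))) (block [
        .iset iG₁ (I iA + I iA + 1),
        gadgetVV,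
        .iset iG₁ (I iA + I iA + 2),
        gadgetVV])]),
    .iset iM (I iM + 1)])]

/-- Collects the indices of the visited edge pairs, in the order of the visits. -/
def collectEdgePairs : Cmd := block [
  .iset iNumE 0,
  .iset iM 0,
  .loop (.ilt (I iM) (I iLen)) (block [
    when (.and (odd (.arr aU₁ (I iM))) (odd (.arr aU₂ (I iM)))) (block [
      .istore aEJ (I iNumE) (.arr aU₁ (I iM) / 2),
      .istore aEK (I iNumE) (.arr aU₂ (I iM) / 2),
      .iset iNumE (I iNumE + 1)]),
    .iset iM (I iM + 1)])]

/-- For the batch of the edge pairs number `iFst` to `iLst`, from `(e_j, e_k)` to `(e_{j'}, e_{k'})`,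
computes `iA₁ = A_{j,k}` and `iA₂ = A*_{j'+1,k'+1}`. The units from `iA₁` to `iA₂` are going to be
enumerated by `iX`, from the last one to the first one. -/
def prepareBatch : Cmd := block [
  .iset iJ (.arr aEJ (I iFst)),
  .iset iK (.arr aEK (I iFst)),
  when (.ilt (I iA₁) (I iK)) (.iset iA₁ (I iK)),
  .loop (farther (I iJ) (I iK) (I iA₁ + 1) (I iA₁)) (.iset iA₁ (I iA₁ + 1)),
  .iset iJ (.arr aEJ (I iLst) + 1),
  .iset iK (.arr aEK (I iLst) + 1),
  when (.ilt (I iA₂) (I iK)) (.iset iA₂ (I iK)),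
  .loop (rle (dist (I iJ) (I iK) (I iA₂)) (dist (I iJ) (I iK) (I iA₂ + 1)))
    (.iset iA₂ (I iA₂ + 1)),
  .iset iX (I iA₂ + I iA₂)]

/-- Vertex `x` is at distance `height e x` from the line of the edge `e`, up to scale. -/
def height (e x : IExp) : RExp := dist e (e + 1) x

/-- Calls the gadget for the unit `iX` and the edge pair `(e_j, e_k)`. -/
def callEE : Cmd := block [
  .iset iG₁ (I iX),
  .iset iG₂ (I iJ + I iJ + 1),
  .iset iG₃ (I iK + I iK + 1),
  gadgetEE]

/-- A batch in a row: edge pairs `(e_j, e_k), (e_j, e_{k+1}), …`. For each of them the units that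
meet the open strip between the parallels to `e_j` through the endpoints of `e_k` are handled. The
strip is empty, and the pair is skipped, if `v_{k+1}` is not farther than `v_k` from `e_j`. -/
def rowBatch : Cmd :=
  .loop (ile (I iFst) (I iLst)) (block [
    .iset iJ (.arr aEJ (I iFst)),
    .iset iK (.arr aEK (I iFst)),
    .rset rLo (height (I iJ) (I iK)),
    .rset rHi (height (I iJ) (I iK + 1)),
    when (.rlt (R rLo) (R rHi)) (block [
      .loop (.and (ile (I iA₁ + I iA₁) (I iX)) (.rlt (height (I iJ) (I iX / 2)) (R rHi))) (block [
        when (.rlt (R rLo) (height (I iJ) (I iX / 2))) callEE,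
        .iset iX (I iX - 1)]),
      when (.and (ile (I iA₁ + I iA₁) (I iX)) (.rlt (height (I iJ) ((I iX + 1) / 2)) (R rHi)))
        callEE]),
    .iset iFst (I iFst + 1)])

/-- A batch in a column: edge pairs `(e_j, e_k), (e_{j+1}, e_k), …`. For each of them the units that
meet the open strip between the parallels to `e_k` through the endpoints of `e_j` are handled. -/
def columnBatch : Cmd :=
  .loop (ile (I iFst) (I iLst)) (block [
    .iset iJ (.arr aEJ (I iFst)),
    .iset iK (.arr aEK (I iFst)),
    .rset rLo (height (I iK) (I iJ + 1)),
    .rset rHi (height (I iK) (I iJ)),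
    when (.rlt (R rLo) (R rHi)) (block [
      .loop (.and (ile (I iA₁ + I iA₁) (I iX)) (.rlt (R rLo) (height (I iK) (I iX / 2)))) (block [
        when (.rlt (height (I iK) (I iX / 2)) (R rHi)) callEE,
        .iset iX (I iX - 1)]),
      when (.and (ile (I iA₁ + I iA₁) (I iX)) (.rlt (R rLo) (height (I iK) ((I iX + 1) / 2))))
        callEE]),
    .iset iFst (I iFst + 1)])

/-- Splits the sequence of visited edge pairs into batches, each of them in a row or in a column. -/
def edgePhase : Cmd := block [
  .iset iFst 0,
  .iset iA₁ 0,
  .iset iA₂ 0,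
  .loop (.ilt (I iFst) (I iNumE)) (block [
    .iset iLst (I iFst),
    .loop (.and (.ilt (I iLst + 1) (I iNumE))
        (.ieq (.arr aEJ (I iLst + 1)) (.arr aEJ (I iFst))))
      (.iset iLst (I iLst + 1)),
    .ite (.ieq (I iLst) (I iFst))
      (block [
        .loop (.and (.ilt (I iLst + 1) (I iNumE))
            (.ieq (.arr aEK (I iLst + 1)) (.arr aEK (I iFst))))
          (.iset iLst (I iLst + 1)),
        prepareBatch,
        columnBatch])
      (block [prepareBatch, rowBatch])])]

/-- The optimized final step. It works on the visited unit pairs that `visitPairs` has stored. -/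
def finalStep : Cmd := block [vertexPhase, collectEdgePairs, edgePhase]

/-- The entire algorithm. -/
def entireAlgorithm : Cmd := block [findOne, visitPairs, finalStep]

/-! ### Input and output -/

/-- The initial state: the number of vertices in `iN`, their coordinates in the two real arrays. -/
def inputState {n : ℕ} (v : Fin n → Point) : State where
  ireg := Function.update (fun _ => 0) iN (n : ℤ)
  iarr := fun _ _ => 0
  rreg := fun _ => 0
  rarr := fun a i =>
    if h : i.toNat < n ∧ 0 ≤ i then
      (if a = 0 then v ⟨i.toNat, h.1⟩ 0 else if a = 1 then v ⟨i.toNat, h.1⟩ 1 else 0)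
    else 0
  out := []

/-- The initial state together with the indices `r, s, t` of three vertices. -/
def inputStateWith {n : ℕ} (v : Fin n → Point) (r s t : Fin n) : State :=
  (((inputState v).iset iR (r.val : ℤ)).iset iS (s.val : ℤ)).iset iT (t.val : ℤ)

/-- The coordinates of the corners of a triangle. -/
def coords (A B C : Point) : OutTri := ((A 0, A 1), (B 0, B 1), (C 0, C 1))

/-- The output list consists of all generally 3-stable triangles. Each is listed clockwise, starting
from any of its corners, at least once. -/
def ListsAll {n : ℕ} (v : Fin n → Point) (out : List OutTri) : Prop :=
  (∀ T ∈ out, ∃ A B C : Point, GenThreeStable v A B C ∧ T = coords A B C) ∧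
  ∀ A B C : Point, GenThreeStable v A B C →
    coords A B C ∈ out ∨ coords B C A ∈ out ∨ coords C A B ∈ out

end StableTri

end

/-! Parametrize the boundary with period `n`, so that integers are vertices and clockwise motion
increases the parameter, and measure the distance of `x` from the line `bc` by the signed area `far
b c x`. For a fixed chord this function is affine on edges and strictly quasi-concave on the
vertices to the right of the chord (`ConvSeq.quasi`). Two consequences carry the running times and
the tests. A local maximum is a global one, so the stability of a corner can be checked on its two
neighbours. And the farthest vertex moves clockwise when both ends of the chord do
(`ConvSeq.far_step_lt`, `ConvSeq.far_step_le`), so pointers to farthest vertices never turn back.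

Two stable triangles interleave: no open arc between consecutive corners of one contains two corners
of the other (`Stab.not_two_in_arc`, `Stab.interleave`). Hence every stable triangle `ABC`, after a
rotation of its corners, has one corner in each arc of the given 3-stable triangle. A run of
Rotate-and-Kill moves a pair `(u₁, u₂)` along two of these arcs. If `B` is in `u₁` and `C` is past
`u₂`, then `A` is at least as far from `v_j v_k` as the point `X` (`Stab.far_of_past_second`). If
`C` is in `u₂` and `B` is past `u₁`, then no point of the boundary is farther than `X`
(`Stab.near_of_past_first`). The strict inequalities are distributed according to the kinds of the
units in such a way that the single comparison of the farthest vertex with `X` always rules out one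
of the two situations. The corresponding unit can be left without losing a stable triangle
(`process_step`). The same argument, applied to the given triangle itself, shows that the run ends
where it should. The three runs store at most `4n` pairs, and these include the pairs of units of
any two consecutive corners of any stable triangle.

Of three corners two are of the same kind, both vertices or both interior to edges
(`Treated.complete`). For two vertices the third corner is in a farthest unit, and being a
representative means lying on one of four lines transverse to the edge
(`exists_line_of_representative`). For two edges the sides opposite to them are parallel to them,
which determines the triangle once the third unit is known (`gadgetEE_run`), and the third corner
lies in the strip of the pair. Within a batch the strips are stacked and the heights on the relevant
chain are monotone, so a single backward scan serves all pairs (`rowBatch_data`,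
`columnBatch_data`). A batch starts its scan at most one vertex before the end of the scan two
batches earlier, so the lengths of all scans add up to `O(n)`.

A first 3-stable triangle is found from a largest triangle rooted at vertex 0. All corners move in
one direction and every move enlarges the area, while moving a corner back never would. No corner
can pass vertex 0, since its triangle would be rooted there and larger than the largest one. Hence
there are at most `6n` moves, and at the end no corner can improve in either direction.

Time is treated as a budget that is part of every invariant (`Runs`); all bounds come from
potentials that are linear in positions of pointers. -/

noncomputable section
namespace StableTri
/-! ### A program logic with time credits -/

/-- The program has no loops. -/
def Cmd.loopFree : Cmd → Bool
  | .seq c d => c.loopFree && d.loopFree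
  | .ite _ c d => c.loopFree && d.loopFree
  | .loop _ _ => false
  | _ => true

/-- An upper bound for the running time of a program without loops. -/
def Cmd.maxCost : Cmd → ℕ
  | .skip => 1
  | .iset _ e => e.cost + 1
  | .istore _ i e => i.cost + e.cost + 1
  | .rset _ e => e.cost + 1
  | .emit x₁ y₁ x₂ y₂ x₃ y₃ =>
      x₁.cost + y₁.cost + x₂.cost + y₂.cost + x₃.cost + y₃.cost + 1
  | .seq c d => c.maxCost + d.maxCost
  | .ite b c d => b.cost + 1 + (c.maxCost + d.maxCost)
  | .loop _ _ => 0

open Classical in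
/-- The final state of a program without loops. -/
def Cmd.run : Cmd → State → State
  | .skip, σ => σ
  | .iset x e, σ => σ.iset x (e.eval σ)
  | .istore a i e, σ => σ.istore a (i.eval σ) (e.eval σ)
  | .rset x e, σ => σ.rset x (e.eval σ)
  | .emit x₁ y₁ x₂ y₂ x₃ y₃, σ =>
      σ.emit ((x₁.eval σ, y₁.eval σ), (x₂.eval σ, y₂.eval σ), (x₃.eval σ, y₃.eval σ))
  | .seq c d, σ => d.run (c.run σ)
  | .ite b c d, σ => if b.eval σ then c.run σ else d.run σ
  | .loop _ _, σ => σ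

/-- The number of steps depends on the branches taken, so only a bound is claimed. Since `maxCost`
adds the costs of both branches, it is a closed number for each concrete program and can be compared
by `decide`. -/
theorem exec_run (c : Cmd) (h : c.loopFree = true) (σ : State) :
    ∃ τ, τ ≤ c.maxCost ∧ Exec c σ τ (c.run σ) := by
  induction c generalizing σ with
  | skip => exact ⟨_, le_rfl, .skip σ⟩
  | iset x e => exact ⟨_, le_rfl, .iset σ x e⟩
  | istore a i e => exact ⟨_, le_rfl, .istore σ a i e⟩
  | rset x e => exact ⟨_, le_rfl, .rset σ x e⟩
  | emit => exact ⟨_, le_rfl, .emit σ ..⟩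
  | seq c d hc hd =>
    simp only [Cmd.loopFree, Bool.and_eq_true] at h
    obtain ⟨τ₁, h₁, e₁⟩ := hc h.1 σ
    obtain ⟨τ₂, h₂, e₂⟩ := hd h.2 (c.run σ)
    exact ⟨_, Nat.add_le_add h₁ h₂, .seq e₁ e₂⟩
  | ite b c d hc hd =>
    simp only [Cmd.loopFree, Bool.and_eq_true] at h
    by_cases hb : b.eval σ
    · obtain ⟨τ, h₁, e₁⟩ := hc h.1 σ
      refine ⟨b.cost + 1 + τ, by simp only [Cmd.maxCost]; omega, ?_⟩
      simp only [Cmd.run, if_pos hb]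
      exact .ite_true hb e₁
    · obtain ⟨τ, h₁, e₁⟩ := hd h.2 σ
      refine ⟨b.cost + 1 + τ, by simp only [Cmd.maxCost]; omega, ?_⟩
      simp only [Cmd.run, if_neg hb]
      exact .ite_false hb e₁
  | loop => simp [Cmd.loopFree] at h

/-- Started in `σ` with a budget of `B` steps, the program halts within this budget, and the final
state and what is left of the budget satisfy `Q`. -/
def Runs (c : Cmd) (σ : State) (B : ℕ) (Q : ℕ → State → Prop) : Prop :=
  ∃ τ p σ', Exec c σ τ σ' ∧ τ + p ≤ B ∧ Q p σ'

theorem Runs.mono {c : Cmd} {σ : State} {B : ℕ} {Q Q' : ℕ → State → Prop}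
    (h : Runs c σ B Q) (hQ : ∀ p σ', Q p σ' → Q' p σ') : Runs c σ B Q' := by
  obtain ⟨τ, p, σ', h₁, h₂, h₃⟩ := h
  exact ⟨τ, p, σ', h₁, h₂, hQ _ _ h₃⟩

theorem Runs.budget {c : Cmd} {σ : State} {B B' : ℕ} {Q : ℕ → State → Prop}
    (h : Runs c σ B Q) (hB : B ≤ B') : Runs c σ B' Q := by
  obtain ⟨τ, p, σ', h₁, h₂, h₃⟩ := h
  exact ⟨τ, p, σ', h₁, h₂.trans hB, h₃⟩

theorem Runs.seq {c d : Cmd} {σ : State} {B : ℕ} {Q : ℕ → State → Prop}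
    (h : Runs c σ B (fun p σ' => Runs d σ' p Q)) : Runs (.seq c d) σ B Q := by
  obtain ⟨τ₁, p₁, σ₁, e₁, h₁, τ₂, p₂, σ₂, e₂, h₂, hQ⟩ := h
  exact ⟨τ₁ + τ₂, p₂, σ₂, .seq e₁ e₂, by omega, hQ⟩

theorem Runs.free {c : Cmd} {σ : State} {B : ℕ} {Q : ℕ → State → Prop} (k : ℕ)
    (hl : c.loopFree = true) (hk : c.maxCost ≤ k) (p : ℕ) (hB : k + p ≤ B)
    (hQ : Q p (c.run σ)) : Runs c σ B Q := by
  obtain ⟨τ, hτ, e⟩ := exec_run c hl σ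
  exact ⟨τ, p, _, e, by omega, hQ⟩

theorem Runs.ite {b : BExp} {c d : Cmd} {σ : State} {B : ℕ} {Q : ℕ → State → Prop} (k : ℕ)
    (hk : b.cost + 1 ≤ k) (p : ℕ) (hB : k + p ≤ B)
    (h₁ : b.eval σ → Runs c σ p Q) (h₂ : ¬ b.eval σ → Runs d σ p Q) :
    Runs (.ite b c d) σ B Q := by
  by_cases hb : b.eval σ
  · obtain ⟨τ, q, σ', e, h, hQ⟩ := h₁ hb
    exact ⟨_, q, σ', .ite_true hb e, by omega, hQ⟩
  · obtain ⟨τ, q, σ', e, h, hQ⟩ := h₂ hb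
    exact ⟨_, q, σ', .ite_false hb e, by omega, hQ⟩

theorem Runs.when {b : BExp} {c : Cmd} {σ : State} {B : ℕ} {Q : ℕ → State → Prop} (k : ℕ)
    (hk : b.cost + 2 ≤ k) (p : ℕ) (hB : k + p ≤ B)
    (h₁ : b.eval σ → Runs c σ p Q) (h₂ : ¬ b.eval σ → Q p σ) :
    Runs (when b c) σ B Q := by
  refine Runs.ite (b.cost + 1) le_rfl (p + 1) (by omega)
    (fun hb => (h₁ hb).budget (by omega)) (fun hb => ⟨1, p, σ, .skip σ, by omega, h₂ hb⟩)

/-- The invariant sees the remaining budget, so that a potential can be part of it. No separate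
termination measure is needed: each test costs at least one step, hence the budget decreases and
strong induction on it suffices. -/
theorem Runs.loop {b : BExp} {c : Cmd} {Q : ℕ → State → Prop} (Inv : ℕ → State → Prop) (k : ℕ)
    (hk : b.cost + 1 ≤ k)
    (step : ∀ p σ, Inv p σ → b.eval σ → ∃ p', k + p' ≤ p ∧ Runs c σ p' Inv)
    (halt : ∀ p σ, Inv p σ → ¬ b.eval σ → ∃ p', k + p' ≤ p ∧ Q p' σ)
    {σ : State} {B : ℕ} (h : Inv B σ) : Runs (.loop b c) σ B Q := by
  induction B using Nat.strong_induction_on generalizing σ with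
  | _ B ih =>
    by_cases hb : b.eval σ
    · obtain ⟨p', hp, τ₁, p₁, σ₁, e₁, h₁, i₁⟩ := step B σ h hb
      obtain ⟨τ₂, p₂, σ₂, e₂, h₂, hQ⟩ := ih p₁ (by omega) i₁
      exact ⟨_, p₂, σ₂, .loop_true hb e₁ e₂, by omega, hQ⟩
    · obtain ⟨p', hp, hQ⟩ := halt B σ h hb
      exact ⟨_, p', σ, .loop_false hb, by omega, hQ⟩

/-- A loop with a loop-free body. -/
theorem Runs.loop_free {b : BExp} {c : Cmd} {Q : ℕ → State → Prop} (Inv : ℕ → State → Prop)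
    (k : ℕ) (hl : c.loopFree = true) (hk : b.cost + 1 + c.maxCost ≤ k)
    (step : ∀ p σ, Inv p σ → b.eval σ → ∃ p', k + p' ≤ p ∧ Inv p' (c.run σ))
    (halt : ∀ p σ, Inv p σ → ¬ b.eval σ → ∃ p', k + p' ≤ p ∧ Q p' σ)
    {σ : State} {B : ℕ} (h : Inv B σ) : Runs (.loop b c) σ B Q := by
  refine Runs.loop Inv (b.cost + 1) le_rfl ?_ ?_ h
  · intro p σ hi hb
    obtain ⟨p', hp, hi'⟩ := step p σ hi hb
    exact ⟨c.maxCost + p', by omega, Runs.free _ hl le_rfl p' le_rfl hi'⟩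
  · intro p σ hi hb
    obtain ⟨p', hp, hQ⟩ := halt p σ hi hb
    exact ⟨p', by omega, hQ⟩

/-! ### Evaluation of expressions -/

section Eval
variable (σ : State)

@[simp] theorem IExp.eval_add (a b : IExp) : (a + b).eval σ = a.eval σ + b.eval σ := rfl
@[simp] theorem IExp.eval_sub (a b : IExp) : (a - b).eval σ = a.eval σ - b.eval σ := rfl
@[simp] theorem IExp.eval_div (a b : IExp) : (a / b).eval σ = a.eval σ / b.eval σ := rfl
@[simp] theorem IExp.eval_mod (a b : IExp) : (a % b).eval σ = a.eval σ % b.eval σ := rfl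
@[simp] theorem IExp.eval_reg (x : ℕ) : (IExp.reg x).eval σ = σ.ireg x := rfl
@[simp] theorem IExp.eval_arr (a : ℕ) (i : IExp) : (IExp.arr a i).eval σ = σ.iarr a (i.eval σ) := rfl
@[simp] theorem RExp.eval_add (a b : RExp) : (a + b).eval σ = a.eval σ + b.eval σ := rfl
@[simp] theorem RExp.eval_sub (a b : RExp) : (a - b).eval σ = a.eval σ - b.eval σ := rfl
@[simp] theorem RExp.eval_mul (a b : RExp) : (a * b).eval σ = a.eval σ * b.eval σ := rfl
@[simp] theorem RExp.eval_div (a b : RExp) : (a / b).eval σ = a.eval σ / b.eval σ := rfl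
@[simp] theorem RExp.eval_reg (x : ℕ) : (RExp.reg x).eval σ = σ.rreg x := rfl
@[simp] theorem BExp.eval_ilt (a b : IExp) : (BExp.ilt a b).eval σ ↔ a.eval σ < b.eval σ := Iff.rfl
@[simp] theorem BExp.eval_ieq (a b : IExp) : (BExp.ieq a b).eval σ ↔ a.eval σ = b.eval σ := Iff.rfl
@[simp] theorem BExp.eval_rlt (a b : RExp) : (BExp.rlt a b).eval σ ↔ a.eval σ < b.eval σ := Iff.rfl
@[simp] theorem BExp.eval_req (a b : RExp) : (BExp.req a b).eval σ ↔ a.eval σ = b.eval σ := Iff.rfl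
@[simp] theorem BExp.eval_not (a : BExp) : (BExp.not a).eval σ ↔ ¬ a.eval σ := Iff.rfl
@[simp] theorem BExp.eval_and (a b : BExp) : (BExp.and a b).eval σ ↔ a.eval σ ∧ b.eval σ := Iff.rfl
@[simp] theorem BExp.eval_or (a b : BExp) : (BExp.or a b).eval σ ↔ a.eval σ ∨ b.eval σ := Iff.rfl
@[simp] theorem eval_ile (a b : IExp) : (ile a b).eval σ ↔ a.eval σ ≤ b.eval σ := not_lt
@[simp] theorem eval_rle (a b : RExp) : (rle a b).eval σ ↔ a.eval σ ≤ b.eval σ := not_lt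
@[simp] theorem eval_even (a : IExp) : (even a).eval σ ↔ a.eval σ % 2 = 0 := Iff.rfl
@[simp] theorem eval_odd (a : IExp) : (odd a).eval σ ↔ a.eval σ % 2 = 1 := Iff.rfl

@[simp] theorem State.iset_ireg (x : ℕ) (z : ℤ) (y : ℕ) :
    (σ.iset x z).ireg y = if y = x then z else σ.ireg y := by
  simp [State.iset, Function.update_apply]
@[simp] theorem State.iset_iarr (x : ℕ) (z : ℤ) : (σ.iset x z).iarr = σ.iarr := rfl
@[simp] theorem State.iset_rreg (x : ℕ) (z : ℤ) : (σ.iset x z).rreg = σ.rreg := rfl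
@[simp] theorem State.iset_rarr (x : ℕ) (z : ℤ) : (σ.iset x z).rarr = σ.rarr := rfl
@[simp] theorem State.iset_out (x : ℕ) (z : ℤ) : (σ.iset x z).out = σ.out := rfl
@[simp] theorem State.rset_rreg (x : ℕ) (z : ℝ) (y : ℕ) :
    (σ.rset x z).rreg y = if y = x then z else σ.rreg y := by
  simp [State.rset, Function.update_apply]
@[simp] theorem State.rset_ireg (x : ℕ) (z : ℝ) : (σ.rset x z).ireg = σ.ireg := rfl
@[simp] theorem State.rset_iarr (x : ℕ) (z : ℝ) : (σ.rset x z).iarr = σ.iarr := rfl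
@[simp] theorem State.rset_rarr (x : ℕ) (z : ℝ) : (σ.rset x z).rarr = σ.rarr := rfl
@[simp] theorem State.rset_out (x : ℕ) (z : ℝ) : (σ.rset x z).out = σ.out := rfl
@[simp] theorem State.istore_iarr (a : ℕ) (i z : ℤ) (b : ℕ) (j : ℤ) :
    (σ.istore a i z).iarr b j = if b = a ∧ j = i then z else σ.iarr b j := by
  by_cases h : b = a
  · subst h; simp [State.istore, Function.update_apply]
  · simp [State.istore, h]
@[simp] theorem State.istore_ireg (a : ℕ) (i z : ℤ) : (σ.istore a i z).ireg = σ.ireg := rfl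
@[simp] theorem State.istore_rreg (a : ℕ) (i z : ℤ) : (σ.istore a i z).rreg = σ.rreg := rfl
@[simp] theorem State.istore_rarr (a : ℕ) (i z : ℤ) : (σ.istore a i z).rarr = σ.rarr := rfl
@[simp] theorem State.istore_out (a : ℕ) (i z : ℤ) : (σ.istore a i z).out = σ.out := rfl
@[simp] theorem State.emit_out (T : OutTri) : (σ.emit T).out = σ.out ++ [T] := rfl
@[simp] theorem State.emit_ireg (T : OutTri) : (σ.emit T).ireg = σ.ireg := rfl
@[simp] theorem State.emit_rreg (T : OutTri) : (σ.emit T).rreg = σ.rreg := rfl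
@[simp] theorem State.emit_iarr (T : OutTri) : (σ.emit T).iarr = σ.iarr := rfl
@[simp] theorem State.emit_rarr (T : OutTri) : (σ.emit T).rarr = σ.rarr := rfl

end Eval

/-! ### The plane -/

/-- The distance of `x` to the line `bc` times the length of `bc`, positive on the right of `bc`. -/
def far (b c x : Point) : ℝ := det (x - b) (c - b)

theorem far_eq (a b c : Point) :
    far a b c = (c 0 - a 0) * (b 1 - a 1) - (c 1 - a 1) * (b 0 - a 0) := by
  simp [far, det]

theorem far_eq_neg_orient (b c x : Point) : far b c x = -orient b c x := by
  simp only [far, orient, det, PiLp.sub_apply]; ring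

theorem far_rotate (a b c : Point) : far a b c = far b c a := by
  simp only [far_eq]; ring

theorem far_swap (a b c : Point) : far a b c = -far b a c := by
  simp only [far_eq]; ring

theorem far_swap_right (a b c : Point) : far a b c = -far a c b := by
  simp only [far_eq]; ring

theorem far_self_left (a c : Point) : far a a c = 0 := by simp [far_eq]
theorem far_self_right (a b : Point) : far a b b = 0 := by simp only [far_eq]; ring
theorem far_self_outer (a b : Point) : far a b a = 0 := by simp only [far_eq]; ring

/-- The alternating sum relation between the values of an affine function at four points. -/
theorem far_four (b c p q r s : Point) :
    far b c p * far q r s + far b c r * far p q s =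
      far b c q * far p r s + far b c s * far p q r := by
  simp only [far_eq]; ring

/-- The two triangulations of the quadrilateral `p q r s`. It is the relation of `far_four` for the
constant function 1; combining the two gives all concavity statements below. -/
theorem far_four_sum (p q r s : Point) :
    far q r s + far p q s = far p r s + far p q r := by
  simp only [far_eq]; ring

/-- Reflection at the diagonal. -/
def refl (p : Point) : Point := !₂[p 1, p 0]

theorem far_refl (a b c : Point) : far (refl a) (refl b) (refl c) = far b a c := by
  simp [far_eq, refl]; ring

/-! ### Convex closed polygons as periodic sequences -/

/-- A periodic sequence that lists the vertices of a convex `n`-gon clockwise. -/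
structure ConvSeq (n : ℤ) (V : ℤ → Point) : Prop where
  three : 3 ≤ n
  per : ∀ i, V (i + n) = V i
  pos : ∀ i j k, i < j → j < k → k < i + n → 0 < far (V i) (V j) (V k)

namespace ConvSeq
variable {n : ℤ} {V : ℤ → Point}

theorem nonneg (h : ConvSeq n V) {i j k : ℤ} (hij : i ≤ j) (hjk : j ≤ k) (hki : k ≤ i + n) :
    0 ≤ far (V i) (V j) (V k) := by
  rcases hij.eq_or_lt with rfl | h1
  · rw [far_self_left]
  rcases hjk.eq_or_lt with rfl | h2
  · rw [far_self_right]
  rcases hki.eq_or_lt with rfl | h3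
  · rw [h.per, far_self_outer]
  exact (h.pos _ _ _ h1 h2 h3).le

theorem per_neg (h : ConvSeq n V) (i : ℤ) : V (i - n) = V i := by
  rw [← h.per (i - n), sub_add_cancel]

/-- The distances to a chord are strictly quasi-concave along the chain on its right. -/
theorem quasi (h : ConvSeq n V) {j k x y z : ℤ} (hjk : j < k) (hkx : k ≤ x) (hxy : x < y)
    (hyz : y < z) (hz : z ≤ j + n) :
    far (V j) (V k) (V x) < far (V j) (V k) (V y) ∨
      far (V j) (V k) (V z) < far (V j) (V k) (V y) := by
  by_contra hc
  push Not at hc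
  have hy := h.pos j k y hjk (by omega) (by omega)
  -- With value 0 at `V j`, the relation writes the value at `y`, times the area of `j x z`, as a
  -- combination of the values at `x` and `z`. The weights exceed that area in sum by the area of `x
  -- y z`, which is positive; so the values at `x` and `z` cannot both be at least the value at `y`.
  have h4 := far_four (V j) (V k) (V j) (V x) (V y) (V z)
  have hs := far_four_sum (V j) (V x) (V y) (V z)
  rw [far_self_outer] at h4
  have m0 := h.pos x y z hxy hyz (by omega)
  have m1 := h.nonneg (i := j) (j := y) (k := z) (by omega) (by omega) hz
  have m3 := h.nonneg (i := j) (j := x) (k := y) (by omega) (by omega) (by omega)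
  nlinarith [mul_le_mul_of_nonneg_right hc.1 m1, mul_le_mul_of_nonneg_right hc.2 m3,
    mul_pos hy m0]

/-- Both sides are the determinant of the chord and the edge `i`. Thus whether the next vertex is
farther from the chord is decided by which end of the chord is higher over the edge, and edge and
chord exchange their roles. -/
theorem step_eq (V : ℤ → Point) (j k i : ℤ) :
    far (V j) (V k) (V (i + 1)) - far (V j) (V k) (V i) =
      far (V i) (V (i + 1)) (V j) - far (V i) (V (i + 1)) (V k) := by
  simp only [far_eq]; ring

/-- Heights over the edge `i`. -/
theorem quasi_edge (h : ConvSeq n V) {i x y z : ℤ} (hx : i + 1 - n ≤ x) (hxy : x < y)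
    (hyz : y < z) (hz : z ≤ i) :
    far (V i) (V (i + 1)) (V x) < far (V i) (V (i + 1)) (V y) ∨
      far (V i) (V (i + 1)) (V z) < far (V i) (V (i + 1)) (V y) := by
  have := h.quasi (j := i - n) (k := i + 1 - n) (x := x) (y := y) (z := z) (by omega) hx hxy hyz
    (by omega)
  rwa [h.per_neg, h.per_neg] at this

/-- When the endpoints of a chord move clockwise, then so does the farthest point. -/
theorem far_step_lt (h : ConvSeq n V) {i j k j' k' : ℤ} (hj : i + 1 - n ≤ j) (hjj : j ≤ j')
    (hkk : k ≤ k') (hjk : j < k) (hjk' : j' < k') (hk : k' ≤ i)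
    (hlt : far (V j) (V k) (V i) < far (V j) (V k) (V (i + 1))) :
    far (V j') (V k') (V i) < far (V j') (V k') (V (i + 1)) := by
  have e := step_eq V j k i
  have e' := step_eq V j' k' i
  have q := fun x y z h1 h2 h3 h4 => h.quasi_edge (i := i) (x := x) (y := y) (z := z) h1 h2 h3 h4
  -- By `step_eq` the claim says that over the edge `i` the first end of the new chord is higher
  -- than the second. Heights over this edge are quasi-concave, and they already drop from `j` to
  -- `k`.
  suffices far (V i) (V (i + 1)) (V k') < far (V i) (V (i + 1)) (V j') by linarith
  have h0 : far (V i) (V (i + 1)) (V k) < far (V i) (V (i + 1)) (V j) := by linarith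
  have h1 : far (V i) (V (i + 1)) (V k') ≤ far (V i) (V (i + 1)) (V k) := by
    rcases hkk.eq_or_lt with rfl | hlt'
    · exact le_rfl
    rcases q j k k' hj hjk hlt' hk with h2 | h2 <;> linarith
  -- Either `j'` is still before `k`, where its height is bounded below by those of `j` and `k`, or
  -- it has reached the part where heights decrease.
  rcases lt_trichotomy j' k with h2 | h2 | h2
  · rcases hjj.eq_or_lt with rfl | h3
    · linarith
    rcases q j j' k hj h3 h2 (by omega) with h4 | h4 <;> linarith
  · subst h2
    rcases q j j' k' hj hjk hjk' hk with h2 | h2 <;> linarith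
  · rcases q j k j' hj hjk h2 (by omega) with h3 | h3
    · linarith
    · rcases q k j' k' (by omega) h2 hjk' hk with h4 | h4 <;> linarith

/-- The argument of `far_step_lt` with ties admitted. This form is needed for pointers to the last
farthest vertex, and for transporting one-sided local maximality. -/
theorem far_step_le (h : ConvSeq n V) {i j k j' k' : ℤ} (hj : i + 1 - n ≤ j) (hjj : j ≤ j')
    (hkk : k ≤ k') (hjk : j < k) (hjk' : j' < k') (hk : k' ≤ i)
    (hlt : far (V j) (V k) (V i) ≤ far (V j) (V k) (V (i + 1))) :
    far (V j') (V k') (V i) ≤ far (V j') (V k') (V (i + 1)) := by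
  have e := step_eq V j k i
  have e' := step_eq V j' k' i
  have q := fun x y z h1 h2 h3 h4 => h.quasi_edge (i := i) (x := x) (y := y) (z := z) h1 h2 h3 h4
  suffices far (V i) (V (i + 1)) (V k') ≤ far (V i) (V (i + 1)) (V j') by linarith
  have h0 : far (V i) (V (i + 1)) (V k) ≤ far (V i) (V (i + 1)) (V j) := by linarith
  have h1 : far (V i) (V (i + 1)) (V k') ≤ far (V i) (V (i + 1)) (V k) := by
    rcases hkk.eq_or_lt with rfl | hlt'
    · exact le_rfl
    rcases q j k k' hj hjk hlt' hk with h2 | h2 <;> linarith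
  rcases lt_trichotomy j' k with h2 | h2 | h2
  · rcases hjj.eq_or_lt with rfl | h3
    · linarith
    rcases q j j' k hj h3 h2 (by omega) with h4 | h4 <;> linarith
  · subst h2
    rcases q j j' k' hj hjk hjk' hk with h2 | h2 <;> linarith
  · rcases q j k j' hj hjk h2 (by omega) with h3 | h3
    · linarith
    · rcases q k j' k' (by omega) h2 hjk' hk with h4 | h4 <;> linarith

/-- The mirror image of the polygon. -/
def mirror (V : ℤ → Point) : ℤ → Point := fun i => refl (V (-i))

/-- The reflection changes the orientation and the reversal of the indices restores it.
Counterclockwise movements are thereby reduced to clockwise ones. -/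
theorem mirror_conv (h : ConvSeq n V) : ConvSeq n (mirror V) where
  three := h.three
  per i := by
    have := h.per (-(i + n))
    simp only [mirror]
    rw [← this]; congr 2; ring
  pos i j k hij hjk hki := by
    simp only [mirror]
    rw [far_refl]
    have := h.pos (-k) (-j) (-i) (by omega) (by omega) (by omega)
    rw [far_rotate] at this
    exact this

theorem far_mirror (V : ℤ → Point) (a b c : ℤ) :
    far (mirror V a) (mirror V b) (mirror V c) = far (V (-b)) (V (-a)) (V (-c)) := by
  simp only [mirror]; rw [far_refl]

/-- Climbing along the chain on the right of a chord, the first step that does not increase the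
distance ends at a farthest vertex. -/
theorem le_of_step (h : ConvSeq n V) {j k m : ℤ} (hjk : j < k) (hkm : k ≤ m)
    (h₁ : far (V j) (V k) (V (m + 1)) ≤ far (V j) (V k) (V m)) {x : ℤ} (hmx : m ≤ x)
    (hx : x ≤ j + n) : far (V j) (V k) (V x) ≤ far (V j) (V k) (V m) := by
  rcases hmx.eq_or_lt with rfl | h1
  · exact le_rfl
  rcases (show m + 1 ≤ x by omega).eq_or_lt with rfl | h2
  · exact h₁
  rcases h.quasi hjk hkm (show m < m + 1 by omega) h2 hx with h3 | h3 <;> linarith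

theorem le_of_step_back (h : ConvSeq n V) {j k m : ℤ} (hjk : j < k) (hkm : k < m) (hm : m ≤ j + n)
    (h₁ : far (V j) (V k) (V (m - 1)) ≤ far (V j) (V k) (V m)) {x : ℤ} (hkx : k ≤ x)
    (hx : x ≤ m) : far (V j) (V k) (V x) ≤ far (V j) (V k) (V m) := by
  rcases hx.eq_or_lt with rfl | h1
  · exact le_rfl
  rcases (show x ≤ m - 1 by omega).eq_or_lt with rfl | h2
  · exact h₁
  rcases h.quasi hjk hkx h2 (show m - 1 < m by omega) hm with h3 | h3 <;> linarith

/-- The distances are nonpositive on the left of the chord. -/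
theorem nonpos_left (h : ConvSeq n V) {j k x : ℤ} (hjk : k ≤ j + n) (hjx : j ≤ x) (hxk : x ≤ k) :
    far (V j) (V k) (V x) ≤ 0 := by
  have := h.nonneg hjx hxk hjk
  rw [far_rotate, far_swap] at this
  rw [far_rotate] at this
  rw [far_rotate, far_rotate]
  linarith

theorem exists_lift (hn : 0 < n) (x k : ℤ) : ∃ z : ℤ, k ≤ x + z * n ∧ x + z * n < k + n := by
  refine ⟨-((x - k) / n), ?_, ?_⟩
  · have := Int.ediv_mul_le (x - k) hn.ne'
    linarith
  · have := Int.lt_ediv_add_one_mul_self (x - k) hn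
    linarith

theorem per_mul (h : ConvSeq n V) (x z : ℤ) : V (x + z * n) = V x := by
  induction z using Int.induction_on with
  | zero => simp
  | succ i ih => rw [← ih, ← h.per (x + i * n)]; congr 1; ring
  | pred i ih => rw [← ih, ← h.per (x + (-i - 1) * n)]; congr 1; ring

/-- A local maximum is a global one. -/
theorem le_of_local (h : ConvSeq n V) {j k m : ℤ} (hjk : j < k) (hkm : k ≤ m) (hm : m < j + n)
    (h₁ : far (V j) (V k) (V (m + 1)) ≤ far (V j) (V k) (V m))
    (h₂ : k = m ∨ far (V j) (V k) (V (m - 1)) ≤ far (V j) (V k) (V m)) (x : ℤ) :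
    far (V j) (V k) (V x) ≤ far (V j) (V k) (V m) := by
  have h0 := h.three
  obtain ⟨z, hz1, hz2⟩ := exists_lift (n := n) (by omega) x m
  rw [← h.per_mul x z]
  generalize x + z * n = y at *
  -- Up to `j + n` the vertex is on the chain after `m`. Beyond that, taken one period earlier, it
  -- is on the left of the chord or on the chain from `k` to `m`.
  by_cases hy : y ≤ j + n
  · exact h.le_of_step hjk hkm h₁ hz1 hy
  · rw [← h.per_neg y]
    by_cases hy' : y - n ≤ k
    · have h3 := h.nonpos_left (j := j) (k := k) (x := y - n) (by omega) (by omega) hy'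
      have h4 := h.nonneg (i := j) (j := k) (k := m) hjk.le hkm hm.le
      linarith
    · rcases h₂ with rfl | h₂
      · omega
      · exact h.le_of_step_back hjk (by omega) hm.le h₂ (by omega) (by omega)

end ConvSeq

/-! ### The boundary as a closed curve -/

/-- The boundary, parametrized with period `n`. -/
def curve (V : ℤ → Point) (x : ℝ) : Point :=
  (1 - Int.fract x) • V ⌊x⌋ + Int.fract x • V (⌊x⌋ + 1)

theorem far_comb (a b c d : Point) (s t : ℝ) (h : s + t = 1) :
    far a b (s • c + t • d) = s * far a b c + t * far a b d := by
  obtain rfl : s = 1 - t := by linarith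
  simp only [far_eq, PiLp.add_apply, PiLp.smul_apply, smul_eq_mul]; ring

theorem curve_int (V : ℤ → Point) (i : ℤ) : curve V i = V i := by simp [curve]

/-- The formula is valid on the closed interval, although the floor jumps at its right end. A vertex
can therefore be read as a point of either adjacent edge. -/
theorem curve_on (V : ℤ → Point) (m : ℤ) (x : ℝ) (h1 : (m : ℝ) ≤ x) (h2 : x ≤ m + 1) :
    curve V x = (1 - (x - m)) • V m + (x - m) • V (m + 1) := by
  rcases h2.eq_or_lt with rfl | h3
  · have := curve_int V (m + 1)
    push_cast at this
    rw [this]; simp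
  · have : ⌊x⌋ = m := Int.floor_eq_iff.2 ⟨h1, h3⟩
    simp only [curve, Int.fract, this]

theorem far_on (V : ℤ → Point) (a b : Point) (m : ℤ) (x : ℝ) (h1 : (m : ℝ) ≤ x) (h2 : x ≤ m + 1) :
    far a b (curve V x) = (1 - (x - m)) * far a b (V m) + (x - m) * far a b (V (m + 1)) := by
  rw [curve_on V m x h1 h2, far_comb _ _ _ _ _ _ (by ring)]

theorem far_on_two (V : ℤ → Point) (c : Point) (m : ℤ) (x y : ℝ) (h1 : (m : ℝ) ≤ x) (h2 : x ≤ m + 1)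
    (h3 : (m : ℝ) ≤ y) (h4 : y ≤ m + 1) :
    far (curve V x) (curve V y) c = (y - x) * far (V m) (V (m + 1)) c := by
  rw [curve_on V m x h1 h2, curve_on V m y h3 h4]
  simp only [far_eq, PiLp.add_apply, PiLp.smul_apply, smul_eq_mul]; ring

namespace ConvSeq
variable {n : ℤ} {V : ℤ → Point}

theorem curve_per (h : ConvSeq n V) (x : ℝ) : curve V (x + n) = curve V x := by
  simp only [curve, Int.floor_add_intCast, Int.fract_add_intCast]
  rw [h.per, ← h.per (⌊x⌋ + 1)]; congr 3; ring

theorem curve_per_neg (h : ConvSeq n V) (x : ℝ) : curve V (x - n) = curve V x := by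
  rw [← h.curve_per (x - n), sub_add_cancel]

theorem curve_per_mul (h : ConvSeq n V) (x : ℝ) (z : ℤ) : curve V (x + z * n) = curve V x := by
  have e : x + (z : ℝ) * n = x + ((z * n : ℤ) : ℝ) := by push_cast; ring
  simp only [e, curve, Int.floor_add_intCast, Int.fract_add_intCast]
  rw [h.per_mul, ← h.per_mul (⌊x⌋ + 1) z]; congr 3; ring

/-- Heights over an edge are positive off the edge. -/
theorem height_pos (h : ConvSeq n V) {p : ℤ} {x : ℝ} (h1 : (p : ℝ) + 1 < x) (h2 : x < p + n) :
    0 < far (V p) (V (p + 1)) (curve V x) := by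
  have f1 := Int.floor_le x
  have f2 := Int.lt_floor_add_one x
  rw [far_on V _ _ ⌊x⌋ x f1 f2.le]
  have g1 : p + 1 ≤ ⌊x⌋ := by
    apply Int.le_floor.2; push_cast; exact h1.le
  have g2 : ⌊x⌋ < p + n := by
    have : (⌊x⌋ : ℝ) < ((p + n : ℤ) : ℝ) := by push_cast; linarith
    exact_mod_cast this
  have h0 := h.three
  rcases g1.eq_or_lt with e | hlt
  · have h3 := h.pos p (p + 1) (⌊x⌋ + 1) (by omega) (by omega) (by omega)
    rw [← e, far_self_right]
    rw [← e] at h3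
    have : 0 < x - ((p + 1 : ℤ) : ℝ) := by push_cast; linarith
    have := mul_pos this h3
    linarith
  · have h3 := h.pos p (p + 1) ⌊x⌋ (by omega) (by omega) (by omega)
    have h4 := h.nonneg (i := p) (j := p + 1) (k := ⌊x⌋ + 1) (by omega) (by omega) (by omega)
    have := mul_pos (by linarith : 0 < 1 - (x - ⌊x⌋)) h3
    have := mul_nonneg (by linarith : 0 ≤ x - ⌊x⌋) h4
    linarith

theorem height_zero (p : ℤ) {x : ℝ} (h1 : (p : ℝ) ≤ x) (h2 : x ≤ p + 1) :
    far (V p) (V (p + 1)) (curve V x) = 0 := by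
  rw [far_on V _ _ p x h1 h2, far_self_outer, far_self_right]; ring

end ConvSeq

/-! ### Orientation of boundary points, and quasi-concavity of heights along the boundary. -/

namespace ConvSeq
variable {n : ℤ} {V : ℤ → Point}

theorem slot_pos {a b : Point} {x : ℝ} (h₁ : 0 < far a b (V ⌊x⌋)) (h₂ : 0 ≤ far a b (V (⌊x⌋ + 1))) :
    0 < far a b (curve V x) := by
  have f1 := Int.floor_le x
  have f2 := Int.lt_floor_add_one x
  rw [far_on V _ _ ⌊x⌋ x f1 f2.le]
  have := mul_pos (by linarith : 0 < 1 - (x - ⌊x⌋)) h₁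
  have := mul_nonneg (by linarith : 0 ≤ x - ⌊x⌋) h₂
  linarith

theorem slot_nonneg {a b : Point} {x : ℝ} (h₁ : 0 ≤ far a b (V ⌊x⌋))
    (h₂ : 0 ≤ far a b (V (⌊x⌋ + 1))) : 0 ≤ far a b (curve V x) := by
  have f1 := Int.floor_le x
  have f2 := Int.lt_floor_add_one x
  rw [far_on V _ _ ⌊x⌋ x f1 f2.le]
  have := mul_nonneg (by linarith : 0 ≤ 1 - (x - ⌊x⌋)) h₁
  have := mul_nonneg (by linarith : 0 ≤ x - ⌊x⌋) h₂
  linarith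

/-- The form `far` is affine in each argument, and a boundary point is a mixture of the ends of its
edge with positive weight on the first end. Replacing the points by vertices one at a time gives one
positive term and otherwise nonnegative ones. -/
theorem pos_of_floor (h : ConvSeq n V) {x y z : ℝ} (h₁ : ⌊x⌋ < ⌊y⌋) (h₂ : ⌊y⌋ < ⌊z⌋)
    (h₃ : ⌊z⌋ < ⌊x⌋ + n) : 0 < far (curve V x) (curve V y) (curve V z) := by
  have hz : ∀ i j, ⌊x⌋ ≤ i → i ≤ ⌊x⌋ + 1 → ⌊y⌋ ≤ j → j ≤ ⌊y⌋ + 1 →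
      0 ≤ far (V i) (V j) (curve V z) := fun i j _ _ _ _ =>
    slot_nonneg (h.nonneg (by omega) (by omega) (by omega))
      (h.nonneg (by omega) (by omega) (by omega))
  have p₁ : 0 < far (V ⌊x⌋) (V ⌊y⌋) (curve V z) :=
    slot_pos (h.pos _ _ _ h₁ h₂ h₃) (h.nonneg (by omega) (by omega) (by omega))
  have hy : ∀ i, ⌊x⌋ ≤ i → i ≤ ⌊x⌋ + 1 → 0 ≤ far (curve V z) (V i) (curve V y) := by
    intro i _ _
    refine slot_nonneg ?_ ?_ <;> rw [far_rotate] <;>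
      exact hz _ _ ‹_› ‹_› (by omega) (by omega)
  have p₂ : 0 < far (curve V z) (V ⌊x⌋) (curve V y) :=
    slot_pos (by rw [far_rotate]; exact p₁)
      (by rw [far_rotate]; exact hz _ _ le_rfl (by omega) (by omega) le_rfl)
  rw [far_rotate]
  exact slot_pos (by rw [far_rotate]; exact p₂)
    (by rw [far_rotate]; exact hy _ (by omega) le_rfl)

/-- Convexity is strict except along edges: three distinct points in cyclic order are degenerate
only if one closed edge contains them all. The three exceptional cases differ in which of the points
comes first on that edge. -/
theorem pos_or_edge (h : ConvSeq n V) {x y z : ℝ} (h₁ : x < y) (h₂ : y < z) (h₃ : z < x + n) :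
    0 < far (curve V x) (curve V y) (curve V z) ∨ (∃ m : ℤ, (m : ℝ) ≤ x ∧ z ≤ m + 1) ∨
      (∃ m : ℤ, (m : ℝ) ≤ y ∧ x + n ≤ m + 1) ∨ (∃ m : ℤ, (m : ℝ) ≤ z ∧ y + n ≤ m + 1) := by
  have fx := Int.floor_le x
  have fx' := Int.lt_floor_add_one x
  have fy := Int.floor_le y
  have fy' := Int.lt_floor_add_one y
  have fz := Int.floor_le z
  have fz' := Int.lt_floor_add_one z
  have h4 : ⌊x⌋ ≤ ⌊y⌋ := Int.floor_le_floor h₁.le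
  have h5 : ⌊y⌋ ≤ ⌊z⌋ := Int.floor_le_floor h₂.le
  have h6 : ⌊z⌋ ≤ ⌊x⌋ + n := by
    have := Int.floor_le_floor h₃.le
    rwa [Int.floor_add_intCast] at this
  rcases h4.eq_or_lt with e | h4
  · by_cases hz : z ≤ ⌊x⌋ + 1
    · exact .inr (.inl ⟨_, fx, hz⟩)
    by_cases hz' : z < ⌊x⌋ + n
    · left
      rw [far_on_two V _ ⌊x⌋ x y fx fx'.le (by rw [e]; exact fy) (by rw [e]; exact fy'.le)]
      exact mul_pos (by linarith) (h.height_pos (not_le.1 hz) hz')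
    · right; right; right
      refine ⟨⌊x⌋ + n, by push_cast; linarith, ?_⟩
      push_cast; rw [e]; linarith
  rcases h5.eq_or_lt with e | h5
  · have hxj : x < ⌊y⌋ := by
      have : ((⌊x⌋ + 1 : ℤ) : ℝ) ≤ ⌊y⌋ := by exact_mod_cast h4
      push_cast at this; linarith
    by_cases hx : x + n ≤ ⌊y⌋ + 1
    · exact .inr (.inr (.inl ⟨_, fy, hx⟩))
    · left
      rw [far_rotate, far_on_two V _ ⌊y⌋ y z fy fy'.le (by rw [e]; exact fz)
        (by rw [e]; exact fz'.le), ← h.curve_per x]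
      exact mul_pos (by linarith) (h.height_pos (not_le.1 hx) (by linarith))
  rcases h6.eq_or_lt with e | h6
  · have e' : (⌊z⌋ : ℝ) = ⌊x⌋ + n := by exact_mod_cast e
    have hy : (⌊x⌋ : ℝ) + 1 ≤ y := by
      have : ((⌊x⌋ + 1 : ℤ) : ℝ) ≤ ⌊y⌋ := by exact_mod_cast h4
      push_cast at this; linarith
    have hy' : y < ⌊x⌋ + n := by
      have : ((⌊y⌋ + 1 : ℤ) : ℝ) ≤ ⌊z⌋ := by exact_mod_cast h5
      push_cast at this; linarith
    rcases hy.eq_or_lt with hy | hy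
    · right; right; right
      exact ⟨⌊z⌋, fz, by linarith⟩
    · left
      rw [far_rotate, far_rotate, ← h.curve_per_neg z,
        far_on_two V _ ⌊x⌋ (z - n) x (by linarith) (by linarith) fx fx'.le]
      exact mul_pos (by linarith) (h.height_pos hy hy')
  · exact .inl (h.pos_of_floor h4 h5 h6)

theorem edge_zero (m : ℤ) {x y z : ℝ} (hx : (m : ℝ) ≤ x) (hxy : x ≤ y) (hyz : y ≤ z)
    (hz : z ≤ m + 1) : far (curve V x) (curve V y) (curve V z) = 0 := by
  rw [far_on_two V _ m x y hx (by linarith) (by linarith) (by linarith),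
    height_zero m (by linarith) hz, mul_zero]

theorem curve_nonneg (h : ConvSeq n V) {x y z : ℝ} (h₁ : x ≤ y) (h₂ : y ≤ z) (h₃ : z ≤ x + n) :
    0 ≤ far (curve V x) (curve V y) (curve V z) := by
  rcases h₁.eq_or_lt with rfl | h₁
  · rw [far_self_left]
  rcases h₂.eq_or_lt with rfl | h₂
  · rw [far_self_right]
  rcases h₃.eq_or_lt with rfl | h₃
  · rw [h.curve_per, far_self_outer]
  rcases h.pos_or_edge h₁ h₂ h₃ with h4 | ⟨m, h4, h5⟩ | ⟨m, h4, h5⟩ | ⟨m, h4, h5⟩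
  · exact h4.le
  · rw [edge_zero m h4 h₁.le h₂.le h5]
  · rw [far_rotate, ← h.curve_per x, edge_zero m h4 h₂.le h₃.le h5]
  · rw [far_rotate, far_rotate, ← h.curve_per x, ← h.curve_per y,
      edge_zero m h4 h₃.le (by linarith) h5]

theorem height_nonneg (h : ConvSeq n V) (p : ℤ) {x : ℝ} (h₁ : (p : ℝ) ≤ x) (h₂ : x ≤ p + n) :
    0 ≤ far (V p) (V (p + 1)) (curve V x) := by
  by_cases hx : x ≤ p + 1
  · rw [height_zero p h₁ hx]
  rcases h₂.eq_or_lt with rfl | h₂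
  · rw [h.curve_per, curve_int, far_self_outer]
  · exact (h.height_pos (not_le.1 hx) h₂).le

theorem exists_lift_real (hn : 0 < n) (x k : ℝ) : ∃ z : ℤ, k ≤ x + z * n ∧ x + z * n < k + n := by
  have hn' : (0 : ℝ) < n := by exact_mod_cast hn
  refine ⟨-⌊(x - k) / n⌋, ?_, ?_⟩
  · have := mul_le_mul_of_nonneg_right (Int.floor_le ((x - k) / n)) hn'.le
    rw [div_mul_cancel₀ _ hn'.ne'] at this
    push_cast; linarith
  · have := mul_lt_mul_of_pos_right (Int.lt_floor_add_one ((x - k) / n)) hn'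
    rw [div_mul_cancel₀ _ hn'.ne'] at this
    push_cast; linarith

theorem height_nonneg_all (h : ConvSeq n V) (p : ℤ) (x : ℝ) :
    0 ≤ far (V p) (V (p + 1)) (curve V x) := by
  have h0 := h.three
  obtain ⟨z, h1, h2⟩ := exists_lift_real (n := n) (by omega) x p
  rw [← h.curve_per_mul x z]
  exact h.height_nonneg p h1 h2.le

theorem height_affine (a b : Point) (m : ℤ) {x y z : ℝ} (hx : (m : ℝ) ≤ x) (hxy : x ≤ y)
    (hyz : y ≤ z) (hz : z ≤ m + 1) :
    (z - x) * far a b (curve V y) =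
      (z - y) * far a b (curve V x) + (y - x) * far a b (curve V z) := by
  rw [far_on V a b m x hx (by linarith), far_on V a b m y (by linarith) (by linarith),
    far_on V a b m z (by linarith) hz]
  ring

/-- Heights over an edge are quasi-concave along the boundary. -/
theorem height_quasi (h : ConvSeq n V) {p : ℤ} {x y z : ℝ} (hx : (p : ℝ) + 1 ≤ x) (hxy : x < y)
    (hyz : y < z) (hz : z ≤ p + n) :
    far (V p) (V (p + 1)) (curve V x) < far (V p) (V (p + 1)) (curve V y) ∨
    far (V p) (V (p + 1)) (curve V z) < far (V p) (V (p + 1)) (curve V y) ∨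
    (far (V p) (V (p + 1)) (curve V x) = far (V p) (V (p + 1)) (curve V y) ∧
      far (V p) (V (p + 1)) (curve V y) = far (V p) (V (p + 1)) (curve V z)) := by
  by_contra hc
  push Not at hc
  obtain ⟨c1, c2, c3⟩ := hc
  have hy := h.height_pos (p := p) (x := y) (by linarith) (by linarith)
  have h4 := far_four (V p) (V (p + 1)) (V p) (curve V x) (curve V y) (curve V z)
  have hs := far_four_sum (V p) (curve V x) (curve V y) (curve V z)
  rw [far_self_outer] at h4
  have hn : (3 : ℝ) ≤ n := by exact_mod_cast h.three
  have m1 : 0 ≤ far (V p) (curve V y) (curve V z) := by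
    have := h.curve_nonneg (x := p) (y := y) (z := z) (by linarith) (by linarith) hz
    rwa [curve_int] at this
  have m3 : 0 ≤ far (V p) (curve V x) (curve V y) := by
    have := h.curve_nonneg (x := p) (y := x) (z := y) (by linarith) (by linarith) (by linarith)
    rwa [curve_int] at this
  have k1 := mul_le_mul_of_nonneg_right c1 m1
  have k3 := mul_le_mul_of_nonneg_right c2 m3
  rcases h.pos_or_edge hxy hyz (by linarith) with m0 | ⟨m, h4, h5⟩ | ⟨m, h4, h5⟩ | ⟨m, h4, h5⟩
  · nlinarith [mul_pos hy m0]
  -- On a common edge the height is affine, so if neither neighbour is lower then all three values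
  -- agree, which is the third alternative.
  · have e := height_affine (V := V) (V p) (V (p + 1)) m h4 hxy.le hyz.le h5
    have k1 := mul_le_mul_of_nonneg_left c1 (sub_nonneg.2 hyz.le)
    have k2 := mul_le_mul_of_nonneg_left c2 (sub_nonneg.2 hxy.le)
    have e1 : (z - y) * (far (V p) (V (p + 1)) (curve V x) -
      far (V p) (V (p + 1)) (curve V y)) = 0 := by linarith
    have e2 : (y - x) * (far (V p) (V (p + 1)) (curve V z) -
      far (V p) (V (p + 1)) (curve V y)) = 0 := by linarith
    rcases mul_eq_zero.1 e1 with e1 | e1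
    · linarith
    rcases mul_eq_zero.1 e2 with e2 | e2
    · linarith
    exact c3 (by linarith) (by linarith)
  -- An edge that contains `y` and `x + n` would begin before the vertex `p + n` and end after it.
  · have : (m : ℝ) < ((p + n : ℤ) : ℝ) := by push_cast; linarith
    have : m + 1 ≤ p + n := by exact_mod_cast this
    have : (m : ℝ) + 1 ≤ p + n := by exact_mod_cast this
    linarith
  · have : (m : ℝ) ≤ ((p + n : ℤ) : ℝ) := by push_cast; linarith
    have : m ≤ p + n := by exact_mod_cast this
    have : (m : ℝ) ≤ p + n := by exact_mod_cast this
    linarith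

/-- Heights increase before a point where they increase. -/
theorem height_mono (h : ConvSeq n V) {p : ℤ} {x y z : ℝ} (hx : (p : ℝ) + 1 ≤ x) (hxy : x ≤ y)
    (hyz : y < z) (hz : z ≤ p + n)
    (hle : far (V p) (V (p + 1)) (curve V y) ≤ far (V p) (V (p + 1)) (curve V z)) :
    far (V p) (V (p + 1)) (curve V x) ≤ far (V p) (V (p + 1)) (curve V y) := by
  rcases hxy.eq_or_lt with rfl | hxy
  · exact le_rfl
  rcases h.height_quasi hx hxy hyz hz with h1 | h1 | ⟨h1, h2⟩ <;> linarith

/-- Heights decrease after a point where they decrease. -/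
theorem height_anti (h : ConvSeq n V) {p : ℤ} {x y z : ℝ} (hx : (p : ℝ) + 1 ≤ x) (hxy : x < y)
    (hyz : y ≤ z) (hz : z ≤ p + n)
    (hle : far (V p) (V (p + 1)) (curve V y) ≤ far (V p) (V (p + 1)) (curve V x)) :
    far (V p) (V (p + 1)) (curve V z) ≤ far (V p) (V (p + 1)) (curve V y) := by
  rcases hyz.eq_or_lt with rfl | hyz
  · exact le_rfl
  rcases h.height_quasi hx hxy hyz hz with h1 | h1 | ⟨h1, h2⟩ <;> linarith

theorem curve_injective (h : ConvSeq n V) {x y : ℝ} (h₁ : x < y) (h₂ : y < x + n) :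
    curve V x ≠ curve V y := by
  intro e
  have fx := Int.floor_le x
  have fx' := Int.lt_floor_add_one x
  have hn : (3 : ℝ) ≤ n := by exact_mod_cast h.three
  by_cases h3 : y ≤ ⌊x⌋ + 1
  · have h4 := far_on_two V (V (⌊x⌋ + 2)) ⌊x⌋ x y fx fx'.le (by linarith) h3
    rw [e, far_self_left] at h4
    have h5 := h.pos ⌊x⌋ (⌊x⌋ + 1) (⌊x⌋ + 2) (by omega) (by omega) (by have := h.three; omega)
    have := mul_pos (sub_pos.2 h₁) h5
    linarith
  by_cases h4 : y < ⌊x⌋ + n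
  · have h5 := h.height_pos (not_le.1 h3) h4
    rw [← e, height_zero _ fx fx'.le] at h5
    exact lt_irrefl _ h5
  · have h4 := far_on_two V (V (⌊x⌋ + 2)) ⌊x⌋ (y - n) x (by linarith) (by linarith) fx fx'.le
    rw [h.curve_per_neg, ← e, far_self_left] at h4
    have h5 := h.pos ⌊x⌋ (⌊x⌋ + 1) (⌊x⌋ + 2) (by omega) (by omega) (by have := h.three; omega)
    have := mul_pos (show 0 < x - (y - n) by linarith) h5
    linarith

end ConvSeq

/-! ### Stable triangles, and how two of them interleave -/

/-- The parameters of the corners of a triangle all of whose corners are stable. -/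
structure Stab (n : ℤ) (V : ℤ → Point) (a b c : ℝ) : Prop where
  lt₁ : a < b
  lt₂ : b < c
  lt₃ : c < a + n
  pos : 0 < far (curve V a) (curve V b) (curve V c)
  max₁ : ∀ x, far (curve V b) (curve V c) (curve V x) ≤ far (curve V b) (curve V c) (curve V a)
  max₂ : ∀ x, far (curve V c) (curve V a) (curve V x) ≤ far (curve V c) (curve V a) (curve V b)
  max₃ : ∀ x, far (curve V a) (curve V b) (curve V x) ≤ far (curve V a) (curve V b) (curve V c)

theorem far_sum (a b c w : Point) : far a b w + far b c w + far c a w = far a b c := by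
  simp only [far_eq]; ring

/-- In the affine coordinates `far b c ·` and `far c a ·` areas become determinants of order two, up
to the factor `far a b c`. -/
theorem far_coord (a b c p q r : Point) :
    far a b c * far p q r =
      (far b c q - far b c p) * (far c a r - far c a p) -
      (far c a q - far c a p) * (far b c r - far b c p) := by
  simp only [far_eq]; ring

theorem eq_of_far {a b c p q : Point} (h : 0 < far a b c) (h₁ : far b c p = far b c q)
    (h₂ : far c a p = far c a q) : p = q := by
  have key : ∀ i : Fin 2, far a b c * (p i - q i) =
      (far b c p - far b c q) * (a i - c i) + (far c a p - far c a q) * (b i - c i) := by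
    intro i
    fin_cases i <;> simp only [far_eq, Fin.zero_eta, Fin.mk_one] <;> ring
  ext i
  have := key i
  rw [h₁, h₂, sub_self, sub_self, zero_mul, zero_mul, add_zero] at this
  rcases mul_eq_zero.1 this with h3 | h3
  · exact absurd h3 h.ne'
  · linarith

/-- The coordinates are the distances from `BC` and from `CA`, so `A = (F, 0)`, `B = (0, F)`, `C =
(0, 0)`, and `X = (x₁, y₁)`, `Y = (x₂, y₂)`, `Z = (p, q)`. The conditions `hA` and `hC` say that `A`
and `C` are not farther from `YZ` than `X`. If `q ≤ y₂`, then `hA` is a sum of nonnegative terms and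
forces `X = A` or `Y = Z`; otherwise `hC` is one and forces `X = B`. -/
theorem no_crossing_coords {F x₁ y₁ x₂ y₂ p q : ℝ} (hx₁ : x₁ ≤ F) (hy₁ : y₁ ≤ F)
    (h₁ : F ≤ x₁ + y₁) (hp : p ≤ x₂)
    (hXA : ¬ (x₁ = F ∧ y₁ = 0)) (hXB : ¬ (x₁ = 0 ∧ y₁ = F))
    (hT : 0 < (x₂ - x₁) * (q - y₁) - (y₂ - y₁) * (p - x₁))
    (hA : (x₂ - p) * y₁ + (y₂ - q) * (F - x₁) ≤ 0) (hC : (x₂ - p) * y₁ - (y₂ - q) * x₁ ≤ 0)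
    (hE : p = x₂ → ¬ q < y₂) : False := by
  have hx0 : 0 ≤ x₁ := by linarith
  have hy0 : 0 ≤ y₁ := by linarith
  have k1 := mul_nonneg (sub_nonneg.2 hp) hy0
  by_cases hd : q ≤ y₂
  · have k2 := mul_nonneg (sub_nonneg.2 hd) (sub_nonneg.2 hx₁)
    rcases hp.eq_or_lt with hp | hp
    · have := hE hp
      have hq : q = y₂ := by linarith
      subst hp hq
      linarith [hT]
    · have : (x₂ - p) * y₁ = 0 := by linarith
      rcases mul_eq_zero.1 this with h3 | h3
      · linarith
      · exact hXA ⟨by linarith, h3⟩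
  · have k3 := mul_nonneg (show 0 ≤ q - y₂ by linarith) hx0
    have : (q - y₂) * x₁ = 0 := by linarith
    rcases mul_eq_zero.1 this with h3 | h3
    · linarith
    · exact hXB ⟨h3, by linarith⟩

/-- Used for two triangles `ABC` and `XYZ` with `X` on the arc cut off by `AB`: stability of `A` and
`B` confines `X` to a parallelogram, stability of `X` bounds `A` and `C`, and the remaining
hypotheses say that going from `Y` to `Z` does not lead away from `BC`. -/
theorem no_crossing {A B C X Y Z : Point} (hF : 0 < far A B C) (hT : 0 < far X Y Z)
    (hX₁ : far B C X ≤ far A B C) (hX₂ : far C A X ≤ far A B C) (hX₃ : far A B X ≤ 0)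
    (hXA : X ≠ A) (hXB : X ≠ B)
    (hA : far Y Z A ≤ far Y Z X) (hC : far Y Z C ≤ far Y Z X)
    (hp : far B C Z ≤ far B C Y) (hE : far B C Z = far B C Y → ¬ far C A Z < far C A Y) :
    False := by
  have s1 := far_sum A B C X
  have c1 := far_coord A B C X Y Z
  have c2 := far_coord A B C Y Z A
  have c3 := far_coord A B C Y Z C
  have c4 := far_coord A B C Y Z X
  have eA : far B C A = far A B C := by rw [far_rotate A]
  have eC : far C A C = 0 := far_self_outer _ _
  have eA' : far C A A = 0 := far_self_right _ _
  have eC' : far B C C = 0 := far_self_right _ _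
  have eB : far B C B = 0 := far_self_outer _ _
  have eB' : far C A B = far A B C := by rw [far_rotate]
  have k1 := mul_le_mul_of_nonneg_left hA hF.le
  have k2 := mul_le_mul_of_nonneg_left hC hF.le
  rw [c2, c4, eA, eA'] at k1
  rw [c3, c4, eC, eC'] at k2
  refine no_crossing_coords hX₁ hX₂ (by linarith) hp ?_ ?_
    (by have := mul_pos hF hT; rw [c1] at this; exact this) (by linarith) (by linarith) hE
  · rintro ⟨e1, e2⟩
    exact hXA (eq_of_far hF (e1.trans eA.symm) (e2.trans eA'.symm))
  · rintro ⟨e1, e2⟩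
    exact hXB (eq_of_far hF (e1.trans eB.symm) (e2.trans eB'.symm))

theorem no_crossing_mirror {A B C X Y Z : Point} (hF : 0 < far A B C) (hT : 0 < far X Y Z)
    (hY₁ : far B C Y ≤ far A B C) (hY₂ : far C A Y ≤ far A B C) (hY₃ : far A B Y ≤ 0)
    (hYA : Y ≠ A) (hYB : Y ≠ B)
    (hB : far Z X B ≤ far Z X Y) (hC : far Z X C ≤ far Z X Y)
    (hp : far C A Z ≤ far C A X) (hE : far C A Z = far C A X → ¬ far B C Z < far B C X) :
    False := by
  have inj : ∀ p q : Point, refl p = refl q → p = q := by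
    intro p q e
    have e0 : refl p 0 = refl q 0 := by rw [e]
    have e1 : refl p 1 = refl q 1 := by rw [e]
    ext i
    fin_cases i
    · simpa [refl] using e1
    · simpa [refl] using e0
  have c : ∀ p q r : Point, far (refl p) (refl q) (refl r) = far q p r := far_refl
  refine no_crossing (A := refl B) (B := refl A) (C := refl C) (X := refl Y) (Y := refl X)
    (Z := refl Z) ?_ ?_ ?_ ?_ ?_ (fun e => hYB (inj _ _ e)) (fun e => hYA (inj _ _ e)) ?_ ?_ ?_ ?_
    <;> simp only [c] <;> assumption

namespace Stab
variable {n : ℤ} {V : ℤ → Point} {a b c : ℝ}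

theorem rotate (h : ConvSeq n V) (s : Stab n V a b c) : Stab n V b c (a + n) where
  lt₁ := s.lt₂
  lt₂ := s.lt₃
  lt₃ := by linarith [s.lt₁]
  pos := by rw [h.curve_per, ← far_rotate]; exact s.pos
  max₁ := by rw [h.curve_per]; exact s.max₂
  max₂ := by rw [h.curve_per]; exact s.max₃
  max₃ := by exact fun x => by rw [h.curve_per]; exact s.max₁ x

theorem shift (h : ConvSeq n V) (s : Stab n V a b c) (z : ℤ) :
    Stab n V (a + z * n) (b + z * n) (c + z * n) where
  lt₁ := by linarith [s.lt₁]
  lt₂ := by linarith [s.lt₂]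
  lt₃ := by linarith [s.lt₃]
  pos := by simp only [h.curve_per_mul]; exact s.pos
  max₁ := by simp only [h.curve_per_mul]; exact s.max₁
  max₂ := by simp only [h.curve_per_mul]; exact s.max₂
  max₃ := by simp only [h.curve_per_mul]; exact s.max₃

theorem rotate_back (h : ConvSeq n V) (s : Stab n V a b c) : Stab n V (c - n) a b := by
  have := (s.rotate h).rotate h |>.shift h (-1)
  convert this using 1 <;> push_cast <;> ring

theorem far_eq_sum (_ : Stab n V a b c) :
    far (curve V b) (curve V c) (curve V a) = far (curve V a) (curve V b) (curve V c) ∧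
      far (curve V c) (curve V a) (curve V b) = far (curve V a) (curve V b) (curve V c) :=
  ⟨(far_rotate _ _ _).symm, far_rotate _ _ _⟩

theorem arc_nonpos (h : ConvSeq n V) {u v w : ℝ} (h1 : u ≤ w) (h2 : w ≤ v) (h3 : v ≤ u + n) :
    far (curve V u) (curve V v) (curve V w) ≤ 0 := by
  have := h.curve_nonneg h1 h2 h3
  rw [far_swap_right] at this
  linarith

/-- This is `no_crossing`, whose condition on `Y` and `Z` holds because distances from `BC` do not
increase on the way from `A`, where they are largest, to `B`, where they vanish. -/
theorem not_three_in_arc (h : ConvSeq n V) (s : Stab n V a b c) {x y z : ℝ} (t : Stab n V x y z)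
    (hax : a < x) (hzb : z < b) : False := by
  have hab := s.lt₁
  have hbc := s.lt₂
  have hca := s.lt₃
  have hxy := t.lt₁
  have hyz := t.lt₂
  obtain ⟨eA, eB⟩ := s.far_eq_sum
  have mx := s.max₁ x
  have mx' := s.max₂ x
  have my := s.max₁ y
  have my' := s.max₂ y
  have mz := s.max₁ z
  rw [eA] at mx my mz
  rw [eB] at mx' my'
  have nx := arc_nonpos h hax.le (show x ≤ b by linarith) (by linarith)
  have ny := arc_nonpos h (show a ≤ y by linarith) (show y ≤ b by linarith) (by linarith)
  have sy := far_sum (curve V a) (curve V b) (curve V c) (curve V y)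
  have nB : curve V y ≠ curve V b := h.curve_injective (by linarith) (by linarith)
  have fB : far (curve V b) (curve V c) (curve V b) = 0 := far_self_outer _ _
  have m0 := h.curve_nonneg hyz.le hzb.le (by linarith)
  refine no_crossing (A := curve V a) (B := curve V b) (C := curve V c)
    (X := curve V x) (Y := curve V y) (Z := curve V z) s.pos t.pos mx mx' nx
    (h.curve_injective hax (by linarith)).symm (h.curve_injective (by linarith) (by linarith))
    (t.max₁ a) (t.max₁ c) ?_ ?_
  -- An increase from `y` to `z` would contradict concavity between `a` and `b`, unless `a`, `z`,
  -- `b` lie on one edge. In that case one of the two triangles is degenerate.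
  · by_contra hlt
    push Not at hlt
    have h4 := far_four (curve V b) (curve V c) (curve V a) (curve V y) (curve V z) (curve V b)
    have hs := far_four_sum (curve V a) (curve V y) (curve V z) (curve V b)
    rw [fB, eA] at h4
    have m3 := h.curve_nonneg (show a ≤ y by linarith) hyz.le (by linarith)
    have k1 := mul_le_mul_of_nonneg_right mz m0
    rcases h.pos_or_edge (show a < z by linarith) hzb (by linarith) with
      m1 | ⟨m, e1, e2⟩ | ⟨m, e1, e2⟩ | ⟨m, e1, e2⟩
    · have k2 := mul_pos (sub_pos.2 hlt) m1
      have k3 := mul_nonneg (show 0 ≤ far (curve V b) (curve V c) (curve V z) by linarith) m3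
      nlinarith
    · have := t.pos
      rw [ConvSeq.edge_zero m (by linarith) hxy.le hyz.le (by linarith)] at this
      exact lt_irrefl _ this
    · have := (s.rotate h).pos
      rw [ConvSeq.edge_zero m (by linarith) hbc.le hca.le (by linarith)] at this
      exact lt_irrefl _ this
    · have := (s.rotate h).pos
      rw [ConvSeq.edge_zero m (by linarith) hbc.le hca.le (by linarith)] at this
      exact lt_irrefl _ this
  -- If `Y` and `Z` are equally far from `BC` and `Z` is closer to `CA`, the order of `Y`, `Z`, `B`
  -- forces the common distance to be 0. Since `Y` is beyond `AB` and not farther from `CA` than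
  -- `B`, it is then `B` itself.
  · intro e hlt
    have c1 := far_coord (curve V a) (curve V b) (curve V c) (curve V y) (curve V z) (curve V b)
    rw [e, fB] at c1
    have k1 := mul_nonneg s.pos.le m0
    have y0 : 0 ≤ far (curve V b) (curve V c) (curve V y) := by linarith
    have y1 : far (curve V b) (curve V c) (curve V y) = 0 := by
      by_contra hne
      have := mul_pos (lt_of_le_of_ne y0 (Ne.symm hne)) (sub_pos.2 hlt)
      nlinarith
    exact nB (eq_of_far s.pos (by linarith) (by linarith))

/-- No open arc of a stable triangle contains two corners of another one. -/
theorem not_two_in_arc (h : ConvSeq n V) (s : Stab n V a b c) {x y z : ℝ} (t : Stab n V x y z)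
    (hax : a < x) (hyb : y < b) : False := by
  have hab := s.lt₁
  have hbc := s.lt₂
  have hca := s.lt₃
  have hxy := t.lt₁
  have hyz := t.lt₂
  have hzx := t.lt₃
  by_cases h1 : z < b
  · exact s.not_three_in_arc h t hax h1
  by_cases h3 : a + n < z
  · exact s.not_three_in_arc h (t.rotate_back h) (by linarith) hyb
  push Not at h1 h3
  obtain ⟨eA, eB⟩ := s.far_eq_sum
  have mx := s.max₁ x
  have mx' := s.max₂ x
  have my := s.max₁ y
  have my' := s.max₂ y
  rw [eA] at mx my
  rw [eB] at mx' my'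
  have nx := arc_nonpos h hax.le (show x ≤ b by linarith) (by linarith)
  have ny := arc_nonpos h (show a ≤ y by linarith) (show y ≤ b by linarith) (by linarith)
  have sx := far_sum (curve V a) (curve V b) (curve V c) (curve V x)
  have sy := far_sum (curve V a) (curve V b) (curve V c) (curve V y)
  have fB : far (curve V b) (curve V c) (curve V b) = 0 := far_self_outer _ _
  have fA : far (curve V c) (curve V a) (curve V a) = 0 := far_self_right _ _
  -- On the arc from `b` to `c` the point `Z` is not on the right of `BC`, while `Y` is not on its
  -- left. On the arc from `c` to `a` the same holds for `CA` and `X`, and the mirror image applies.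
  by_cases h2 : z ≤ c
  · have hz := arc_nonpos h h1 h2 (by linarith)
    refine no_crossing s.pos t.pos mx mx' nx
      (h.curve_injective hax (by linarith)).symm (h.curve_injective (by linarith) (by linarith))
      (t.max₁ a) (t.max₁ c) (by linarith) fun e _ => ?_
    exact h.curve_injective hyb (by linarith)
      (eq_of_far s.pos (show _ = far _ _ (curve V b) by linarith) (by linarith))
  · have hz := arc_nonpos h (show c ≤ z by linarith) h3 (by linarith)
    rw [h.curve_per] at hz
    refine no_crossing_mirror s.pos t.pos my my' ny
      (h.curve_injective (by linarith) (by linarith)).symm (h.curve_injective hyb (by linarith))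
      (t.max₂ b) (t.max₂ c) (by linarith) fun e _ => ?_
    exact h.curve_injective hax (by linarith)
      (eq_of_far s.pos (show far _ _ (curve V a) = _ by linarith) (by linarith))

/-- Every open arc of either triangle contains at most one corner of the other, so corners
alternate. The second alternative needs a common corner `a = r`, which can be counted at the end of
the period as well as at its start. -/
theorem interleave_sorted (h : ConvSeq n V) (s : Stab n V a b c) {r s' t : ℝ}
    (k : Stab n V r s' t) (ha : r ≤ a) (hc : c < r + n) :
    (a ≤ s' ∧ s' ≤ b ∧ b ≤ t ∧ t ≤ c) ∨ (a = r ∧ b ≤ s' ∧ s' ≤ c ∧ c ≤ t) := by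
  have hab := s.lt₁
  have hbc := s.lt₂
  have hrs := k.lt₁
  have hst := k.lt₂
  have htr := k.lt₃
  have h1 : a ≤ s' := by
    by_contra hlt
    exact ((s.rotate h).rotate h).not_two_in_arc h ((k.rotate h).rotate h |>.rotate h)
      hc (by linarith)
  have e1 : r < a → s' ≤ b := fun h2 => by
    by_contra hlt
    exact k.not_two_in_arc h s h2 (by linarith)
  by_cases hb : s' ≤ b
  · by_cases hw : t ≤ c
    · left
      refine ⟨h1, hb, ?_, hw⟩
      by_contra hlt
      exact ((k.rotate h).rotate h).not_two_in_arc h (s.rotate h) (by linarith) (by linarith)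
    · right
      push Not at hw
      refine ⟨le_antisymm ?_ ha, ?_, by linarith, hw.le⟩
      · by_contra hlt
        exact ((s.rotate h).rotate h).not_two_in_arc h ((k.rotate h).rotate h) hw (by linarith)
      · by_contra hlt
        exact (k.rotate h).not_two_in_arc h (s.rotate h) (by linarith) (by linarith)
  · right
    push Not at hb
    have : a = r := by
      rcases ha.eq_or_lt with e | hlt
      · exact e.symm
      · exact absurd (e1 hlt) (by linarith)
    refine ⟨this, hb.le, ?_, ?_⟩
    · by_contra hlt
      exact k.not_two_in_arc h (s.rotate h) (by linarith) (by linarith)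
    · by_contra hlt
      exact (s.rotate h).not_two_in_arc h (k.rotate h) (by linarith) (by linarith)

/-- Three rotations of the corners amount to a shift by one period, so invariance under rotation
implies invariance under all shifts. -/
theorem rotation_shift {P : ℝ → ℝ → ℝ → Prop} (hP : ∀ x y z, P y z (x + n) ↔ P x y z) (a b c : ℝ)
    (z : ℤ) : P (a + z * n) (b + z * n) (c + z * n) ↔ P a b c := by
  have one : ∀ a b c, P (a + n) (b + n) (c + n) ↔ P a b c := fun a b c =>
    ((hP c (a + n) (b + n)).trans (hP b c (a + n))).trans (hP a b c)
  induction z using Int.induction_on with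
  | zero => simp
  | succ i ih =>
    refine Iff.trans ?_ ih
    have : ∀ x : ℝ, x + ((i + 1 : ℤ) : ℝ) * n = x + (i : ℤ) * n + n := by
      intro x; push_cast; ring
    rw [this, this, this]
    exact one _ _ _
  | pred i ih =>
    refine Iff.trans ?_ ih
    have : ∀ x : ℝ, x + ((-i : ℤ) : ℝ) * n = x + ((-i - 1 : ℤ) : ℝ) * n + n := by
      intro x; push_cast; ring
    rw [this, this, this]
    exact (one _ _ _).symm

/-- Two stable triangles interleave, after a suitable rotation of the corners of one of them. -/
theorem interleave (h : ConvSeq n V) (s : Stab n V a b c) {r s' t : ℝ} (k : Stab n V r s' t) :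
    ∃ a' b' c' : ℝ, Stab n V a' b' c' ∧ r ≤ a' ∧ a' ≤ s' ∧ s' ≤ b' ∧ b' ≤ t ∧ t ≤ c' ∧ c' ≤ r + n ∧
      ∀ P : ℝ → ℝ → ℝ → Prop, (∀ x y z, P y z (x + n) ↔ P x y z) → (P a' b' c' ↔ P a b c) := by
  have htr := k.lt₃
  -- It suffices to name the corners such that their parameters lie in the period that starts at
  -- `r`. The clause on `P` records that the new triple is the same triangle for every purpose that
  -- does not depend on the naming.
  suffices ∃ a' b' c' : ℝ, Stab n V a' b' c' ∧ r ≤ a' ∧ c' < r + n ∧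
      ∀ P : ℝ → ℝ → ℝ → Prop, (∀ x y z, P y z (x + n) ↔ P x y z) → (P a' b' c' ↔ P a b c) by
    obtain ⟨a', b', c', s1, ha, hc, hP⟩ := this
    have hab := s1.lt₁
    rcases s1.interleave_sorted h k ha hc with ⟨h1, h2, h3, h4⟩ | ⟨h1, h2, h3, h4⟩
    · exact ⟨a', b', c', s1, ha, h1, h2, h3, h4, hc.le, hP⟩
    · exact ⟨b', c', a' + n, s1.rotate h, by linarith, h2, h3, h4, by linarith, by linarith,
        fun P hP' => (hP' _ _ _).trans (hP P hP')⟩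
  obtain ⟨z, h1, h2⟩ := ConvSeq.exists_lift_real (n := n) (by have := h.three; omega) a r
  have s1 := s.shift h z
  have hP := fun (P : ℝ → ℝ → ℝ → Prop) hP => rotation_shift (n := n) (P := P) hP a b c z
  revert s1 hP h1 h2
  generalize a + (z : ℝ) * n = x
  generalize b + (z : ℝ) * n = y
  generalize c + (z : ℝ) * n = w
  intro h1 h2 s1 hP
  have hxy := s1.lt₁
  have hyw := s1.lt₂
  have hwx := s1.lt₃
  by_cases h3 : w < r + n
  · exact ⟨x, y, w, s1, h1, h3, hP⟩
  have e : ∀ u : ℝ, u = u - n + n := fun u => by ring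
  by_cases h4 : y < r + n
  · refine ⟨w - n, x, y, s1.rotate_back h, by linarith, h4, fun P hP' => ?_⟩
    rw [← hP P hP', ← hP' (w - n), ← e]
  · refine ⟨y - n, w - n, x, (s1.rotate_back h).rotate_back h, by linarith, by linarith,
      fun P hP' => ?_⟩
    rw [← hP P hP', ← hP' (y - n), ← e, ← hP' (w - n), ← e]

end Stab

/-! ### Pairs of units that cannot belong to a stable triangle -/

/-- The code of the unit that contains a boundary point. -/
def unitOf (x : ℝ) : ℤ := ⌊x⌋ + ⌈x⌉

/-- Together with `odd_le_unitOf` this turns comparisons of codes into comparisons of parameters: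
even codes correspond to weak inequalities with integers, odd ones to strict inequalities. -/
theorem even_le_unitOf {x : ℝ} {i : ℤ} : 2 * i ≤ unitOf x ↔ (i : ℝ) ≤ x := by
  constructor
  · intro h
    by_contra hlt
    push Not at hlt
    have h1 := Int.floor_lt.2 hlt
    have h2 := Int.ceil_le.2 hlt.le
    unfold unitOf at h
    omega
  · intro h
    have h1 := Int.le_floor.2 h
    have h2 := (Int.floor_le_ceil x)
    unfold unitOf
    omega

theorem odd_le_unitOf {x : ℝ} {i : ℤ} : 2 * i + 1 ≤ unitOf x ↔ (i : ℝ) < x := by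
  constructor
  · intro h
    by_contra hlt
    push Not at hlt
    have h2 := Int.ceil_le.2 hlt
    have h3 := Int.floor_le_ceil x
    unfold unitOf at h
    omega
  · intro h
    have h1 := Int.le_floor.2 h.le
    have h2 := Int.lt_ceil.2 h
    unfold unitOf
    omega

theorem unitOf_even {x : ℝ} {i : ℤ} (h : unitOf x = 2 * i) : x = i :=
  le_antisymm (not_lt.1 fun h1 => by have := odd_le_unitOf.2 h1; omega)
    (even_le_unitOf.1 h.ge)

theorem unitOf_odd {x : ℝ} {i : ℤ} (h : unitOf x = 2 * i + 1) : (i : ℝ) < x ∧ x < i + 1 :=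
  ⟨odd_le_unitOf.1 h.ge, not_le.1 fun h1 => by
    have := even_le_unitOf (x := x) (i := i + 1) |>.2 (by push_cast; exact h1)
    omega⟩

theorem unitOf_int (i : ℤ) : unitOf (i : ℝ) = 2 * i := by simp [unitOf]; ring

theorem unitOf_mono {x y : ℝ} (h : x ≤ y) : unitOf x ≤ unitOf y :=
  add_le_add (Int.floor_le_floor h) (Int.ceil_le_ceil h)

theorem unitOf_shift (x : ℝ) (m : ℤ) : unitOf (x + m) = unitOf x + 2 * m := by
  simp [unitOf]; ring

/-- The edge vector. -/
def ev (V : ℤ → Point) (p : ℤ) : Point := V (p + 1) - V p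

theorem far_diff (x y q q' : Point) : far x y q' - far x y q = far q q' x - far q q' y := by
  simp only [far_eq]; ring

theorem far_bary (a b c u v w : Point) :
    far a b c * far u v w =
      far b c w * far u v a + far c a w * far u v b + far a b w * far u v c := by
  simp only [far_eq]; ring

theorem det_ev (V : ℤ → Point) (p : ℤ) (x y : Point) :
    det (ev V p) (y - x) = far (V p) (V (p + 1)) x - far (V p) (V (p + 1)) y := by
  simp only [far_eq, det, ev, PiLp.sub_apply]; ring

theorem det_ev_ev (V : ℤ → Point) (p q : ℤ) :
    det (ev V p) (ev V q) =
      far (V p) (V (p + 1)) (V q) - far (V p) (V (p + 1)) (V (q + 1)) := det_ev ..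

theorem det_ev_ev' (V : ℤ → Point) (p q : ℤ) :
    det (ev V p) (ev V q) =
      far (V q) (V (q + 1)) (V (p + 1)) - far (V q) (V (q + 1)) (V p) := by
  simp only [far_eq, det, ev, PiLp.sub_apply]; ring

/-- With the heights over two edges as coordinates an area is a determinant, scaled by that of the
edge vectors. For the chord `V j`, `V k` two of the four heights vanish, and the formula compares a
point with `X`. -/
theorem far_mul_det (V : ℤ → Point) (p q : ℤ) (b c a : Point) :
    far b c a * -det (ev V p) (ev V q) =
      (far (V q) (V (q + 1)) a - far (V q) (V (q + 1)) b) *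
        (far (V p) (V (p + 1)) c - far (V p) (V (p + 1)) b) +
      (far (V p) (V (p + 1)) a - far (V p) (V (p + 1)) b) *
        (far (V q) (V (q + 1)) b - far (V q) (V (q + 1)) c) := by
  simp only [far_eq, det, ev, PiLp.sub_apply]; ring

theorem edge_value (a b : Point) (V : ℤ → Point) (m : ℤ) {x : ℝ} (h₁ : (m : ℝ) ≤ x)
    (h₂ : x ≤ m + 1) :
    far a b (curve V x) - far a b (V m) = (x - m) * (far a b (V (m + 1)) - far a b (V m)) := by
  rw [far_on V a b m x h₁ h₂]; ring

theorem edge_value' (a b : Point) (V : ℤ → Point) (m : ℤ) {x : ℝ} (h₁ : (m : ℝ) ≤ x)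
    (h₂ : x ≤ m + 1) :
    far a b (V (m + 1)) - far a b (curve V x) =
      (m + 1 - x) * (far a b (V (m + 1)) - far a b (V m)) := by
  rw [far_on V a b m x h₁ h₂]; ring

namespace Stab
variable {n : ℤ} {V : ℤ → Point} {a b c : ℝ}

/-- Distances to `AB` are concave along the chain and largest at `C`. A decrease from `x` to `y`
would make `x` and `c` collinear with `a` and also with `b`, so that `x` would be `c`. -/
theorem chain_up (h : ConvSeq n V) (s : Stab n V a b c) {x y : ℝ} (hbx : b ≤ x) (hxy : x ≤ y)
    (hyc : y ≤ c) :
    far (curve V a) (curve V b) (curve V x) ≤ far (curve V a) (curve V b) (curve V y) := by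
  by_contra hlt
  push Not at hlt
  have hab := s.lt₁
  have hca := s.lt₃
  have key : ∀ u : ℝ, far (curve V a) (curve V b) (curve V u) = 0 → u ≤ b → a ≤ u →
      far (curve V u) (curve V x) (curve V c) = 0 := by
    intro u hu hub hau
    have h4 := far_four (curve V a) (curve V b) (curve V u) (curve V x) (curve V y) (curve V c)
    have hs := far_four_sum (curve V u) (curve V x) (curve V y) (curve V c)
    have m0 := h.curve_nonneg hxy hyc (by linarith)
    have m2 := h.curve_nonneg (show u ≤ x by linarith) (show x ≤ c by linarith) (by linarith)
    have m3 := h.curve_nonneg (show u ≤ x by linarith) hxy (by linarith)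
    have fx := h.curve_nonneg hab.le hbx (by linarith)
    have k1 := mul_le_mul_of_nonneg_right (s.max₃ x) m3
    have k2 := mul_nonneg fx m0
    rw [hu] at h4
    by_contra hne
    have k3 := mul_pos (sub_pos.2 hlt) (lt_of_le_of_ne m2 (Ne.symm hne))
    nlinarith
  have k1 := key b (far_self_right _ _) le_rfl hab.le
  have k2 := key a (far_self_outer _ _) hab.le le_rfl
  have hxc : x < c := by
    rcases (hxy.trans hyc).eq_or_lt with rfl | h1
    · have : y = x := le_antisymm hyc hxy
      rw [this] at hlt
      exact absurd hlt (lt_irrefl _)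
    · exact h1
  refine h.curve_injective hxc (by linarith) (eq_of_far s.pos ?_ ?_)
  · rw [far_self_right, far_swap_right, k1, neg_zero]
  · rw [far_self_outer, ← k2, far_rotate]

/-- The first unit of the pair can be left: it does not form a stable triangle with a unit past the
second one, unless the farthest point is far enough. -/
theorem far_of_past_second (h : ConvSeq n V) (s : Stab n V a b c) {r s' p q j k : ℤ} (hrs : r < s')
    (has : a ≤ s') (hcr : c ≤ r + n) (hsp : s' ≤ p) (hpq : p < q) (hjk : j < k)
    (hb : (j = p ∧ b = p) ∨ (j = p + 1 ∧ (p : ℝ) < b ∧ b < p + 1))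
    (hc : (k = q ∧ (q : ℝ) < c) ∨ (k = q + 1 ∧ (q : ℝ) + 1 ≤ c)) :
    det (ev V p) (ev V q) < 0 ∧
      far (V p) (V (p + 1)) (V k) * far (V q) (V (q + 1)) (V j) ≤
        far (V j) (V k) (curve V a) * -det (ev V p) (ev V q) ∧
      (¬ (j = p ∧ k = q + 1) →
        far (V p) (V (p + 1)) (V k) * far (V q) (V (q + 1)) (V j) <
          far (V j) (V k) (curve V a) * -det (ev V p) (ev V q)) := by
  have hab := s.lt₁
  have hbc := s.lt₂
  have hca := s.lt₃
  have hrs' : (r : ℝ) + 1 ≤ s' := by exact_mod_cast hrs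
  have hsp' : (s' : ℝ) ≤ p := by exact_mod_cast hsp
  have hpq' : (p : ℝ) + 1 ≤ q := by exact_mod_cast hpq
  have hn3 : (3 : ℝ) ≤ n := by exact_mod_cast h.three
  have hqc : (q : ℝ) < c := by rcases hc with hc | hc <;> linarith [hc.2]
  have hqr : (q : ℝ) + 1 ≤ r + n := by
    have : (q : ℝ) < ((r + n : ℤ) : ℝ) := by push_cast; linarith
    have : q + 1 ≤ r + n := by exact_mod_cast this
    exact_mod_cast this
  have hqr' : q + 1 ≤ r + n := by exact_mod_cast hqr
  have hpb : (p : ℝ) ≤ b := by rcases hb with hb | hb <;> linarith [hb.2]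
  have hbp : b < p + 1 := by rcases hb with hb | hb <;> linarith [hb.2]
  -- `A` is at least as high as `C` over the edge `p`
  have i1 : far (V p) (V (p + 1)) (curve V c) ≤ far (V p) (V (p + 1)) (curve V a) := by
    have e1 := edge_value' (curve V c) (curve V a) V p hpb hbp.le
    have e2 := s.max₂ ((p + 1 : ℤ) : ℝ)
    rw [curve_int] at e2
    have e3 := far_diff (curve V c) (curve V a) (V p) (V (p + 1))
    by_contra hlt
    push Not at hlt
    have := mul_pos (show 0 < (p : ℝ) + 1 - b by linarith) (show 0 < far (curve V c) (curve V a)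
      (V (p + 1)) - far (curve V c) (curve V a) (V p) by linarith)
    linarith
  -- `A` is at least as high as `B` over the edge `q`, because the distance to `AB` does not
  -- decrease along that edge.
  have i2 : far (V q) (V (q + 1)) (curve V b) ≤ far (V q) (V (q + 1)) (curve V a) := by
    have e3 := far_diff (curve V a) (curve V b) (V q) (V (q + 1))
    by_cases hcq : (q : ℝ) + 1 ≤ c
    · have := s.chain_up h (x := q) (y := ((q + 1 : ℤ) : ℝ)) (by linarith) (by push_cast; linarith)
        (by push_cast; linarith)
      rw [curve_int, curve_int] at this
      linarith
    · push Not at hcq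
      have e1 := edge_value (curve V a) (curve V b) V q hqc.le hcq.le
      have e2 := s.max₃ q
      rw [curve_int] at e2
      by_contra hlt
      push Not at hlt
      have := mul_pos (show 0 < c - q by linarith) (show 0 < far (curve V a) (curve V b)
        (V q) - far (curve V a) (curve V b) (V (q + 1)) by linarith)
      linarith
  have hC : 0 < far (V p) (V (p + 1)) (curve V c) := h.height_pos (by linarith) (by linarith)
  have mono : ∀ x : ℝ, (p : ℝ) + 1 ≤ x → x ≤ c →
      far (V p) (V (p + 1)) (curve V x) ≤ far (V p) (V (p + 1)) (curve V c) := by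
    intro x h1 h2
    refine h.height_mono h1 h2 hca (by linarith) ?_
    rwa [h.curve_per]
  have mq := mono q hpq' hqc.le
  rw [curve_int] at mq
  have hqle : far (V p) (V (p + 1)) (V q) ≤ far (V p) (V (p + 1)) (V (q + 1)) := by
    by_cases hcq : (q : ℝ) + 1 < c
    · have h1 := mono (q + 1) (by linarith) hcq.le
      have := h.height_mono (x := q) (y := q + 1) hpq' (by linarith) hcq (by linarith) h1
      rw [curve_int] at this
      have e := curve_int V (q + 1)
      push_cast at e
      rwa [e] at this
    · push Not at hcq
      have e1 := edge_value (V p) (V (p + 1)) V q hqc.le hcq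
      by_contra hlt
      push Not at hlt
      have := mul_pos (show 0 < c - q by linarith) (sub_pos.2 hlt)
      linarith
  have w1 := det_ev_ev V p q
  have w2 := det_ev_ev' V p q
  have hB0 : far (V p) (V (p + 1)) (curve V b) = 0 := ConvSeq.height_zero p hpb hbp.le
  have hqp : 0 < far (V q) (V (q + 1)) (V p) := by
    have := h.height_pos (p := q) (x := ((p + n : ℤ) : ℝ)) (by push_cast; linarith)
      (by push_cast; linarith)
    rwa [curve_int, h.per] at this
  -- If the edges were parallel, `B` would be as high over the edge `q` as `V p`. For the chord `V
  -- p`, `V q` the identity `far_mul_det` would then present 0 as a nonnegative plus a positive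
  -- term.
  have hw : det (ev V p) (ev V q) < 0 := by
    refine lt_of_le_of_ne (by linarith) fun hw => ?_
    have e' := far_mul_det V p q (V p) (V q) (curve V a)
    rw [hw, neg_zero, mul_zero, far_self_outer, far_self_outer] at e'
    have hqn : 0 ≤ far (V p) (V (p + 1)) (V q) := by
      have := h.height_nonneg_all p q
      rwa [curve_int] at this
    have hbq : far (V q) (V (q + 1)) (curve V b) = far (V q) (V (q + 1)) (V p) := by
      have := edge_value (V q) (V (q + 1)) V p hpb hbp.le
      rw [← w2, hw, mul_zero] at this
      linarith
    have k1 := mul_nonneg (sub_nonneg.2 i2) hqn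
    have k2 := mul_pos (show 0 < far (V p) (V (p + 1)) (curve V a) by linarith) hqp
    rw [hbq] at k1
    rw [sub_zero, sub_zero] at e'
    linarith
  have hj0 : far (V p) (V (p + 1)) (V j) = 0 := by
    rcases hb with ⟨rfl, -⟩ | ⟨rfl, -⟩
    · exact far_self_outer _ _
    · exact far_self_right _ _
  have hk0 : far (V q) (V (q + 1)) (V k) = 0 := by
    rcases hc with ⟨rfl, -⟩ | ⟨rfl, -⟩
    · exact far_self_outer _ _
    · exact far_self_right _ _
  have i4 : far (V q) (V (q + 1)) (V j) ≤ far (V q) (V (q + 1)) (curve V a) ∧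
      (j = p + 1 → far (V q) (V (q + 1)) (V j) < far (V q) (V (q + 1)) (curve V a)) := by
    rcases hb with ⟨e, e'⟩ | ⟨e, e'⟩
    · rw [e', curve_int] at i2
      rw [e]
      exact ⟨i2, fun h1 => by omega⟩
    · have e1 := edge_value' (V q) (V (q + 1)) V p hpb hbp.le
      rw [← w2] at e1
      have := mul_pos_of_neg_of_neg hw (show b - (p + 1) < 0 by linarith)
      rw [e]
      exact ⟨by linarith, fun _ => by linarith⟩
  have hkc : (p : ℝ) + 1 ≤ k ∧ (k : ℝ) ≤ c := by
    rcases hc with ⟨rfl, h1⟩ | ⟨rfl, h1⟩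
    · exact ⟨hpq', h1.le⟩
    · push_cast; exact ⟨by linarith, h1⟩
  have i5 : far (V p) (V (p + 1)) (V k) ≤ far (V p) (V (p + 1)) (curve V a) := by
    have := mono k hkc.1 hkc.2
    rw [curve_int] at this
    linarith
  have i5' : k = q → far (V p) (V (p + 1)) (V k) < far (V p) (V (p + 1)) (curve V a) := by
    rintro rfl
    by_cases hcq : (k : ℝ) + 1 ≤ c
    · have := mono ((k + 1 : ℤ) : ℝ) (by push_cast; linarith) (by push_cast; linarith)
      rw [curve_int] at this
      linarith
    · push Not at hcq
      have e1 := edge_value (V p) (V (p + 1)) V k hqc.le hcq.le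
      have := mul_pos_of_neg_of_neg hw (show k - c < 0 by linarith)
      have e2 : far (V p) (V (p + 1)) (V (k + 1)) - far (V p) (V (p + 1)) (V k) =
        - det (ev V p) (ev V k) := by linarith
      rw [e2] at e1
      nlinarith
  have hpk : 0 ≤ far (V p) (V (p + 1)) (V k) := by
    have := h.height_nonneg_all p k
    rwa [curve_int] at this
  have hqj : 0 ≤ far (V q) (V (q + 1)) (V j) := by
    have := h.height_nonneg_all q j
    rwa [curve_int] at this
  -- The distance of `A`, in this scale, is `(h_q A - h_q j) h_p k + h_p A h_q j` with `h` for
  -- heights. As `h_q A ≥ h_q j` and `h_p A ≥ h_p k`, it is at least `h_p k h_q j`, which is the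
  -- distance of `X`.
  have fin := far_mul_det V p q (V j) (V k) (curve V a)
  rw [hj0, hk0, sub_zero, sub_zero, sub_zero] at fin
  refine ⟨hw, ?_, ?_⟩
  · rw [fin]
    have k1 := mul_nonneg (sub_nonneg.2 i4.1) hpk
    have k2 := mul_le_mul_of_nonneg_right i5 hqj
    linarith
  -- The first height is strictly larger if `B` is interior to the edge `p`, the second if `V k` is
  -- before `C`. Only a vertex-edge pair has neither.
  · intro hne
    rw [fin]
    have k1 := mul_nonneg (sub_nonneg.2 i4.1) hpk
    have k2 := mul_le_mul_of_nonneg_right i5 hqj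
    by_cases hjp : j = p + 1
    · have : 0 < far (V p) (V (p + 1)) (V k) := by
        have hjk' : (j : ℝ) < k := by exact_mod_cast hjk
        have := h.height_pos (p := p) (x := k) (by rw [hjp] at hjk'; push_cast at hjk'; linarith)
          (by linarith)
        rwa [curve_int] at this
      have := mul_pos (sub_pos.2 (i4.2 hjp)) this
      linarith
    · have hjp : j = p := by rcases hb with hb | hb <;> omega
      have hkq : k = q := by rcases hc with hc | hc <;> omega
      subst hjp
      have := mul_lt_mul_of_pos_right (i5' hkq) hqp
      linarith

/-- Relates the distance from a chord `bv` to that from a chord `uk`, where `v` is on the line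
through `k` with direction `e`; the expressions `-det e (· - k)` are heights over that line. It
transfers a bound from the side `BC` to the chord `V j`, `V k`. -/
theorem far_chord (u v w : Point) (k b e : Point) (l : ℝ) (hv : v = k - l • e) :
    -det e (u - k) * far b v w =
      (far u k w + l * -det e (u - k)) * -det e (b - k) + -det e (w - k) * far u b k -
        l * -det e (w - k) * -det e (u - k) := by
  subst hv
  simp only [far_eq, det, PiLp.sub_apply, PiLp.smul_apply, smul_eq_mul]; ring

/-- The second unit of the pair can be left: if it forms a stable triangle with a unit past the
first one, then all points are close. -/
theorem near_of_past_first (h : ConvSeq n V) (s : Stab n V a b c) {r s' p q j k : ℤ} (hrs : r < s')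
    (has : a ≤ s') (hsp : s' ≤ p) (hpq : p < q) (hkr : k ≤ r + n)
    (hb : (j = p ∧ (p : ℝ) < b) ∨ (j = p + 1 ∧ (p : ℝ) + 1 ≤ b))
    (hc : (k = q ∧ c = q) ∨ (k = q + 1 ∧ (q : ℝ) < c ∧ c < q + 1))
    (hw : det (ev V p) (ev V q) < 0) (x : ℝ) :
      far (V j) (V k) (curve V x) * -det (ev V p) (ev V q) ≤
        far (V p) (V (p + 1)) (V k) * far (V q) (V (q + 1)) (V j) ∧
      ((j = p ∧ k = q + 1) →
        far (V j) (V k) (curve V x) * -det (ev V p) (ev V q) <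
        far (V p) (V (p + 1)) (V k) * far (V q) (V (q + 1)) (V j)) := by
  have hab := s.lt₁
  have hbc := s.lt₂
  have hca := s.lt₃
  have hrs' : (r : ℝ) + 1 ≤ s' := by exact_mod_cast hrs
  have hsp' : (s' : ℝ) ≤ p := by exact_mod_cast hsp
  have hpq' : (p : ℝ) + 1 ≤ q := by exact_mod_cast hpq
  have hkr' : (k : ℝ) ≤ r + n := by exact_mod_cast hkr
  have hn3 : (3 : ℝ) ≤ n := by exact_mod_cast h.three
  have hqk : (q : ℝ) ≤ c ∧ c < q + 1 ∧ c ≤ k := by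
    rcases hc with ⟨h1, h2⟩ | ⟨h1, h2⟩
    · rw [h1, h2]; exact ⟨le_rfl, by linarith, le_rfl⟩
    · rw [h1]; push_cast; exact ⟨by linarith, by linarith, by linarith⟩
  obtain ⟨hqc, hcq, hck⟩ := hqk
  have hpb : (p : ℝ) < b := by rcases hb with hb | hb <;> linarith [hb.2]
  have hjb : (j : ℝ) ≤ b := by
    rcases hb with ⟨h1, h2⟩ | ⟨h1, h2⟩
    · rw [h1]; exact h2.le
    · rw [h1]; push_cast; exact h2
  have hpj : (p : ℝ) ≤ j := by
    rcases hb with ⟨h1, h2⟩ | ⟨h1, h2⟩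
    · rw [h1]
    · rw [h1]; push_cast; linarith
  have w1 := det_ev_ev V p q
  have w2 := det_ev_ev' V p q
  have hC0 : far (V q) (V (q + 1)) (curve V c) = 0 := ConvSeq.height_zero q hqc hcq.le
  have hk0 : far (V q) (V (q + 1)) (V k) = 0 := by
    rcases hc with ⟨rfl, -⟩ | ⟨rfl, -⟩
    · exact far_self_outer _ _
    · exact far_self_right _ _
  have hj0 : far (V p) (V (p + 1)) (V j) = 0 := by
    rcases hb with ⟨rfl, -⟩ | ⟨rfl, -⟩
    · exact far_self_outer _ _
    · exact far_self_right _ _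
  -- `A` is at most as high as `C` over the edge `p`
  have i1 : far (V p) (V (p + 1)) (curve V a) ≤ far (V p) (V (p + 1)) (curve V c) := by
    have e3 := far_diff (curve V c) (curve V a) (V p) (V (p + 1))
    by_cases hbp : (p : ℝ) + 1 ≤ b
    · have := (s.rotate_back h).chain_up h (x := p) (y := ((p + 1 : ℤ) : ℝ)) (by linarith)
        (by push_cast; linarith) (by push_cast; linarith)
      rw [curve_int, curve_int, h.curve_per_neg] at this
      linarith
    · push Not at hbp
      have e1 := edge_value (curve V c) (curve V a) V p hpb.le hbp.le
      have e2 := s.max₂ p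
      rw [curve_int] at e2
      by_contra hlt
      push Not at hlt
      have := mul_pos (show 0 < b - p by linarith) (show 0 < far (curve V c) (curve V a)
        (V p) - far (curve V c) (curve V a) (V (p + 1)) by linarith)
      linarith
  have e3 := far_diff (curve V a) (curve V b) (V q) (V (q + 1))
  have i2 : far (V q) (V (q + 1)) (curve V a) ≤ far (V q) (V (q + 1)) (curve V b) := by
    have e1 := edge_value' (curve V a) (curve V b) V q hqc hcq.le
    have e2 := s.max₃ ((q + 1 : ℤ) : ℝ)
    rw [curve_int] at e2
    by_contra hlt
    push Not at hlt
    have := mul_pos (show 0 < (q : ℝ) + 1 - c by linarith) (show 0 < far (curve V a) (curve V b)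
      (V (q + 1)) - far (curve V a) (curve V b) (V q) by linarith)
    linarith
  -- If `C` is interior to the edge `q`, that edge is parallel to `AB`.
  have i2' : (q : ℝ) < c →
      far (V q) (V (q + 1)) (curve V a) = far (V q) (V (q + 1)) (curve V b) := by
    intro hlt
    refine le_antisymm i2 ?_
    have e1 := edge_value (curve V a) (curve V b) V q hqc hcq.le
    have e2 := s.max₃ q
    rw [curve_int] at e2
    by_contra hlt'
    push Not at hlt'
    have := mul_pos (sub_pos.2 hlt) (show 0 < far (curve V a) (curve V b)
      (V q) - far (curve V a) (curve V b) (V (q + 1)) by linarith)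
    linarith
  -- Otherwise `B` and `C` are both on the edge `q`, so `A` has height 0 over it too, and the
  -- triangle is degenerate.
  have hbq : b < q := by
    by_contra hge
    push Not at hge
    have h0 : far (V q) (V (q + 1)) (curve V b) = 0 :=
      ConvSeq.height_zero q hge (by linarith)
    have h1 := far_bary (curve V a) (curve V b) (curve V c) (V q) (V (q + 1)) (V (q + 2))
    rw [i2' (by linarith), h0, hC0] at h1
    have h2 := h.pos q (q + 1) (q + 2) (by omega) (by omega) (by have := h.three; omega)
    have := mul_pos s.pos h2
    linarith
  have hH : 0 < far (V q) (V (q + 1)) (curve V b) := by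
    rw [← h.curve_per]
    have : (q : ℝ) ≤ k := by linarith
    exact h.height_pos (by linarith) (by linarith)
  have hqk : (q : ℝ) ≤ k := by linarith
  have hq1 : (q : ℝ) + 1 < j + n := by
    rcases (show (q : ℝ) + 1 ≤ j + n by linarith).eq_or_lt with e | e
    · exfalso
      have e' : q + 1 = p + n := by
        have : (q : ℝ) + 1 = p + n := by linarith
        exact_mod_cast this
      rw [e', h.per, far_self_outer] at w1
      have := h.height_nonneg_all p q
      rw [curve_int] at this
      linarith
    · exact e
  have hHj : 0 < far (V q) (V (q + 1)) (V j) := by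
    have := h.height_pos (p := q) (x := ((j + n : ℤ) : ℝ)) (by push_cast; linarith)
      (by push_cast; linarith)
    rwa [curve_int, h.per] at this
  have i3 : far (V p) (V (p + 1)) (curve V b) ≤ far (V p) (V (p + 1)) (curve V c) := by
    by_cases hbp : b ≤ p + 1
    · rw [ConvSeq.height_zero p hpb.le hbp]
      exact h.height_nonneg_all p c
    · push Not at hbp
      have e1 := edge_value' (V p) (V (p + 1)) V q hqc hcq.le
      have e2 := mul_pos (show 0 < (q : ℝ) + 1 - c by linarith) (show 0 < far (V p) (V (p + 1))
        (V (q + 1)) - far (V p) (V (p + 1)) (V q) by linarith)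
      refine h.height_mono (z := ((q + 1 : ℤ) : ℝ)) hbp.le hbc.le (by push_cast; linarith)
        (by push_cast; linarith) ?_
      rw [curve_int]
      linarith
  have hCk : far (V p) (V (p + 1)) (curve V c) =
      far (V p) (V (p + 1)) (V k) + (k - c) * det (ev V p) (ev V q) := by
    have e1 := edge_value (V p) (V (p + 1)) V q hqc hcq.le
    have e2 := edge_value' (V p) (V (p + 1)) V q hqc hcq.le
    rcases hc with ⟨rfl, h2⟩ | ⟨rfl, -⟩
    · rw [h2, curve_int]; ring
    · rw [w1]; push_cast; linarith
  have hB0 := h.height_nonneg_all p b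
  have hF := far_mul_det V p q (curve V b) (curve V c) (curve V a)
  rw [hC0, sub_zero] at hF
  have k1 := mul_nonneg (sub_nonneg.2 i2) (sub_nonneg.2 i3)
  have k2 := mul_le_mul_of_nonneg_right i1 hH.le
  have k3 := mul_nonneg hB0 hH.le
  -- In the formula of `far_mul_det` for the chord `BC` the first product is nonpositive, since `A`
  -- is not higher than `B` over `q` and `B` is not higher than `C` over `p`. The second is at most
  -- the height of `C` over `p` times that of `B` over `q`.
  have hFle : far (curve V b) (curve V c) (curve V a) * -det (ev V p) (ev V q) ≤
      (far (V p) (V (p + 1)) (V k) + (k - c) * det (ev V p) (ev V q)) *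
        far (V q) (V (q + 1)) (curve V b) := by
    rw [hCk] at k1 k2 hF
    nlinarith
  have hx := mul_le_mul_of_nonneg_right (s.max₁ x) (neg_nonneg.2 hw.le)
  have hxF := mul_le_mul_of_nonneg_left (hx.trans hFle) hHj.le
  have hch := far_chord (V j) (curve V c) (curve V x) (V k) (curve V b) (ev V q) (k - c) (by
    rw [curve_on V q c hqc hcq.le]
    rcases hc with ⟨h1, h2⟩ | ⟨h1, -⟩
    · rw [h1, h2]; simp
    · rw [h1]
      ext i
      simp only [ev, PiLp.add_apply, PiLp.sub_apply, PiLp.smul_apply, smul_eq_mul]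
      push_cast; ring)
  simp only [det_ev, hk0, zero_sub, neg_neg] at hch
  have hWn := h.height_nonneg_all q x
  have hNn : 0 ≤ far (V j) (curve V b) (V k) := by
    have := h.curve_nonneg (x := j) (y := b) (z := k) hjb (by linarith) (by linarith)
    rwa [curve_int, curve_int] at this
  -- Here `A` and `B` have equal height over the edge `q` and `C` has height 0. As no point is
  -- farther from `BC` than `A` or from `CA` than `B`, barycentric coordinates bound all heights by
  -- twice that of `B`.
  have hW2 : 0 < (k : ℝ) - c →
      far (V q) (V (q + 1)) (curve V x) ≤ 2 * far (V q) (V (q + 1)) (curve V b) := by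
    intro hl
    have hqc' : (q : ℝ) < c := by
      rcases hc with ⟨h1, h2⟩ | ⟨h1, h2⟩
      · rw [h1, h2] at hl; linarith
      · exact h2.1
    have h1 := far_bary (curve V a) (curve V b) (curve V c) (V q) (V (q + 1)) (curve V x)
    rw [i2' hqc', hC0] at h1
    obtain ⟨eA, eB⟩ := s.far_eq_sum
    have m1 := s.max₁ x
    have m2 := s.max₂ x
    rw [eA] at m1
    rw [eB] at m2
    have m3 := mul_le_mul_of_nonneg_right m1 hH.le
    have m4 := mul_le_mul_of_nonneg_right m2 hH.le
    refine le_of_mul_le_mul_left ?_ s.pos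
    linarith
  have hl0 : 0 ≤ (k : ℝ) - c := by linarith
  -- Elimination of the distance `f` from `BC`: `d` is the distance from `V j V k`, `W` the height
  -- of the point over `q`, `P` the height of `V k` over `p`, and `l = k - c`. The slack is the sum
  -- of two nonnegative terms.
  have key : ∀ {d w H Hj N P l W f : ℝ}, Hj * f = (d + l * Hj) * H + W * N - l * W * Hj →
      Hj * (f * -w) ≤ Hj * ((P + l * w) * H) →
      d * -w * H ≤ P * Hj * H - -w * (W * N + l * Hj * (2 * H - W)) := by
    intro d w H Hj N P l W f h1 h2
    have h3 : Hj * (f * -w) = -w * ((d + l * Hj) * H + W * N - l * W * Hj) := by rw [← h1]; ring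
    rw [h3] at h2
    linarith
  have hkey := key hch hxF
  have hnon : 0 ≤ (k - c) * far (V q) (V (q + 1)) (V j) *
      (2 * far (V q) (V (q + 1)) (curve V b) - far (V q) (V (q + 1)) (curve V x)) := by
    rcases hl0.eq_or_lt with e | e
    · rw [← e]; simp
    · exact mul_nonneg (mul_nonneg hl0 hHj.le) (sub_nonneg.2 (hW2 e))
  constructor
  · refine le_of_mul_le_mul_right ?_ hH
    have := mul_nonneg (neg_nonneg.2 hw.le) (add_nonneg (mul_nonneg hWn hNn) hnon)
    linarith
  -- At a vertex-edge pair the slack is positive: its second term is so if `W = 0`, its first one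
  -- otherwise.
  · rintro ⟨hjp, hkq⟩
    have hl : 0 < (k : ℝ) - c := by rw [hkq]; push_cast; linarith
    have hjpr : (j : ℝ) = p := by exact_mod_cast hjp
    have hkqr : (k : ℝ) = q + 1 := by exact_mod_cast hkq
    have hN : 0 < far (V j) (curve V b) (V k) := by
      have := h.pos_or_edge (x := j) (y := b) (z := k) (by linarith) (by linarith) (by linarith)
      rw [curve_int, curve_int] at this
      rcases this with h1 | ⟨m, h1, h2⟩ | ⟨m, h1, h2⟩ | ⟨m, h1, h2⟩
      · exact h1
      · linarith
      · linarith
      · linarith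
    refine lt_of_mul_lt_mul_right ?_ hH.le
    have : 0 < far (V q) (V (q + 1)) (curve V x) * far (V j) (curve V b) (V k) +
        (k - c) * far (V q) (V (q + 1)) (V j) *
        (2 * far (V q) (V (q + 1)) (curve V b) - far (V q) (V (q + 1)) (curve V x)) := by
      rcases hWn.eq_or_lt with e | e
      · rw [← e]
        have := mul_pos (mul_pos hl hHj) hH
        linarith
      · have := mul_pos e hN
        linarith
    have := mul_pos (neg_pos.2 hw) this
    linarith

end Stab

/-! ### One step of the Rotate-and-Kill process -/

/-- A stable triangle whose corners interleave with the triangle `r s t`. -/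
structure Inter (n : ℤ) (V : ℤ → Point) (r s t : ℤ) (a b c : ℝ) : Prop where
  stab : Stab n V a b c
  ra : (r : ℝ) ≤ a
  as : a ≤ s
  sb : (s : ℝ) ≤ b
  bt : b ≤ t
  tc : (t : ℝ) ≤ c
  cr : c ≤ r + n

/-- The possible unit pairs of a run with parameters `(r, s, t)`. -/
structure PairOK (n r s t u₁ u₂ : ℤ) : Prop where
  su : 2 * s ≤ u₁
  ut : u₁ ≤ 2 * t
  tu : 2 * t ≤ u₂
  ur : u₂ ≤ 2 * (r + n)
  gap : u₁ + 2 ≤ u₂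

/-- The first unit of the pair is advanced, if `A` is the farthest vertex. -/
def Advances (V : ℤ → Point) (u₁ u₂ A : ℤ) : Prop :=
  0 < det (ev V (u₁ / 2)) (ev V (u₂ / 2)) ∨
  if u₁ % 2 = 0 ∧ u₂ % 2 = 1 then
    far (V ((u₁ + 1) / 2)) (V ((u₂ + 1) / 2)) (V A) * -det (ev V (u₁ / 2)) (ev V (u₂ / 2)) <
      det (ev V (u₁ / 2)) (V ((u₂ + 1) / 2) - V ((u₁ + 1) / 2)) *
        det (V ((u₂ + 1) / 2) - V ((u₁ + 1) / 2)) (ev V (u₂ / 2))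
  else
    far (V ((u₁ + 1) / 2)) (V ((u₂ + 1) / 2)) (V A) * -det (ev V (u₁ / 2)) (ev V (u₂ / 2)) ≤
      det (ev V (u₁ / 2)) (V ((u₂ + 1) / 2) - V ((u₁ + 1) / 2)) *
        det (V ((u₂ + 1) / 2) - V ((u₁ + 1) / 2)) (ev V (u₂ / 2))

/-- The program's numerator is the product of the heights of the two ends of the chord over the
edges `p` and `q`, because `V j` is on the line of `e_p` and `V k` on that of `e_q`. -/
theorem num_eq (V : ℤ → Point) {j k p q : ℤ} (hj : j = p ∨ j = p + 1) (hk : k = q ∨ k = q + 1) :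
    det (ev V p) (V k - V j) * det (V k - V j) (ev V q) =
      far (V p) (V (p + 1)) (V k) * far (V q) (V (q + 1)) (V j) := by
  have e : det (V k - V j) (ev V q) = -det (ev V q) (V k - V j) := by simp only [det]; ring
  rw [e, det_ev, det_ev]
  rcases hj with rfl | rfl <;> rcases hk with rfl | rfl <;>
    simp only [far_self_outer, far_self_right] <;> ring

theorem curve_far_le {V : ℤ → Point} {a b : Point} {m : ℝ} (h : ∀ i, far a b (V i) ≤ m) (x : ℝ) :
    far a b (curve V x) ≤ m := by
  have f1 := Int.floor_le x
  have f2 := Int.lt_floor_add_one x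
  rw [far_on V a b ⌊x⌋ x f1 f2.le]
  have k1 := mul_le_mul_of_nonneg_left (h ⌊x⌋) (show 0 ≤ 1 - (x - ⌊x⌋) by linarith)
  have k2 := mul_le_mul_of_nonneg_left (h (⌊x⌋ + 1)) (show 0 ≤ x - ⌊x⌋ by linarith)
  linarith

section
variable {n : ℤ} {V : ℤ → Point} {r s t u₁ u₂ A : ℤ}

/-- By `far_of_past_second` the corner `A`, and hence the farthest vertex, is too far for the first
unit to be advanced. The exceptional pair where only a weak inequality is available is the one where
advancing requires a strict one. -/
theorem no_past_second (h : ConvSeq n V) (ok : PairOK n r s t u₁ u₂) (hrs : r < s)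
    (hA : ∀ i, far (V ((u₁ + 1) / 2)) (V ((u₂ + 1) / 2)) (V i) ≤
      far (V ((u₁ + 1) / 2)) (V ((u₂ + 1) / 2)) (V A))
    (adv : Advances V u₁ u₂ A) {a b c : ℝ} (hi : Inter n V r s t a b c) (hb : unitOf b = u₁)
    (hc : u₂ < unitOf c) : False := by
  obtain ⟨su, ut, tu, ur, gap⟩ := ok
  have hb' : ((u₁ + 1) / 2 = u₁ / 2 ∧ b = ((u₁ / 2 : ℤ) : ℝ)) ∨
      ((u₁ + 1) / 2 = u₁ / 2 + 1 ∧ ((u₁ / 2 : ℤ) : ℝ) < b ∧ b < ((u₁ / 2 : ℤ) : ℝ) + 1) := by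
    rcases Int.emod_two_eq_zero_or_one u₁ with h1 | h1
    · exact .inl ⟨by omega, unitOf_even (by omega)⟩
    · exact .inr ⟨by omega, unitOf_odd (by omega)⟩
  have hc' : ((u₂ + 1) / 2 = u₂ / 2 ∧ ((u₂ / 2 : ℤ) : ℝ) < c) ∨
      ((u₂ + 1) / 2 = u₂ / 2 + 1 ∧ ((u₂ / 2 : ℤ) : ℝ) + 1 ≤ c) := by
    rcases Int.emod_two_eq_zero_or_one u₂ with h1 | h1
    · exact .inl ⟨by omega, odd_le_unitOf.1 (by omega)⟩
    · refine .inr ⟨by omega, ?_⟩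
      have := (even_le_unitOf (x := c) (i := u₂ / 2 + 1)).1 (by omega)
      push_cast at this
      exact this
  obtain ⟨h1, h2, h3⟩ := hi.stab.far_of_past_second h (r := r) (s' := s) hrs hi.as hi.cr
    (by omega) (by omega) (by omega) hb' hc'
  have h4 := mul_le_mul_of_nonneg_right (curve_far_le hA a) (neg_nonneg.2 h1.le)
  have hnum := num_eq V (j := (u₁ + 1) / 2) (k := (u₂ + 1) / 2) (p := u₁ / 2) (q := u₂ / 2)
    (by omega) (by omega)
  unfold Advances at adv
  rcases adv with adv | adv
  · linarith
  rw [hnum] at adv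
  split_ifs at adv with hve
  · linarith
  · have := h3 (by omega)
    linarith

/-- The converse situation. When the second unit is advanced, the farthest vertex is farther than
`X`, or as far at a vertex-edge pair; this contradicts `near_of_past_first`. A vanishing determinant
has to be excluded first, since then `X` is at infinity, except where the pair does not allow it. -/
theorem no_past_first (h : ConvSeq n V) (ok : PairOK n r s t u₁ u₂) (hrs : r < s)
    (adv : ¬ Advances V u₁ u₂ A) {a b c : ℝ} (hi : Inter n V r s t a b c) (hb : u₁ < unitOf b)
    (hc : unitOf c = u₂) : False := by
  obtain ⟨su, ut, tu, ur, gap⟩ := ok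
  have hb' : ((u₁ + 1) / 2 = u₁ / 2 ∧ ((u₁ / 2 : ℤ) : ℝ) < b) ∨
      ((u₁ + 1) / 2 = u₁ / 2 + 1 ∧ ((u₁ / 2 : ℤ) : ℝ) + 1 ≤ b) := by
    rcases Int.emod_two_eq_zero_or_one u₁ with h1 | h1
    · exact .inl ⟨by omega, odd_le_unitOf.1 (by omega)⟩
    · refine .inr ⟨by omega, ?_⟩
      have := (even_le_unitOf (x := b) (i := u₁ / 2 + 1)).1 (by omega)
      push_cast at this
      exact this
  have hc' : ((u₂ + 1) / 2 = u₂ / 2 ∧ c = ((u₂ / 2 : ℤ) : ℝ)) ∨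
      ((u₂ + 1) / 2 = u₂ / 2 + 1 ∧ ((u₂ / 2 : ℤ) : ℝ) < c ∧ c < ((u₂ / 2 : ℤ) : ℝ) + 1) := by
    rcases Int.emod_two_eq_zero_or_one u₂ with h1 | h1
    · exact .inl ⟨by omega, unitOf_even (by omega)⟩
    · exact .inr ⟨by omega, unitOf_odd (by omega)⟩
  have hnum := num_eq V (j := (u₁ + 1) / 2) (k := (u₂ + 1) / 2) (p := u₁ / 2) (q := u₂ / 2)
    (by omega) (by omega)
  have hpk := h.height_nonneg_all (u₁ / 2) (((u₂ + 1) / 2 : ℤ) : ℝ)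
  have hqj := h.height_nonneg_all (u₂ / 2) (((u₁ + 1) / 2 : ℤ) : ℝ)
  rw [curve_int] at hpk hqj
  unfold Advances at adv
  push Not at adv
  obtain ⟨adv1, adv2⟩ := adv
  rw [hnum] at adv2
  have hw : det (ev V (u₁ / 2)) (ev V (u₂ / 2)) < 0 := by
    refine lt_of_le_of_ne adv1 fun e => ?_
    rw [e, neg_zero, mul_zero] at adv2
    split_ifs at adv2 with hve
    · have k1 := h.pos (u₁ / 2) (u₁ / 2 + 1) ((u₂ + 1) / 2) (by omega) (by omega) (by omega)
      have k2 := h.pos (u₂ / 2) (u₂ / 2 + 1) ((u₁ + 1) / 2 + n) (by omega) (by omega) (by omega)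
      rw [h.per] at k2
      have := mul_pos k1 k2
      exact adv2 this
    · have := mul_nonneg hpk hqj
      exact adv2 this
  obtain ⟨h1, h2⟩ := hi.stab.near_of_past_first h (r := r) (s' := s) hrs hi.as
    (by omega) (show u₁ / 2 < u₂ / 2 by omega) (by omega) hb' hc' hw (A : ℝ)
  rw [curve_int] at h1 h2
  split_ifs at adv2 with hve
  · have := h2 (by omega)
    linarith
  · linarith

/-- For neighbouring vertices or neighbouring edges the numerator vanishes, so `X` is at distance 0,
while the farthest vertex is at a positive distance. Hence the first unit never catches up with the
second. -/
theorem not_advances_of_gap (h : ConvSeq n V) (ok : PairOK n r s t u₁ u₂)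
    (hA : ∀ i, far (V ((u₁ + 1) / 2)) (V ((u₂ + 1) / 2)) (V i) ≤
      far (V ((u₁ + 1) / 2)) (V ((u₂ + 1) / 2)) (V A)) (hgap : u₁ + 2 = u₂) :
    ¬ Advances V u₁ u₂ A := by
  obtain ⟨su, ut, tu, ur, gap⟩ := ok
  have hn := h.three
  have hnum := num_eq V (j := (u₁ + 1) / 2) (k := (u₂ + 1) / 2) (p := u₁ / 2) (q := u₂ / 2)
    (by omega) (by omega)
  have eq : u₂ / 2 = u₁ / 2 + 1 := by omega
  have hw : det (ev V (u₁ / 2)) (ev V (u₂ / 2)) < 0 := by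
    rw [det_ev_ev, eq, far_self_right]
    have := h.pos (u₁ / 2) (u₁ / 2 + 1) (u₁ / 2 + 1 + 1) (by omega) (by omega) (by omega)
    linarith
  have hfar : 0 < far (V ((u₁ + 1) / 2)) (V ((u₂ + 1) / 2)) (V A) :=
    lt_of_lt_of_le (h.pos _ _ ((u₂ + 1) / 2 + 1) (by omega) (by omega) (by omega)) (hA _)
  have hz : far (V (u₁ / 2)) (V (u₁ / 2 + 1)) (V ((u₂ + 1) / 2)) *
      far (V (u₂ / 2)) (V (u₂ / 2 + 1)) (V ((u₁ + 1) / 2)) = 0 := by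
    rcases Int.emod_two_eq_zero_or_one u₁ with h1 | h1
    · rw [show (u₂ + 1) / 2 = u₁ / 2 + 1 by omega, far_self_right, zero_mul]
    · rw [show (u₁ + 1) / 2 = u₂ / 2 by omega, far_self_outer, mul_zero]
  have hpos := mul_pos hfar (neg_pos.2 hw)
  unfold Advances
  rw [hnum, hz]
  push Not
  refine ⟨hw.le, ?_⟩
  split_ifs <;> linarith

/-- One step of the process keeps the invariants, and every stable triangle is visited or is still
ahead. -/
theorem process_step (h : ConvSeq n V) (ok : PairOK n r s t u₁ u₂) (hrs : r < s)
    (st : Stab n V r s t) (hne : ¬ (u₁ = 2 * t ∧ u₂ = 2 * (r + n)))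
    (hA : ∀ i, far (V ((u₁ + 1) / 2)) (V ((u₂ + 1) / 2)) (V i) ≤
      far (V ((u₁ + 1) / 2)) (V ((u₂ + 1) / 2)) (V A)) :
    (Advances V u₁ u₂ A → PairOK n r s t (u₁ + 1) u₂ ∧ ∀ a b c, Inter n V r s t a b c →
      u₁ ≤ unitOf b → u₂ ≤ unitOf c → (unitOf b = u₁ ∧ unitOf c = u₂) ∨ u₁ + 1 ≤ unitOf b) ∧
    (¬ Advances V u₁ u₂ A → PairOK n r s t u₁ (u₂ + 1) ∧ ∀ a b c, Inter n V r s t a b c →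
      u₁ ≤ unitOf b → u₂ ≤ unitOf c → (unitOf b = u₁ ∧ unitOf c = u₂) ∨ u₂ + 1 ≤ unitOf c) := by
  have hrs' : (r : ℝ) ≤ s := by exact_mod_cast hrs.le
  -- The given triangle interleaves with itself, with `B` at `t` and `C` at `r + n`. It is never
  -- ruled out, which keeps both units from moving past these final positions.
  have last : Inter n V r s t s t (r + n) :=
    ⟨st.rotate h, hrs', le_rfl, st.lt₂.le, le_rfl, st.lt₃.le, le_rfl⟩
  have ut : unitOf (t : ℝ) = 2 * t := unitOf_int t
  have ur : unitOf ((r : ℝ) + n) = 2 * (r + n) := by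
    have := unitOf_int (r + n)
    push_cast at this
    exact this
  obtain ⟨h1, h2, h3, h4, h5⟩ := ok
  have ok : PairOK n r s t u₁ u₂ := ⟨h1, h2, h3, h4, h5⟩
  constructor
  · intro adv
    refine ⟨⟨by omega, ?_, h3, h4, ?_⟩, fun a b c hi hb hc => ?_⟩
    · by_contra hlt
      exact no_past_second h ok hrs hA adv last (by omega) (by omega)
    · by_contra hlt
      exact not_advances_of_gap h ok hA (by omega) adv
    · by_contra hlt
      exact no_past_second h ok hrs hA adv hi (by omega) (by omega)
  · intro adv
    refine ⟨⟨h1, h2, by omega, ?_, by omega⟩, fun a b c hi hb hc => ?_⟩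
    · by_contra hlt
      exact no_past_first h ok hrs adv last (by omega) (by omega)
    · by_contra hlt
      exact no_past_first h ok hrs adv hi (by omega) (by omega)

end

/-! ### The memory -/

/-- The `i`-th vertex, subscripts taken modulo `n`. -/
def vert {n : ℕ} (v : Fin n → Point) (i : ℤ) : Point :=
  if h : 0 < n then
    v ⟨(i % n).toNat, by
      have h1 := Int.emod_nonneg i (show (n : ℤ) ≠ 0 by omega)
      have h2 := Int.emod_lt_of_pos i (show (0 : ℤ) < n by omega)
      omega⟩
  else 0

theorem vert_val {n : ℕ} (v : Fin n → Point) (i : Fin n) : vert v (i.val : ℤ) = v i := by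
  have hi := i.isLt
  unfold vert
  rw [dif_pos (by omega)]
  congr 1
  apply Fin.ext
  simp only
  rw [Int.emod_eq_of_lt (by omega) (by omega)]
  rfl

theorem vert_conv {n : ℕ} {v : Fin n → Point} (h : IsConvexPolygon v) : ConvSeq n (vert v) := by
  have hn := h.1
  have per : ∀ i, vert v (i + n) = vert v i := by
    intro i
    unfold vert
    rw [dif_pos (by omega), dif_pos (by omega)]
    simp
  have per_mul : ∀ i z : ℤ, vert v (i + z * n) = vert v i := by
    intro i z
    unfold vert
    rw [dif_pos (by omega), dif_pos (by omega)]
    simp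
  have base : ∀ i j k : ℤ, 0 ≤ i → i < j → j < k → k < n →
      0 < far (vert v i) (vert v j) (vert v k) := by
    intro i j k h0 hij hjk hk
    have := h.2 ⟨i.toNat, by omega⟩ ⟨j.toNat, by omega⟩ ⟨k.toNat, by omega⟩
      (by simp only [Fin.lt_def]; omega) (by simp only [Fin.lt_def]; omega)
    have e : ∀ x : ℤ, 0 ≤ x → ∀ hx : x.toNat < n, vert v x = v ⟨x.toNat, hx⟩ := by
      intro x h1 hx
      rw [← vert_val v ⟨x.toNat, hx⟩]
      congr 1
      simp only
      omega
    rw [e i h0 (by omega), e j (by omega) (by omega), e k (by omega) (by omega), far_eq_neg_orient]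
    linarith
  refine ⟨by omega, per, fun i j k hij hjk hki => ?_⟩
  obtain ⟨z, h1, h2⟩ := ConvSeq.exists_lift (n := n) (by omega) i 0
  rw [← per_mul i z, ← per_mul j z, ← per_mul k z]
  have h3 : i + z * n < j + z * n := by omega
  have h4 : j + z * n < k + z * n := by omega
  have h5 : k + z * n < i + z * n + n := by omega
  generalize i + z * n = i at *
  generalize j + z * n = j at *
  generalize k + z * n = k at *
  -- With `i` in the first period, `j` and `k` may be in the next one. Moving them back by `n`
  -- permutes the triple cyclically.
  by_cases hk : k < n
  · exact base i j k h1 h3 h4 hk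
  have per' : ∀ x, vert v (x - n) = vert v x := fun x => by rw [← per (x - n), sub_add_cancel]
  by_cases hj : j < n
  · have := base (k - n) i j (by omega) (by omega) h3 hj
    rw [per'] at this
    rwa [far_rotate, far_rotate]
  · have := base (j - n) (k - n) i (by omega) (by omega) (by omega) (by omega)
    rw [per', per'] at this
    rwa [far_rotate]

/-- The memory holds the input. -/
structure Mem {n : ℕ} (v : Fin n → Point) (σ : State) : Prop where
  num : σ.ireg 0 = n
  arr : σ.rarr = (inputState v).rarr

/-- The value of a pair of expressions. -/
def PExp.point (σ : State) (p : PExp) : Point := !₂[p.1.eval σ, p.2.eval σ]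

theorem eval_pdet (σ : State) (p q : PExp) : (pdet p q).eval σ = det (p.point σ) (q.point σ) := by
  simp [pdet, det, PExp.point]

theorem point_psub (σ : State) (p q : PExp) : (psub p q).point σ = p.point σ - q.point σ := by
  ext i; fin_cases i <;> simp [psub, PExp.point]

theorem eval_pdist (σ : State) (b c x : PExp) :
    (pdist b c x).eval σ = far (b.point σ) (c.point σ) (x.point σ) := by
  rw [pdist, eval_pdet, point_psub, point_psub, far]

namespace Mem
variable {n : ℕ} {v : Fin n → Point} {σ : State}

theorem point_vtx (hn : 0 < n) (m : Mem v σ) (i : IExp) :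
    (vtx i).point σ = vert v (i.eval σ) := by
  have h1 := Int.emod_nonneg (i.eval σ) (show (n : ℤ) ≠ 0 by omega)
  have h2 := Int.emod_lt_of_pos (i.eval σ) (show (0 : ℤ) < n by omega)
  have e : ((i % I iN : IExp).eval σ) = i.eval σ % n := by
    rw [← m.num]; rfl
  have h3 : (i.eval σ % n).toNat < n ∧ 0 ≤ i.eval σ % n := by omega
  ext k
  unfold vert
  rw [dif_pos hn]
  fin_cases k <;> simp only [PExp.point, vtx, RExp.eval, e, m.arr, inputState, dif_pos h3] <;> simp

theorem point_evec (hn : 0 < n) (m : Mem v σ) (i : IExp) :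
    (evec i).point σ = ev (vert v) (i.eval σ) := by
  rw [evec, point_psub, m.point_vtx hn, m.point_vtx hn]; rfl

theorem eval_dist (hn : 0 < n) (m : Mem v σ) (b c x : IExp) :
    (dist b c x).eval σ = far (vert v (b.eval σ)) (vert v (c.eval σ)) (vert v (x.eval σ)) := by
  rw [dist, eval_pdist, m.point_vtx hn, m.point_vtx hn, m.point_vtx hn]

theorem eval_farther (hn : 0 < n) (m : Mem v σ) (b c x y : IExp) :
    (farther b c x y).eval σ ↔
      far (vert v (b.eval σ)) (vert v (c.eval σ)) (vert v (y.eval σ)) <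
      far (vert v (b.eval σ)) (vert v (c.eval σ)) (vert v (x.eval σ)) := by
  rw [farther, BExp.eval_rlt, m.eval_dist hn, m.eval_dist hn]

theorem congr {σ' : State} (m : Mem v σ) (h₁ : σ'.ireg 0 = σ.ireg 0) (h₂ : σ'.rarr = σ.rarr) :
    Mem v σ' := ⟨h₁.trans m.num, h₂.trans m.arr⟩

end Mem

attribute [simp] iN iR iS iT iA iB iC iDir iB₀ iC₀ iU₁ iU₂ iLen iJ iK iM iNumE iFst iLst iA₁ iA₂ iX
  iG₁ iG₂ iG₃ aU₁ aU₂ aEJ aEK rBest rW rNum rDist rLo rHi rL₁ rL₂ rL₃ rX₁ rY₁ rX₂ rY₂ rX₃ rY₃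

@[simp] theorem IExp.eval_zero (σ : State) : (0 : IExp).eval σ = 0 := rfl
@[simp] theorem IExp.eval_one (σ : State) : (1 : IExp).eval σ = 1 := rfl
@[simp] theorem IExp.eval_two (σ : State) : (2 : IExp).eval σ = 2 := rfl
@[simp] theorem RExp.eval_zero (σ : State) : (0 : RExp).eval σ = 0 := Int.cast_zero
@[simp] theorem RExp.eval_one (σ : State) : (1 : RExp).eval σ = 1 := Int.cast_one
@[simp] theorem RExp.eval_two (σ : State) : (2 : RExp).eval σ = 2 := by
  show ((2 : ℤ) : ℝ) = 2
  norm_num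

/-! ### Rules for blocks and searches -/

theorem Runs.step {c : Cmd} {σ : State} {B : ℕ} {Q : ℕ → State → Prop} (k : ℕ)
    (hl : c.loopFree = true) (hk : c.maxCost ≤ k) (hB : k ≤ B)
    (hQ : Q (B - k) (c.run σ)) : Runs c σ B Q :=
  Runs.free k hl hk (B - k) (by omega) hQ

/-- A block is nested to the right, so a prefix is not a subterm of it. An execution of the prefix
is taken apart and associated anew. -/
theorem Runs.split {l : List Cmd} (k : ℕ) (h₀ : 0 < k) (h₁ : k < l.length) {σ : State} {B : ℕ}
    {Q : ℕ → State → Prop}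
    (h : Runs (block (l.take k)) σ B (fun p σ' => Runs (block (l.drop k)) σ' p Q)) :
    Runs (block l) σ B Q := by
  induction l generalizing k σ B with
  | nil => simp at h₁
  | cons c cs ih =>
    cases cs with
    | nil => simp only [List.length_cons, List.length_nil] at h₁; omega
    | cons d ds =>
      simp only [block]
      refine Runs.seq ?_
      match k, h₀ with
      | 1, _ => simpa [block] using h
      | k + 2, _ =>
        simp only [List.take_succ_cons, List.drop_succ_cons, block] at h
        obtain ⟨τ, p, σ', e, hB, hQ⟩ := h
        cases e with
        | @seq _ _ _ σ₂ _ τ₁ τ₂ e₁ e₂ =>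
          refine ⟨τ₁, B - τ₁, σ₂, e₁, by omega, ?_⟩
          refine ih (k + 1) (by omega) (by simpa using h₁) ?_
          exact ⟨_, p, _, by simpa using e₂, by omega, by simpa using hQ⟩

theorem least_stop (P : ℤ → Prop) {a M : ℤ} (haM : a ≤ M) (hM : ¬ P M) :
    ∃ a', a ≤ a' ∧ a' ≤ M ∧ ¬ P a' ∧ ∀ i, a ≤ i → i < a' → P i := by
  obtain ⟨d, rfl⟩ : ∃ d : ℕ, M = a + d := ⟨(M - a).toNat, by omega⟩
  induction d using Nat.strong_induction_on with
  | _ d ih =>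
    by_cases h : ∃ e : ℕ, e < d ∧ ¬ P (a + e)
    · obtain ⟨e, he, hP⟩ := h
      obtain ⟨a', h1, h2, h3, h4⟩ := ih e he (by omega) hP
      exact ⟨a', h1, by omega, h3, h4⟩
    · push Not at h
      refine ⟨a + d, by omega, le_rfl, hM, fun i h1 h2 => ?_⟩
      have := h (i - a).toNat (by omega)
      rwa [show a + ((i - a).toNat : ℤ) = i by omega] at this

theorem State.iset_iset (σ : State) (x : ℕ) (y z : ℤ) : (σ.iset x y).iset x z = σ.iset x z := by
  simp [State.iset]

theorem State.iset_self (σ : State) (x : ℕ) : σ.iset x (σ.ireg x) = σ := by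
  simp [State.iset]

/-- A search with a counter. -/
theorem Runs.scan {b : BExp} {x : ℕ} {σ : State} {B : ℕ} {Q : ℕ → State → Prop} (P : ℤ → Prop)
    (k : ℕ) (hk : b.cost + 5 ≤ k) (hev : ∀ y, b.eval (σ.iset x y) ↔ P y) {a' : ℤ}
    (ha : σ.ireg x ≤ a') (hP : ∀ i, σ.ireg x ≤ i → i < a' → P i) (hhalt : ¬ P a')
    (hB : k * (a' - σ.ireg x) + k ≤ (B : ℤ))
    (hQ : ∀ p : ℕ, (p : ℤ) = B - k * (a' - σ.ireg x) - k → Q p (σ.iset x a')) :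
    Runs (.loop b (.iset x (I x + 1))) σ B Q := by
  have hcost : (Cmd.iset x (I x + 1)).maxCost = 4 := rfl
  refine Runs.loop_free (fun p σ' => ∃ y, σ' = σ.iset x y ∧ σ.ireg x ≤ y ∧ y ≤ a' ∧
    (p : ℤ) = B - k * (y - σ.ireg x)) k rfl (by rw [hcost]; omega) ?_ ?_
    ⟨σ.ireg x, (σ.iset_self x).symm, le_rfl, ha, by ring⟩
  · rintro p _ ⟨y, rfl, h1, h2, h3⟩ hb
    rw [hev] at hb
    have hy : y < a' := lt_of_le_of_ne h2 fun e => hhalt (e ▸ hb)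
    have h4 : (k : ℤ) * (y + 1 - σ.ireg x) ≤ k * (a' - σ.ireg x) :=
      mul_le_mul_of_nonneg_left (by omega) (by omega)
    have h5 : (k : ℤ) * (y + 1 - σ.ireg x) = k * (y - σ.ireg x) + k := by ring
    refine ⟨p - k, by omega, y + 1, ?_, by omega, by omega, by omega⟩
    simp only [Cmd.run, IExp.eval_add, IExp.eval_reg, State.iset_ireg, if_true, State.iset_iset]
    rfl
  · rintro p _ ⟨y, rfl, h1, h2, h3⟩ hb
    rw [hev] at hb
    have hy : y = a' := by
      by_contra hne
      exact hb (hP y h1 (lt_of_le_of_ne h2 hne))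
    subst hy
    exact ⟨p - k, by omega, hQ _ (by omega)⟩

/-! ### The visited pairs -/

/-- The pair `(x, y)` is stored. -/
def VisAt (σ : State) (x y : ℤ) : Prop :=
  ∃ m, 0 ≤ m ∧ m < σ.ireg 12 ∧ σ.iarr 0 m = x ∧ σ.iarr 1 m = y

/-- One of the two units moves on. -/
def Moves (x y x' y' : ℤ) : Prop := (x' = x + 1 ∧ y' = y) ∨ (x' = x ∧ y' = y + 1)

/-- The two gaps keep the units apart on both sides of the polygon, so that the chord is proper and
there are vertices on its right. The last bound limits all pointers, since indices are not reduced
modulo `n`. -/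
structure PairGood (n x y : ℤ) : Prop where
  nonneg : 0 ≤ x
  gap : x + 2 ≤ y
  gap' : (y + 1) / 2 + 1 ≤ x / 2 + n
  bound : y ≤ 6 * n

/-- The stored pairs form a path. -/
structure Visited (n : ℤ) (σ : State) : Prop where
  len : 0 ≤ σ.ireg 12
  good : ∀ m, 0 ≤ m → m < σ.ireg 12 → PairGood n (σ.iarr 0 m) (σ.iarr 1 m)
  step : ∀ m, 0 ≤ m → m + 1 < σ.ireg 12 →
    Moves (σ.iarr 0 m) (σ.iarr 1 m) (σ.iarr 0 (m + 1)) (σ.iarr 1 (m + 1))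

/-- The state `σ₀` is the one before the run. The length of the list measures the progress of the
pair, and `link` continues the path from one run to the next. The final pair of a run is not stored
by it; `start` ensures that the next run stores it. -/
structure RunInv {n : ℕ} (v : Fin n → Point) (r s t : ℤ) (σ₀ σ : State) : Prop where
  mem : Mem v σ
  reg₁ : σ.ireg 1 = σ₀.ireg 1
  reg₂ : σ.ireg 2 = σ₀.ireg 2
  reg₃ : σ.ireg 3 = σ₀.ireg 3
  out : σ.out = σ₀.out
  ok : PairOK n r s t (σ.ireg 10) (σ.ireg 11)
  len : σ.ireg 12 = σ₀.ireg 12 + (σ.ireg 10 + σ.ireg 11 - 2 * s - 2 * t)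
  keep : ∀ m, m < σ₀.ireg 12 → σ.iarr 0 m = σ₀.iarr 0 m ∧ σ.iarr 1 m = σ₀.iarr 1 m
  vis : Visited n σ
  link : 0 < σ.ireg 12 → Moves (σ.iarr 0 (σ.ireg 12 - 1)) (σ.iarr 1 (σ.ireg 12 - 1))
    (σ.ireg 10) (σ.ireg 11)
  complete : ∀ a b c, Inter n (vert v) r s t a b c →
    VisAt σ (unitOf b) (unitOf c) ∨ (σ.ireg 10 ≤ unitOf b ∧ σ.ireg 11 ≤ unitOf c)
  start : VisAt σ (2 * s) (2 * t) ∨ (σ.ireg 10 = 2 * s ∧ σ.ireg 11 = 2 * t)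

/-- The farthest vertex is found by climbing from `A`. -/
structure ClimbFrom {n : ℕ} (v : Fin n → Point) (r u₁ u₂ A : ℤ) : Prop where
  low : r + n ≤ A
  high : A < (u₁ + 1) / 2 + n
  up : A = (u₂ + 1) / 2 ∨ far (vert v ((u₁ + 1) / 2)) (vert v ((u₂ + 1) / 2)) (vert v (A - 1)) ≤
    far (vert v ((u₁ + 1) / 2)) (vert v ((u₂ + 1) / 2)) (vert v A)

/-- The step that led to `A` is not a descent for the new pair either, so the farthest vertex can be
sought from `A` onwards. -/
theorem ClimbFrom.next {n : ℕ} {v : Fin n → Point} (h : ConvSeq n (vert v)) {r s t u₁ u₂ u₁' u₂' A : ℤ}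
    (c : ClimbFrom v r u₁ u₂ A) (ok : PairOK n r s t u₁ u₂) (ok' : PairOK n r s t u₁' u₂')
    (h₁ : u₁ ≤ u₁') (h₂ : u₂ ≤ u₂') : ClimbFrom v r u₁' u₂' A := by
  obtain ⟨c1, c2, c3⟩ := c
  obtain ⟨-, -, -, h4, h5⟩ := ok'
  obtain ⟨-, -, -, -, h6⟩ := ok
  refine ⟨c1, by omega, ?_⟩
  by_cases hA : A = (u₂' + 1) / 2
  · exact .inl hA
  right
  rcases c3 with c3 | c3
  · omega
  have := h.far_step_le (i := A - 1) (j := (u₁ + 1) / 2) (k := (u₂ + 1) / 2)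
    (j' := (u₁' + 1) / 2) (k' := (u₂' + 1) / 2) (by omega) (by omega) (by omega) (by omega)
    (by omega) (by omega)
  rw [sub_add_cancel] at this
  exact this c3

/-- The part of `visitRun` that compares `A` and `X`. -/
def compareCmd : Cmd := block [
    .rset rW (pdet (evec (I iU₁ / 2)) (evec (I iU₂ / 2))),
    .rset rNum (pdet (evec (I iU₁ / 2)) (psub (vtx (I iK)) (vtx (I iJ))) *
      pdet (psub (vtx (I iK)) (vtx (I iJ))) (evec (I iU₂ / 2))),
    .rset rDist (dist (I iJ) (I iK) (I iA)),
    .ite (.and (even (I iU₁)) (odd (I iU₂)))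
      (.ite (.or (.rlt 0 (R rW)) (.rlt (R rDist * (0 - R rW)) (R rNum)))
        (.iset iU₁ (I iU₁ + 1)) (.iset iU₂ (I iU₂ + 1)))
      (.ite (.or (.rlt 0 (R rW)) (rle (R rDist * (0 - R rW)) (R rNum)))
        (.iset iU₁ (I iU₁ + 1)) (.iset iU₂ (I iU₂ + 1)))]

open Classical in
theorem compare_run {n : ℕ} {v : Fin n → Point} (hn : 0 < n) {σ : State} (m : Mem v σ)
    (hJ : σ.ireg 13 = (σ.ireg 10 + 1) / 2) (hK : σ.ireg 14 = (σ.ireg 11 + 1) / 2) :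
    (compareCmd.run σ).ireg = (if Advances (vert v) (σ.ireg 10) (σ.ireg 11) (σ.ireg 4) then
      σ.iset 10 (σ.ireg 10 + 1) else σ.iset 11 (σ.ireg 11 + 1)).ireg ∧
    (compareCmd.run σ).iarr = σ.iarr ∧ (compareCmd.run σ).rarr = σ.rarr ∧
    (compareCmd.run σ).out = σ.out := by
  obtain ⟨W, hW⟩ : ∃ W, W = (pdet (evec (I iU₁ / 2)) (evec (I iU₂ / 2))).eval σ := ⟨_, rfl⟩
  have m1 : Mem v (σ.rset rW W) := m.congr rfl rfl
  obtain ⟨N, hN⟩ : ∃ N, N = (pdet (evec (I iU₁ / 2)) (psub (vtx (I iK)) (vtx (I iJ))) *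
      pdet (psub (vtx (I iK)) (vtx (I iJ))) (evec (I iU₂ / 2))).eval (σ.rset rW W) := ⟨_, rfl⟩
  have m2 : Mem v ((σ.rset rW W).rset rNum N) := m.congr rfl rfl
  obtain ⟨D, hD⟩ : ∃ D, D = (dist (I iJ) (I iK) (I iA)).eval ((σ.rset rW W).rset rNum N) :=
    ⟨_, rfl⟩
  have e : compareCmd.run σ = Cmd.run (.ite (.and (even (I iU₁)) (odd (I iU₂)))
      (.ite (.or (.rlt 0 (R rW)) (.rlt (R rDist * (0 - R rW)) (R rNum)))
        (.iset iU₁ (I iU₁ + 1)) (.iset iU₂ (I iU₂ + 1)))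
      (.ite (.or (.rlt 0 (R rW)) (rle (R rDist * (0 - R rW)) (R rNum)))
        (.iset iU₁ (I iU₁ + 1)) (.iset iU₂ (I iU₂ + 1))))
      (((σ.rset rW W).rset rNum N).rset rDist D) := by rw [hD, hN, hW]; rfl
  rw [eval_pdet, m.point_evec hn, m.point_evec hn] at hW
  rw [RExp.eval_mul, eval_pdet, eval_pdet, point_psub, m1.point_evec hn, m1.point_evec hn,
    m1.point_vtx hn, m1.point_vtx hn] at hN
  rw [m2.eval_dist hn] at hD
  simp only [IExp.eval_div, IExp.eval_reg, IExp.eval_two, State.rset_ireg, iU₁, iU₂, iJ, iK, iA,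
    hJ, hK] at hW hN hD
  rw [e]
  unfold Advances
  rw [← hW, ← hN, ← hD]
  clear hW hN hD m1 m2 e
  simp only [Cmd.run, BExp.eval_and, eval_even, eval_odd, IExp.eval_reg, BExp.eval_or,
    BExp.eval_rlt, eval_rle, RExp.eval_zero, RExp.eval_reg, RExp.eval_mul, RExp.eval_sub, zero_sub,
    State.rset_rreg, State.rset_ireg, iU₁, iU₂, rW, rNum, rDist, R, if_pos, IExp.eval_add,
    IExp.eval_one, show ¬ (1 = 2) by decide, show ¬ (1 = 3) by decide, show ¬ (2 = 3) by decide,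
    if_false]
  split_ifs <;> exact ⟨rfl, rfl, rfl, rfl⟩

/-! ### A run of the Rotate-and-Kill process -/

@[simp] theorem IExp.cost_add (a b : IExp) : (a + b).cost = a.cost + b.cost + 1 := rfl

theorem Runs.call {c : Cmd} {σ : State} {k B : ℕ} {Q : State → Prop} {Q' : ℕ → State → Prop}
    (h : Runs c σ k (fun _ => Q)) (p : ℕ) (hB : k + p ≤ B) (hQ : ∀ σ', Q σ' → Q' p σ') :
    Runs c σ B Q' := by
  obtain ⟨τ, q, σ', e, h, hq⟩ := h
  exact ⟨τ, p, σ', e, by omega, hQ _ hq⟩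

theorem RunInv.next {n : ℕ} {v : Fin n → Point} {r s t : ℤ} {σ₀ σ σ' : State}
    (I : RunInv v r s t σ₀ σ) (hs : 0 ≤ s) (hr : r ≤ 2 * n) (hrs : r < s)
    (h₀ : σ'.ireg 0 = σ.ireg 0) (h₁ : σ'.ireg 1 = σ.ireg 1) (h₂ : σ'.ireg 2 = σ.ireg 2)
    (h₃ : σ'.ireg 3 = σ.ireg 3) (hrarr : σ'.rarr = σ.rarr) (hout : σ'.out = σ.out)
    (hl : σ'.ireg 12 = σ.ireg 12 + 1)
    (ha : ∀ m, σ'.iarr 0 m = if m = σ.ireg 12 then σ.ireg 10 else σ.iarr 0 m)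
    (hb : ∀ m, σ'.iarr 1 m = if m = σ.ireg 12 then σ.ireg 11 else σ.iarr 1 m)
    (ok : PairOK n r s t (σ'.ireg 10) (σ'.ireg 11))
    (hmv : Moves (σ.ireg 10) (σ.ireg 11) (σ'.ireg 10) (σ'.ireg 11))
    (hc : ∀ a b c, Inter n (vert v) r s t a b c → σ.ireg 10 ≤ unitOf b → σ.ireg 11 ≤ unitOf c →
      (unitOf b = σ.ireg 10 ∧ unitOf c = σ.ireg 11) ∨
        (σ'.ireg 10 ≤ unitOf b ∧ σ'.ireg 11 ≤ unitOf c)) : RunInv v r s t σ₀ σ' := by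
  have here : VisAt σ' (σ.ireg 10) (σ.ireg 11) :=
    ⟨σ.ireg 12, I.vis.len, by omega, by rw [ha, if_pos rfl], by rw [hb, if_pos rfl]⟩
  have old : ∀ x y, VisAt σ x y → VisAt σ' x y := by
    rintro x y ⟨m, m1, m2, m3, m4⟩
    refine ⟨m, m1, by omega, ?_, ?_⟩
    · rw [ha, if_neg (by omega), m3]
    · rw [hb, if_neg (by omega), m4]
  obtain ⟨o1, o2, o3, o4, o5⟩ := I.ok
  refine ⟨I.mem.congr h₀ hrarr, h₁.trans I.reg₁, h₂.trans I.reg₂, h₃.trans I.reg₃,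
    hout.trans I.out, ok, ?_, ?_, ⟨?_, ?_, ?_⟩, ?_, ?_, ?_⟩
  · rw [hl, I.len]; rcases hmv with ⟨e1, e2⟩ | ⟨e1, e2⟩ <;> rw [e1, e2] <;> ring
  · intro m hm
    have := I.len
    have e : m ≠ σ.ireg 12 := by omega
    rw [ha, hb, if_neg e, if_neg e]
    exact I.keep m hm
  · have := I.vis.len
    omega
  · intro m m1 m2
    rw [ha, hb]
    split_ifs with e
    · exact ⟨by omega, o5, by omega, by omega⟩
    · exact I.vis.good m m1 (by omega)
  · intro m m1 m2
    rw [ha, hb, ha, hb, if_neg (show m ≠ σ.ireg 12 by omega), if_neg (show m ≠ σ.ireg 12 by omega)]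
    split_ifs with e
    · have := I.link (by omega)
      rwa [show σ.ireg 12 - 1 = m by omega] at this
    · exact I.vis.step m m1 (by omega)
  · intro _
    rw [hl, add_sub_cancel_right, ha, hb, if_pos rfl, if_pos rfl]
    exact hmv
  · intro a b c hi
    rcases I.complete a b c hi with h | ⟨h1, h2⟩
    · exact .inl (old _ _ h)
    · rcases hc a b c hi h1 h2 with ⟨e1, e2⟩ | h
      · exact .inl (by rw [e1, e2]; exact here)
      · exact .inr h
  · rcases I.start with h | ⟨e1, e2⟩
    · exact .inl (old _ _ h)
    · exact .inl (by rw [← e1, ← e2]; exact here)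

/-- The part of `visitRun` that stores the pair. -/
def storeCmd : Cmd := block [
    .istore aU₁ (I iLen) (I iU₁),
    .istore aU₂ (I iLen) (I iU₂),
    .iset iLen (I iLen + 1),
    .iset iJ ((I iU₁ + 1) / 2),
    .iset iK ((I iU₂ + 1) / 2)]

theorem compareCmd_cost : compareCmd.maxCost ≤ 1000 := by decide

theorem storeCmd_run (σ : State) :
    (∀ x, (storeCmd.run σ).ireg x = if x = 14 then (σ.ireg 11 + 1) / 2 else
      if x = 13 then (σ.ireg 10 + 1) / 2 else if x = 12 then σ.ireg 12 + 1 else σ.ireg x) ∧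
    (∀ m, (storeCmd.run σ).iarr 0 m = if m = σ.ireg 12 then σ.ireg 10 else σ.iarr 0 m) ∧
    (∀ m, (storeCmd.run σ).iarr 1 m = if m = σ.ireg 12 then σ.ireg 11 else σ.iarr 1 m) ∧
    (storeCmd.run σ).rarr = σ.rarr ∧ (storeCmd.run σ).out = σ.out := by
  refine ⟨fun x => ?_, fun m => ?_, fun m => ?_, rfl, rfl⟩ <;>
    simp [storeCmd, block, Cmd.run]

/-- The climb stops before `j + n`, where the distance is 0 again. At the stop both neighbours are
not farther, or `A'` is the end of the chord, and local maximality is global. -/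
theorem climb_end {n : ℕ} {v : Fin n → Point} (h : ConvSeq n (vert v)) {r s t u₁ u₂ A : ℤ}
    (c : ClimbFrom v r u₁ u₂ A) (ok : PairOK n r s t u₁ u₂) :
    ∃ A', A ≤ A' ∧ ClimbFrom v r u₁ u₂ A' ∧
      (∀ i, A ≤ i → i < A' → far (vert v ((u₁ + 1) / 2)) (vert v ((u₂ + 1) / 2)) (vert v i) <
        far (vert v ((u₁ + 1) / 2)) (vert v ((u₂ + 1) / 2)) (vert v (i + 1))) ∧
      ¬ far (vert v ((u₁ + 1) / 2)) (vert v ((u₂ + 1) / 2)) (vert v A') <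
        far (vert v ((u₁ + 1) / 2)) (vert v ((u₂ + 1) / 2)) (vert v (A' + 1)) ∧
      ∀ i, far (vert v ((u₁ + 1) / 2)) (vert v ((u₂ + 1) / 2)) (vert v i) ≤
        far (vert v ((u₁ + 1) / 2)) (vert v ((u₂ + 1) / 2)) (vert v A') := by
  obtain ⟨c1, c2, c3⟩ := c
  obtain ⟨h1, h2, h3, h4, h5⟩ := ok
  obtain ⟨j, hj⟩ : ∃ j, j = (u₁ + 1) / 2 := ⟨_, rfl⟩
  obtain ⟨k, hk⟩ : ∃ k, k = (u₂ + 1) / 2 := ⟨_, rfl⟩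
  have hjk : j < k := by omega
  have hkr : k ≤ r + n := by omega
  rw [← hj] at c2
  rw [← hj, ← hk] at c3 ⊢
  have hM : ¬ far (vert v j) (vert v k) (vert v (j + n - 1)) <
      far (vert v j) (vert v k) (vert v (j + n - 1 + 1)) := by
    rw [sub_add_cancel, h.per, far_self_outer, not_lt]
    exact h.nonneg (by omega) (by omega) (by omega)
  obtain ⟨A', a1, a2, a3, a4⟩ := least_stop (fun i => far (vert v j) (vert v k) (vert v i) <
    far (vert v j) (vert v k) (vert v (i + 1))) (show A ≤ j + n - 1 by omega) hM
  have up : A' = k ∨ far (vert v j) (vert v k) (vert v (A' - 1)) ≤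
      far (vert v j) (vert v k) (vert v A') := by
    rcases a1.eq_or_lt with rfl | a1
    · exact c3
    · have := a4 (A' - 1) (by omega) (by omega)
      rw [sub_add_cancel] at this
      exact .inr this.le
  refine ⟨A', a1, ⟨by omega, by omega, by rw [← hj, ← hk]; exact up⟩, a4, a3, ?_⟩
  exact h.le_of_local hjk (by omega) (by omega) (not_lt.1 a3) (up.imp_left Eq.symm)

theorem visitRun_spec {n : ℕ} {v : Fin n → Point} (hv : IsConvexPolygon v) {r s t : ℤ}
    (st : Stab n (vert v) r s t) (hs : 0 ≤ s) (hr : r ≤ 2 * n) {re se te : IExp} {σ₀ : State}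
    (cr : re.cost ≤ 10) (cs : se.cost ≤ 10) (ct : te.cost ≤ 10)
    (er : ∀ σ : State, σ.ireg 0 = σ₀.ireg 0 → σ.ireg 1 = σ₀.ireg 1 → σ.ireg 2 = σ₀.ireg 2 →
      σ.ireg 3 = σ₀.ireg 3 → re.eval σ = r + n ∧ se.eval σ = s ∧ te.eval σ = t)
    (m : Mem v σ₀) (vis : Visited n σ₀)
    (link : 0 < σ₀.ireg 12 →
      Moves (σ₀.iarr 0 (σ₀.ireg 12 - 1)) (σ₀.iarr 1 (σ₀.ireg 12 - 1)) (2 * s) (2 * t)) :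
    Runs (visitRun re se te) σ₀ (10000 * n) (fun _ σ =>
      RunInv v r s t σ₀ σ ∧ σ.ireg 10 = 2 * t ∧ σ.ireg 11 = 2 * (r + n)) := by
  have h := vert_conv hv
  have hn := h.three
  have hrs : r < s := by exact_mod_cast st.lt₁
  have hst : s < t := by exact_mod_cast st.lt₂
  have htr : t < r + n := by exact_mod_cast st.lt₃
  have num₀ := m.num
  obtain ⟨er₀, es₀, et₀⟩ := er σ₀ rfl rfl rfl rfl
  refine Runs.split 3 (by decide) (by simp) ?_
  refine Runs.step 100 rfl (by simp only [List.take, block, Cmd.maxCost, IExp.cost_add]; omega)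
    (by omega) ?_
  obtain ⟨σ₁, hσ₁⟩ : ∃ σ, σ = ((σ₀.iset 10 (2 * s)).iset 11 (2 * t)).iset 4 (r + n) := ⟨_, rfl⟩
  have hrun : (block (List.take 3 [Cmd.iset iU₁ (se + se), .iset iU₂ (te + te),
      .iset iA re])).run σ₀ = σ₁ := by
    simp only [List.take, block, Cmd.run, IExp.eval_add]
    rw [es₀, (er (σ₀.iset iU₁ (s + s)) rfl rfl rfl rfl).2.2,
      (er ((σ₀.iset iU₁ (s + s)).iset iU₂ (t + t)) rfl rfl rfl rfl).1, hσ₁, two_mul, two_mul]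
    rfl
  have inv₁ : RunInv v r s t σ₀ σ₁ := by
    subst hσ₁
    refine ⟨m.congr rfl rfl, rfl, rfl, rfl, rfl, ?_, ?_, fun _ _ => ⟨rfl, rfl⟩,
      ⟨vis.len, vis.good, vis.step⟩, ?_, ?_, ?_⟩
    · exact ⟨by simp, by simp; omega, by simp, by simp; omega, by simp; omega⟩
    · simp
    · simpa using link
    · intro a b c hi
      right
      simp only [State.iset_ireg]
      exact ⟨even_le_unitOf.2 hi.sb, even_le_unitOf.2 hi.tc⟩
    · simp
  have climb₁ : ClimbFrom v r (σ₁.ireg 10) (σ₁.ireg 11) (σ₁.ireg 4) := by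
    have e1 : σ₁.ireg 10 = 2 * s := by simp [hσ₁]
    have e2 : σ₁.ireg 11 = 2 * t := by simp [hσ₁]
    have e3 : σ₁.ireg 4 = r + n := by simp [hσ₁]
    rw [e1, e2, e3]
    refine ⟨le_rfl, by omega, .inr ?_⟩
    -- The climb may start at the corner `r`, which is farthest from the first chord by stability.
    have := st.max₁ ((r - 1 + n : ℤ) : ℝ)
    simp only [curve_int, h.per] at this
    rw [show (2 * s + 1) / 2 = s by omega, show (2 * t + 1) / 2 = t by omega, h.per,
      show r + n - 1 = r - 1 + n by ring, h.per]
    exact this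
  -- The potential: each of the remaining moves of the two units pays for one iteration, and each
  -- remaining step of `A`, which stays below `t + n`, pays for itself.
  have bud₁ : 2000 * ((2 * t - σ₁.ireg 10) + (2 * (r + n) - σ₁.ireg 11)) +
      300 * (t + n - σ₁.ireg 4) + 500 ≤ ((10000 * n - 100 : ℕ) : ℤ) := by
    have e1 : σ₁.ireg 10 = 2 * s := by simp [hσ₁]
    have e2 : σ₁.ireg 11 = 2 * t := by simp [hσ₁]
    have e3 : σ₁.ireg 4 = r + n := by simp [hσ₁]
    omega
  change Runs (.loop _ _) ((block (List.take 3 [Cmd.iset iU₁ (se + se), .iset iU₂ (te + te),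
      .iset iA re])).run σ₀) _ _
  rw [hrun]
  clear hrun hσ₁ link vis m
  refine Runs.loop (fun p σ => RunInv v r s t σ₀ σ ∧ ClimbFrom v r (σ.ireg 10) (σ.ireg 11) (σ.ireg 4) ∧
    2000 * ((2 * t - σ.ireg 10) + (2 * (r + n) - σ.ireg 11)) +
      300 * (t + n - σ.ireg 4) + 500 ≤ (p : ℤ)) 100
    (by simp only [BExp.cost, IExp.cost]; omega) ?_ ?_ ⟨inv₁, climb₁, bud₁⟩
  · rintro p σ ⟨inv, climb, bud⟩ hb
    obtain ⟨er₁, es₁, et₁⟩ := er σ (inv.mem.num.trans num₀.symm) inv.reg₁ inv.reg₂ inv.reg₃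
    have ne : ¬ (σ.ireg 10 = 2 * t ∧ σ.ireg 11 = 2 * (r + n)) := by
      simp only [BExp.eval_not, BExp.eval_and, BExp.eval_ieq, IExp.eval_add, er₁, et₁, ← two_mul] at hb
      exact hb
    obtain ⟨o1, o2, o3, o4, o5⟩ := inv.ok
    obtain ⟨A', a1, climb', up, halt, far'⟩ := climb_end h climb inv.ok
    have step := process_step h inv.ok hrs st ne far'
    obtain ⟨s1, s2, s3, s4, s5⟩ := storeCmd_run σ
    have hA' : A' < t + n := by have := climb'.high; omega
    refine ⟨p - 100, by omega, ?_⟩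
    refine Runs.split 5 (by decide) (by decide) ?_
    refine Runs.step (c := storeCmd) 100 rfl (by decide) (by omega) ?_
    obtain ⟨σ₂, hσ₂⟩ : ∃ σ₂, σ₂ = storeCmd.run σ := ⟨_, rfl⟩
    rw [← hσ₂] at s1 s2 s3 s4 s5 ⊢
    have m₂ : Mem v σ₂ := inv.mem.congr (by rw [s1]; rfl) s4
    have i10 : σ₂.ireg 10 = σ.ireg 10 := by rw [s1]; rfl
    have i11 : σ₂.ireg 11 = σ.ireg 11 := by rw [s1]; rfl
    have i4 : σ₂.ireg 4 = σ.ireg 4 := by rw [s1]; rfl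
    have i13 : σ₂.ireg 13 = (σ.ireg 10 + 1) / 2 := by rw [s1]; rfl
    have i14 : σ₂.ireg 14 = (σ.ireg 11 + 1) / 2 := by rw [s1]; rfl
    refine Runs.split 1 (by decide) (by decide) ?_
    refine Runs.scan (x := iA) (fun i => far (vert v ((σ.ireg 10 + 1) / 2))
      (vert v ((σ.ireg 11 + 1) / 2)) (vert v i) < far (vert v ((σ.ireg 10 + 1) / 2))
      (vert v ((σ.ireg 11 + 1) / 2)) (vert v (i + 1))) 150 (by decide) ?_ (a' := A')
      (by rw [show iA = 4 from rfl, i4]; exact a1) (by rw [show iA = 4 from rfl, i4]; exact up) halt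
      (by rw [show iA = 4 from rfl, i4]; omega) ?_
    · intro y
      rw [(show Mem v (σ₂.iset iA y) from m₂.congr rfl rfl).eval_farther (by omega)]
      simp [i13, i14]
    intro p' hp'
    rw [show iA = 4 from rfl, i4] at hp'
    have m₃ : Mem v (σ₂.iset iA A') := m₂.congr rfl rfl
    obtain ⟨c1, c2, c3, c4⟩ := compare_run (by omega) m₃ (by simp [i13, i10]) (by simp [i14, i11])
    refine Runs.step (c := compareCmd) 1000 rfl compareCmd_cost (by omega) ?_
    obtain ⟨σ₄, hσ₄⟩ : ∃ σ₄, σ₄ = compareCmd.run (σ₂.iset iA A') := ⟨_, rfl⟩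
    rw [← hσ₄] at c1 c2 c3 c4 ⊢
    have e10 : (σ₂.iset iA A').ireg 10 = σ.ireg 10 := by simp [i10]
    have e11 : (σ₂.iset iA A').ireg 11 = σ.ireg 11 := by simp [i11]
    have e4 : (σ₂.iset iA A').ireg 4 = A' := by simp
    rw [e10, e11, e4] at c1
    have reg : ∀ x, x ≠ 10 → x ≠ 11 → σ₄.ireg x = if x = 4 then A' else σ₂.ireg x := by
      intro x h1 h2
      rw [c1]
      split_ifs with q1 q2 q2 <;> simp [h1, h2, q2]
    have key : (PairOK n r s t (σ₄.ireg 10) (σ₄.ireg 11) ∧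
        Moves (σ.ireg 10) (σ.ireg 11) (σ₄.ireg 10) (σ₄.ireg 11) ∧
        ∀ a b c, Inter n (vert v) r s t a b c → σ.ireg 10 ≤ unitOf b → σ.ireg 11 ≤ unitOf c →
          (unitOf b = σ.ireg 10 ∧ unitOf c = σ.ireg 11) ∨
          (σ₄.ireg 10 ≤ unitOf b ∧ σ₄.ireg 11 ≤ unitOf c)) := by
      by_cases ad : Advances (vert v) (σ.ireg 10) (σ.ireg 11) A'
      · rw [if_pos ad] at c1
        have e1 : σ₄.ireg 10 = σ.ireg 10 + 1 := by rw [c1]; simp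
        have e2 : σ₄.ireg 11 = σ.ireg 11 := by rw [c1]; simp [i11]
        rw [e1, e2]
        refine ⟨(step.1 ad).1, .inl ⟨rfl, rfl⟩, fun a b c hi hb hc => ?_⟩
        exact ((step.1 ad).2 a b c hi hb hc).imp_right fun h => ⟨h, hc⟩
      · rw [if_neg ad] at c1
        have e1 : σ₄.ireg 10 = σ.ireg 10 := by rw [c1]; simp [i10]
        have e2 : σ₄.ireg 11 = σ.ireg 11 + 1 := by rw [c1]; simp
        rw [e1, e2]
        refine ⟨(step.2 ad).1, .inr ⟨rfl, rfl⟩, fun a b c hi hb hc => ?_⟩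
        exact ((step.2 ad).2 a b c hi hb hc).imp_right fun h => ⟨hb, h⟩
    obtain ⟨ok', mv, comp⟩ := key
    have g4 : σ₄.ireg 4 = A' := by rw [reg] <;> simp
    refine ⟨inv.next hs hr hrs ?_ ?_ ?_ ?_ ?_ ?_ ?_ ?_ ?_ ok' mv comp, ?_, ?_⟩
    · rw [reg] <;> simp [s1]
    · rw [reg] <;> simp [s1]
    · rw [reg] <;> simp [s1]
    · rw [reg] <;> simp [s1]
    · rw [c3]; exact s4
    · rw [c4]; exact s5
    · rw [reg] <;> simp [s1]
    · rw [c2]; exact s2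
    · rw [c2]; exact s3
    · rw [g4]
      rcases mv with ⟨m1, m2⟩ | ⟨m1, m2⟩
      · exact climb'.next h inv.ok ok' (by omega) (by omega)
      · exact climb'.next h inv.ok ok' (by omega) (by omega)
    · rw [g4]
      rcases mv with ⟨m1, m2⟩ | ⟨m1, m2⟩ <;> omega
  · rintro p σ ⟨inv, climb, bud⟩ hb
    obtain ⟨er₁, es₁, et₁⟩ := er σ (inv.mem.num.trans num₀.symm) inv.reg₁ inv.reg₂ inv.reg₃
    simp only [BExp.eval_not, BExp.eval_and, BExp.eval_ieq, IExp.eval_add, er₁, et₁, ← two_mul,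
      not_not] at hb
    obtain ⟨o1, o2, o3, o4, o5⟩ := inv.ok
    have := climb.high
    exact ⟨0, by omega, inv, hb.1, hb.2⟩

/-! ### Stability in terms of distances -/

/-- The product of two squared lengths exceeds the square of the determinant by the square of the
inner product. For the foot of the perpendicular the inner product vanishes, which is
`foot_dist_line`. -/
theorem sq_dist_line (B C X : Point) (l : ℝ) :
    (far B C X) ^ 2 ≤ Dist.dist X (B + l • (C - B)) ^ 2 * Dist.dist B C ^ 2 := by
  simp only [EuclideanSpace.dist_eq, Fin.sum_univ_two, Real.dist_eq, sq_abs, PiLp.add_apply,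
    PiLp.smul_apply, PiLp.sub_apply, smul_eq_mul]
  rw [Real.sq_sqrt (by positivity), Real.sq_sqrt (by positivity), far_eq]
  nlinarith [sq_nonneg ((X 0 - (B 0 + l * (C 0 - B 0))) * (B 0 - C 0) +
    (X 1 - (B 1 + l * (C 1 - B 1))) * (B 1 - C 1))]

theorem foot_dist_line {B C : Point} (h : B ≠ C) (X : Point) :
    ∃ l : ℝ, Dist.dist X (B + l • (C - B)) ^ 2 * Dist.dist B C ^ 2 = (far B C X) ^ 2 := by
  have hd : (B 0 - C 0) ^ 2 + (B 1 - C 1) ^ 2 ≠ 0 := by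
    intro e
    have h0 : B 0 - C 0 = 0 := by nlinarith [sq_nonneg (B 0 - C 0), sq_nonneg (B 1 - C 1)]
    have h1 : B 1 - C 1 = 0 := by nlinarith [sq_nonneg (B 0 - C 0), sq_nonneg (B 1 - C 1)]
    apply h
    ext i
    fin_cases i <;> simp <;> linarith
  refine ⟨((X 0 - B 0) * (C 0 - B 0) + (X 1 - B 1) * (C 1 - B 1)) /
    ((B 0 - C 0) ^ 2 + (B 1 - C 1) ^ 2), ?_⟩
  simp only [EuclideanSpace.dist_eq, Fin.sum_univ_two, Real.dist_eq, sq_abs, PiLp.add_apply,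
    PiLp.smul_apply, PiLp.sub_apply, smul_eq_mul]
  rw [Real.sq_sqrt (by positivity), Real.sq_sqrt (by positivity), far_eq]
  field_simp
  ring

theorem mem_line {B C P : Point} : P ∈ line[ℝ, B, C] ↔ ∃ l : ℝ, P = B + l • (C - B) := by
  rw [mem_affineSpan_pair_iff_exists_lineMap_eq]
  simp only [AffineMap.lineMap_apply, vsub_eq_sub, vadd_eq_add]
  constructor
  · rintro ⟨l, rfl⟩; exact ⟨l, add_comm _ _⟩
  · rintro ⟨l, rfl⟩; exact ⟨l, add_comm _ _⟩

theorem lineDist_eq {B C : Point} (h : B ≠ C) (X : Point) :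
    lineDist B C X = |far B C X| / Dist.dist B C := by
  have hd : 0 < Dist.dist B C := dist_pos.2 h
  have key : ∀ l : ℝ, |far B C X| ≤ Dist.dist X (B + l • (C - B)) * Dist.dist B C := by
    intro l
    apply abs_le_of_sq_le_sq _ (by positivity)
    rw [mul_pow]
    exact sq_dist_line B C X l
  apply le_antisymm
  · obtain ⟨l, hl⟩ := foot_dist_line h X
    refine (Metric.infDist_le_dist_of_mem (SetLike.mem_coe.2 (mem_line.2 ⟨l, rfl⟩))).trans ?_
    rw [le_div_iff₀ hd]
    refine le_of_sq_le_sq ?_ (abs_nonneg _)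
    rw [mul_pow, hl, sq_abs]
  · rw [lineDist, Metric.le_infDist ⟨B, left_mem_affineSpan_pair ℝ B C⟩]
    intro P hP
    obtain ⟨l, rfl⟩ := mem_line.1 (SetLike.mem_coe.1 hP)
    rw [div_le_iff₀ hd]
    exact key l

theorem ne_of_far {A B C : Point} (h : 0 < far B C A) : B ≠ C := by
  rintro rfl
  simp [far_self_left] at h

theorem far_convex (B C : Point) (m : ℝ) : Convex ℝ {X | far B C X ≤ m} := by
  intro x hx y hy s t hs ht hst
  simp only [Set.mem_ofPred_eq] at *
  rw [far_comb _ _ _ _ _ _ hst]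
  have e : s * m + t * m = m := by rw [← add_mul, hst, one_mul]
  have := mul_le_mul_of_nonneg_left hx hs
  have := mul_le_mul_of_nonneg_left hy ht
  linarith

section
variable {n : ℕ} {v : Fin n → Point}

theorem exists_vert (hn : 0 < n) (i : ℤ) : ∃ j : Fin n, vert v i = v j := by
  unfold vert
  rw [dif_pos hn]
  exact ⟨_, rfl⟩

/-- The signed distance is affine, so its bound on the vertices extends to their convex hull. Points
that are not on the right of `BC` satisfy the bound anyway because `far B C A` is positive. -/
theorem cornerStable_iff (hn : 0 < n) {A B C : Point} (hA : 0 < far B C A) :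
    CornerStable v A B C ↔ ∀ i, far B C (vert v i) ≤ far B C A := by
  have hBC := ne_of_far hA
  have hd : 0 < Dist.dist B C := dist_pos.2 hBC
  constructor
  · intro h i
    obtain ⟨j, hj⟩ := exists_vert (v := v) hn i
    rw [hj]
    by_contra hlt
    push Not at hlt
    have := h (v j) (subset_convexHull ℝ _ ⟨j, rfl⟩) (by
      have := far_eq_neg_orient B C (v j); linarith)
    rw [lineDist_eq hBC, lineDist_eq hBC, div_le_div_iff_of_pos_right hd, abs_of_pos hA,
      abs_of_pos (hA.trans hlt)] at this
    linarith
  · intro h X hX hr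
    have hX' : far B C X ≤ far B C A := by
      have : region v ⊆ {X | far B C X ≤ far B C A} := by
        refine convexHull_min ?_ (far_convex B C _)
        rintro _ ⟨j, rfl⟩
        have := h j.val
        rwa [vert_val] at this
      exact this hX
    have hX0 : 0 < far B C X := by rw [far_eq_neg_orient]; linarith
    rw [lineDist_eq hBC, lineDist_eq hBC, div_le_div_iff_of_pos_right hd, abs_of_pos hA,
      abs_of_pos hX0]
    exact hX'

theorem vert_next (i : Fin n) : vert v (i.val + 1) = v (nextIdx i) := by
  have hn : 0 < n := i.pos
  unfold vert
  rw [dif_pos hn]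
  rfl

theorem mem_boundary (h : ConvSeq n (vert v)) {X : Point} :
    X ∈ boundary v ↔ ∃ x : ℝ, X = curve (vert v) x := by
  have hn := h.three
  simp only [boundary, Set.mem_iUnion]
  constructor
  · rintro ⟨i, s, t, hs, ht, hst, rfl⟩
    refine ⟨(i.val : ℤ) + t, ?_⟩
    rw [curve_on _ (i.val : ℤ) _ (by linarith) (by linarith), vert_val, vert_next]
    rw [show (1 : ℝ) - (((i.val : ℤ) : ℝ) + t - ((i.val : ℤ) : ℝ)) = s by linarith, add_sub_cancel_left]
  · rintro ⟨x, rfl⟩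
    obtain ⟨z, h1, h2⟩ := ConvSeq.exists_lift (n := n) (by omega) ⌊x⌋ 0
    have f1 := Int.floor_le x
    have f2 := Int.lt_floor_add_one x
    refine ⟨⟨(⌊x⌋ + z * n).toNat, by omega⟩, 1 - (x - ⌊x⌋), x - ⌊x⌋, by linarith, by linarith,
      by ring, ?_⟩
    rw [curve_on _ ⌊x⌋ x f1 f2.le, ← vert_val v, ← vert_next (v := v)]
    simp only
    rw [Int.toNat_of_nonneg h1, h.per_mul, show ⌊x⌋ + z * n + 1 = ⌊x⌋ + 1 + z * n by ring,
      h.per_mul]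

theorem mem_edge (h : ConvSeq n (vert v)) {i : Fin n} {x : ℝ} (hx : curve (vert v) x ∈ edge v i) :
    ∃ z : ℤ, ((i.val : ℤ) + z * (n : ℤ) : ℝ) < x ∧ x < ((i.val : ℤ) + z * (n : ℤ) : ℝ) + 1 := by
  have hn := h.three
  obtain ⟨s, t, hs, ht, hst, e⟩ := hx
  obtain ⟨z, h1, h2⟩ := ConvSeq.exists_lift_real (n := n) (by omega) x (i.val : ℤ)
  have e' : curve (vert v) ((i.val : ℤ) + t) = curve (vert v) (x + z * (n : ℤ)) := by
    rw [h.curve_per_mul, ← e, curve_on _ (i.val : ℤ) _ (by linarith) (by linarith), vert_val,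
      vert_next]
    rw [show (1 : ℝ) - (((i.val : ℤ) : ℝ) + t - ((i.val : ℤ) : ℝ)) = s by linarith, add_sub_cancel_left]
  have hn' : (3 : ℝ) ≤ ((n : ℤ) : ℝ) := by exact_mod_cast hn
  have : ((i.val : ℤ) : ℝ) + t = x + z * (n : ℤ) := by
    rcases lt_trichotomy (((i.val : ℤ) : ℝ) + t) (x + z * (n : ℤ)) with hlt | heq | hgt
    · exact absurd e' (h.curve_injective hlt (by linarith))
    · exact heq
    · exact absurd e'.symm (h.curve_injective hgt (by linarith))
  refine ⟨-z, ?_, ?_⟩ <;> push_cast at * <;> nlinarith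

theorem curve_eq_int (h : ConvSeq n (vert v)) {x : ℝ} {i : ℤ}
    (hx : curve (vert v) x = vert v i) : ∃ z : ℤ, x = ((i + z * n : ℤ) : ℝ) := by
  have hn := h.three
  obtain ⟨z, h1, h2⟩ := ConvSeq.exists_lift_real (n := n) (by omega) x i
  rw [← h.curve_per_mul x z, ← curve_int (vert v) i] at hx
  rcases h1.eq_or_lt with h1 | h1
  · exact ⟨-z, by push_cast at *; linarith⟩
  · exact absurd hx.symm (h.curve_injective h1 h2)

theorem allStable_of_stab (h : ConvSeq n (vert v)) {a b c : ℝ} (s : Stab n (vert v) a b c) :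
    AllStable v (curve (vert v) a) (curve (vert v) b) (curve (vert v) c) := by
  have hn : 0 < n := by have := h.three; omega
  obtain ⟨e1, e2⟩ := s.far_eq_sum
  have key := s.pos
  refine ⟨(mem_boundary h).2 ⟨a, rfl⟩, (mem_boundary h).2 ⟨b, rfl⟩, (mem_boundary h).2 ⟨c, rfl⟩,
    ?_, ?_, ?_, ?_⟩
  · rw [far_eq_neg_orient] at key; linarith
  · rw [cornerStable_iff hn (by rw [e1]; exact key)]
    exact fun i => by rw [← curve_int (vert v) i]; exact s.max₁ i
  · rw [cornerStable_iff hn (by rw [e2]; exact key)]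
    exact fun i => by rw [← curve_int (vert v) i]; exact s.max₂ i
  · rw [cornerStable_iff hn key]
    exact fun i => by rw [← curve_int (vert v) i]; exact s.max₃ i

/-- Lifted to the period after `a`, the parameters of the other corners must be increasing, since
the opposite order would make the orientation nonpositive. -/
theorem exists_order (h : ConvSeq n (vert v)) {a b c : ℝ}
    (hp : 0 < far (curve (vert v) a) (curve (vert v) b) (curve (vert v) c)) :
    ∃ y z : ℤ, a < b + y * (n : ℤ) ∧ b + y * (n : ℤ) < c + z * (n : ℤ) ∧ c + z * (n : ℤ) < a + (n : ℤ) := by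
  have hn := h.three
  obtain ⟨y, y1, y2⟩ := ConvSeq.exists_lift_real (n := n) (by omega) b a
  obtain ⟨z, z1, z2⟩ := ConvSeq.exists_lift_real (n := n) (by omega) c a
  refine ⟨y, z, ?_, ?_, z2⟩
  · refine lt_of_le_of_ne y1 fun e => ?_
    rw [← h.curve_per_mul b y, ← e, far_self_left] at hp
    exact lt_irrefl _ hp
  · by_contra hlt
    have := h.curve_nonneg z1 (not_lt.1 hlt) y2.le
    rw [h.curve_per_mul, h.curve_per_mul, far_swap_right] at this
    linarith

/-- The local conditions of stability, with the order of the parameters. -/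
theorem stab_of_far {a b c : ℝ} (h₁ : a < b) (h₂ : b < c) (h₃ : c < a + (n : ℤ))
    (hp : 0 < far (curve (vert v) a) (curve (vert v) b) (curve (vert v) c))
    (m₁ : ∀ i, far (curve (vert v) b) (curve (vert v) c) (vert v i) ≤
      far (curve (vert v) b) (curve (vert v) c) (curve (vert v) a))
    (m₂ : ∀ i, far (curve (vert v) c) (curve (vert v) a) (vert v i) ≤
      far (curve (vert v) c) (curve (vert v) a) (curve (vert v) b))
    (m₃ : ∀ i, far (curve (vert v) a) (curve (vert v) b) (vert v i) ≤
      far (curve (vert v) a) (curve (vert v) b) (curve (vert v) c)) : Stab n (vert v) a b c :=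
  ⟨h₁, h₂, h₃, hp, curve_far_le m₁, curve_far_le m₂, curve_far_le m₃⟩

theorem stab_of_allStable (h : ConvSeq n (vert v)) {a b c : ℝ}
    (s : AllStable v (curve (vert v) a) (curve (vert v) b) (curve (vert v) c)) :
    ∃ y z : ℤ, Stab n (vert v) a (b + y * (n : ℤ)) (c + z * (n : ℤ)) := by
  have hn : 0 < n := by have := h.three; omega
  have hp : 0 < far (curve (vert v) a) (curve (vert v) b) (curve (vert v) c) := by
    have := s.clockwise
    rw [far_eq_neg_orient]; linarith
  have hp' := hp
  have hp'' := hp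
  rw [far_rotate] at hp'
  rw [far_rotate, far_rotate] at hp''
  have s1 := (cornerStable_iff hn hp').1 s.stable₁
  have s2 := (cornerStable_iff hn hp'').1 s.stable₂
  have s3 := (cornerStable_iff hn hp).1 s.stable₃
  obtain ⟨y, z, e1, e2, e3⟩ := exists_order h hp
  rw [← h.curve_per_mul b y, ← h.curve_per_mul c z] at hp s1 s2 s3
  exact ⟨y, z, stab_of_far e1 e2 e3 hp s1 s2 s3⟩

end

/-! ### The three runs -/

theorem VisAt.keep {n : ℕ} {v : Fin n → Point} {r s t : ℤ} {σ₀ σ : State} (I : RunInv v r s t σ₀ σ)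
    {x y : ℤ} (h : VisAt σ₀ x y) : VisAt σ x y := by
  obtain ⟨m, m1, m2, m3, m4⟩ := h
  obtain ⟨k1, k2⟩ := I.keep m m2
  have := I.len
  obtain ⟨o1, o2, o3, o4, o5⟩ := I.ok
  exact ⟨m, m1, by omega, k1.trans m3, k2.trans m4⟩

/-- The pair of the units of two corners is visited. -/
def Seen (n : ℤ) (σ : State) (x y : ℝ) : Prop :=
  ∃ z : ℤ, VisAt σ (unitOf (x + z * n)) (unitOf (y + z * n))

theorem Seen.shift {n : ℤ} {σ : State} {x y : ℝ} : Seen n σ (x + n) (y + n) ↔ Seen n σ x y := by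
  constructor
  · rintro ⟨z, h⟩
    refine ⟨z + 1, ?_⟩
    push_cast
    rwa [show x + ((z : ℝ) + 1) * n = x + n + z * n by ring,
      show y + ((z : ℝ) + 1) * n = y + n + z * n by ring]
  · rintro ⟨z, h⟩
    refine ⟨z - 1, ?_⟩
    push_cast
    rwa [show x + n + ((z : ℝ) - 1) * n = x + z * n by ring,
      show y + n + ((z : ℝ) - 1) * n = y + z * n by ring]

theorem Seen.of_vis {n : ℤ} {σ : State} {x y : ℝ} (h : VisAt σ (unitOf x) (unitOf y)) :
    Seen n σ x y := ⟨0, by simpa using h⟩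

/-- What the visited pairs are good for. -/
structure VisitOK {n : ℕ} (v : Fin n → Point) (out : List OutTri) (σ : State) : Prop where
  mem : Mem v σ
  out : σ.out = out
  vis : Visited n σ
  len : σ.ireg 12 ≤ 4 * n
  complete : ∀ a b c, Stab n (vert v) a b c → Seen n σ a b ∧ Seen n σ b c ∧ Seen n σ c (a + (n : ℤ))

theorem RunInv.seen {n : ℕ} {v : Fin n → Point} {r s t : ℤ} {σ₀ σ : State}
    (I : RunInv v r s t σ₀ σ) (h₁ : σ.ireg 10 = 2 * t) (h₂ : σ.ireg 11 = 2 * (r + n))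
    {a b c : ℝ} (hi : Inter n (vert v) r s t a b c) :
    VisAt σ (unitOf b) (unitOf c) ∨ (unitOf b = 2 * t ∧ unitOf c = 2 * (r + n)) := by
  refine (I.complete a b c hi).imp_right fun ⟨h3, h4⟩ => ?_
  have h5 := unitOf_mono hi.bt
  have h6 := unitOf_mono hi.cr
  rw [unitOf_int] at h5
  rw [← Int.cast_add, unitOf_int] at h6
  exact ⟨by omega, by omega⟩

theorem order_of_threeStable {n : ℕ} {v : Fin n → Point} (h : ConvSeq n (vert v)) {r s t : ℤ}
    (hr : 0 ≤ r) (hr' : r < n) (hs : 0 ≤ s) (hs' : s < n) (ht : 0 ≤ t) (ht' : t < n)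
    (st : AllStable v (vert v r) (vert v s) (vert v t)) :
    Stab n (vert v) r ((if s < r then s + n else s : ℤ) : ℝ)
      ((if t < (if s < r then s + n else s) then t + n else t : ℤ) : ℝ) := by
  simp only [← curve_int (vert v)] at st
  obtain ⟨y, z, hst⟩ := stab_of_allStable h st
  have h1 : r < s + y * n := by exact_mod_cast hst.lt₁
  have h2 : s + y * n < t + z * n := by exact_mod_cast hst.lt₂
  have h3 : t + z * n < r + n := by exact_mod_cast hst.lt₃
  have key : ∀ x y : ℤ, 0 ≤ x → x < n → r < x + y * n → x + y * n < r + n →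
      (y = 0 ∨ y = 1) := by
    intro x y h1 h2 h3 h4
    have k1 : -1 < y := by
      by_contra hc
      have : y * (n : ℤ) ≤ -1 * n := mul_le_mul_of_nonneg_right (by omega) (by omega)
      omega
    have k2 : y < 2 := by
      by_contra hc
      have : 2 * (n : ℤ) ≤ y * n := mul_le_mul_of_nonneg_right (by omega) (by omega)
      omega
    omega
  have e1 : (if s < r then s + n else s : ℤ) = s + y * n := by
    rcases key s y hs hs' h1 (by omega) with rfl | rfl <;> split_ifs <;> omega
  have e2 : (if t < s + y * n then t + n else t : ℤ) = t + z * n := by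
    rcases key t z ht ht' (by omega) h3 with rfl | rfl <;> split_ifs <;> omega
  rw [e1, e2]
  push_cast at hst ⊢
  exact hst

/-- A stable triangle interleaves with `r s t`, and each of its three pairs of consecutive corners
runs through the two arcs of one of the runs. The lengths of the runs are `2 (r + n - s)`, `2 (s + n
- t)` and `2 (t - r)`, together `4n`. -/
theorem visitPairs_spec {n : ℕ} {v : Fin n → Point} (hv : IsConvexPolygon v) {σ₀ : State}
    (m : Mem v σ₀) (hr : 0 ≤ σ₀.ireg 1) (hr' : σ₀.ireg 1 < n) (hs : 0 ≤ σ₀.ireg 2)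
    (hs' : σ₀.ireg 2 < n) (ht : 0 ≤ σ₀.ireg 3) (ht' : σ₀.ireg 3 < n)
    (st : AllStable v (vert v (σ₀.ireg 1)) (vert v (σ₀.ireg 2)) (vert v (σ₀.ireg 3))) :
    Runs visitPairs σ₀ (40000 * n) (fun _ σ => VisitOK v σ₀.out σ) := by
  have h := vert_conv hv
  have hn := h.three
  have hst := order_of_threeStable h hr hr' hs hs' ht ht' st
  obtain ⟨r, er⟩ : ∃ r, r = σ₀.ireg 1 := ⟨_, rfl⟩
  obtain ⟨s, es⟩ : ∃ s, s = if σ₀.ireg 2 < σ₀.ireg 1 then σ₀.ireg 2 + n else σ₀.ireg 2 := ⟨_, rfl⟩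
  rw [← es] at hst
  obtain ⟨t, et⟩ : ∃ t, t = if σ₀.ireg 3 < s then σ₀.ireg 3 + n else σ₀.ireg 3 := ⟨_, rfl⟩
  rw [← et, ← er] at hst
  have hrs : r < s := by exact_mod_cast hst.lt₁
  have hst' : s < t := by exact_mod_cast hst.lt₂
  have htr : t < r + n := by exact_mod_cast hst.lt₃
  refine Runs.split 3 (by decide) (by decide) ?_
  refine Runs.step 100 rfl (by decide) (by omega) ?_
  obtain ⟨σ₁, hσ₁⟩ : ∃ σ, σ = (block (List.take 3 [when (.ilt (I iS) (I iR)) (.iset iS (I iS + I iN)),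
    when (.ilt (I iT) (I iS)) (.iset iT (I iT + I iN)), .iset iLen 0])).run σ₀ := ⟨_, rfl⟩
  have F : (∀ x, σ₁.ireg x = if x = 12 then 0 else if x = 3 then t else if x = 2 then s else
      σ₀.ireg x) ∧ σ₁.iarr = σ₀.iarr ∧ σ₁.rarr = σ₀.rarr ∧ σ₁.out = σ₀.out := by
    have m0 := m.num
    subst hσ₁
    by_cases h1 : σ₀.ireg 2 < σ₀.ireg 1
    · rw [if_pos h1] at es
      by_cases h2 : σ₀.ireg 3 < s
      · rw [if_pos h2] at et
        rw [es] at h2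
        refine ⟨fun x => ?_, ?_, ?_, ?_⟩ <;>
          simp [block, when, Cmd.run, h1, h2, m0, es, et]
      · rw [if_neg h2] at et
        rw [es] at h2
        refine ⟨fun x => ?_, ?_, ?_, ?_⟩ <;>
          simp [block, when, Cmd.run, h1, h2, m0, es, et]
        split_ifs <;> simp_all
    · rw [if_neg h1] at es
      by_cases h2 : σ₀.ireg 3 < s
      · rw [if_pos h2] at et
        rw [es] at h2
        refine ⟨fun x => ?_, ?_, ?_, ?_⟩ <;>
          simp [block, when, Cmd.run, h1, h2, m0, es, et]
        split_ifs <;> simp_all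
      · rw [if_neg h2] at et
        rw [es] at h2
        refine ⟨fun x => ?_, ?_, ?_, ?_⟩ <;>
          simp [block, when, Cmd.run, h1, h2, es, et]
        split_ifs <;> simp_all
  obtain ⟨F1, F2, F3, F4⟩ := F
  have m₁ : Mem v σ₁ := m.congr (by rw [F1]; rfl) F3
  change Runs _ ((block (List.take 3 [when (.ilt (I iS) (I iR)) (.iset iS (I iS + I iN)),
    when (.ilt (I iT) (I iS)) (.iset iT (I iT + I iN)), .iset iLen 0])).run σ₀) _ _
  rw [← hσ₁]
  have g0 : σ₁.ireg 0 = n := m₁.num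
  have g1 : σ₁.ireg 1 = r := by rw [F1, er]; rfl
  have g2 : σ₁.ireg 2 = s := by rw [F1]; rfl
  have g3 : σ₁.ireg 3 = t := by rw [F1]; rfl
  have g12 : σ₁.ireg 12 = 0 := by rw [F1]; rfl
  clear hσ₁
  have st₁ : Stab n (vert v) s t ((r + n : ℤ) : ℝ) := by
    have := hst.rotate h
    push_cast at this ⊢
    exact this
  have st₂ : Stab n (vert v) t ((r + n : ℤ) : ℝ) ((s + n : ℤ) : ℝ) := by
    have := st₁.rotate h
    push_cast at this ⊢
    exact this
  have hsn : s ≤ 2 * n := by rw [es]; split_ifs <;> omega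
  have ev₁ : ∀ σ : State, σ.ireg 0 = σ₁.ireg 0 → σ.ireg 1 = σ₁.ireg 1 → σ.ireg 2 = σ₁.ireg 2 →
      σ.ireg 3 = σ₁.ireg 3 → σ.ireg 0 = n ∧ σ.ireg 1 = r ∧ σ.ireg 2 = s ∧ σ.ireg 3 = t :=
    fun σ h0 h1 h2 h3 => ⟨h0.trans g0, h1.trans g1, h2.trans g2, h3.trans g3⟩
  refine Runs.split 1 (by decide) (by decide) ?_
  have R₁ := visitRun_spec hv hst (by omega) (by omega) (re := I iR + I iN) (se := I iS)
    (te := I iT) (σ₀ := σ₁) (by decide) (by decide) (by decide) (fun σ h0 h1 h2 h3 => by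
      obtain ⟨k0, k1, k2, k3⟩ := ev₁ σ h0 h1 h2 h3
      simp [k0, k1, k2, k3]) m₁
    ⟨by omega, fun m h1 h2 => by omega, fun m h1 h2 => by omega⟩ (by omega)
  refine R₁.call (30000 * n - 100) (by omega) fun σ₂ ⟨I₂, a2, b2⟩ => ?_
  have ev₂ : ∀ σ : State, σ.ireg 0 = σ₂.ireg 0 → σ.ireg 1 = σ₂.ireg 1 → σ.ireg 2 = σ₂.ireg 2 →
      σ.ireg 3 = σ₂.ireg 3 → σ.ireg 0 = n ∧ σ.ireg 1 = r ∧ σ.ireg 2 = s ∧ σ.ireg 3 = t :=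
    fun σ h0 h1 h2 h3 => ⟨h0.trans I₂.mem.num, h1.trans (I₂.reg₁.trans g1),
      h2.trans (I₂.reg₂.trans g2), h3.trans (I₂.reg₃.trans g3)⟩
  refine Runs.split 1 (by decide) (by decide) ?_
  have R₂ := visitRun_spec hv st₁ (by omega) (by omega) (re := I iS + I iN) (se := I iT)
    (te := I iR + I iN) (σ₀ := σ₂) (by decide) (by decide) (by decide) (fun σ h0 h1 h2 h3 => by
      obtain ⟨k0, k1, k2, k3⟩ := ev₂ σ h0 h1 h2 h3
      simp [k0, k1, k2, k3]) I₂.mem I₂.vis (fun hl => by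
        have := I₂.link hl
        rwa [a2, b2] at this)
  refine R₂.call (20000 * n - 100) (by omega) fun σ₃ ⟨I₃, a3, b3⟩ => ?_
  have ev₃ : ∀ σ : State, σ.ireg 0 = σ₃.ireg 0 → σ.ireg 1 = σ₃.ireg 1 → σ.ireg 2 = σ₃.ireg 2 →
      σ.ireg 3 = σ₃.ireg 3 → σ.ireg 0 = n ∧ σ.ireg 1 = r ∧ σ.ireg 2 = s ∧ σ.ireg 3 = t :=
    fun σ h0 h1 h2 h3 => ev₂ σ (h0.trans (I₃.mem.num.trans I₂.mem.num.symm)) (h1.trans I₃.reg₁)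
      (h2.trans I₃.reg₂) (h3.trans I₃.reg₃)
  have R₃ := visitRun_spec hv st₂ (by omega) (by omega) (re := I iT + I iN) (se := I iR + I iN)
    (te := I iS + I iN) (σ₀ := σ₃) (by decide) (by decide) (by decide) (fun σ h0 h1 h2 h3 => by
      obtain ⟨k0, k1, k2, k3⟩ := ev₃ σ h0 h1 h2 h3
      simp [k0, k1, k2, k3]) I₃.mem I₃.vis (fun hl => by
        have := I₃.link hl
        rwa [a3, b3] at this)
  refine R₃.call 0 (by omega) fun σ₄ ⟨I₄, a4, b4⟩ => ?_
  have l2 := I₂.len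
  have l3 := I₃.len
  have l4 := I₄.len
  have s2 := I₂.start.resolve_right (by omega)
  have s3 := I₃.start.resolve_right (by omega)
  have s4 := I₄.start.resolve_right (by omega)
  refine ⟨I₄.mem, I₄.out.trans (I₃.out.trans (I₂.out.trans F4)), I₄.vis, by omega, ?_⟩
  intro a b c sabc
  obtain ⟨a', b', c', s', h1, h2, h3, h4, h5, h6, hP⟩ := sabc.interleave h hst
  have i1 : Inter n (vert v) r s t a' b' c' := ⟨s', h1, h2, h3, h4, h5, h6⟩
  have i2 : Inter n (vert v) s t (r + n) b' c' (a' + (n : ℤ)) :=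
    ⟨s'.rotate h, h3, h4, h5, by rw [Int.cast_add]; exact h6,
      by rw [Int.cast_add]; linarith,
      by linarith⟩
  have i3 : Inter n (vert v) t (r + n) (s + n) c' (a' + (n : ℤ)) (b' + (n : ℤ)) :=
    ⟨(s'.rotate h).rotate h, h5, i2.bt, i2.tc, by rw [Int.cast_add]; linarith,
      by rw [Int.cast_add]; linarith,
      by linarith⟩
  have v1 : VisAt σ₄ (unitOf b') (unitOf c') := by
    rcases I₂.seen a2 b2 i1 with hv | ⟨e1, e2⟩
    · exact (hv.keep I₃).keep I₄
    -- The final pair of the first run is the starting pair of the second.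
    · rw [e1, e2]; exact s3.keep I₄
  have v2 : VisAt σ₄ (unitOf c') (unitOf (a' + (n : ℤ))) := by
    rcases I₃.seen a3 b3 i2 with hv | ⟨e1, e2⟩
    · exact hv.keep I₄
    · rw [e1, e2]; exact s4
  have v3 : Seen n σ₄ (a' + (n : ℤ)) (b' + (n : ℤ)) := by
    rcases I₄.seen a4 b4 i3 with hv | ⟨e1, e2⟩
    · exact Seen.of_vis hv
    -- The final pair of the third run is the starting pair of the first one, one period later.
    · refine Seen.shift.2 (Seen.of_vis ?_)
      rw [unitOf_shift] at e1 e2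
      rw [show unitOf a' = 2 * s by omega, show unitOf b' = 2 * t by omega]
      exact (s2.keep I₃).keep I₄
  refine (hP (fun x y z => Seen n σ₄ x y ∧ Seen n σ₄ y z ∧ Seen n σ₄ z (x + (n : ℤ))) ?_).1
    ⟨Seen.shift.1 v3, Seen.of_vis v1, Seen.of_vis v2⟩
  intro x y z
  rw [Seen.shift]
  tauto

/-! ### Local tests for stability -/

/-- The polygon lies in the cone at `q` spanned by the two edges there, and the heights over these
edges are coordinates in the cone. So an affine function that does not increase along either edge is
largest at `q`, without any condition on the position of the chord. -/
theorem vertex_max_identity (a b p q r x : Point) :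
    far p q r * (far a b x - far a b q) =
      far q r x * (far a b p - far a b q) + far p q x * (far a b r - far a b q) := by
  simp only [far_eq]; ring

theorem ConvSeq.le_of_neighbours {n : ℤ} {V : ℤ → Point} (h : ConvSeq n V) {a b : Point} {i : ℤ}
    (h₁ : far a b (V (i - 1)) ≤ far a b (V i)) (h₂ : far a b (V (i + 1)) ≤ far a b (V i)) (x : ℤ) :
    far a b (V x) ≤ far a b (V i) := by
  have h3 := h.three
  have k0 := h.pos (i - 1) i (i + 1) (by omega) (by omega) (by omega)
  have k1 := h.height_nonneg_all i x
  have k2 := h.height_nonneg_all (i - 1) x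
  rw [curve_int] at k1 k2
  rw [sub_add_cancel] at k2
  have := vertex_max_identity a b (V (i - 1)) (V i) (V (i + 1)) (V x)
  have l1 := mul_nonneg k1 (sub_nonneg.2 h₁)
  have l2 := mul_nonneg k2 (sub_nonneg.2 h₂)
  by_contra hlt
  have := mul_pos k0 (sub_pos.2 (not_le.1 hlt))
  linarith

/-- Along an edge that is parallel to a chord with endpoint `b`. -/
theorem ConvSeq.le_of_edge {n : ℤ} {V : ℤ → Point} (h : ConvSeq n V) {b c : Point} {i : ℤ} {y : ℝ}
    (hb : b = curve V y) (h₁ : far b c (V (i + 1)) = far b c (V i)) (h₂ : 0 < far b c (V i))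
    (x : ℤ) : far b c (V x) ≤ far b c (V i) := by
  have h3 := h.three
  have key : ∀ x, far b c (V x) * far (V i) (V (i + 1)) b =
      far b c (V i) * (far (V i) (V (i + 1)) b - far (V i) (V (i + 1)) (V x)) := by
    intro x
    have e1 := far_four b c (V i) (V (i + 1)) (V x) b
    have e2 := far_four_sum (V i) (V (i + 1)) (V x) b
    rw [far_self_outer, h₁] at e1
    linear_combination e1 - far b c (V i) * e2
  have hB : 0 ≤ far (V i) (V (i + 1)) b := by rw [hb]; exact h.height_nonneg_all i y
  rcases hB.eq_or_lt with e | hB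
  · have := key (i + 2)
    have p := h.pos i (i + 1) (i + 2) (by omega) (by omega) (by omega)
    rw [← e] at this
    nlinarith [mul_pos h₂ p]
  · have p := h.height_nonneg_all i x
    rw [curve_int] at p
    have := key x
    have := mul_nonneg h₂.le p
    by_contra hlt
    have := mul_pos (sub_pos.2 (not_le.1 hlt)) hB
    linarith

/-- The point of the unit `g` with parameter `l`. -/
def unitPoint (V : ℤ → Point) (g : ℤ) (l : ℝ) : Point := V (g / 2) + l • ev V (g / 2)

/-- The parameter is a valid one for the unit. -/
def ValidParam (g : ℤ) (l : ℝ) : Prop := (g % 2 = 0 ∧ l = 0) ∨ (g % 2 = 1 ∧ 0 < l ∧ l < 1)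

theorem unitPoint_curve {V : ℤ → Point} {g : ℤ} {l : ℝ} (h : ValidParam g l) :
    unitPoint V g l = curve V ((g / 2 : ℤ) + l) ∧ unitOf ((g / 2 : ℤ) + l) = g := by
  have hl : 0 ≤ l ∧ l < 1 := by rcases h with ⟨_, rfl⟩ | ⟨_, h1, h2⟩ <;> constructor <;> linarith
  constructor
  · rw [curve_on V (g / 2) _ (by linarith) (by linarith), unitPoint, ev]
    ext i
    simp only [PiLp.add_apply, PiLp.smul_apply, PiLp.sub_apply, smul_eq_mul]
    ring
  · rcases h with ⟨h0, rfl⟩ | ⟨h0, h1, h2⟩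
    · rw [add_zero, unitOf_int]; omega
    · have k1 : g ≤ unitOf (((g / 2 : ℤ) : ℝ) + l) := by
        have := odd_le_unitOf (x := ((g / 2 : ℤ) : ℝ) + l) (i := g / 2)
        have := this.2 (by linarith)
        omega
      have k2 : ¬ 2 * (g / 2 + 1) ≤ unitOf (((g / 2 : ℤ) : ℝ) + l) := by
        rw [even_le_unitOf]
        push_cast
        linarith
      omega

theorem exists_param (V : ℤ → Point) (x : ℝ) :
    ∃ l, ValidParam (unitOf x) l ∧ unitPoint V (unitOf x) l = curve V x ∧
      x = (unitOf x / 2 : ℤ) + l := by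
  have key : ∃ l, ValidParam (unitOf x) l ∧ x = (unitOf x / 2 : ℤ) + l := by
    rcases Int.emod_two_eq_zero_or_one (unitOf x) with h | h
    · have := unitOf_even (x := x) (i := unitOf x / 2) (by omega)
      exact ⟨0, .inl ⟨h, rfl⟩, by rw [add_zero]; exact this⟩
    · obtain ⟨h1, h2⟩ := unitOf_odd (x := x) (i := unitOf x / 2) (by omega)
      exact ⟨x - (unitOf x / 2 : ℤ), .inr ⟨h, by linarith, by linarith⟩, by ring⟩
  obtain ⟨l, h1, h2⟩ := key
  refine ⟨l, h1, ?_, h2⟩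
  rw [(unitPoint_curve h1).1, ← h2]

theorem far_unitPoint (V : ℤ → Point) (a b : Point) (g : ℤ) (l : ℝ) :
    far a b (unitPoint V g l) = far a b (V (g / 2)) +
      l * (far a b (V (g / 2 + 1)) - far a b (V (g / 2))) := by
  simp only [unitPoint, ev, far_eq, PiLp.add_apply, PiLp.smul_apply, PiLp.sub_apply, smul_eq_mul]
  ring

/-- The test for one corner. -/
def CornerOK (V : ℤ → Point) (g : ℤ) (A B C : Point) : Prop :=
  0 < far B C A ∧ far B C (V ((g - 1) / 2)) ≤ far B C A ∧ far B C (V ((g + 2) / 2)) ≤ far B C A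

/-- At a vertex the tests are those of `le_of_neighbours`. Inside an edge the value is a proper mean
of the values at the ends, so the two tests force equality, the edge is parallel to `BC`, and
`le_of_edge` applies. -/
theorem cornerOK_iff {n : ℤ} {V : ℤ → Point} (h : ConvSeq n V) {g : ℤ} {l : ℝ}
    (hl : ValidParam g l) {B C : Point} {y : ℝ} (hB : B = curve V y) :
    CornerOK V g (unitPoint V g l) B C ↔ 0 < far B C (unitPoint V g l) ∧
      ∀ x, far B C (V x) ≤ far B C (unitPoint V g l) := by
  constructor
  · rintro ⟨h0, h1, h2⟩
    refine ⟨h0, fun x => ?_⟩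
    rcases hl with ⟨he, rfl⟩ | ⟨ho, l0, l1⟩
    · have e : unitPoint V g 0 = V (g / 2) := by simp [unitPoint]
      rw [e] at h0 h1 h2 ⊢
      rw [show (g - 1) / 2 = g / 2 - 1 by omega] at h1
      rw [show (g + 2) / 2 = g / 2 + 1 by omega] at h2
      exact h.le_of_neighbours h1 h2 x
    · rw [show (g - 1) / 2 = g / 2 by omega] at h1
      rw [show (g + 2) / 2 = g / 2 + 1 by omega] at h2
      have e := far_unitPoint V B C g l
      have e1 : far B C (V (g / 2 + 1)) = far B C (V (g / 2)) := by nlinarith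
      rw [e1, sub_self, mul_zero, add_zero] at e
      rw [e] at h0 ⊢
      exact h.le_of_edge hB e1 h0 x
  · rintro ⟨h0, h1⟩
    exact ⟨h0, h1 _, h1 _⟩

theorem edge_eq_of_max {V : ℤ → Point} {g : ℤ} {l : ℝ} {B C : Point} (ho : g % 2 = 1)
    (hl : ValidParam g l) (hm : ∀ x, far B C (V x) ≤ far B C (unitPoint V g l)) :
    far B C (V (g / 2 + 1)) = far B C (V (g / 2)) ∧
      far B C (unitPoint V g l) = far B C (V (g / 2)) := by
  rcases hl with ⟨he, _⟩ | ⟨_, l0, l1⟩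
  · omega
  have h1 := hm (g / 2)
  have h2 := hm (g / 2 + 1)
  have e := far_unitPoint V B C g l
  have e1 : far B C (V (g / 2 + 1)) = far B C (V (g / 2)) := by nlinarith
  rw [e1, sub_self, mul_zero, add_zero] at e
  exact ⟨e1, e⟩

theorem allStable_iff {n : ℕ} {v : Fin n → Point} (h : ConvSeq n (vert v)) {x y z : ℝ} {A B C : Point}
    (hA : A = curve (vert v) x) (hB : B = curve (vert v) y) (hC : C = curve (vert v) z) :
    AllStable v A B C ↔ 0 < far A B C ∧ (∀ i, far B C (vert v i) ≤ far B C A) ∧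
      (∀ i, far C A (vert v i) ≤ far C A B) ∧ (∀ i, far A B (vert v i) ≤ far A B C) := by
  have hn : 0 < n := by have := h.three; omega
  have r1 := far_rotate A B C
  have r2 := far_rotate B C A
  constructor
  · intro s
    have hp : 0 < far A B C := by
      have := s.clockwise
      rw [far_eq_neg_orient]; linarith
    exact ⟨hp, (cornerStable_iff hn (by linarith)).1 s.stable₁,
      (cornerStable_iff hn (by linarith)).1 s.stable₂, (cornerStable_iff hn hp).1 s.stable₃⟩
  · rintro ⟨hp, h1, h2, h3⟩
    refine ⟨(mem_boundary h).2 ⟨x, hA⟩, (mem_boundary h).2 ⟨y, hB⟩, (mem_boundary h).2 ⟨z, hC⟩,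
      ?_, (cornerStable_iff hn (by linarith)).2 h1, (cornerStable_iff hn (by linarith)).2 h2,
      (cornerStable_iff hn hp).2 h3⟩
    rw [far_eq_neg_orient] at hp; linarith

theorem tests_iff {n : ℕ} {v : Fin n → Point} (h : ConvSeq n (vert v)) {g₁ g₂ g₃ : ℤ} {l₁ l₂ l₃ : ℝ}
    (h₁ : ValidParam g₁ l₁) (h₂ : ValidParam g₂ l₂) (h₃ : ValidParam g₃ l₃) {A B C : Point}
    (hA : A = unitPoint (vert v) g₁ l₁) (hB : B = unitPoint (vert v) g₂ l₂)
    (hC : C = unitPoint (vert v) g₃ l₃) :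
    (CornerOK (vert v) g₁ A B C ∧ CornerOK (vert v) g₂ B C A ∧ CornerOK (vert v) g₃ C A B) ↔
      AllStable v A B C := by
  have cA := hA.trans (unitPoint_curve h₁).1
  have cB := hB.trans (unitPoint_curve h₂).1
  have cC := hC.trans (unitPoint_curve h₃).1
  have r1 := far_rotate A B C
  have r2 := far_rotate B C A
  rw [allStable_iff h cA cB cC]
  have t1 := cornerOK_iff h h₁ (C := C) cB
  have t2 := cornerOK_iff h h₂ (C := A) cC
  have t3 := cornerOK_iff h h₃ (C := B) cA
  rw [← hA] at t1
  rw [← hB] at t2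
  rw [← hC] at t3
  rw [t1, t2, t3, ← r2, ← r1]
  tauto

theorem curve_mem_range_iff {n : ℕ} {v : Fin n → Point} (h : ConvSeq n (vert v)) {x : ℝ}
    (hx : curve (vert v) x ∈ Set.range v) : unitOf x % 2 = 0 := by
  obtain ⟨i, hi⟩ := hx
  rw [← vert_val v] at hi
  obtain ⟨z, hz⟩ := curve_eq_int h hi.symm
  rw [hz, unitOf_int]; omega

theorem not_mem_edge {n : ℕ} {v : Fin n → Point} (h : ConvSeq n (vert v)) {x : ℝ} {i : Fin n}
    (hx : curve (vert v) x ∈ edge v i) : unitOf x % 2 = 1 := by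
  obtain ⟨z, h1, h2⟩ := mem_edge h hx
  have k1 := (odd_le_unitOf (x := x) (i := i.val + z * n)).2 (by push_cast at *; exact h1)
  have k2 : ¬ 2 * ((i.val : ℤ) + z * n + 1) ≤ unitOf x := by
    rw [even_le_unitOf]; push_cast at *; linarith
  omega

/-! ### Representatives -/

/-- The lines that bound the region of the points `A` for which the vertices `j`, `k` are stable. -/
def Cand (j k p q : ℤ) (e : ℝ) : Prop :=
  (p = j ∧ q = k - 1 ∧ e = -1) ∨ (p = j ∧ q = k ∧ e = 1) ∨ (p = k ∧ q = j - 1 ∧ e = 1) ∨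
    (p = k ∧ q = j ∧ e = -1)

theorem far_step_det (V : ℤ → Point) (a b : Point) (q : ℤ) :
    far a b (V (q + 1)) - far a b (V q) = -det (ev V q) (a - b) := by
  simp only [far_eq, ev, det, PiLp.sub_apply]; ring

theorem det_unitPoint (V : ℤ → Point) (p q g : ℤ) (t : ℝ) :
    det (ev V q) (unitPoint V g t - V p) =
      det (ev V q) (V (g / 2) - V p) + t * det (ev V q) (ev V (g / 2)) := by
  simp only [unitPoint, ev, det, PiLp.sub_apply, PiLp.add_apply, PiLp.smul_apply, smul_eq_mul]; ring

theorem det_neg_sub (a x y : Point) : det a (x - y) = -det a (y - x) := by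
  simp only [det, PiLp.sub_apply]; ring

theorem cand_nonneg {V : ℤ → Point} {A : Point} {j k : ℤ}
    (h₂ : ∀ i, far (V k) A (V i) ≤ far (V k) A (V j))
    (h₃ : ∀ i, far A (V j) (V i) ≤ far A (V j) (V k)) {p q : ℤ} {e : ℝ} (hc : Cand j k p q e) :
    0 ≤ e * det (ev V q) (A - V p) := by
  rcases hc with ⟨rfl, rfl, rfl⟩ | ⟨rfl, rfl, rfl⟩ | ⟨rfl, rfl, rfl⟩ | ⟨rfl, rfl, rfl⟩
  · have := far_step_det V A (V p) (k - 1)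
    rw [sub_add_cancel] at this
    linarith [h₃ (k - 1)]
  · have := far_step_det V A (V p) q
    linarith [h₃ (q + 1)]
  · have := far_step_det V (V p) A (j - 1)
    rw [sub_add_cancel, det_neg_sub] at this
    linarith [h₂ (j - 1)]
  · have := far_step_det V (V p) A q
    rw [det_neg_sub] at this
    linarith [h₂ (q + 1)]

/-- Moving `A` along its edge keeps the distance to the opposite side. The four inequalities say
that the neighbours of `j` and of `k` are not farther than these, which is all that stability of the
two vertices requires. -/
theorem allStable_of_cand {n : ℕ} {v : Fin n → Point} (h : ConvSeq n (vert v)) {A A' : Point}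
    {j k : ℤ} {x x' : ℝ} (hA : A = curve (vert v) x) (hA' : A' = curve (vert v) x')
    (st : AllStable v A (vert v j) (vert v k))
    (he : far (vert v j) (vert v k) A' = far (vert v j) (vert v k) A)
    (hc : ∀ p q e, Cand j k p q e → 0 ≤ e * det (ev (vert v) q) (A' - vert v p)) :
    AllStable v A' (vert v j) (vert v k) := by
  have hj := (curve_int (vert v) j).symm
  have hk := (curve_int (vert v) k).symm
  rw [allStable_iff h hA hj hk] at st
  rw [allStable_iff h hA' hj hk]
  obtain ⟨h0, h1, h2, h3⟩ := st
  refine ⟨?_, ?_, ?_, ?_⟩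
  · rw [far_rotate] at h0 ⊢; linarith
  · rw [he]; exact h1
  · refine h.le_of_neighbours ?_ ?_
    · have := hc k (j - 1) 1 (by simp [Cand])
      have := far_step_det (vert v) (vert v k) A' (j - 1)
      rw [sub_add_cancel, det_neg_sub] at this
      linarith
    · have := hc k j (-1) (by simp [Cand])
      have := far_step_det (vert v) (vert v k) A' j
      rw [det_neg_sub] at this
      linarith
  · refine h.le_of_neighbours ?_ ?_
    · have := hc j (k - 1) (-1) (by simp [Cand])
      have := far_step_det (vert v) A' (vert v j) (k - 1)
      rw [sub_add_cancel] at this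
      linarith
    · have := hc j k 1 (by simp [Cand])
      have := far_step_det (vert v) A' (vert v j) k
      linarith

theorem edge_eq_unit {n : ℕ} {v : Fin n → Point} (h : ConvSeq n (vert v)) {g : ℤ} {l : ℝ}
    (hl : ValidParam g l) {i : Fin n} (hi : unitPoint (vert v) g l ∈ edge v i) :
    edge v i = {X | ∃ t, 0 < t ∧ t < 1 ∧ X = unitPoint (vert v) g t} := by
  obtain ⟨e1, e2⟩ := unitPoint_curve (V := vert v) hl
  rw [e1] at hi
  have ho := not_mem_edge h hi
  rw [e2] at ho
  obtain ⟨z, z1, z2⟩ := mem_edge h hi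
  have hz : g / 2 = i.val + z * n := by
    rcases hl with ⟨h0, _⟩ | ⟨_, l0, l1⟩
    · omega
    · have k1 : (i.val + z * n : ℤ) < g / 2 + 1 := by
        have : ((i.val + z * n : ℤ) : ℝ) < ((g / 2 + 1 : ℤ) : ℝ) := by push_cast at *; linarith
        exact_mod_cast this
      have k2 : g / 2 < (i.val + z * n : ℤ) + 1 := by
        have : ((g / 2 : ℤ) : ℝ) < ((i.val + z * n + 1 : ℤ) : ℝ) := by push_cast at *; linarith
        exact_mod_cast this
      omega
  have v1 : vert v (g / 2) = v i := by rw [hz, h.per_mul, vert_val]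
  have v2 : vert v (g / 2 + 1) = v (nextIdx i) := by
    rw [hz, show (i.val : ℤ) + z * n + 1 = i.val + 1 + z * n by ring, h.per_mul, vert_next]
  have pt : ∀ s t : ℝ, s + t = 1 → s • v i + t • v (nextIdx i) = unitPoint (vert v) g t := by
    intro s t hst
    obtain rfl : s = 1 - t := by linarith
    rw [unitPoint, ev, v1, v2]
    ext k
    simp only [PiLp.add_apply, PiLp.smul_apply, PiLp.sub_apply, smul_eq_mul]
    ring
  ext X
  constructor
  · rintro ⟨s, t, hs, ht, hst, rfl⟩
    exact ⟨t, ht, by linarith, pt s t hst⟩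
  · rintro ⟨t, ht, ht', rfl⟩
    exact ⟨1 - t, t, by linarith, ht, by ring, pt _ _ (by ring)⟩

/-- An affine function that is nonnegative on the stable positions in the edge, vanishes at `A` and
is not constant along the edge exhibits `A` as an extreme point. -/
theorem representative_of_line {n : ℕ} {v : Fin n → Point} (h : ConvSeq n (vert v)) {g j k p q : ℤ}
    {l e : ℝ} (hl : ValidParam g l) (st : AllStable v (unitPoint (vert v) g l) (vert v j) (vert v k))
    (hc : Cand j k p q e) (hd : det (ev (vert v) q) (ev (vert v) (g / 2)) ≠ 0)
    (hz : det (ev (vert v) q) (unitPoint (vert v) g l - vert v p) = 0) :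
    Representative v (unitPoint (vert v) g l) (vert v j) (vert v k) := by
  intro i hA _ _
  have he := edge_eq_unit h hl hA
  refine ⟨⟨hA, st⟩, ?_⟩
  rintro X₁ ⟨m₁, s₁⟩ X₂ ⟨m₂, s₂⟩ ⟨a, b, ha, hb, hab, hX⟩
  have nn : ∀ X ∈ edge v i, AllStable v X (vert v j) (vert v k) →
      0 ≤ e * det (ev (vert v) q) (X - vert v p) := by
    intro X hX hs
    rw [he] at hX
    obtain ⟨t, t0, t1, rfl⟩ := hX
    have ho : g % 2 = 1 := by
      rw [(unitPoint_curve hl).1] at hA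
      have := not_mem_edge h hA
      rwa [(unitPoint_curve (V := vert v) hl).2] at this
    have cX := (unitPoint_curve (V := vert v) (g := g) (l := t) (.inr ⟨ho, t0, t1⟩)).1
    obtain ⟨_, _, h2, h3⟩ := (allStable_iff h cX (curve_int (vert v) j).symm
      (curve_int (vert v) k).symm).1 hs
    exact cand_nonneg h2 h3 hc
  have n1 := nn _ m₁ s₁
  have n2 := nn _ m₂ s₂
  rw [← hX] at hz
  have e1 : det (ev (vert v) q) (a • X₁ + b • X₂ - vert v p) =
      a * det (ev (vert v) q) (X₁ - vert v p) + b * det (ev (vert v) q) (X₂ - vert v p) := by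
    obtain rfl : a = 1 - b := by linarith
    simp only [det, PiLp.sub_apply, PiLp.add_apply, PiLp.smul_apply, smul_eq_mul]; ring
  rw [e1] at hz
  have z1 : det (ev (vert v) q) (X₁ - vert v p) = 0 := by
    have k1 := mul_nonneg ha.le n1
    have k2 := mul_nonneg hb.le n2
    have k3 : a * (e * det (ev (vert v) q) (X₁ - vert v p)) = 0 := by
      have : a * (e * det (ev (vert v) q) (X₁ - vert v p)) +
        b * (e * det (ev (vert v) q) (X₂ - vert v p)) = 0 := by linear_combination e * hz
      linarith
    have he0 : e ≠ 0 := by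
      rcases hc with ⟨_, _, rfl⟩ | ⟨_, _, rfl⟩ | ⟨_, _, rfl⟩ | ⟨_, _, rfl⟩ <;> norm_num
    rcases mul_eq_zero.1 k3 with h | h
    · exact absurd h ha.ne'
    · exact (mul_eq_zero.1 h).resolve_left he0
  rw [← e1, hX] at hz
  rw [he] at m₁
  obtain ⟨t, t0, t1, rfl⟩ := m₁
  rw [det_unitPoint] at z1 hz
  have : t = l := by
    have : (t - l) * det (ev (vert v) q) (ev (vert v) (g / 2)) = 0 := by linear_combination z1 - hz
    rcases mul_eq_zero.1 this with h | h
    · linarith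
    · exact absurd h hd
  rw [this]

theorem unitPoint_injective {n : ℤ} {V : ℤ → Point} (h : ConvSeq n V) {g : ℤ} {s t : ℝ}
    (e : unitPoint V g s = unitPoint V g t) : s = t := by
  have h3 := h.three
  have p := h.pos (g / 2 - 1) (g / 2) (g / 2 + 1) (by omega) (by omega) (by omega)
  have e1 := far_unitPoint V (V (g / 2 - 1)) (V (g / 2)) g s
  have e2 := far_unitPoint V (V (g / 2 - 1)) (V (g / 2)) g t
  rw [far_self_right, sub_zero, zero_add] at e1 e2
  rw [e] at e1
  exact mul_right_cancel₀ p.ne' (e1.symm.trans e2)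

/-- If no transverse line passes through `A`, each of the four inequalities is strict at `A` or
constant along the edge. All of them then persist in a neighbourhood, and `A` is the midpoint of two
stable positions. -/
theorem exists_line_of_representative {n : ℕ} {v : Fin n → Point} (h : ConvSeq n (vert v))
    {g j k : ℤ} {l : ℝ} (hl : ValidParam g l) (ho : g % 2 = 1)
    (st : AllStable v (unitPoint (vert v) g l) (vert v j) (vert v k))
    (hr : Representative v (unitPoint (vert v) g l) (vert v j) (vert v k)) :
    ∃ p q e, Cand j k p q e ∧ det (ev (vert v) q) (ev (vert v) (g / 2)) ≠ 0 ∧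
      det (ev (vert v) q) (unitPoint (vert v) g l - vert v p) = 0 := by
  by_contra hno
  push Not at hno
  have hn : 0 < n := by have := h.three; omega
  have l01 : 0 < l ∧ l < 1 := by
    rcases hl with ⟨h0, _⟩ | ⟨_, h1⟩
    · omega
    · exact h1
  have hc := (unitPoint_curve (V := vert v) hl).1
  obtain ⟨hp, h1, h2, h3⟩ := (allStable_iff h hc (curve_int (vert v) j).symm
    (curve_int (vert v) k).symm).1 st
  have ev1 : ∀ p q e, Cand j k p q e → ∀ᶠ t in nhds l,
      0 ≤ e * det (ev (vert v) q) (unitPoint (vert v) g t - vert v p) := by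
    intro p q e hcand
    have n0 := cand_nonneg h2 h3 hcand
    simp only [det_unitPoint] at n0 hno ⊢
    by_cases hd : det (ev (vert v) q) (ev (vert v) (g / 2)) = 0
    · simp only [hd, mul_zero, add_zero] at n0 ⊢
      exact Filter.Eventually.of_forall fun _ => n0
    · have h0 := hno p q e hcand hd
      have he0 : e ≠ 0 := by
        rcases hcand with ⟨_, _, rfl⟩ | ⟨_, _, rfl⟩ | ⟨_, _, rfl⟩ | ⟨_, _, rfl⟩ <;> norm_num
      have hpos := lt_of_le_of_ne n0 (mul_ne_zero he0 h0).symm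
      have cont : Continuous fun t : ℝ => e * (det (ev (vert v) q) (vert v (g / 2) - vert v p) +
        t * det (ev (vert v) q) (ev (vert v) (g / 2))) := by fun_prop
      exact (cont.continuousAt.eventually (lt_mem_nhds hpos)).mono fun _ => le_of_lt
  have ev2 : ∀ᶠ t in nhds l, 0 < t ∧ t < 1 ∧
      ∀ p q e, Cand j k p q e → 0 ≤ e * det (ev (vert v) q) (unitPoint (vert v) g t - vert v p) := by
    filter_upwards [lt_mem_nhds l01.1, gt_mem_nhds l01.2, ev1 j (k - 1) (-1) (by simp [Cand]),
      ev1 j k 1 (by simp [Cand]), ev1 k (j - 1) 1 (by simp [Cand]),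
      ev1 k j (-1) (by simp [Cand])] with t t0 t1 a1 a2 a3 a4
    refine ⟨t0, t1, ?_⟩
    rintro p q e (⟨rfl, rfl, rfl⟩ | ⟨rfl, rfl, rfl⟩ | ⟨rfl, rfl, rfl⟩ | ⟨rfl, rfl, rfl⟩) <;>
      assumption
  obtain ⟨d, d0, hd⟩ := Metric.eventually_nhds_iff.1 ev2
  obtain ⟨i, hi⟩ : ∃ i, unitPoint (vert v) g l ∈ edge v i := by
    obtain ⟨z, z1, z2⟩ := ConvSeq.exists_lift (n := n) (by omega) (g / 2) 0
    refine ⟨⟨(g / 2 + z * n).toNat, by omega⟩, 1 - l, l, by linarith, by linarith, by ring, ?_⟩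
    rw [← vert_val v, ← vert_next (v := v)]
    simp only
    rw [Int.toNat_of_nonneg z1, h.per_mul, show g / 2 + z * n + 1 = g / 2 + 1 + z * n by ring,
      h.per_mul, unitPoint, ev]
    ext k
    simp only [PiLp.add_apply, PiLp.smul_apply, PiLp.sub_apply, smul_eq_mul]
    ring
  have hB : vert v j ∈ Set.range v := by
    obtain ⟨x, hx⟩ := exists_vert (v := v) hn j
    exact ⟨x, hx.symm⟩
  have hC : vert v k ∈ Set.range v := by
    obtain ⟨x, hx⟩ := exists_vert (v := v) hn k
    exact ⟨x, hx.symm⟩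
  have ext := hr i hi hB hC
  have he := edge_eq_unit h hl hi
  have mem : ∀ t, Dist.dist t l < d → unitPoint (vert v) g t ∈
      {A' ∈ edge v i | AllStable v A' (vert v j) (vert v k)} := by
    intro t ht
    obtain ⟨t0, t1, hc'⟩ := hd ht
    refine ⟨by rw [he]; exact ⟨t, t0, t1, rfl⟩, ?_⟩
    refine allStable_of_cand h hc (unitPoint_curve (.inr ⟨ho, t0, t1⟩)).1 st ?_ hc'
    obtain ⟨e1, e2⟩ := edge_eq_of_max ho hl h1
    rw [far_unitPoint, far_unitPoint, e1]
    ring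
  have := ext.2 (mem (l - d / 2) (by rw [Real.dist_eq, abs_of_neg] <;> linarith))
    (mem (l + d / 2) (by rw [Real.dist_eq, abs_of_pos] <;> linarith))
    ⟨1 / 2, 1 / 2, by norm_num, by norm_num, by norm_num, by
      ext k
      simp only [unitPoint, PiLp.add_apply, PiLp.smul_apply, smul_eq_mul]
      ring⟩
  have := unitPoint_injective h this
  linarith

theorem representative_of_not_range {n : ℕ} {v : Fin n → Point} {A B C : Point}
    (hB : B ∉ Set.range v ∨ C ∉ Set.range v) : Representative v A B C := by
  intro i _ h1 h2
  tauto

theorem representative_of_vertex {n : ℕ} {v : Fin n → Point} (h : ConvSeq n (vert v)) {A B C : Point}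
    {i : ℤ} (hA : A = vert v i) : Representative v A B C := by
  intro k hi
  rw [hA, ← curve_int (vert v) i] at hi
  have := not_mem_edge h hi
  rw [unitOf_int] at this
  omega

/-! ### The gadget -/

/-- The coordinates of a generally 3-stable triangle. -/
def IsGenOut {n : ℕ} (v : Fin n → Point) (T : OutTri) : Prop :=
  ∃ A B C : Point, GenThreeStable v A B C ∧ T = coords A B C

/-- The program has only extended the output, correctly, and changed real registers from 6 on. -/
structure Emits {n : ℕ} (v : Fin n → Point) (σ σ' : State) : Prop where
  ireg : σ'.ireg = σ.ireg
  iarr : σ'.iarr = σ.iarr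
  rarr : σ'.rarr = σ.rarr
  rreg : ∀ x, x < 6 → σ'.rreg x = σ.rreg x
  keep : ∀ T ∈ σ.out, T ∈ σ'.out
  sound : ∀ T ∈ σ'.out, T ∈ σ.out ∨ IsGenOut v T

theorem Emits.trans {n : ℕ} {v : Fin n → Point} {σ σ' σ'' : State} (h : Emits v σ σ')
    (h' : Emits v σ' σ'') : Emits v σ σ'' :=
  ⟨h'.ireg.trans h.ireg, h'.iarr.trans h.iarr, h'.rarr.trans h.rarr,
    fun x hx => (h'.rreg x hx).trans (h.rreg x hx), fun T hT => h'.keep T (h.keep T hT),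
    fun T hT => (h'.sound T hT).elim (h.sound T) .inr⟩

theorem Emits.refl {n : ℕ} (v : Fin n → Point) (σ : State) : Emits v σ σ :=
  ⟨rfl, rfl, rfl, fun _ _ => rfl, fun _ h => h, fun _ h => .inl h⟩

theorem Emits.rset {n : ℕ} (v : Fin n → Point) (σ : State) {x : ℕ} (hx : 6 ≤ x) (z : ℝ) :
    Emits v σ (σ.rset x z) :=
  ⟨rfl, rfl, rfl, fun y hy => by rw [State.rset_rreg, if_neg (by omega)], fun _ h => h,
    fun _ h => .inl h⟩

namespace Mem
variable {n : ℕ} {v : Fin n → Point} {σ : State}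

theorem rset (m : Mem v σ) (x : ℕ) (z : ℝ) : Mem v (σ.rset x z) := m.congr rfl rfl

theorem emits (m : Mem v σ) {σ' : State} (h : Emits v σ σ') : Mem v σ' :=
  m.congr (by rw [h.ireg]) h.rarr

theorem eval_vtx (hn : 0 < n) (m : Mem v σ) (i : IExp) :
    (vtx i).1.eval σ = vert v (i.eval σ) 0 ∧ (vtx i).2.eval σ = vert v (i.eval σ) 1 := by
  rw [← m.point_vtx hn]; exact ⟨rfl, rfl⟩

theorem eval_corner (hn : 0 < n) (m : Mem v σ) (g : IExp) (l : RExp) :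
    (corner g l).1.eval σ = unitPoint (vert v) (g.eval σ) (l.eval σ) 0 ∧
      (corner g l).2.eval σ = unitPoint (vert v) (g.eval σ) (l.eval σ) 1 := by
  have e1 : (evec (g / 2)).1.eval σ = ev (vert v) (g.eval σ / 2) 0 := by
    have := m.point_evec hn (g / 2)
    exact congrArg (fun p : Point => p 0) this
  have e2 : (evec (g / 2)).2.eval σ = ev (vert v) (g.eval σ / 2) 1 := by
    have := m.point_evec hn (g / 2)
    exact congrArg (fun p : Point => p 1) this
  simp [corner, e1, e2, (m.eval_vtx hn (g / 2)).1, (m.eval_vtx hn (g / 2)).2, unitPoint]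

theorem eval_cornerTest (hn : 0 < n) (m : Mem v σ) (g : IExp) {a b c : PExp} {A B C : Point}
    (hA : a.point σ = A) (hB : b.point σ = B) (hC : c.point σ = C) :
    (cornerTest g a b c).eval σ ↔ CornerOK (vert v) (g.eval σ) A B C := by
  simp only [cornerTest, BExp.eval_and, BExp.eval_rlt, eval_rle, eval_pdist, m.point_vtx hn, hA, hB,
    hC, RExp.eval_zero, CornerOK, IExp.eval_div, IExp.eval_sub, IExp.eval_add, IExp.eval_one,
    IExp.eval_two]

end Mem

theorem eval_inUnit {σ : State} {g : IExp} {l : RExp} {G : ℤ} {L : ℝ} (hg : g.eval σ = G)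
    (hl : l.eval σ = L) (hz : G % 2 = 0 → L = 0) : (inUnit g l).eval σ ↔ ValidParam G L := by
  simp only [inUnit, BExp.eval_or, eval_even, BExp.eval_and, BExp.eval_rlt, RExp.eval_zero,
    RExp.eval_one, hg, hl, ValidParam]
  have : G % 2 = 0 ∨ G % 2 = 1 := by omega
  constructor
  · rintro (h | h)
    · exact .inl ⟨h, hz h⟩
    · rcases this with h0 | h0
      · exact .inl ⟨h0, hz h0⟩
      · exact .inr ⟨h0, h⟩
  · rintro (h | h)
    · exact .inl h.1
    · exact .inr h.2

open Classical in
theorem report_run {n : ℕ} {v : Fin n → Point} (h : ConvSeq n (vert v)) {σ : State} (m : Mem v σ)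
    {g₁ g₂ g₃ : ℤ} {l₁ l₂ l₃ : ℝ} (e₁ : σ.ireg 22 = g₁) (e₂ : σ.ireg 23 = g₂) (e₃ : σ.ireg 24 = g₃)
    (f₁ : σ.rreg 6 = l₁) (f₂ : σ.rreg 7 = l₂) (f₃ : σ.rreg 8 = l₃)
    (z₁ : g₁ % 2 = 0 → l₁ = 0) (z₂ : g₂ % 2 = 0 → l₂ = 0) (z₃ : g₃ % 2 = 0 → l₃ = 0)
    {A B C : Point} (hA : A = unitPoint (vert v) g₁ l₁) (hB : B = unitPoint (vert v) g₂ l₂)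
    (hC : C = unitPoint (vert v) g₃ l₃) :
    (report.run σ).ireg = σ.ireg ∧ (report.run σ).iarr = σ.iarr ∧ (report.run σ).rarr = σ.rarr ∧
    (∀ x, x < 9 → (report.run σ).rreg x = σ.rreg x) ∧
    (report.run σ).out = σ.out ++ if ValidParam g₁ l₁ ∧ ValidParam g₂ l₂ ∧ ValidParam g₃ l₃ ∧
      AllStable v A B C then [coords A B C] else [] := by
  have hn : 0 < n := by have := h.three; omega
  obtain ⟨σ', hσ'⟩ : ∃ σ', σ' = (((((σ.rset 9 (A 0)).rset 10 (A 1)).rset 11 (B 0)).rset 12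
    (B 1)).rset 13 (C 0)).rset 14 (C 1) := ⟨_, rfl⟩
  have hrun : report.run σ = Cmd.run (when (.and (inUnit (I iG₁) (R rL₁)) (.and (inUnit (I iG₂)
      (R rL₂)) (.and (inUnit (I iG₃) (R rL₃))
      (.and (cornerTest (I iG₁) (R rX₁, R rY₁) (R rX₂, R rY₂) (R rX₃, R rY₃))
        (.and (cornerTest (I iG₂) (R rX₂, R rY₂) (R rX₃, R rY₃) (R rX₁, R rY₁))
          (cornerTest (I iG₃) (R rX₃, R rY₃) (R rX₁, R rY₁) (R rX₂, R rY₂)))))))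
    (.emit (R rX₁) (R rY₁) (R rX₂) (R rY₂) (R rX₃) (R rY₃))) σ' := by
    have m1 := m.rset 9 (A 0)
    have m2 := m1.rset 10 (A 1)
    have m3 := m2.rset 11 (B 0)
    have m4 := m3.rset 12 (B 1)
    have m5 := m4.rset 13 (C 0)
    have k1 : (corner (I iG₁) (R rL₁)).1.eval σ = A 0 := by
      rw [(m.eval_corner hn _ _).1, hA]; simp [e₁, f₁]
    have k2 : (corner (I iG₁) (R rL₁)).2.eval (σ.rset 9 (A 0)) = A 1 := by
      rw [(m1.eval_corner hn _ _).2, hA]; simp [e₁, f₁]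
    have k3 : (corner (I iG₂) (R rL₂)).1.eval ((σ.rset 9 (A 0)).rset 10 (A 1)) = B 0 := by
      rw [(m2.eval_corner hn _ _).1, hB]; simp [e₂, f₂]
    have k4 : (corner (I iG₂) (R rL₂)).2.eval (((σ.rset 9 (A 0)).rset 10 (A 1)).rset 11 (B 0)) =
        B 1 := by
      rw [(m3.eval_corner hn _ _).2, hB]; simp [e₂, f₂]
    have k5 : (corner (I iG₃) (R rL₃)).1.eval ((((σ.rset 9 (A 0)).rset 10 (A 1)).rset 11
        (B 0)).rset 12 (B 1)) = C 0 := by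
      rw [(m4.eval_corner hn _ _).1, hC]; simp [e₃, f₃]
    have k6 : (corner (I iG₃) (R rL₃)).2.eval (((((σ.rset 9 (A 0)).rset 10 (A 1)).rset 11
        (B 0)).rset 12 (B 1)).rset 13 (C 0)) = C 1 := by
      rw [(m5.eval_corner hn _ _).2, hC]; simp [e₃, f₃]
    simp only [report, block, Cmd.run, rX₁, rX₂, rX₃, rY₁, rY₂, rY₃, k1, k2, k3, k4, k5, k6]
    rw [hσ']
  have m' : Mem v σ' := m.congr (by rw [hσ']; rfl) (by rw [hσ']; rfl)
  have pt : ∀ (X : Point) (x y : ℕ), σ'.rreg x = X 0 → σ'.rreg y = X 1 →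
      PExp.point σ' (R x, R y) = X := by
    intro X x y hx hy
    ext i
    fin_cases i <;> simp [PExp.point, hx, hy]
  have pA : PExp.point σ' (R rX₁, R rY₁) = A := by apply pt <;> simp [hσ']
  have pB : PExp.point σ' (R rX₂, R rY₂) = B := by apply pt <;> simp [hσ']
  have pC : PExp.point σ' (R rX₃, R rY₃) = C := by apply pt <;> simp [hσ']
  have i' : σ'.ireg = σ.ireg := by rw [hσ']; rfl
  have r' : ∀ x, x < 9 → σ'.rreg x = σ.rreg x := by
    intro x hx
    have : x ≠ 9 ∧ x ≠ 10 ∧ x ≠ 11 ∧ x ≠ 12 ∧ x ≠ 13 ∧ x ≠ 14 := by omega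
    simp [hσ', this]
  have j1 : (I iG₁).eval σ' = g₁ := by simp [i', e₁]
  have j2 : (I iG₂).eval σ' = g₂ := by simp [i', e₂]
  have j3 : (I iG₃).eval σ' = g₃ := by simp [i', e₃]
  have u1 := eval_inUnit (σ := σ') (g := I iG₁) (l := R rL₁) j1 ((r' 6 (by norm_num)).trans f₁) z₁
  have u2 := eval_inUnit (σ := σ') (g := I iG₂) (l := R rL₂) j2 ((r' 7 (by norm_num)).trans f₂) z₂
  have u3 := eval_inUnit (σ := σ') (g := I iG₃) (l := R rL₃) j3 ((r' 8 (by norm_num)).trans f₃) z₃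
  have t1 := m'.eval_cornerTest hn (I iG₁) pA pB pC
  have t2 := m'.eval_cornerTest hn (I iG₂) pB pC pA
  have t3 := m'.eval_cornerTest hn (I iG₃) pC pA pB
  rw [j1] at t1
  rw [j2] at t2
  rw [j3] at t3
  have cond : (BExp.and (inUnit (I iG₁) (R rL₁)) (.and (inUnit (I iG₂)
      (R rL₂)) (.and (inUnit (I iG₃) (R rL₃))
      (.and (cornerTest (I iG₁) (R rX₁, R rY₁) (R rX₂, R rY₂) (R rX₃, R rY₃))
        (.and (cornerTest (I iG₂) (R rX₂, R rY₂) (R rX₃, R rY₃) (R rX₁, R rY₁))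
          (cornerTest (I iG₃) (R rX₃, R rY₃) (R rX₁, R rY₁) (R rX₂, R rY₂))))))).eval σ' ↔
      (ValidParam g₁ l₁ ∧ ValidParam g₂ l₂ ∧ ValidParam g₃ l₃ ∧ AllStable v A B C) := by
    simp only [BExp.eval_and, u1, u2, u3, t1, t2, t3]
    constructor
    · rintro ⟨w1, w2, w3, w⟩
      exact ⟨w1, w2, w3, (tests_iff h w1 w2 w3 hA hB hC).1 w⟩
    · rintro ⟨w1, w2, w3, w⟩
      exact ⟨w1, w2, w3, (tests_iff h w1 w2 w3 hA hB hC).2 w⟩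
  rw [hrun]
  simp only [when, Cmd.run, cond]
  have fr : σ'.iarr = σ.iarr ∧ σ'.rarr = σ.rarr ∧ σ'.out = σ.out := by
    rw [hσ']; exact ⟨rfl, rfl, rfl⟩
  obtain ⟨fr1, fr2, fr3⟩ := fr
  split_ifs with hc
  · refine ⟨i', fr1, fr2, r', ?_⟩
    rw [State.emit_out, fr3]
    simp [coords, hσ']
  · exact ⟨i', fr1, fr2, r', by rw [fr3, List.append_nil]⟩

section
variable {n : ℕ} {v : Fin n → Point} {σ : State}

theorem Cmd.run_ite_pos {b : BExp} {c d : Cmd} (hb : b.eval σ) : (Cmd.ite b c d).run σ = c.run σ :=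
  if_pos hb

theorem Cmd.run_ite_neg {b : BExp} {c d : Cmd} (hb : ¬ b.eval σ) :
    (Cmd.ite b c d).run σ = d.run σ := if_neg hb

/-- The test in `report` decides stability only. The condition on representatives is left to the
hypothesis `gen`, because its reason depends on the kinds of the three units. -/
theorem report_emits (h : ConvSeq n (vert v)) (m : Mem v σ)
    {g₁ g₂ g₃ : ℤ} {l₁ l₂ l₃ : ℝ} (e₁ : σ.ireg 22 = g₁) (e₂ : σ.ireg 23 = g₂) (e₃ : σ.ireg 24 = g₃)
    (f₁ : σ.rreg 6 = l₁) (f₂ : σ.rreg 7 = l₂) (f₃ : σ.rreg 8 = l₃)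
    (z₁ : g₁ % 2 = 0 → l₁ = 0) (z₂ : g₂ % 2 = 0 → l₂ = 0) (z₃ : g₃ % 2 = 0 → l₃ = 0)
    {A B C : Point} (hA : A = unitPoint (vert v) g₁ l₁) (hB : B = unitPoint (vert v) g₂ l₂)
    (hC : C = unitPoint (vert v) g₃ l₃)
    (gen : ValidParam g₁ l₁ → ValidParam g₂ l₂ → ValidParam g₃ l₃ → AllStable v A B C →
      GenThreeStable v A B C) :
    Emits v σ (report.run σ) ∧ (∀ x, x < 9 → (report.run σ).rreg x = σ.rreg x) ∧
      (ValidParam g₁ l₁ → ValidParam g₂ l₂ → ValidParam g₃ l₃ → AllStable v A B C →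
        coords A B C ∈ (report.run σ).out) := by
  obtain ⟨r1, r2, r3, r4, r5⟩ := report_run h m e₁ e₂ e₃ f₁ f₂ f₃ z₁ z₂ z₃ hA hB hC
  refine ⟨⟨r1, r2, r3, fun x hx => r4 x (by omega), ?_, ?_⟩, r4, ?_⟩
  · intro T hT
    rw [r5]
    exact List.mem_append_left _ hT
  · intro T hT
    rw [r5, List.mem_append] at hT
    refine hT.imp_right fun hT => ?_
    split_ifs at hT with hc
    · exact ⟨A, B, C, gen hc.1 hc.2.1 hc.2.2.1 hc.2.2.2, List.mem_singleton.1 hT⟩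
    · simp at hT
  · intro w1 w2 w3 w
    rw [r5, if_pos ⟨w1, w2, w3, w⟩]
    simp

theorem Mem.eval_param (hn : 0 < n) (m : Mem v σ) (i : IExp) (p : PExp) (j : IExp) :
    (param i p j).eval σ = det (ev (vert v) (j.eval σ)) (p.point σ - vert v (i.eval σ)) /
      det (ev (vert v) (j.eval σ)) (ev (vert v) (i.eval σ)) := by
  rw [param, RExp.eval_div, eval_pdet, eval_pdet, point_psub, m.point_evec hn, m.point_evec hn,
    m.point_vtx hn]

theorem Mem.eval_parallel (hn : 0 < n) (m : Mem v σ) (i j : IExp) :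
    (parallel i j).eval σ ↔ det (ev (vert v) (i.eval σ)) (ev (vert v) (j.eval σ)) = 0 := by
  rw [parallel, BExp.eval_req, eval_pdet, m.point_evec hn, m.point_evec hn, RExp.eval_zero]

theorem unitPoint_zero (V : ℤ → Point) (i : ℤ) : unitPoint V (2 * i) 0 = V i := by
  simp [unitPoint]

/-- The values of the registers when `gadgetVV` tries its lines. -/
structure VVState (v : Fin n → Point) (g j k : ℤ) (σ : State) : Prop where
  mem : Mem v σ
  g₁ : σ.ireg 22 = g
  g₂ : σ.ireg 23 = 2 * j
  g₃ : σ.ireg 24 = 2 * k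
  l₂ : σ.rreg 7 = 0
  l₃ : σ.rreg 8 = 0

theorem tryLine_run (h : ConvSeq n (vert v)) {g j k P Q : ℤ} {e : ℝ} (ho : g % 2 = 1)
    (s : VVState v g j k σ) {p q : IExp} (hp : p.eval σ = P)
    (hq : q.eval σ = Q) (hc : Cand j k P Q e) :
    Emits v σ ((tryLine p q).run σ) ∧ VVState v g j k ((tryLine p q).run σ) ∧
      ∀ l, ValidParam g l → AllStable v (unitPoint (vert v) g l) (vert v j) (vert v k) →
        det (ev (vert v) Q) (ev (vert v) (g / 2)) ≠ 0 →
        det (ev (vert v) Q) (unitPoint (vert v) g l - vert v P) = 0 →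
        coords (unitPoint (vert v) g l) (vert v j) (vert v k) ∈ ((tryLine p q).run σ).out := by
  have hn : 0 < n := by have := h.three; omega
  obtain ⟨m, g1, g2, g3, l2, l3⟩ := s
  have hcond : (BExp.not (.req (pdet (evec q) (evec (I iG₁ / 2))) 0)).eval σ ↔
      det (ev (vert v) Q) (ev (vert v) (g / 2)) ≠ 0 := by
    rw [BExp.eval_not, BExp.eval_req, eval_pdet, m.point_evec hn, m.point_evec hn, RExp.eval_zero, hq]
    simp [g1]
  have hpar : (param (I iG₁ / 2) (vtx p) q).eval σ = det (ev (vert v) Q) (vert v P - vert v (g / 2)) /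
      det (ev (vert v) Q) (ev (vert v) (g / 2)) := by
    rw [m.eval_param hn, m.point_vtx hn, hq, hp]
    simp [g1]
  obtain ⟨l₀, hl₀⟩ : ∃ l₀, l₀ = det (ev (vert v) Q) (vert v P - vert v (g / 2)) /
      det (ev (vert v) Q) (ev (vert v) (g / 2)) := ⟨_, rfl⟩
  simp only [tryLine, when, block, Cmd.run, hcond, hpar, ← hl₀]
  split_ifs with hd
  · have uniq : ∀ l, det (ev (vert v) Q) (unitPoint (vert v) g l - vert v P) = 0 → l = l₀ := by
      intro l hl
      rw [hl₀, eq_div_iff hd]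
      rw [det_unitPoint, det_neg_sub] at hl
      linarith
    have zero : det (ev (vert v) Q) (unitPoint (vert v) g l₀ - vert v P) = 0 := by
      rw [det_unitPoint, hl₀, det_neg_sub, div_mul_cancel₀ _ hd]
      ring
    have m' := m.rset rL₁ l₀
    obtain ⟨r1, r2, r3⟩ := report_emits h m' (g₁ := g) (g₂ := 2 * j) (g₃ := 2 * k) (l₁ := l₀)
      (l₂ := 0) (l₃ := 0) (by simp [g1]) (by simp [g2]) (by simp [g3]) (by simp) (by simp [l2])
      (by simp [l3]) (by omega) (by simp) (by simp) rfl (unitPoint_zero _ _).symm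
      (unitPoint_zero _ _).symm (fun w1 _ _ st => ⟨st, representative_of_line h w1 st hc hd zero,
        representative_of_vertex h rfl, representative_of_vertex h rfl⟩)
    have em := (Emits.rset v σ (x := rL₁) le_rfl l₀).trans r1
    refine ⟨em, ⟨m.emits em, ?_, ?_, ?_, ?_, ?_⟩, ?_⟩
    · rw [em.ireg, g1]
    · rw [em.ireg, g2]
    · rw [em.ireg, g3]
    · rw [r2 7 (by norm_num)]; simp [l2]
    · rw [r2 8 (by norm_num)]; simp [l3]
    · intro l hl st _ hz
      obtain rfl := uniq l hz
      exact r3 hl (.inl ⟨by omega, rfl⟩) (.inl ⟨by omega, rfl⟩) st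
  · exact ⟨Emits.refl v σ, ⟨m, g1, g2, g3, l2, l3⟩, fun l _ _ hd' => absurd hd' hd⟩

/-- A corner at a vertex needs no search. A representative inside an edge lies on one of the four
lines and not parallel to it, and each line determines the parameter. -/
theorem gadgetVV_run (h : ConvSeq n (vert v)) (m : Mem v σ) {g j k : ℤ}
    (g₁ : σ.ireg 22 = g) (g₂ : σ.ireg 23 = 2 * j) (g₃ : σ.ireg 24 = 2 * k) :
    Emits v σ (gadgetVV.run σ) ∧ ∀ x, unitOf x = g →
      GenThreeStable v (curve (vert v) x) (vert v j) (vert v k) →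
        coords (curve (vert v) x) (vert v j) (vert v k) ∈ (gadgetVV.run σ).out := by
  obtain ⟨σ', hσ'⟩ : ∃ σ', σ' = (σ.rset 7 0).rset 8 0 := ⟨_, rfl⟩
  have em : Emits v σ σ' := by
    rw [hσ']
    exact (Emits.rset v σ (by norm_num) 0).trans (Emits.rset v _ (by norm_num) 0)
  have s₁ : VVState v g j k σ' := by
    refine ⟨m.emits em, ?_, ?_, ?_, ?_, ?_⟩
    · rw [em.ireg, g₁]
    · rw [em.ireg, g₂]
    · rw [em.ireg, g₃]
    · simp [hσ']
    · simp [hσ']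
  have hcond : (even (I iG₁)).eval σ' ↔ g % 2 = 0 := by
    simp [s₁.g₁]
  have hrun : gadgetVV.run σ = Cmd.run (.ite (even (I iG₁)) (block [.rset rL₁ 0, report])
      (block [tryLine (I iG₂ / 2) (I iG₃ / 2 - 1), tryLine (I iG₂ / 2) (I iG₃ / 2),
        tryLine (I iG₃ / 2) (I iG₂ / 2 - 1), tryLine (I iG₃ / 2) (I iG₂ / 2)])) σ' := by
    rw [hσ', ← RExp.eval_zero σ]; rfl
  rw [hrun]
  by_cases he : g % 2 = 0
  · have hrun' : Cmd.run (block [.rset rL₁ 0, report]) σ' = report.run (σ'.rset 6 0) := by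
      rw [← RExp.eval_zero σ']; rfl
    rw [Cmd.run_ite_pos (hcond.2 he), hrun']
    obtain ⟨i, rfl⟩ : ∃ i, g = 2 * i := ⟨g / 2, by omega⟩
    have em' := Emits.rset v σ' (x := 6) le_rfl 0
    obtain ⟨m', g1, g2, g3, l2, l3⟩ := s₁
    obtain ⟨r1, r2, r3⟩ := report_emits h (m'.emits em') (g₁ := 2 * i) (g₂ := 2 * j) (g₃ := 2 * k)
      (l₁ := 0) (l₂ := 0) (l₃ := 0) (by simp [g1]) (by simp [g2]) (by simp [g3]) (by simp)
      (by simp [l2]) (by simp [l3]) (by simp) (by simp) (by simp) (unitPoint_zero _ _).symm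
      (unitPoint_zero _ _).symm
      (unitPoint_zero _ _).symm (fun _ _ _ st => ⟨st, representative_of_vertex h rfl,
        representative_of_vertex h rfl, representative_of_vertex h rfl⟩)
    refine ⟨em.trans (em'.trans r1), ?_⟩
    intro x hx gen
    rw [unitOf_even hx, curve_int] at gen ⊢
    exact r3 (.inl ⟨by omega, rfl⟩) (.inl ⟨by omega, rfl⟩) (.inl ⟨by omega, rfl⟩) gen.1
  · rw [Cmd.run_ite_neg (mt hcond.1 he)]
    simp only [block, Cmd.run]
    have ho : g % 2 = 1 := by omega
    obtain ⟨em1, s2, c1⟩ := tryLine_run h ho s₁ (p := I iG₂ / 2) (q := I iG₃ / 2 - 1) (P := j)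
      (Q := k - 1) (e := -1) (by simp [s₁.g₂]) (by simp [s₁.g₃]) (by simp [Cand])
    obtain ⟨σ₂, h₂⟩ : ∃ σ₂, σ₂ = (tryLine (I iG₂ / 2) (I iG₃ / 2 - 1)).run σ' := ⟨_, rfl⟩
    rw [← h₂] at em1 s2 c1 ⊢
    obtain ⟨em2, s3, c2⟩ := tryLine_run h ho s2 (p := I iG₂ / 2) (q := I iG₃ / 2) (P := j)
      (Q := k) (e := 1) (by simp [s2.g₂]) (by simp [s2.g₃]) (by simp [Cand])
    obtain ⟨σ₃, h₃⟩ : ∃ σ₃, σ₃ = (tryLine (I iG₂ / 2) (I iG₃ / 2)).run σ₂ := ⟨_, rfl⟩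
    rw [← h₃] at em2 s3 c2 ⊢
    obtain ⟨em3, s4, c3⟩ := tryLine_run h ho s3 (p := I iG₃ / 2) (q := I iG₂ / 2 - 1) (P := k)
      (Q := j - 1) (e := 1) (by simp [s3.g₃]) (by simp [s3.g₂]) (by simp [Cand])
    obtain ⟨σ₄, h₄⟩ : ∃ σ₄, σ₄ = (tryLine (I iG₃ / 2) (I iG₂ / 2 - 1)).run σ₃ := ⟨_, rfl⟩
    rw [← h₄] at em3 s4 c3 ⊢
    obtain ⟨em4, s5, c4⟩ := tryLine_run h ho s4 (p := I iG₃ / 2) (q := I iG₂ / 2) (P := k)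
      (Q := j) (e := -1) (by simp [s4.g₃]) (by simp [s4.g₂]) (by simp [Cand])
    refine ⟨em.trans (em1.trans (em2.trans (em3.trans em4))), ?_⟩
    intro x hx gen
    obtain ⟨l, w, e1, -⟩ := exists_param (vert v) x
    rw [hx] at w e1
    rw [← e1] at gen ⊢
    obtain ⟨p, q, e, hc, hd, hz⟩ := exists_line_of_representative h w ho gen.1 gen.2.1
    rcases hc with ⟨rfl, rfl, rfl⟩ | ⟨rfl, rfl, rfl⟩ | ⟨rfl, rfl, rfl⟩ | ⟨rfl, rfl, rfl⟩
    · exact em4.keep _ (em3.keep _ (em2.keep _ (c1 l w gen.1 hd hz)))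
    · exact em4.keep _ (em3.keep _ (c2 l w gen.1 hd hz))
    · exact em4.keep _ (c3 l w gen.1 hd hz)
    · exact c4 l w gen.1 hd hz

/-! Two edges. -/

theorem parallel_of_max {V : ℤ → Point} {g : ℤ} {l : ℝ} {B C : Point} (ho : g % 2 = 1)
    (hl : ValidParam g l) (hm : ∀ x, far B C (V x) ≤ far B C (unitPoint V g l)) :
    det (ev V (g / 2)) (B - C) = 0 := by
  have := (edge_eq_of_max ho hl hm).1
  have := far_step_det V B C (g / 2)
  linarith

theorem det_zero_trans {e f x y : Point} (he : e ≠ 0) (hf : f ≠ 0) (h₁ : det e x = 0)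
    (h₂ : det f y = 0) (h : det e f = 0) : det x y = 0 := by
  have ne : ∀ p : Point, p ≠ 0 → p 0 ≠ 0 ∨ p 1 ≠ 0 := by
    intro p hp
    by_contra hc
    push Not at hc
    apply hp
    ext i
    fin_cases i
    · exact hc.1
    · exact hc.2
  have par : ∀ p q r : Point, p ≠ 0 → det p q = 0 → det p r = 0 → det q r = 0 := by
    intro p q r hp hq hr
    simp only [det] at *
    rcases ne p hp with h0 | h0
    · apply mul_left_cancel₀ h0
      linear_combination q 0 * hr - r 0 * hq
    · apply mul_left_cancel₀ h0
      linear_combination q 1 * hr - r 1 * hq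
  have h3 := par e x f he h₁ h
  refine par f x y hf ?_ h₂
  simp only [det] at *
  linarith

theorem ev_ne_zero {V : ℤ → Point} {n : ℤ} (h : ConvSeq n V) (i : ℤ) : ev V i ≠ 0 := by
  intro e
  have h3 := h.three
  have := h.pos i (i + 1) (i + 2) (by omega) (by omega) (by omega)
  have e' := far_step_det V (V (i + 2)) (V i) i
  rw [e, ← far_rotate, far_self_right] at e'
  have : det (0 : Point) (V (i + 2) - V i) = 0 := by simp [det]
  rw [far_rotate, far_rotate] at e'
  linarith

/-- The midpoint formula. -/
theorem mid_identity {ei ej ek A B C vi vj vk : Point} {l : ℝ} (hij : det ej ei ≠ 0)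
    (hik : det ek ei ≠ 0) (hA : A = vi + l • ei) (hB : det ej (vj - B) = 0)
    (hC : det ek (vk - C) = 0) (h₁ : det ei (B - C) = 0) (h₂ : det ej (C - A) = 0)
    (h₃ : det ek (A - B) = 0) :
    l = (det ej (vj - vi) / det ej ei + det ek (vk - vi) / det ek ei) / 2 := by
  have e1 : det ej (vj - vi) = det ej (B - A) + l * det ej ei := by
    subst hA
    simp only [det, PiLp.sub_apply, PiLp.add_apply, PiLp.smul_apply, smul_eq_mul] at *
    linear_combination hB
  have e2 : det ek (vk - vi) = det ek (C - A) + l * det ek ei := by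
    subst hA
    simp only [det, PiLp.sub_apply, PiLp.add_apply, PiLp.smul_apply, smul_eq_mul] at *
    linear_combination hC
  rw [e1, e2]
  -- `ABC` is the medial triangle of the triangle formed by the three edge lines. Hence the
  -- intersections of the line of `ei` with the other two are symmetric with respect to `A`.
  have key : det ej (B - A) * det ek ei + det ek (C - A) * det ej ei = 0 := by
    simp only [det, PiLp.sub_apply] at *
    linear_combination -(ej 0 * ek 1 - ej 1 * ek 0) * h₁ - (ej 0 * ei 1 - ej 1 * ei 0) * h₃ +
      (ek 0 * ei 1 - ek 1 * ei 0) * h₂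
  field_simp
  linear_combination (-1 : ℝ) * key

theorem unitPoint_not_range (h : ConvSeq n (vert v)) {g : ℤ} {l : ℝ} (hl : ValidParam g l)
    (ho : g % 2 = 1) : unitPoint (vert v) g l ∉ Set.range v := by
  intro hr
  rw [(unitPoint_curve hl).1] at hr
  have := curve_mem_range_iff h hr
  rw [(unitPoint_curve (V := vert v) hl).2] at this
  omega

/-- With two corners inside edges no two corners are left that could both be vertices beside the
third, so stability alone suffices. -/
theorem gen_of_two_edges (h : ConvSeq n (vert v)) {A : Point} {g₂ g₃ : ℤ} {l₂ l₃ : ℝ}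
    (h₂ : ValidParam g₂ l₂) (h₃ : ValidParam g₃ l₃) (o₂ : g₂ % 2 = 1) (o₃ : g₃ % 2 = 1)
    (st : AllStable v A (unitPoint (vert v) g₂ l₂) (unitPoint (vert v) g₃ l₃)) :
    GenThreeStable v A (unitPoint (vert v) g₂ l₂) (unitPoint (vert v) g₃ l₃) :=
  ⟨st, representative_of_not_range (.inl (unitPoint_not_range h h₂ o₂)),
    representative_of_not_range (.inl (unitPoint_not_range h h₃ o₃)),
    representative_of_not_range (.inr (unitPoint_not_range h h₂ o₂))⟩

theorem unit_on_line (V : ℤ → Point) (g : ℤ) (l : ℝ) :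
    det (ev V (g / 2)) (V (g / 2) - unitPoint V g l) = 0 := by
  simp only [unitPoint, det, PiLp.sub_apply, PiLp.add_apply, PiLp.smul_apply, smul_eq_mul]; ring

/-- The parallelism of the sides and edges that belong to the corners of a stable triangle. -/
theorem parallel_of_allStable (h : ConvSeq n (vert v)) {g₁ g₂ g₃ : ℤ} {l₁ l₂ l₃ : ℝ}
    (h₁ : ValidParam g₁ l₁) (h₂ : ValidParam g₂ l₂) (h₃ : ValidParam g₃ l₃)
    {A B C : Point} (hA : A = unitPoint (vert v) g₁ l₁) (hB : B = unitPoint (vert v) g₂ l₂)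
    (hC : C = unitPoint (vert v) g₃ l₃) (st : AllStable v A B C) :
    (g₁ % 2 = 1 → det (ev (vert v) (g₁ / 2)) (B - C) = 0) ∧
    (g₂ % 2 = 1 → det (ev (vert v) (g₂ / 2)) (C - A) = 0) ∧
    (g₃ % 2 = 1 → det (ev (vert v) (g₃ / 2)) (A - B) = 0) ∧
    (g₁ % 2 = 1 → g₂ % 2 = 1 → det (ev (vert v) (g₁ / 2)) (ev (vert v) (g₂ / 2)) ≠ 0) ∧
    (g₂ % 2 = 1 → g₃ % 2 = 1 → det (ev (vert v) (g₂ / 2)) (ev (vert v) (g₃ / 2)) ≠ 0) ∧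
    (g₁ % 2 = 1 → g₃ % 2 = 1 → det (ev (vert v) (g₁ / 2)) (ev (vert v) (g₃ / 2)) ≠ 0) := by
  obtain ⟨h0, m1, m2, m3⟩ := (allStable_iff h (hA.trans (unitPoint_curve h₁).1)
    (hB.trans (unitPoint_curve h₂).1) (hC.trans (unitPoint_curve h₃).1)).1 st
  have p1 : g₁ % 2 = 1 → det (ev (vert v) (g₁ / 2)) (B - C) = 0 := by
    intro o; rw [hA] at m1; exact parallel_of_max o h₁ m1
  have p2 : g₂ % 2 = 1 → det (ev (vert v) (g₂ / 2)) (C - A) = 0 := by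
    intro o; rw [hB] at m2; exact parallel_of_max o h₂ m2
  have p3 : g₃ % 2 = 1 → det (ev (vert v) (g₃ / 2)) (A - B) = 0 := by
    intro o; rw [hC] at m3; exact parallel_of_max o h₃ m3
  have q12 : det (B - C) (C - A) = -far A B C := by
    simp only [det, far_eq, PiLp.sub_apply]; ring
  have q23 : det (C - A) (A - B) = -far A B C := by
    simp only [det, far_eq, PiLp.sub_apply]; ring
  have q13 : det (B - C) (A - B) = far A B C := by
    simp only [det, far_eq, PiLp.sub_apply]; ring
  refine ⟨p1, p2, p3, fun o1 o2 e => ?_, fun o1 o2 e => ?_, fun o1 o2 e => ?_⟩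
  · have := det_zero_trans (ev_ne_zero h _) (ev_ne_zero h _) (p1 o1) (p2 o2) e
    linarith
  · have := det_zero_trans (ev_ne_zero h _) (ev_ne_zero h _) (p2 o1) (p3 o2) e
    linarith
  · have := det_zero_trans (ev_ne_zero h _) (ev_ne_zero h _) (p1 o1) (p3 o2) e
    linarith

theorem det_symm_ne {a b : Point} (h : det a b ≠ 0) : det b a ≠ 0 := by
  intro e
  apply h
  simp only [det] at *
  linarith

/-- The value of `midParam`. -/
def midValue (V : ℤ → Point) (i j k : ℤ) : ℝ :=
  (det (ev V j) (V j - V i) / det (ev V j) (ev V i) +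
    det (ev V k) (V k - V i) / det (ev V k) (ev V i)) / 2

theorem Mem.eval_midParam (hn : 0 < n) (m : Mem v σ) (i j k : IExp) :
    (midParam i j k).eval σ = midValue (vert v) (i.eval σ) (j.eval σ) (k.eval σ) := by
  rw [midParam, RExp.eval_div, RExp.eval_add, m.eval_param hn, m.eval_param hn, m.point_vtx hn,
    m.point_vtx hn, RExp.eval_two, midValue]

/-- Sides opposite to corners inside edges are parallel to those edges, and such edges are pairwise
not parallel. If the third unit is a vertex, it fixes the two parameters by two parallels; if it is
an edge, the midpoint formula gives all three. The computed triangle is therefore the only possible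
one. -/
theorem gadgetEE_run (h : ConvSeq n (vert v)) (m : Mem v σ) {g j k : ℤ}
    (g₁ : σ.ireg 22 = g) (g₂ : σ.ireg 23 = 2 * j + 1) (g₃ : σ.ireg 24 = 2 * k + 1) :
    Emits v σ (gadgetEE.run σ) ∧ ∀ x y z, unitOf x = g → unitOf y = 2 * j + 1 →
      unitOf z = 2 * k + 1 → AllStable v (curve (vert v) x) (curve (vert v) y) (curve (vert v) z) →
        coords (curve (vert v) x) (curve (vert v) y) (curve (vert v) z) ∈ (gadgetEE.run σ).out := by
  have hn : 0 < n := by have := h.three; omega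
  have hjj : (2 * j + 1) / 2 = j := by omega
  have hkk : (2 * k + 1) / 2 = k := by omega
  suffices H : Emits v σ (gadgetEE.run σ) ∧ ∀ l₁ l₂ l₃, ValidParam g l₁ → ValidParam (2 * j + 1) l₂ →
      ValidParam (2 * k + 1) l₃ → AllStable v (unitPoint (vert v) g l₁)
        (unitPoint (vert v) (2 * j + 1) l₂) (unitPoint (vert v) (2 * k + 1) l₃) →
      coords (unitPoint (vert v) g l₁) (unitPoint (vert v) (2 * j + 1) l₂)
        (unitPoint (vert v) (2 * k + 1) l₃) ∈ (gadgetEE.run σ).out by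
    refine ⟨H.1, fun x y z hx hy hz st => ?_⟩
    obtain ⟨l₁, w1, e1, -⟩ := exists_param (vert v) x
    obtain ⟨l₂, w2, e2, -⟩ := exists_param (vert v) y
    obtain ⟨l₃, w3, e3, -⟩ := exists_param (vert v) z
    rw [hx] at w1 e1
    rw [hy] at w2 e2
    rw [hz] at w3 e3
    rw [← e1, ← e2, ← e3] at st ⊢
    exact H.2 l₁ l₂ l₃ w1 w2 w3 st
  have c0 : (BExp.not (parallel (I iG₂ / 2) (I iG₃ / 2))).eval σ ↔
      det (ev (vert v) j) (ev (vert v) k) ≠ 0 := by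
    rw [BExp.eval_not, m.eval_parallel hn]
    simp [g₂, g₃, hjj, hkk]
  have out : ∀ (s : State) (l₁ l₂ l₃ : ℝ), s = ((σ.rset 6 l₁).rset 7 l₂).rset 8 l₃ →
      (g % 2 = 0 → l₁ = 0) → Emits v σ (report.run s) ∧ (ValidParam g l₁ →
        ValidParam (2 * j + 1) l₂ → ValidParam (2 * k + 1) l₃ → AllStable v (unitPoint (vert v) g l₁)
        (unitPoint (vert v) (2 * j + 1) l₂) (unitPoint (vert v) (2 * k + 1) l₃) →
      coords (unitPoint (vert v) g l₁) (unitPoint (vert v) (2 * j + 1) l₂)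
        (unitPoint (vert v) (2 * k + 1) l₃) ∈ (report.run s).out) := by
    rintro s l₁ l₂ l₃ rfl hz
    have em : Emits v σ (((σ.rset 6 l₁).rset 7 l₂).rset 8 l₃) :=
      ((Emits.rset v σ le_rfl l₁).trans (Emits.rset v _ (by norm_num) l₂)).trans
        (Emits.rset v _ (by norm_num) l₃)
    obtain ⟨r1, r2, r3⟩ := report_emits h (m.emits em) (g₁ := g) (g₂ := 2 * j + 1)
      (g₃ := 2 * k + 1) (l₁ := l₁) (l₂ := l₂) (l₃ := l₃) (by simp [g₁]) (by simp [g₂])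
      (by simp [g₃]) (by simp) (by simp) (by simp) hz (by omega) (by omega) rfl rfl rfl
      (fun _ w2 w3 st => gen_of_two_edges h w2 w3 (by omega) (by omega) st)
    exact ⟨em.trans r1, r3⟩
  by_cases hjk : det (ev (vert v) j) (ev (vert v) k) = 0
  · rw [gadgetEE, when, Cmd.run_ite_neg (by rw [c0]; exact not_not.2 hjk)]
    refine ⟨Emits.refl v σ, fun l₁ l₂ l₃ w1 w2 w3 st => ?_⟩
    have := (parallel_of_allStable h w1 w2 w3 rfl rfl rfl st).2.2.2.2.1 (by omega) (by omega)
    rw [hjj, hkk] at this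
    exact absurd hjk this
  rw [gadgetEE, when, Cmd.run_ite_pos (c0.2 hjk)]
  have ce : (even (I iG₁)).eval σ ↔ g % 2 = 0 := by simp [g₁]
  by_cases he : g % 2 = 0
  · rw [Cmd.run_ite_pos (ce.2 he)]
    have m1 := m.rset 6 0
    obtain ⟨b, hb⟩ : ∃ b, b = det (ev (vert v) k) (vert v (g / 2) - vert v j) /
      det (ev (vert v) k) (ev (vert v) j) := ⟨_, rfl⟩
    obtain ⟨c, hc⟩ : ∃ c, c = det (ev (vert v) j) (vert v (g / 2) - vert v k) /
      det (ev (vert v) j) (ev (vert v) k) := ⟨_, rfl⟩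
    have hrun : Cmd.run (block [.rset rL₁ 0,
        .rset rL₂ (param (I iG₂ / 2) (vtx (I iG₁ / 2)) (I iG₃ / 2)),
        .rset rL₃ (param (I iG₃ / 2) (vtx (I iG₁ / 2)) (I iG₂ / 2)), report]) σ =
        report.run (((σ.rset 6 0).rset 7 b).rset 8 c) := by
      have e1 : (param (I iG₂ / 2) (vtx (I iG₁ / 2)) (I iG₃ / 2)).eval (σ.rset 6 0) = b := by
        rw [m1.eval_param hn, m1.point_vtx hn, hb]; simp [g₁, g₂, g₃, hjj, hkk]
      have e2 : (param (I iG₃ / 2) (vtx (I iG₁ / 2)) (I iG₂ / 2)).eval ((σ.rset 6 0).rset 7 b) =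
          c := by
        rw [(m1.rset 7 b).eval_param hn, (m1.rset 7 b).point_vtx hn, hc]
        simp [g₁, g₂, g₃, hjj, hkk]
      rw [← e2, ← e1, ← RExp.eval_zero σ]
      rfl
    rw [hrun]
    obtain ⟨o1, o2⟩ := out _ 0 b c rfl (fun _ => rfl)
    refine ⟨o1, fun l₁ l₂ l₃ w1 w2 w3 st => ?_⟩
    have z1 : l₁ = 0 := by
      rcases w1 with ⟨_, h⟩ | ⟨h, _⟩
      · exact h
      · omega
    subst z1
    obtain ⟨p1, p2, p3, -, -, -⟩ := parallel_of_allStable h w1 w2 w3 rfl rfl rfl st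
    have e0 : unitPoint (vert v) g 0 = vert v (g / 2) := by simp [unitPoint]
    have eb : l₂ = b := by
      have := p3 (by omega)
      rw [hkk, e0, det_neg_sub, det_unitPoint, hjj, det_neg_sub] at this
      rw [hb, eq_div_iff (det_symm_ne hjk)]
      linarith
    have ec : l₃ = c := by
      have := p2 (by omega)
      rw [hjj, e0, det_unitPoint, hkk, det_neg_sub] at this
      rw [hc, eq_div_iff hjk]
      linarith
    subst eb ec
    exact o2 w1 w2 w3 st
  · rw [Cmd.run_ite_neg (mt ce.1 he)]
    have ho : g % 2 = 1 := by omega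
    have c1 : (BExp.not (.or (parallel (I iG₁ / 2) (I iG₂ / 2))
        (parallel (I iG₁ / 2) (I iG₃ / 2)))).eval σ ↔
        ¬ (det (ev (vert v) (g / 2)) (ev (vert v) j) = 0 ∨
          det (ev (vert v) (g / 2)) (ev (vert v) k) = 0) := by
      rw [BExp.eval_not, BExp.eval_or, m.eval_parallel hn, m.eval_parallel hn]
      simp [g₁, g₂, g₃, hjj, hkk]
    by_cases hd : det (ev (vert v) (g / 2)) (ev (vert v) j) = 0 ∨
        det (ev (vert v) (g / 2)) (ev (vert v) k) = 0
    · rw [when, Cmd.run_ite_neg (by rw [c1]; exact not_not.2 hd)]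
      refine ⟨Emits.refl v σ, fun l₁ l₂ l₃ w1 w2 w3 st => ?_⟩
      obtain ⟨-, -, -, d1, -, d2⟩ := parallel_of_allStable h w1 w2 w3 rfl rfl rfl st
      have d1 := d1 ho (by omega)
      have d2 := d2 ho (by omega)
      rw [hjj] at d1
      rw [hkk] at d2
      tauto
    rw [when, Cmd.run_ite_pos (c1.2 hd)]
    push Not at hd
    obtain ⟨hd1, hd2⟩ := hd
    obtain ⟨a, ha⟩ : ∃ a, a = midValue (vert v) (g / 2) j k := ⟨_, rfl⟩
    obtain ⟨b, hb⟩ : ∃ b, b = midValue (vert v) j k (g / 2) := ⟨_, rfl⟩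
    obtain ⟨c, hc⟩ : ∃ c, c = midValue (vert v) k (g / 2) j := ⟨_, rfl⟩
    have hrun : Cmd.run (block [
        .rset rL₁ (midParam (I iG₁ / 2) (I iG₂ / 2) (I iG₃ / 2)),
          .rset rL₂ (midParam (I iG₂ / 2) (I iG₃ / 2) (I iG₁ / 2)),
          .rset rL₃ (midParam (I iG₃ / 2) (I iG₁ / 2) (I iG₂ / 2)), report]) σ =
        report.run (((σ.rset 6 a).rset 7 b).rset 8 c) := by
      have e1 : (midParam (I iG₁ / 2) (I iG₂ / 2) (I iG₃ / 2)).eval σ = a := by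
        rw [m.eval_midParam hn, ha]; simp [g₁, g₂, g₃, hjj, hkk]
      have e2 : (midParam (I iG₂ / 2) (I iG₃ / 2) (I iG₁ / 2)).eval (σ.rset 6 a) = b := by
        rw [(m.rset 6 a).eval_midParam hn, hb]; simp [g₁, g₂, g₃, hjj, hkk]
      have e3 : (midParam (I iG₃ / 2) (I iG₁ / 2) (I iG₂ / 2)).eval ((σ.rset 6 a).rset 7 b) = c := by
        rw [((m.rset 6 a).rset 7 b).eval_midParam hn, hc]; simp [g₁, g₂, g₃, hjj, hkk]
      rw [← e3, ← e2, ← e1]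
      rfl
    rw [hrun]
    obtain ⟨o1, o2⟩ := out _ a b c rfl (fun h => by omega)
    refine ⟨o1, fun l₁ l₂ l₃ w1 w2 w3 st => ?_⟩
    obtain ⟨p1, p2, p3, -, -, -⟩ := parallel_of_allStable h w1 w2 w3 rfl rfl rfl st
    have p1 := p1 ho
    have p2 := p2 (by omega)
    have p3 := p3 (by omega)
    have L1 := unit_on_line (vert v) g l₁
    have L2 := unit_on_line (vert v) (2 * j + 1) l₂
    have L3 := unit_on_line (vert v) (2 * k + 1) l₃
    rw [hjj] at p2 L2
    rw [hkk] at p3 L3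
    have u2 : unitPoint (vert v) (2 * j + 1) l₂ = vert v j + l₂ • ev (vert v) j := by
      rw [unitPoint, hjj]
    have u3 : unitPoint (vert v) (2 * k + 1) l₃ = vert v k + l₃ • ev (vert v) k := by
      rw [unitPoint, hkk]
    have ea : l₁ = a := by
      rw [ha]
      exact mid_identity (det_symm_ne hd1) (det_symm_ne hd2) rfl L2 L3 p1 p2 p3
    have eb : l₂ = b := by
      rw [hb]
      exact mid_identity (det_symm_ne hjk) hd1 u2 L3 L1 p2 p3 p1
    have ec : l₃ = c := by
      rw [hc]
      exact mid_identity hd2 hjk u3 L1 L2 p3 p1 p2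
    subst ea eb ec
    exact o2 w1 w2 w3 st

end

/-! ### The visited vertex pairs -/

/-- Like `Emits`, but also the registers of the gadget may have changed. -/
structure Outs {n : ℕ} (v : Fin n → Point) (σ σ' : State) : Prop where
  ireg : ∀ x, x < 22 → σ'.ireg x = σ.ireg x
  iarr : σ'.iarr = σ.iarr
  rarr : σ'.rarr = σ.rarr
  rreg : ∀ x, x < 6 → σ'.rreg x = σ.rreg x
  keep : ∀ T ∈ σ.out, T ∈ σ'.out
  sound : ∀ T ∈ σ'.out, T ∈ σ.out ∨ IsGenOut v T

section
variable {n : ℕ} {v : Fin n → Point} {σ : State}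

theorem Emits.outs {σ' : State} (h : Emits v σ σ') : Outs v σ σ' :=
  ⟨fun _ _ => by rw [h.ireg], h.iarr, h.rarr, h.rreg, h.keep, h.sound⟩

theorem Outs.trans {σ' σ'' : State} (h : Outs v σ σ') (h' : Outs v σ' σ'') : Outs v σ σ'' :=
  ⟨fun x hx => (h'.ireg x hx).trans (h.ireg x hx), h'.iarr.trans h.iarr, h'.rarr.trans h.rarr,
    fun x hx => (h'.rreg x hx).trans (h.rreg x hx), fun T hT => h'.keep T (h.keep T hT),
    fun T hT => (h'.sound T hT).elim (h.sound T) .inr⟩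

theorem Outs.iset (v : Fin n → Point) (σ : State) {x : ℕ} (hx : 22 ≤ x) (z : ℤ) :
    Outs v σ (σ.iset x z) :=
  ⟨fun y hy => by rw [State.iset_ireg, if_neg (by omega)], rfl, rfl, fun _ _ => rfl, fun _ h => h,
    fun _ h => .inl h⟩

theorem Mem.outs (m : Mem v σ) {σ' : State} (h : Outs v σ σ') : Mem v σ' :=
  m.congr (h.ireg 0 (by norm_num)) h.rarr

theorem Mem.iset (m : Mem v σ) {x : ℕ} (hx : x ≠ 0) (z : ℤ) : Mem v (σ.iset x z) :=
  m.congr (by rw [State.iset_ireg, if_neg hx.symm]) rfl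

theorem Visited.mono {n : ℤ} {σ : State} (h : Visited n σ) {m m' : ℤ} (h₀ : 0 ≤ m) (hm : m ≤ m')
    (hm' : m' < σ.ireg 12) : σ.iarr 0 m ≤ σ.iarr 0 m' ∧ σ.iarr 1 m ≤ σ.iarr 1 m' := by
  obtain ⟨d, rfl⟩ : ∃ d : ℕ, m' = m + d := ⟨(m' - m).toNat, by omega⟩
  clear hm
  induction d with
  | zero => simp
  | succ d ih =>
    obtain ⟨i1, i2⟩ := ih (by push_cast at hm'; omega)
    have := h.step (m + d) (by omega) (by push_cast at hm'; omega)
    rw [show m + ((d + 1 : ℕ) : ℤ) = m + d + 1 by push_cast; ring]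
    rcases this with ⟨e1, e2⟩ | ⟨e1, e2⟩ <;> omega

theorem AllStable.rotate {A B C : Point} (s : AllStable v A B C) : AllStable v B C A :=
  ⟨s.mem₂, s.mem₃, s.mem₁, by
    have := s.clockwise
    have e1 := far_eq_neg_orient A B C
    have e2 := far_eq_neg_orient B C A
    rw [far_rotate] at e1
    linarith, s.stable₂, s.stable₃, s.stable₁⟩

/-- The units that carry the farthest points of a chord. -/
theorem unit_of_max (h : ConvSeq n (vert v)) {j k A : ℤ} (hjk : j < k)
    (hA : ∀ i, k ≤ i → i < A → far (vert v j) (vert v k) (vert v i) <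
      far (vert v j) (vert v k) (vert v (i + 1))) (hkA : k ≤ A) (hAj : A < j + n)
    (halt : far (vert v j) (vert v k) (vert v (A + 1)) ≤ far (vert v j) (vert v k) (vert v A))
    {x : ℝ} (hx : (k : ℝ) < x) (hx' : x < j + (n : ℤ))
    (mx : ∀ y, far (vert v j) (vert v k) (curve (vert v) y) ≤
      far (vert v j) (vert v k) (curve (vert v) x)) :
    unitOf x = 2 * A ∨ (far (vert v j) (vert v k) (vert v (A + 1)) =
      far (vert v j) (vert v k) (vert v A) ∧ (unitOf x = 2 * A + 1 ∨ unitOf x = 2 * A + 2)) := by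
  have glob : ∀ i, far (vert v j) (vert v k) (vert v i) ≤ far (vert v j) (vert v k) (vert v A) := by
    refine h.le_of_local hjk hkA hAj halt ?_
    rcases hkA.eq_or_lt with e | hlt
    · exact .inl e
    · have := hA (A - 1) (by omega) (by omega)
      rw [sub_add_cancel] at this
      exact .inr this.le
  -- By strict quasi-concavity the largest distance is attained at `A` and at most once more, at `A
  -- + 1`.
  have key : ∀ i : ℤ, k ≤ i → i ≤ j + n → far (vert v j) (vert v k) (vert v A) ≤
      far (vert v j) (vert v k) (vert v i) → i = A ∨ (i = A + 1 ∧
        far (vert v j) (vert v k) (vert v (A + 1)) = far (vert v j) (vert v k) (vert v A)) := by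
    intro i h1 h2 h3
    rcases lt_trichotomy i A with h4 | h4 | h4
    · have := hA i h1 h4
      linarith [glob (i + 1)]
    · exact .inl h4
    · rcases (show A + 1 ≤ i by omega).eq_or_lt with h5 | h5
      · subst h5
        exact .inr ⟨rfl, le_antisymm halt h3⟩
      · rcases h.quasi hjk hkA (show A < A + 1 by omega) h5 h2 with h6 | h6 <;> linarith [glob (A + 1)]
  obtain ⟨l, hl, e1, e2⟩ := exists_param (vert v) x
  have mi : ∀ i : ℤ, far (vert v j) (vert v k) (vert v i) ≤
      far (vert v j) (vert v k) (curve (vert v) x) := fun i => by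
    rw [← curve_int (vert v) i]; exact mx i
  rcases Int.emod_two_eq_zero_or_one (unitOf x) with he | ho
  · have ex := unitOf_even (x := x) (i := unitOf x / 2) (by omega)
    have b1 : k < unitOf x / 2 := by rw [ex] at hx; exact_mod_cast hx
    have b2 : unitOf x / 2 < j + n := by rw [ex] at hx'; exact_mod_cast hx'
    have m1 := mx A
    rw [ex, curve_int, curve_int] at m1
    rcases key _ b1.le b2.le m1 with h1 | ⟨h1, h2⟩
    · left; omega
    · right; exact ⟨h2, by omega⟩
  · obtain ⟨b1, b2⟩ := unitOf_odd (x := x) (i := unitOf x / 2) (by omega)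
    have c1 : k < unitOf x / 2 + 1 := by
      have : (k : ℝ) < ((unitOf x / 2 + 1 : ℤ) : ℝ) := by push_cast; linarith
      exact_mod_cast this
    have c2 : unitOf x / 2 < j + n := by
      have : ((unitOf x / 2 : ℤ) : ℝ) < ((j + n : ℤ) : ℝ) := by push_cast at *; linarith
      exact_mod_cast this
    rw [← e1] at mx mi
    obtain ⟨q1, q2⟩ := edge_eq_of_max ho hl mi
    have m1 := mx A
    rw [curve_int, q2] at m1
    have m2 := m1
    rw [← q1] at m2
    have r1 := key _ (by omega) (by omega) m1
    have r2 := key _ (by omega) (by omega) m2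
    right
    rcases r1 with r1 | ⟨r1, -⟩
    · rcases r2 with r2 | ⟨r2, r3⟩
      · omega
      · exact ⟨r3, by omega⟩
    · omega

theorem vert_of_gen (h : ConvSeq n (vert v)) {j k : ℤ} (hjk : j < k) (hkj : k < j + n) {X : Point}
    (st : AllStable v X (vert v j) (vert v k)) : ∃ x : ℝ, X = curve (vert v) x ∧ (k : ℝ) < x ∧
      x < j + (n : ℤ) ∧ ∀ y, far (vert v j) (vert v k) (curve (vert v) y) ≤
        far (vert v j) (vert v k) (curve (vert v) x) := by
  obtain ⟨x, hx⟩ := (mem_boundary h).1 st.mem₁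
  have s' := st.rotate
  rw [hx, ← curve_int (vert v) j, ← curve_int (vert v) k] at s'
  obtain ⟨y, z, s⟩ := stab_of_allStable h s'
  have h1 : j < k + y * n := by exact_mod_cast s.lt₁
  have h2 : k + y * n < j + n := by exact_mod_cast s.lt₂.trans s.lt₃
  have hy : y = 0 := by
    have := h.three
    by_contra hne
    rcases lt_or_gt_of_ne hne with hy | hy
    · have : y * (n : ℤ) ≤ -1 * n := mul_le_mul_of_nonneg_right (by omega) (by omega)
      omega
    · have : 1 * (n : ℤ) ≤ y * n := mul_le_mul_of_nonneg_right (by omega) (by omega)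
      omega
  subst hy
  rw [Int.cast_zero, zero_mul, add_zero] at s
  have mx := s.max₃
  rw [curve_int, curve_int] at mx
  exact ⟨x + z * (n : ℤ), by rw [hx, h.curve_per_mul], s.lt₂, s.lt₃, mx⟩

/-- The part of `vertexPhase` that calls the gadget. -/
def vertexCalls : Cmd := block [
  .iset iG₁ (I iA + I iA),
  gadgetVV,
  when (.req (dist (I iJ) (I iK) (I iA + 1)) (dist (I iJ) (I iK) (I iA))) (block [
    .iset iG₁ (I iA + I iA + 1),
    gadgetVV,
    .iset iG₁ (I iA + I iA + 2),
    gadgetVV])]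

theorem vertexCalls_free : vertexCalls.loopFree = true := by decide
theorem vertexCalls_cost : vertexCalls.maxCost ≤ 30000 := by decide

theorem vertexCalls_run (h : ConvSeq n (vert v)) (m : Mem v σ) {j k A : ℤ} (hA : σ.ireg 4 = A)
    (hj : σ.ireg 13 = j) (hk : σ.ireg 14 = k) (h₂ : σ.ireg 23 = 2 * j) (h₃ : σ.ireg 24 = 2 * k) :
    Outs v σ (vertexCalls.run σ) ∧ ∀ x, (unitOf x = 2 * A ∨
      (far (vert v j) (vert v k) (vert v (A + 1)) = far (vert v j) (vert v k) (vert v A) ∧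
        (unitOf x = 2 * A + 1 ∨ unitOf x = 2 * A + 2))) →
      GenThreeStable v (curve (vert v) x) (vert v j) (vert v k) →
        coords (curve (vert v) x) (vert v j) (vert v k) ∈ (vertexCalls.run σ).out := by
  have hn : 0 < n := by have := h.three; omega
  have hrun : vertexCalls.run σ = Cmd.run (when (.req (dist (I iJ) (I iK) (I iA + 1))
      (dist (I iJ) (I iK) (I iA))) (block [.iset iG₁ (I iA + I iA + 1), gadgetVV,
        .iset iG₁ (I iA + I iA + 2), gadgetVV])) (gadgetVV.run (σ.iset 22 (2 * A))) := by
    have : (I iA + I iA).eval σ = 2 * A := by simp [hA]; ring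
    rw [← this]; rfl
  rw [hrun]
  have o0 := Outs.iset v σ (x := 22) le_rfl (2 * A)
  obtain ⟨em1, c1⟩ := gadgetVV_run h (m.outs o0) (g := 2 * A) (j := j) (k := k) (by simp)
    (by simp [h₂]) (by simp [h₃])
  obtain ⟨σ₁, h₁⟩ : ∃ σ₁, σ₁ = gadgetVV.run (σ.iset 22 (2 * A)) := ⟨_, rfl⟩
  rw [← h₁] at em1 c1 ⊢
  have o1 := o0.trans em1.outs
  have m1 := m.outs o1
  have a1 : σ₁.ireg 4 = A := (o1.ireg 4 (by norm_num)).trans hA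
  have j1 : σ₁.ireg 13 = j := (o1.ireg 13 (by norm_num)).trans hj
  have k1 : σ₁.ireg 14 = k := (o1.ireg 14 (by norm_num)).trans hk
  have g2 : σ₁.ireg 23 = 2 * j := by rw [em1.ireg]; simp [h₂]
  have g3 : σ₁.ireg 24 = 2 * k := by rw [em1.ireg]; simp [h₃]
  have hc : (BExp.req (dist (I iJ) (I iK) (I iA + 1)) (dist (I iJ) (I iK) (I iA))).eval σ₁ ↔
      far (vert v j) (vert v k) (vert v (A + 1)) = far (vert v j) (vert v k) (vert v A) := by
    rw [BExp.eval_req, m1.eval_dist hn, m1.eval_dist hn]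
    simp [a1, j1, k1]
  by_cases he : far (vert v j) (vert v k) (vert v (A + 1)) = far (vert v j) (vert v k) (vert v A)
  · rw [when, Cmd.run_ite_pos (hc.2 he)]
    have o2 := Outs.iset v σ₁ (x := 22) le_rfl (2 * A + 1)
    obtain ⟨em2, c2⟩ := gadgetVV_run h (m1.outs o2) (g := 2 * A + 1) (j := j) (k := k) (by simp)
      (by simp [g2]) (by simp [g3])
    obtain ⟨σ₂, hσ₂⟩ : ∃ σ₂, σ₂ = gadgetVV.run (σ₁.iset 22 (2 * A + 1)) := ⟨_, rfl⟩
    rw [← hσ₂] at em2 c2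
    have a2 : σ₂.ireg 4 = A := by rw [em2.ireg]; simp [a1]
    have o3 := Outs.iset v σ₂ (x := 22) le_rfl (2 * A + 2)
    obtain ⟨em3, c3⟩ := gadgetVV_run h ((m1.outs (o2.trans em2.outs)).outs o3) (g := 2 * A + 2)
      (j := j) (k := k) (by simp) (by simp [em2.ireg, g2]) (by simp [em2.ireg, g3])
    have hrun' : Cmd.run (block [.iset iG₁ (I iA + I iA + 1), gadgetVV,
        .iset iG₁ (I iA + I iA + 2), gadgetVV]) σ₁ = gadgetVV.run (σ₂.iset 22 (2 * A + 2)) := by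
      have e1 : (I iA + I iA + 1).eval σ₁ = 2 * A + 1 := by simp [a1]; ring
      have e2 : (I iA + I iA + 2).eval σ₂ = 2 * A + 2 := by simp [a2]; ring
      rw [← e2, hσ₂, ← e1]; rfl
    rw [hrun']
    refine ⟨o1.trans (o2.trans (em2.outs.trans (o3.trans em3.outs))), ?_⟩
    rintro x (hx | ⟨-, hx | hx⟩) gen
    · exact em3.keep _ (em2.keep _ (c1 x hx gen))
    · exact em3.keep _ (c2 x hx gen)
    · exact c3 x hx gen
  · rw [when, Cmd.run_ite_neg (mt hc.1 he)]
    refine ⟨o1, ?_⟩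
    rintro x (hx | ⟨h, -⟩) gen
    · exact c1 x hx gen
    · exact absurd h he

end

/-- The strictly increasing part of the distances extends at least to `A`. -/
def UpTo (n : ℤ) (V : ℤ → Point) (j k A : ℤ) : Prop :=
  A < j + n ∧ ∀ i, k ≤ i → i < A → far (V j) (V k) (V i) < far (V j) (V k) (V (i + 1))

/-- Strict increases survive when the chord moves clockwise, so a pointer that has not passed the
first farthest vertex of one chord has not passed that of a later chord. -/
theorem UpTo.next {n : ℤ} {V : ℤ → Point} (h : ConvSeq n V) {j k j' k' A : ℤ} (u : UpTo n V j k A)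
    (hj : j ≤ j') (hk : k ≤ k') (hjk : j < k) (hjk' : j' < k') : UpTo n V j' k' A := by
  obtain ⟨u1, u2⟩ := u
  exact ⟨by omega, fun i h1 h2 => h.far_step_lt (by omega) hj hk hjk hjk' h1 (u2 i (by omega) h2)⟩

/-- The climb from `A` to the first farthest vertex. -/
theorem UpTo.climb {n : ℤ} {V : ℤ → Point} (h : ConvSeq n V) {j k A : ℤ} (hjk : j < k)
    (hkj : k < j + n) (u : UpTo n V j k A) : ∃ A', max A k ≤ A' ∧ UpTo n V j k A' ∧
      ¬ far (V j) (V k) (V A') < far (V j) (V k) (V (A' + 1)) := by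
  obtain ⟨u1, u2⟩ := u
  have hM : ¬ far (V j) (V k) (V (j + n - 1)) < far (V j) (V k) (V (j + n - 1 + 1)) := by
    rw [sub_add_cancel, h.per, far_self_outer, not_lt]
    exact h.nonneg (by omega) (by omega) (by omega)
  obtain ⟨A', a1, a2, a3, a4⟩ := least_stop (fun i => far (V j) (V k) (V i) <
    far (V j) (V k) (V (i + 1))) (show max A k ≤ j + n - 1 by omega) hM
  refine ⟨A', a1, ⟨by omega, fun i h1 h2 => ?_⟩, a3⟩
  by_cases hi : i < A
  · exact u2 i h1 hi
  · exact a4 i (by omega) h2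

section
variable {n : ℕ} {v : Fin n → Point}

/-- By `ptr` the single pointer `A` is a valid start for every vertex pair still to come. -/
structure VertexInv (v : Fin n → Point) (σ₀ σ : State) : Prop where
  mem : Mem v σ
  len : σ.ireg 12 = σ₀.ireg 12
  iarr : σ.iarr = σ₀.iarr
  low : 0 ≤ σ.ireg 15
  high : σ.ireg 15 ≤ σ₀.ireg 12
  keep : ∀ T ∈ σ₀.out, T ∈ σ.out
  sound : ∀ T ∈ σ.out, T ∈ σ₀.out ∨ IsGenOut v T
  bound : σ.ireg 4 ≤ 5 * n
  done : ∀ m, 0 ≤ m → m < σ.ireg 15 → ∀ j k, σ₀.iarr 0 m = 2 * j → σ₀.iarr 1 m = 2 * k →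
    ∀ X, GenThreeStable v X (vert v j) (vert v k) → coords X (vert v j) (vert v k) ∈ σ.out
  ptr : ∀ m, σ.ireg 15 ≤ m → m < σ₀.ireg 12 → ∀ j k, σ₀.iarr 0 m = 2 * j → σ₀.iarr 1 m = 2 * k →
    UpTo n (vert v) j k (σ.ireg 4)

/-- Both indices of the visited pairs are nondecreasing, so one pointer to the first farthest vertex
serves all of them. Each pair pays a constant, and each step of the pointer, which stays below `5n`,
pays for itself. -/
theorem vertexPhase_spec (h : ConvSeq n (vert v)) {σ₀ : State} (m₀ : Mem v σ₀)
    (vis : Visited n σ₀) (hlen : σ₀.ireg 12 ≤ 4 * n) :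
    Runs vertexPhase σ₀ (300000 * n) (fun _ σ => VertexInv v σ₀ σ ∧ σ.ireg 15 = σ₀.ireg 12) := by
  have hn := h.three
  refine Runs.split 2 (by decide) (by decide) ?_
  refine Runs.step 10 rfl (by decide) (by omega) ?_
  change Runs (.loop _ _) ((σ₀.iset 4 0).iset 15 0) _ _
  have inv₀ : VertexInv v σ₀ ((σ₀.iset 4 0).iset 15 0) := by
    refine ⟨(m₀.iset (by norm_num) 0).iset (by norm_num) 0, by simp, rfl, by simp,
      by simpa using vis.len, fun _ h => h, fun _ h => .inl h, by simp, fun m h1 h2 => ?_, ?_⟩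
    · simp at h2; omega
    · intro m h1 h2 j k hj hk
      have h1 : 0 ≤ m := by simpa using h1
      obtain ⟨g1, g2, g3, g4⟩ := vis.good m h1 h2
      have : ((σ₀.iset 4 0).iset 15 0).ireg 4 = 0 := by simp
      rw [this]
      exact ⟨by omega, fun i h3 h4 => by omega⟩
  refine Runs.loop (fun p σ => VertexInv v σ₀ σ ∧
    50000 * (σ₀.ireg 12 - σ.ireg 15) + 300 * (5 * n - σ.ireg 4) + 500 ≤ (p : ℤ)) 10 (by decide)
    ?_ ?_ ⟨inv₀, by simp; omega⟩
  · rintro p σ ⟨inv, bud⟩ hb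
    have hM : σ.ireg 15 < σ₀.ireg 12 := by
      rw [← inv.len]; simpa using hb
    obtain ⟨M, eM⟩ : ∃ M, M = σ.ireg 15 := ⟨_, rfl⟩
    obtain ⟨inv1, inv2, inv3, inv4, inv5, inv6, inv7, inv8, inv9, inv10⟩ := inv
    rw [← eM] at inv4 inv5 inv9 inv10 hM bud
    obtain ⟨g1, g2, g3, g4⟩ := vis.good M inv4 hM
    obtain ⟨x, ex⟩ : ∃ x, x = σ₀.iarr 0 M := ⟨_, rfl⟩
    obtain ⟨y, ey⟩ : ∃ y, y = σ₀.iarr 1 M := ⟨_, rfl⟩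
    rw [← ex] at g1 g2 g3
    rw [← ey] at g2 g3 g4
    refine ⟨p - 10, by omega, ?_⟩
    refine Runs.split 2 (by decide) (by decide) ?_
    refine Runs.step 10 rfl (by decide) (by omega) ?_
    have e1 : Cmd.run (block (List.take 2 [Cmd.iset iG₂ (.arr aU₁ (I iM)),
        .iset iG₃ (.arr aU₂ (I iM))])) σ = (σ.iset 23 x).iset 24 y := by
      rw [ex, ey, ← inv3, eM]; rfl
    change Runs _ (Cmd.run (block (List.take 2 [Cmd.iset iG₂ (.arr aU₁ (I iM)),
        .iset iG₃ (.arr aU₂ (I iM))])) σ) _ _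
    rw [e1]
    obtain ⟨σ₁, h₁⟩ : ∃ σ₁, σ₁ = (σ.iset 23 x).iset 24 y := ⟨_, rfl⟩
    rw [← h₁]
    have o1 : Outs v σ σ₁ := by
      rw [h₁]
      exact (Outs.iset v σ (by norm_num) x).trans (Outs.iset v _ (by norm_num) y)
    refine Runs.split 1 (by decide) (by decide) ?_
    suffices H : Runs (when (.and (even (I iG₂)) (even (I iG₃))) (block [
        .iset iJ (I iG₂ / 2),
        .iset iK (I iG₃ / 2),
        when (.ilt (I iA) (I iK)) (.iset iA (I iK)),
        .loop (farther (I iJ) (I iK) (I iA + 1) (I iA)) (.iset iA (I iA + 1)),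
        .iset iG₁ (I iA + I iA),
        gadgetVV,
        when (.req (dist (I iJ) (I iK) (I iA + 1)) (dist (I iJ) (I iK) (I iA))) (block [
          .iset iG₁ (I iA + I iA + 1),
          gadgetVV,
          .iset iG₁ (I iA + I iA + 2),
          gadgetVV])])) σ₁ (p - 10 - 10) (fun p' σ' =>
          VertexInv v σ₀ (σ'.iset 15 (M + 1)) ∧ σ'.ireg 15 = M ∧
          50000 * (σ₀.ireg 12 - (M + 1)) + 300 * (5 * n - σ'.ireg 4) + 1000 ≤ (p' : ℤ)) by
      refine Runs.mono H fun p' σ' ⟨i', r', b'⟩ => ?_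
      have b4 : σ'.ireg 4 ≤ 5 * n := by have := i'.bound; simpa using this
      refine Runs.step 10 rfl (by decide) (by omega) ?_
      have : Cmd.run (block (List.drop 1 [Cmd.skip, .iset iM (I iM + 1)])) σ' =
          σ'.iset 15 (M + 1) := by rw [← r']; rfl
      change VertexInv v σ₀ (Cmd.run (block (List.drop 1 [Cmd.skip, .iset iM (I iM + 1)])) σ') ∧
        50000 * (σ₀.ireg 12 - (Cmd.run (block (List.drop 1 [Cmd.skip, .iset iM (I iM + 1)]))
          σ').ireg 15) + 300 * (5 * n - (Cmd.run (block (List.drop 1 [Cmd.skip,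
          .iset iM (I iM + 1)])) σ').ireg 4) + 500 ≤ _
      rw [this]
      refine ⟨i', ?_⟩
      rw [show (σ'.iset 15 (M + 1)).ireg 15 = M + 1 by simp,
        show (σ'.iset 15 (M + 1)).ireg 4 = σ'.ireg 4 by simp]
      omega
    have hcond : (BExp.and (even (I iG₂)) (even (I iG₃))).eval σ₁ ↔ x % 2 = 0 ∧ y % 2 = 0 := by
      simp [h₁]
    have r4 : σ₁.ireg 4 = σ.ireg 4 := o1.ireg 4 (by norm_num)
    refine Runs.when 20 (by decide) (p - 40) (by omega) (fun hc => ?_) (fun hc => ?_)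
    · rw [hcond] at hc
      obtain ⟨j, hj⟩ : ∃ j, x = 2 * j := ⟨x / 2, by omega⟩
      obtain ⟨k, hk⟩ : ∃ k, y = 2 * k := ⟨y / 2, by omega⟩
      have up := inv10 M le_rfl hM j k (by omega) (by omega)
      obtain ⟨A', a1, a2, a3⟩ := up.climb h (by omega) (by omega)
      refine Runs.split 3 (by decide) (by decide) ?_
      refine Runs.step 50 rfl (by decide) (by omega) ?_
      obtain ⟨σ₂, h₂⟩ : ∃ σ₂, σ₂ = Cmd.run (block (List.take 3 [Cmd.iset iJ (I iG₂ / 2),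
        .iset iK (I iG₃ / 2), when (.ilt (I iA) (I iK)) (.iset iA (I iK))])) σ₁ := ⟨_, rfl⟩
      change Runs _ (Cmd.run (block (List.take 3 [Cmd.iset iJ (I iG₂ / 2),
        .iset iK (I iG₃ / 2), when (.ilt (I iA) (I iK)) (.iset iA (I iK))])) σ₁) _ _
      rw [← h₂]
      have f2 : σ₂ = ((σ₁.iset 13 j).iset 14 k).iset 4 (max (σ.ireg 4) k) := by
        have hj' : (I iG₂ / 2).eval σ₁ = j := by simp [h₁]; omega
        have hk' : (I iG₃ / 2).eval (σ₁.iset 13 j) = k := by simp [h₁]; omega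
        have step : σ₂ = Cmd.run (when (.ilt (I iA) (I iK)) (.iset iA (I iK)))
            ((σ₁.iset 13 j).iset 14 k) := by
          rw [h₂, ← hk', ← hj']; rfl
        rw [step]
        by_cases hlt : σ.ireg 4 < k
        · rw [when, Cmd.run_ite_pos (by simpa [r4] using hlt), max_eq_right hlt.le]
          simp [Cmd.run]
        · rw [when, Cmd.run_ite_neg (by simpa [r4] using hlt), max_eq_left (by omega), ← r4]
          have : ((σ₁.iset 13 j).iset 14 k).ireg 4 = σ₁.ireg 4 := by simp
          rw [← this, State.iset_self]
          rfl
      have m₂ : Mem v σ₂ := by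
        rw [f2]
        exact (((inv1.outs o1).iset (by norm_num) _).iset (by norm_num) _).iset (by norm_num) _
      have i4 : σ₂.ireg 4 = max (σ.ireg 4) k := by rw [f2]; simp
      have i13 : σ₂.ireg 13 = j := by rw [f2]; simp
      have i14 : σ₂.ireg 14 = k := by rw [f2]; simp
      refine Runs.split 1 (by decide) (by decide) ?_
      refine Runs.scan (x := iA) (fun i => far (vert v j) (vert v k) (vert v i) <
        far (vert v j) (vert v k) (vert v (i + 1))) 150 (by decide) ?_ (a' := A')
        (by rw [show iA = 4 from rfl, i4]; exact a1)
        (by rw [show iA = 4 from rfl, i4]; exact fun i h1 h2 => a2.2 i (by omega) h2) a3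
        (by rw [show iA = 4 from rfl, i4]; have := a2.1; omega) ?_
      · intro z
        rw [(m₂.iset (x := iA) (by norm_num) z).eval_farther (by omega)]
        simp [i13, i14]
      intro p' hp'
      rw [show iA = 4 from rfl, i4] at hp'
      refine Runs.step (c := vertexCalls) 30000 vertexCalls_free vertexCalls_cost
        (by have := a2.1; omega) ?_
      have m₃ : Mem v (σ₂.iset iA A') := m₂.iset (by norm_num) A'
      obtain ⟨o3, comp⟩ := vertexCalls_run h m₃ (j := j) (k := k) (A := A') (by simp)
        (by simp [i13]) (by simp [i14]) (by simp [f2, h₁, hj]) (by simp [f2, h₁, hk])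
      obtain ⟨σ₄, h₄⟩ : ∃ σ₄, σ₄ = vertexCalls.run (σ₂.iset iA A') := ⟨_, rfl⟩
      rw [← h₄] at o3 comp ⊢
      have r4' : σ₄.ireg 4 = A' := by rw [o3.ireg 4 (by norm_num)]; simp
      have out₂ : (σ₂.iset iA A').out = σ.out := by rw [f2, h₁]; rfl
      have arr₄ : σ₄.iarr = σ₀.iarr := by rw [o3.iarr, f2, h₁]; exact inv3
      have keep₄ : ∀ T ∈ σ.out, T ∈ σ₄.out := fun T hT => o3.keep T (by rw [out₂]; exact hT)
      refine ⟨⟨(m₃.outs o3).iset (by norm_num) _, ?_, arr₄, ?_, ?_, ?_, ?_, ?_, ?_, ?_⟩, ?_, ?_⟩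
      · rw [State.iset_ireg, if_neg (by norm_num), o3.ireg 12 (by norm_num), ← inv2]
        simp [f2, h₁]
      · rw [State.iset_ireg, if_pos rfl]; omega
      · rw [State.iset_ireg, if_pos rfl]; omega
      · exact fun T hT => keep₄ T (inv6 T hT)
      · intro T hT
        rcases o3.sound T hT with hT | hT
        · rw [out₂] at hT; exact inv7 T hT
        · exact .inr hT
      · rw [State.iset_ireg, if_neg (by norm_num), r4']
        have := a2.1
        omega
      · intro m hm0 hm1 j' k' ej ek X gen
        rw [State.iset_ireg, if_pos rfl] at hm1
        by_cases hm : m = M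
        · subst hm
          obtain rfl : j' = j := by omega
          obtain rfl : k' = k := by omega
          obtain ⟨x', rfl, b1, b2, mx⟩ := vert_of_gen h (by omega) (by omega) gen.1
          exact comp x' (unit_of_max h (by omega) a2.2 (by omega) a2.1 (not_lt.1 a3) b1 b2 mx) gen
        · exact keep₄ _ (inv9 m hm0 (by omega) j' k' ej ek X gen)
      · intro m hm0 hm1 j' k' ej ek
        rw [State.iset_ireg, if_pos rfl] at hm0
        rw [State.iset_ireg, if_neg (by norm_num), r4']
        obtain ⟨q1, q2⟩ := vis.mono inv4 (show M ≤ m by omega) hm1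
        obtain ⟨q3, q4, q5, q6⟩ := vis.good m (by omega) hm1
        exact a2.next h (by omega) (by omega) (by omega) (by omega)
      · rw [o3.ireg 15 (by norm_num), eM]; simp [f2, h₁]
      · rw [r4']
        have := a2.1
        omega
    · rw [hcond] at hc
      have keep₁ := o1.keep
      refine ⟨⟨(inv1.outs o1).iset (by norm_num) _, ?_, o1.iarr.trans inv3, ?_, ?_, ?_, ?_, ?_, ?_,
        ?_⟩, ?_, ?_⟩
      · rw [State.iset_ireg, if_neg (by norm_num), o1.ireg 12 (by norm_num), ← inv2]
      · rw [State.iset_ireg, if_pos rfl]; omega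
      · rw [State.iset_ireg, if_pos rfl]; omega
      · exact fun T hT => keep₁ T (inv6 T hT)
      · intro T hT
        rcases o1.sound T hT with hT | hT
        · exact inv7 T hT
        · exact .inr hT
      · rw [State.iset_ireg, if_neg (by norm_num), r4]; exact inv8
      · intro m hm0 hm1 j' k' ej ek X gen
        rw [State.iset_ireg, if_pos rfl] at hm1
        by_cases hm : m = M
        · subst hm
          exact absurd ⟨by omega, by omega⟩ hc
        · exact keep₁ _ (inv9 m hm0 (by omega) j' k' ej ek X gen)
      · intro m hm0 hm1 j' k' ej ek
        rw [State.iset_ireg, if_pos rfl] at hm0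
        rw [State.iset_ireg, if_neg (by norm_num), r4]
        exact inv10 m (by omega) hm1 j' k' ej ek
      · rw [o1.ireg 15 (by norm_num), eM]
      · rw [r4]
        omega
  · rintro p σ ⟨inv, bud⟩ hb
    have hM : ¬ σ.ireg 15 < σ₀.ireg 12 := by
      rw [← inv.len]; simpa using hb
    have := inv.high
    have := inv.bound
    exact ⟨0, by omega, inv, by omega⟩

end

/-! ### The list of the visited edge pairs. -/

theorem Visited.sum_lt {n : ℤ} {σ : State} (h : Visited n σ) {m m' : ℤ} (h₀ : 0 ≤ m) (hm : m < m')
    (hl : m' < σ.ireg 12) : σ.iarr 0 m + σ.iarr 1 m < σ.iarr 0 m' + σ.iarr 1 m' := by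
  obtain ⟨d, rfl⟩ : ∃ d : ℕ, m' = m + 1 + d := ⟨(m' - m - 1).toNat, by omega⟩
  induction d with
  | zero =>
    rw [Nat.cast_zero, add_zero] at hl ⊢
    rcases h.step m h₀ hl with ⟨h1, h2⟩ | ⟨h1, h2⟩ <;> omega
  | succ d ih =>
    have := ih (by omega) (by omega)
    rw [Nat.cast_succ, ← add_assoc] at hl ⊢
    rcases h.step (m + 1 + d) (by omega) hl with ⟨h1, h2⟩ | ⟨h1, h2⟩ <;> omega

/-- The listed pairs of edges move forward. -/
structure EdgeList (n : ℤ) (σ : State) : Prop where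
  num : 0 ≤ σ.ireg 16
  good : ∀ m, 0 ≤ m → m < σ.ireg 16 → 0 ≤ σ.iarr 2 m ∧ σ.iarr 2 m < σ.iarr 3 m ∧
    σ.iarr 3 m + 2 ≤ σ.iarr 2 m + n ∧ σ.iarr 3 m ≤ 3 * n
  step : ∀ m, 0 ≤ m → m + 1 < σ.ireg 16 → σ.iarr 2 m ≤ σ.iarr 2 (m + 1) ∧
    σ.iarr 3 m ≤ σ.iarr 3 (m + 1) ∧ (σ.iarr 2 m < σ.iarr 2 (m + 1) ∨ σ.iarr 3 m < σ.iarr 3 (m + 1))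

theorem EdgeList.mono {n : ℤ} {σ : State} (h : EdgeList n σ) {m m' : ℤ} (h₀ : 0 ≤ m) (hm : m ≤ m')
    (hl : m' < σ.ireg 16) : σ.iarr 2 m ≤ σ.iarr 2 m' ∧ σ.iarr 3 m ≤ σ.iarr 3 m' ∧
      (m < m' → σ.iarr 2 m < σ.iarr 2 m' ∨ σ.iarr 3 m < σ.iarr 3 m') := by
  obtain ⟨d, rfl⟩ : ∃ d : ℕ, m' = m + d := ⟨(m' - m).toNat, by omega⟩
  induction d with
  | zero => rw [Nat.cast_zero, add_zero]; exact ⟨le_rfl, le_rfl, fun h => absurd h (lt_irrefl _)⟩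
  | succ d ih =>
    obtain ⟨h1, h2, -⟩ := ih (by omega) (by omega)
    rw [Nat.cast_succ, ← add_assoc] at hl ⊢
    obtain ⟨h3, h4, h5⟩ := h.step (m + d) (by omega) hl
    exact ⟨by omega, by omega, fun _ => by omega⟩

/-- Here `M` counts the visited pairs already inspected. `source` lets the list inherit the order
and the gaps of the visited pairs, and `all` states that nothing is lost. -/
structure Collected (n : ℤ) (σ₀ : State) (M : ℤ) (σ : State) : Prop where
  ireg : ∀ x, x < 15 → σ.ireg x = σ₀.ireg x
  rarr : σ.rarr = σ₀.rarr
  out : σ.out = σ₀.out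
  keep : ∀ m, σ.iarr 0 m = σ₀.iarr 0 m ∧ σ.iarr 1 m = σ₀.iarr 1 m
  list : EdgeList n σ
  len : σ.ireg 16 ≤ M
  source : ∀ e, 0 ≤ e → e < σ.ireg 16 → ∃ m, 0 ≤ m ∧ m < M ∧
    σ₀.iarr 0 m = 2 * σ.iarr 2 e + 1 ∧ σ₀.iarr 1 m = 2 * σ.iarr 3 e + 1
  all : ∀ m, 0 ≤ m → m < M → ∀ j k, σ₀.iarr 0 m = 2 * j + 1 → σ₀.iarr 1 m = 2 * k + 1 →
    ∃ e, 0 ≤ e ∧ e < σ.ireg 16 ∧ σ.iarr 2 e = j ∧ σ.iarr 3 e = k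

def storeEdges : Cmd := block [
  .istore aEJ (I iNumE) (.arr aU₁ (I iM) / 2),
  .istore aEK (I iNumE) (.arr aU₂ (I iM) / 2),
  .iset iNumE (I iNumE + 1)]

theorem collect_step {n : ℤ} {σ₀ σ : State} (vis : Visited n σ₀) {M : ℤ} (hM₀ : 0 ≤ M)
    (hM : M < σ₀.ireg 12) (h : Collected n σ₀ M σ) (hσ : σ.ireg 15 = M) :
    Collected n σ₀ (M + 1) (Cmd.run (when (.and (odd (.arr aU₁ (I iM))) (odd (.arr aU₂ (I iM))))
      storeEdges) σ) ∧ (Cmd.run (when (.and (odd (.arr aU₁ (I iM))) (odd (.arr aU₂ (I iM))))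
      storeEdges) σ).ireg 15 = M := by
  obtain ⟨k1, k2⟩ := h.keep M
  obtain ⟨g1, g2, g3, g4⟩ := vis.good M hM₀ hM
  have hc : (BExp.and (odd (.arr aU₁ (I iM))) (odd (.arr aU₂ (I iM)))).eval σ ↔
      σ₀.iarr 0 M % 2 = 1 ∧ σ₀.iarr 1 M % 2 = 1 := by
    simp [hσ, k1, k2]
  by_cases ho : σ₀.iarr 0 M % 2 = 1 ∧ σ₀.iarr 1 M % 2 = 1
  · obtain ⟨j, hj⟩ : ∃ j, σ₀.iarr 0 M = 2 * j + 1 := ⟨σ₀.iarr 0 M / 2, by omega⟩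
    obtain ⟨k, hk⟩ : ∃ k, σ₀.iarr 1 M = 2 * k + 1 := ⟨σ₀.iarr 1 M / 2, by omega⟩
    obtain ⟨N, hN⟩ : ∃ N, N = σ.ireg 16 := ⟨_, rfl⟩
    obtain ⟨σ', h'⟩ : ∃ σ', σ' = ((σ.istore 2 N j).istore 3 N k).iset 16 (N + 1) := ⟨_, rfl⟩
    have e : Cmd.run (when (.and (odd (.arr aU₁ (I iM))) (odd (.arr aU₂ (I iM))))
        storeEdges) σ = σ' := by
      rw [when, Cmd.run_ite_pos (hc.2 ho), h']
      have e1 : (IExp.arr aU₁ (I iM) / 2).eval σ = j := by simp [hσ, k1, hj]; omega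
      have e2 : (IExp.arr aU₂ (I iM) / 2).eval (σ.istore 2 N j) = k := by simp [hσ, k2, hk]; omega
      rw [← e2, ← e1, hN]; rfl
    rw [e]
    have r : ∀ x, x ≠ 16 → σ'.ireg x = σ.ireg x := fun x hx => by simp [h', hx]
    have r16 : σ'.ireg 16 = N + 1 := by simp [h']
    have a2 : ∀ m, σ'.iarr 2 m = if m = N then j else σ.iarr 2 m := fun m => by simp [h']
    have a3 : ∀ m, σ'.iarr 3 m = if m = N then k else σ.iarr 3 m := fun m => by simp [h']
    obtain ⟨c1, c2, c3, c4, ⟨c5, c6, c7⟩, c8, c9, c10⟩ := h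
    rw [← hN] at c5 c6 c7 c8 c9 c10
    have src : ∀ e, 0 ≤ e → e < N + 1 → ∃ m, 0 ≤ m ∧ m < M + 1 ∧
        σ₀.iarr 0 m = 2 * σ'.iarr 2 e + 1 ∧ σ₀.iarr 1 m = 2 * σ'.iarr 3 e + 1 := by
      intro e h1 h2
      rw [a2, a3]
      by_cases he : e = N
      · rw [if_pos he, if_pos he]; exact ⟨M, hM₀, by omega, hj, hk⟩
      · rw [if_neg he, if_neg he]
        obtain ⟨m, q1, q2, q3⟩ := c9 e h1 (by omega)
        exact ⟨m, q1, by omega, q3⟩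
    refine ⟨⟨fun x hx => by rw [r x (by omega), c1 x hx], by rw [h']; exact c2, by rw [h']; exact c3,
      fun m => by simpa [h'] using c4 m, ⟨by omega, ?_, ?_⟩, by omega, by rwa [r16], ?_⟩,
      by rw [r 15 (by norm_num), hσ]⟩
    · intro m h1 h2
      obtain ⟨q, q1, q2, q3, q4⟩ := src m h1 (by omega)
      obtain ⟨p1, p2, p3, p4⟩ := vis.good q q1 (by omega)
      omega
    · intro m h1 h2
      by_cases he : m + 1 = N
      · obtain ⟨q, q1, q2, q3, q4⟩ := c9 m h1 (by omega)
        obtain ⟨p1, p2⟩ := vis.mono q1 q2.le hM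
        have p3 := vis.sum_lt q1 q2 hM
        rw [a2, a3, a2, a3, if_pos he, if_pos he, if_neg (by omega), if_neg (by omega)]
        omega
      · rw [a2, a3, a2, a3, if_neg he, if_neg he, if_neg (by omega), if_neg (by omega)]
        exact c7 m h1 (by omega)
    · intro m h1 h2 j' k' hj' hk'
      by_cases hm : m = M
      · subst hm
        exact ⟨N, c5, by omega, by rw [a2, if_pos rfl]; omega, by rw [a3, if_pos rfl]; omega⟩
      · obtain ⟨e, q1, q2, q3, q4⟩ := c10 m h1 (by omega) j' k' hj' hk'
        exact ⟨e, q1, by omega, by rw [a2, if_neg (by omega), q3],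
          by rw [a3, if_neg (by omega), q4]⟩
  · rw [when, Cmd.run_ite_neg (mt hc.1 ho)]
    change Collected n σ₀ (M + 1) σ ∧ σ.ireg 15 = M
    obtain ⟨c1, c2, c3, c4, c5, c8, c9, c10⟩ := h
    refine ⟨⟨c1, c2, c3, c4, c5, by omega, fun e h1 h2 => ?_, fun m h1 h2 j k hj hk => ?_⟩, hσ⟩
    · obtain ⟨m, q1, q2, q3⟩ := c9 e h1 h2
      exact ⟨m, q1, by omega, q3⟩
    · refine c10 m h1 ?_ j k hj hk
      by_contra hm
      obtain rfl : m = M := by omega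
      exact ho ⟨by omega, by omega⟩

theorem collectEdgePairs_spec {n : ℕ} (hn : 3 ≤ n) {σ₀ : State} (vis : Visited n σ₀)
    (hlen : σ₀.ireg 12 ≤ 4 * n) :
    Runs collectEdgePairs σ₀ (1000 * n) (fun _ σ => Collected n σ₀ (σ₀.ireg 12) σ) := by
  refine Runs.split 2 (by decide) (by decide) ?_
  refine Runs.step 10 rfl (by decide) (by omega) ?_
  change Runs (.loop _ _) ((σ₀.iset 16 0).iset 15 0) _ _
  refine Runs.loop_free (fun p σ => Collected n σ₀ (σ.ireg 15) σ ∧ 0 ≤ σ.ireg 15 ∧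
    σ.ireg 15 ≤ σ₀.ireg 12 ∧ 200 * (σ₀.ireg 12 - σ.ireg 15) + 200 ≤ (p : ℤ)) 200 rfl (by decide)
    ?_ ?_ ?_
  · rintro p σ ⟨c, h0, h1, bud⟩ hb
    have hM : σ.ireg 15 < σ₀.ireg 12 := by rw [← c.ireg 12 (by norm_num)]; simpa using hb
    obtain ⟨M, eM⟩ : ∃ M, M = σ.ireg 15 := ⟨_, rfl⟩
    rw [← eM] at c h0 h1 bud hM
    obtain ⟨c', e'⟩ := collect_step vis h0 hM c eM.symm
    obtain ⟨σ', h'⟩ : ∃ σ', σ' = Cmd.run (when (.and (odd (.arr aU₁ (I iM))) (odd (.arr aU₂ (I iM))))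
      storeEdges) σ := ⟨_, rfl⟩
    rw [← h'] at c' e'
    refine ⟨p - 200, by omega, ?_⟩
    have : Cmd.run (block [when (.and (odd (.arr aU₁ (I iM))) (odd (.arr aU₂ (I iM)))) storeEdges,
        .iset iM (I iM + 1)]) σ = σ'.iset 15 (M + 1) := by rw [← e', h']; rfl
    change Collected n σ₀ ((Cmd.run (block [when (.and (odd (.arr aU₁ (I iM)))
      (odd (.arr aU₂ (I iM)))) storeEdges, .iset iM (I iM + 1)]) σ).ireg 15) (Cmd.run (block
      [when (.and (odd (.arr aU₁ (I iM))) (odd (.arr aU₂ (I iM)))) storeEdges,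
        .iset iM (I iM + 1)]) σ) ∧ 0 ≤ (Cmd.run (block [when (.and (odd (.arr aU₁ (I iM)))
      (odd (.arr aU₂ (I iM)))) storeEdges, .iset iM (I iM + 1)]) σ).ireg 15 ∧ (Cmd.run (block
      [when (.and (odd (.arr aU₁ (I iM))) (odd (.arr aU₂ (I iM)))) storeEdges,
        .iset iM (I iM + 1)]) σ).ireg 15 ≤ _ ∧ 200 * (_ - (Cmd.run (block [when (.and (odd
      (.arr aU₁ (I iM))) (odd (.arr aU₂ (I iM)))) storeEdges, .iset iM (I iM + 1)]) σ).ireg 15) +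
      200 ≤ _
    rw [this, show (σ'.iset 15 (M + 1)).ireg 15 = M + 1 by simp]
    obtain ⟨c1, c2, c3, c4, ⟨c5, c6, c7⟩, c8, c9, c10⟩ := c'
    have r16 : (σ'.iset 15 (M + 1)).ireg 16 = σ'.ireg 16 := by simp
    refine ⟨⟨fun x hx => ?_, c2, c3, c4, ⟨by rwa [r16], by rwa [r16], by rwa [r16]⟩, by rwa [r16],
      by rwa [r16], by rwa [r16]⟩, by omega, by omega, by omega⟩
    rw [State.iset_ireg, if_neg (by omega), c1 x hx]
  · rintro p σ ⟨c, h0, h1, bud⟩ hb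
    have hM : ¬ σ.ireg 15 < σ₀.ireg 12 := by rw [← c.ireg 12 (by norm_num)]; simpa using hb
    rw [show σ.ireg 15 = σ₀.ireg 12 by omega] at c
    exact ⟨0, by omega, c⟩
  · refine ⟨⟨fun x hx => ?_, rfl, rfl, fun _ => ⟨rfl, rfl⟩, ⟨by simp, fun m h1 h2 => ?_,
      fun m h1 h2 => ?_⟩, by simp, fun m h1 h2 => ?_, fun m h1 h2 => ?_⟩, by simp,
      by simpa using vis.len, by simp; omega⟩
    · simp [show x ≠ 15 by omega, show x ≠ 16 by omega]
    · simp at h2; omega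
    · simp at h2; omega
    · simp at h2; omega
    · simp at h2; omega

/-! ### Stable triangles with two corners in edges -/

/-- A stable triangle with its first two corners in the edges `j` and `k`. -/
structure TwoEdges (n : ℤ) (V : ℤ → Point) (j k : ℤ) (b c a : ℝ) : Prop where
  stab : Stab n V b c a
  lt_b : (j : ℝ) < b
  b_lt : b < j + 1
  lt_c : (k : ℝ) < c
  c_lt : c < k + 1
  gap : j + 1 ≤ k
  gap' : k + 2 ≤ j + n

namespace TwoEdges
variable {n : ℤ} {V : ℤ → Point} {j k : ℤ} {b c a : ℝ}

theorem cast (t : TwoEdges n V j k b c a) : (j : ℝ) + 1 ≤ k ∧ (k : ℝ) + 2 ≤ j + n := by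
  constructor
  · exact_mod_cast t.gap
  · exact_mod_cast t.gap'

/-- A maximum in the interior of an edge makes the affine function constant on it. The side `pq` is
thus parallel to the edge, and its ends have equal height. -/
theorem level_of_max {V : ℤ → Point} {p q : Point} {m : ℤ} {x : ℝ} (h₁ : (m : ℝ) < x)
    (h₂ : x < m + 1) (hm : ∀ y, far p q (curve V y) ≤ far p q (curve V x)) :
    far (V m) (V (m + 1)) p = far (V m) (V (m + 1)) q := by
  have e := edge_value p q V m h₁.le h₂.le
  have e' := edge_value' p q V m h₁.le h₂.le
  have q1 := hm m
  have q2 := hm (m + 1 : ℤ)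
  rw [curve_int] at q1 q2
  have d := far_diff p q (V m) (V (m + 1))
  have p1 : 0 ≤ (x - m) * (far p q (V (m + 1)) - far p q (V m)) := by linarith
  have p2 : (m + 1 - x) * (far p q (V (m + 1)) - far p q (V m)) ≤ 0 := by linarith
  have p3 := nonneg_of_mul_nonneg_right p1 (by linarith)
  have p4 : far p q (V (m + 1)) - far p q (V m) ≤ 0 := by
    by_contra hc
    have := mul_pos (show 0 < (m : ℝ) + 1 - x by linarith) (not_le.1 hc)
    linarith
  linarith

theorem level_j (t : TwoEdges n V j k b c a) :
    far (V j) (V (j + 1)) (curve V c) = far (V j) (V (j + 1)) (curve V a) :=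
  level_of_max t.lt_b t.b_lt t.stab.max₁

theorem level_k (t : TwoEdges n V j k b c a) :
    far (V k) (V (k + 1)) (curve V a) = far (V k) (V (k + 1)) (curve V b) :=
  level_of_max t.lt_c t.c_lt t.stab.max₂

theorem pos_j (t : TwoEdges n V j k b c a) (h : ConvSeq n V) :
    0 < far (V j) (V (j + 1)) (curve V a) := by
  obtain ⟨g1, g2⟩ := t.cast
  rw [← t.level_j]
  exact h.height_pos (by linarith [t.lt_c]) (by linarith [t.c_lt])

theorem pos_k (t : TwoEdges n V j k b c a) (h : ConvSeq n V) :
    0 < far (V k) (V (k + 1)) (curve V a) := by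
  obtain ⟨g1, g2⟩ := t.cast
  rw [t.level_k, ← h.curve_per b]
  exact h.height_pos (by linarith [t.lt_b]) (by linarith [t.b_lt])

theorem lt_a (t : TwoEdges n V j k b c a) (h : ConvSeq n V) : (k : ℝ) + 1 < a := by
  by_contra hc
  have := t.pos_k h
  rw [ConvSeq.height_zero k (by linarith [t.stab.lt₂, t.lt_c]) (not_lt.1 hc)] at this
  exact lt_irrefl _ this

theorem a_lt (t : TwoEdges n V j k b c a) (h : ConvSeq n V) : a < j + n := by
  by_contra hc
  have := t.pos_j h
  rw [← h.curve_per_neg, ConvSeq.height_zero j (by linarith) (by linarith [t.stab.lt₃, t.b_lt])] at this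
  exact lt_irrefl _ this

/-- The edge vectors turn by less than a straight angle: for the triangle, the identity
`far_mul_det` reduces to a product of two positive heights. -/
theorem strip (t : TwoEdges n V j k b c a) (h : ConvSeq n V) :
    far (V j) (V (j + 1)) (V k) < far (V j) (V (j + 1)) (V (k + 1)) ∧
      far (V k) (V (k + 1)) (V (j + 1)) < far (V k) (V (k + 1)) (V j) := by
  have e := far_mul_det V j k (curve V b) (curve V c) (curve V a)
  rw [ConvSeq.height_zero j t.lt_b.le t.b_lt.le, ConvSeq.height_zero k t.lt_c.le t.c_lt.le, t.level_k, t.level_j,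
    ← t.level_k] at e
  have := t.stab.pos
  have p := mul_pos (t.pos_j h) (t.pos_k h)
  have d1 := det_ev_ev V j k
  have d2 := det_ev_ev' V j k
  have : 0 < -det (ev V j) (ev V k) := by
    by_contra hc
    have := mul_nonpos_of_nonneg_of_nonpos this.le (not_lt.1 hc)
    linarith
  constructor <;> linarith

/-- `A` has the height of `C`, and `C` is interior to the edge `k`, along which the height over `j`
strictly increases. -/
theorem in_strip_j (t : TwoEdges n V j k b c a) (h : ConvSeq n V) :
    far (V j) (V (j + 1)) (V k) < far (V j) (V (j + 1)) (curve V a) ∧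
      far (V j) (V (j + 1)) (curve V a) < far (V j) (V (j + 1)) (V (k + 1)) := by
  have e := edge_value (V j) (V (j + 1)) V k t.lt_c.le t.c_lt.le
  have e' := edge_value' (V j) (V (j + 1)) V k t.lt_c.le t.c_lt.le
  have s := sub_pos.2 (t.strip h).1
  have := mul_pos (sub_pos.2 t.lt_c) s
  have := mul_pos (sub_pos.2 t.c_lt) s
  rw [← t.level_j]
  constructor <;> linarith

theorem in_strip_k (t : TwoEdges n V j k b c a) (h : ConvSeq n V) :
    far (V k) (V (k + 1)) (V (j + 1)) < far (V k) (V (k + 1)) (curve V a) ∧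
      far (V k) (V (k + 1)) (curve V a) < far (V k) (V (k + 1)) (V j) := by
  have e := edge_value (V k) (V (k + 1)) V j t.lt_b.le t.b_lt.le
  have e' := edge_value' (V k) (V (k + 1)) V j t.lt_b.le t.b_lt.le
  have s := sub_pos.2 (t.strip h).2
  have := mul_pos (sub_pos.2 t.lt_b) s
  have := mul_pos (sub_pos.2 t.b_lt) s
  rw [t.level_k]
  constructor <;> linarith

/-- Heights over `j` agree at `c` and `a`. By quasi-concavity they are not smaller in between and
not larger after `a`; the lemmas for columns use the equal heights of `a` and `b` over `k` in the
same way. -/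
theorem row_before (t : TwoEdges n V j k b c a) (h : ConvSeq n V) {y : ℝ} (h₁ : (k : ℝ) + 1 ≤ y)
    (h₂ : y ≤ a) : far (V j) (V (j + 1)) (curve V a) ≤ far (V j) (V (j + 1)) (curve V y) := by
  obtain ⟨g1, g2⟩ := t.cast
  rcases h₂.eq_or_lt with rfl | h₂
  · exact le_rfl
  have e := t.level_j
  rcases h.height_quasi (p := j) (x := c) (y := y) (z := a) (by linarith [t.lt_c])
    (by linarith [t.c_lt]) h₂ (t.a_lt h).le with h1 | h1 | ⟨h1, h2⟩ <;> linarith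

theorem row_after (t : TwoEdges n V j k b c a) (h : ConvSeq n V) {y : ℝ} (h₁ : a ≤ y)
    (h₂ : y ≤ j + n) : far (V j) (V (j + 1)) (curve V y) ≤ far (V j) (V (j + 1)) (curve V a) := by
  obtain ⟨g1, g2⟩ := t.cast
  rcases h₁.eq_or_lt with rfl | h₁
  · exact le_rfl
  have e := t.level_j
  rcases h.height_quasi (p := j) (x := c) (y := a) (z := y) (by linarith [t.lt_c])
    t.stab.lt₂ h₁ h₂ with h1 | h1 | ⟨h1, h2⟩ <;> linarith

theorem column_before (t : TwoEdges n V j k b c a) (h : ConvSeq n V) {y : ℝ} (h₁ : (k : ℝ) + 1 ≤ y)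
    (h₂ : y ≤ a) : far (V k) (V (k + 1)) (curve V y) ≤ far (V k) (V (k + 1)) (curve V a) := by
  obtain ⟨g1, g2⟩ := t.cast
  rcases h₂.eq_or_lt with rfl | h₂
  · exact le_rfl
  have e := t.level_k
  rcases h.height_quasi (p := k) (x := y) (y := a) (z := b + n) h₁ h₂ t.stab.lt₃
    (by linarith [t.b_lt]) with h1 | h1 | ⟨h1, h2⟩
  · linarith
  · rw [h.curve_per] at h1; linarith
  · linarith

theorem column_after (t : TwoEdges n V j k b c a) (h : ConvSeq n V) {y : ℝ} (h₁ : a ≤ y)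
    (h₂ : y ≤ j + n) : far (V k) (V (k + 1)) (curve V a) ≤ far (V k) (V (k + 1)) (curve V y) := by
  obtain ⟨g1, g2⟩ := t.cast
  rcases h₁.eq_or_lt with rfl | h₁
  · exact le_rfl
  have e := t.level_k
  rcases h.height_quasi (p := k) (x := a) (y := y) (z := b + n) (t.lt_a h).le h₁
    (by linarith [t.lt_b]) (by linarith [t.b_lt]) with h1 | h1 | ⟨h1, h2⟩
  · linarith
  · rw [h.curve_per] at h1; linarith
  · linarith

/-- The third corner is not before the first farthest vertex. -/
theorem le_a (t : TwoEdges n V j k b c a) (h : ConvSeq n V) {A : ℤ} (u : UpTo n V j k A) :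
    (A : ℝ) ≤ a := by
  obtain ⟨g1, g2⟩ := t.cast
  by_contra hc
  push Not at hc
  obtain ⟨i, hi⟩ : ∃ i, i = ⌊a⌋ := ⟨_, rfl⟩
  have i1 : (i : ℝ) ≤ a := hi ▸ Int.floor_le a
  have i2 : a < i + 1 := hi ▸ Int.lt_floor_add_one a
  have i3 : k + 1 ≤ i := by
    rw [hi, Int.le_floor]; push_cast; exact (t.lt_a h).le
  have i4 : i < A := by
    have : (i : ℝ) < A := lt_of_le_of_lt i1 hc
    exact_mod_cast this
  have i5 : (k : ℝ) + 1 ≤ i := by exact_mod_cast i3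
  have u1 := u.1
  have i6 : (i : ℝ) + 1 ≤ j + n := by exact_mod_cast (show i + 1 ≤ j + n by omega)
  -- Over the edge `i` the vertex `j` is higher than `k`, because the distance from the chord still
  -- increases, while stability of `A` makes `B` not higher than `C`. In the order `j`, `B`, `k`,
  -- `C` this contradicts quasi-concavity.
  have up := u.2 i (by omega) i4
  have se := ConvSeq.step_eq V j k i
  have e := edge_value' (curve V b) (curve V c) V i i1 i2.le
  have mx := t.stab.max₃ (i + 1 : ℤ)
  rw [curve_int] at mx
  have d := far_diff (curve V b) (curve V c) (V i) (V (i + 1))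
  have le : far (V i) (V (i + 1)) (curve V b) ≤ far (V i) (V (i + 1)) (curve V c) := by
    by_contra hlt
    have := mul_pos (show 0 < (i : ℝ) + 1 - a by linarith) (show 0 < far (curve V b) (curve V c)
      (V (i + 1)) - far (curve V b) (curve V c) (V i) by linarith)
    linarith
  have q1 := h.height_anti (p := i) (x := j + n) (y := k + n) (z := c + n) (by linarith)
    (by linarith) (by linarith [t.lt_c]) (by linarith [t.c_lt])
  have q2 := h.height_quasi (p := i) (x := j + n) (y := b + n) (z := k + n) (by linarith)
    (by linarith [t.lt_b]) (by linarith [t.b_lt]) (by linarith)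
  simp only [h.curve_per, curve_int] at q1 q2
  have q3 := q1 (by linarith)
  rcases q2 with q | q | ⟨q, q'⟩ <;> linarith

/-- The third corner is not after the last farthest vertex. -/
theorem a_le (t : TwoEdges n V j k b c a) (h : ConvSeq n V) {j' k' A : ℤ} (hj : j < j')
    (hk : k < k') (hjk : j' < k') (hA : k' ≤ A)
    (halt : far (V j') (V k') (V (A + 1)) < far (V j') (V k') (V A)) : a ≤ A := by
  obtain ⟨g1, g2⟩ := t.cast
  by_contra hc
  push Not at hc
  obtain ⟨i, hi⟩ : ∃ i, i + 1 = ⌈a⌉ := ⟨⌈a⌉ - 1, by ring⟩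
  have i1 : (i : ℝ) < a := by
    have := Int.ceil_lt_add_one a
    rw [← hi] at this; push_cast at this; linarith
  have i2 : a ≤ i + 1 := by
    have := Int.le_ceil a
    rw [← hi] at this; push_cast at this; linarith
  have i3 : A ≤ i := by
    have : (A : ℝ) < i + 1 := by linarith
    exact Int.lt_add_one_iff.1 (by exact_mod_cast this)
  have i4 : i + 1 ≤ j + n := by
    rw [hi, Int.ceil_le]; push_cast; exact (t.a_lt h).le
  have i5 : (i : ℝ) + 1 ≤ j + n := by exact_mod_cast i4
  have i6 : (k' : ℝ) ≤ i := by exact_mod_cast hA.trans i3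
  have j1 : (j : ℝ) + 1 ≤ j' := by exact_mod_cast hj
  have k1 : (k : ℝ) + 1 ≤ k' := by exact_mod_cast hk
  have jk : (j' : ℝ) < k' := by exact_mod_cast hjk
  have down : far (V j') (V k') (V (i + 1)) < far (V j') (V k') (V i) := by
    rcases i3.eq_or_lt with rfl | i3
    · exact halt
    rcases h.quasi hjk hA (show A < A + 1 by omega) (show A + 1 < i + 1 by omega) (by omega)
      with q | q
    · linarith
    · by_contra hle
      rcases (show A + 1 ≤ i by omega).eq_or_lt with r | r
      · rw [r] at q; linarith
      · rcases h.quasi hjk (show k' ≤ A + 1 by omega) r (show i < i + 1 by omega) (by omega)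
          with r | r <;> linarith
  -- The reverse of the previous argument: over the edge `i` the vertex `j'` is lower than `k'`, but
  -- `C` is not higher than `B`, while `j'` comes after `B` and `k'` after `C`.
  have se := ConvSeq.step_eq V j' k' i
  have e := edge_value (curve V b) (curve V c) V i i1.le i2
  have mx := t.stab.max₃ i
  rw [curve_int] at mx
  have d := far_diff (curve V b) (curve V c) (V i) (V (i + 1))
  have le : far (V i) (V (i + 1)) (curve V c) ≤ far (V i) (V (i + 1)) (curve V b) := by
    by_contra hlt
    have := mul_pos (show 0 < a - i by linarith) (show 0 < far (curve V b) (curve V c)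
      (V i) - far (curve V b) (curve V c) (V (i + 1)) by linarith)
    linarith
  have q1 := h.height_anti (p := i) (x := b + n) (y := c + n) (z := k' + n) (by linarith [t.lt_b])
    (by linarith [t.stab.lt₁]) (by linarith [t.c_lt]) (by linarith)
  have q2 := h.height_quasi (p := i) (x := b + n) (y := j' + n) (z := k' + n)
    (by linarith [t.lt_b]) (by linarith [t.b_lt]) (by linarith) (by linarith)
  simp only [h.curve_per, curve_int] at q1 q2
  have q3 := q1 le
  rcases q2 with q | q | ⟨q, q'⟩ <;> linarith

/-- In a column, the last farthest vertex does not pass the first corner. -/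
theorem last_le (t : TwoEdges n V j k b c a) (h : ConvSeq n V) {j' A : ℤ} (hj : j < j')
    (hjk : j' ≤ k)
    (up : ∀ i, k + 1 ≤ i → i < A → far (V j') (V (k + 1)) (V i) ≤ far (V j') (V (k + 1)) (V (i + 1))) :
    A ≤ j + n := by
  by_contra hc
  have g' := t.gap'
  -- Past `j + n` the edge `j` itself would have to be an ascent, so `j'` would be at least as high
  -- over it as `k + 1`. But `k` is lower than `k + 1` over this edge.
  have u := up (j + n) (by omega) (by omega)
  rw [h.per, show j + n + 1 = j + 1 + n by ring, h.per] at u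
  have se := ConvSeq.step_eq V j' (k + 1) j
  have s := (t.strip h).1
  rcases hjk.eq_or_lt with rfl | hjk
  · linarith
  rcases h.quasi (j := j) (k := j + 1) (x := j') (y := k) (z := k + 1) (by omega) (by omega) hjk
    (by omega) (by omega) with q | q <;> linarith

end TwoEdges

theorem unitOf_half_le (x : ℝ) : ((unitOf x / 2 : ℤ) : ℝ) ≤ x := even_le_unitOf.1 (by omega)

theorem le_of_unitOf_le {x : ℝ} {i : ℤ} (h : unitOf x ≤ 2 * i) : x ≤ i := by
  by_contra hc
  have := odd_le_unitOf.2 (not_le.1 hc)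
  omega

theorem le_half_unitOf (x : ℝ) : x ≤ (((unitOf x + 1) / 2 : ℤ) : ℝ) := le_of_unitOf_le (by omega)

/-! ### Scanning the units of a batch -/

/-- The common form of `rowBatch` and `columnBatch`. -/
def scanBatch (e₁ e₂ : RExp) (b₁ b₂ b₃ : BExp) : Cmd :=
  .loop (ile (I iFst) (I iLst)) (block [
    .iset iJ (.arr aEJ (I iFst)),
    .iset iK (.arr aEK (I iFst)),
    .rset rLo e₁,
    .rset rHi e₂,
    when (.rlt (R rLo) (R rHi)) (block [
      .loop (.and (ile (I iA₁ + I iA₁) (I iX)) b₁) (block [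
        when b₂ callEE,
        .iset iX (I iX - 1)]),
      when (.and (ile (I iA₁ + I iA₁) (I iX)) b₃) callEE]),
    .iset iFst (I iFst + 1)])

theorem rowBatch_eq : rowBatch = scanBatch (height (I iJ) (I iK)) (height (I iJ) (I iK + 1))
    (.rlt (height (I iJ) (I iX / 2)) (R rHi)) (.rlt (R rLo) (height (I iJ) (I iX / 2)))
    (.rlt (height (I iJ) ((I iX + 1) / 2)) (R rHi)) := rfl

theorem columnBatch_eq : columnBatch = scanBatch (height (I iK) (I iJ + 1)) (height (I iK) (I iJ))
    (.rlt (R rLo) (height (I iK) (I iX / 2))) (.rlt (height (I iK) (I iX / 2)) (R rHi))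
    (.rlt (R rLo) (height (I iK) ((I iX + 1) / 2))) := rfl

section
variable {n : ℕ} {v : Fin n → Point}

/-- Like `Outs`, but also the registers of a batch may have changed. -/
structure Scans (v : Fin n → Point) (σ σ' : State) : Prop where
  ireg : ∀ x, x < 22 → x ≠ 13 → x ≠ 14 → x ≠ 17 → x ≠ 21 → σ'.ireg x = σ.ireg x
  iarr : σ'.iarr = σ.iarr
  rarr : σ'.rarr = σ.rarr
  keep : ∀ T ∈ σ.out, T ∈ σ'.out
  sound : ∀ T ∈ σ'.out, T ∈ σ.out ∨ IsGenOut v T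

theorem Outs.scans {σ σ' : State} (h : Outs v σ σ') : Scans v σ σ' :=
  ⟨fun x hx _ _ _ _ => h.ireg x hx, h.iarr, h.rarr, h.keep, h.sound⟩

theorem Scans.trans {σ σ' σ'' : State} (h : Scans v σ σ') (h' : Scans v σ' σ'') : Scans v σ σ'' :=
  ⟨fun x h1 h2 h3 h4 h5 => (h'.ireg x h1 h2 h3 h4 h5).trans (h.ireg x h1 h2 h3 h4 h5),
    h'.iarr.trans h.iarr, h'.rarr.trans h.rarr, fun T hT => h'.keep T (h.keep T hT),
    fun T hT => (h'.sound T hT).elim (h.sound T) .inr⟩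

theorem Scans.refl (v : Fin n → Point) (σ : State) : Scans v σ σ :=
  ⟨fun _ _ _ _ _ _ => rfl, rfl, rfl, fun _ h => h, fun _ h => .inl h⟩

theorem Scans.iset (v : Fin n → Point) (σ : State) {x : ℕ} (hx : x = 13 ∨ x = 14 ∨ x = 17 ∨ x = 21)
    (z : ℤ) : Scans v σ (σ.iset x z) :=
  ⟨fun y h1 h2 h3 h4 h5 => by rw [State.iset_ireg, if_neg (by omega)], rfl, rfl, fun _ h => h,
    fun _ h => .inl h⟩

theorem Scans.rset (v : Fin n → Point) (σ : State) (x : ℕ) (z : ℝ) : Scans v σ (σ.rset x z) :=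
  ⟨fun _ _ _ _ _ _ => rfl, rfl, rfl, fun _ h => h, fun _ h => .inl h⟩

theorem Mem.scans {σ σ' : State} (m : Mem v σ) (h : Scans v σ σ') : Mem v σ' :=
  m.congr (h.ireg 0 (by norm_num) (by norm_num) (by norm_num) (by norm_num) (by norm_num)) h.rarr

/-- All stable triangles with corners in the unit `g` and the edges `j`, `k` are listed. -/
def Listed (v : Fin n → Point) (j k g : ℤ) (σ : State) : Prop :=
  ∀ a b c, unitOf a = g → unitOf b = 2 * j + 1 → unitOf c = 2 * k + 1 →
    AllStable v (curve (vert v) a) (curve (vert v) b) (curve (vert v) c) →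
      coords (curve (vert v) a) (curve (vert v) b) (curve (vert v) c) ∈ σ.out

theorem Listed.scans {j k g : ℤ} {σ σ' : State} (l : Listed v j k g σ) (h : Scans v σ σ') :
    Listed v j k g σ' := fun a b c ha hb hc st => h.keep _ (l a b c ha hb hc st)

theorem callEE_free : callEE.loopFree = true := by decide
theorem callEE_cost : callEE.maxCost ≤ 15000 := by decide

theorem callEE_run (h : ConvSeq n (vert v)) {σ : State} (m : Mem v σ) :
    Outs v σ (callEE.run σ) ∧ Listed v (σ.ireg 13) (σ.ireg 14) (σ.ireg 21) (callEE.run σ) := by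
  obtain ⟨σ', h'⟩ : ∃ σ', σ' = ((σ.iset 22 (σ.ireg 21)).iset 23 (2 * σ.ireg 13 + 1)).iset 24
    (2 * σ.ireg 14 + 1) := ⟨_, rfl⟩
  have e : callEE.run σ = gadgetEE.run σ' := by
    have e1 : (I iJ + I iJ + 1).eval (σ.iset 22 (σ.ireg 21)) = 2 * σ.ireg 13 + 1 := by
      simp; ring
    have e2 : (I iK + I iK + 1).eval ((σ.iset 22 (σ.ireg 21)).iset 23 (2 * σ.ireg 13 + 1)) =
        2 * σ.ireg 14 + 1 := by simp; ring
    rw [h', ← e2, ← e1]; rfl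
  have o : Outs v σ σ' := by
    rw [h']
    exact ((Outs.iset v σ (by norm_num) _).trans (Outs.iset v _ (by norm_num) _)).trans
      (Outs.iset v _ (by norm_num) _)
  obtain ⟨em, l⟩ := gadgetEE_run h (m.outs o) (g := σ.ireg 21) (j := σ.ireg 13) (k := σ.ireg 14)
    (by simp [h']) (by simp [h']) (by simp [h'])
  rw [e]
  exact ⟨o.trans em.outs, l⟩

/-- What `scanBatch` needs: `T m g` says that the unit `g` has to be tested with the pair number
`m`. -/
structure ScanData (v : Fin n → Point) (J K : ℤ → ℤ) (A₁ A₂ F L : ℤ) (e₁ e₂ : RExp)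
    (b₁ b₂ b₃ : BExp) (lo hi : ℤ → ℝ) (P₁ P₂ P₃ T : ℤ → ℤ → Prop) : Prop where
  lo_eq : ∀ σ m, Mem v σ → σ.ireg 13 = J m → σ.ireg 14 = K m → e₁.eval σ = lo m
  hi_eq : ∀ σ m, Mem v σ → σ.ireg 13 = J m → σ.ireg 14 = K m → e₂.eval σ = hi m
  iff₁ : ∀ σ m, Mem v σ → σ.ireg 13 = J m → σ.ireg 14 = K m → σ.rreg 4 = lo m → σ.rreg 5 = hi m →
    (b₁.eval σ ↔ P₁ m (σ.ireg 21))
  iff₂ : ∀ σ m, Mem v σ → σ.ireg 13 = J m → σ.ireg 14 = K m → σ.rreg 4 = lo m → σ.rreg 5 = hi m →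
    (b₂.eval σ ↔ P₂ m (σ.ireg 21))
  iff₃ : ∀ σ m, Mem v σ → σ.ireg 13 = J m → σ.ireg 14 = K m → σ.rreg 4 = lo m → σ.rreg 5 = hi m →
    (b₃.eval σ ↔ P₃ m (σ.ireg 21))
  cost : e₁.cost ≤ 200 ∧ e₂.cost ≤ 200 ∧ b₁.cost ≤ 200 ∧ b₂.cost ≤ 200 ∧ b₃.cost ≤ 200
  strip : ∀ m g, F ≤ m → m ≤ L → T m g → lo m < hi m
  range : ∀ m g, F ≤ m → m ≤ L → T m g → 2 * A₁ ≤ g ∧ g ≤ 2 * A₂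
  go : ∀ m g x, F ≤ m → m ≤ L → T m g → g < x → x ≤ 2 * A₂ → P₁ m x
  test₂ : ∀ m g, F ≤ m → m ≤ L → T m g → P₂ m g
  test₃ : ∀ m g, F ≤ m → m ≤ L → T m g → P₃ m g
  stay : ∀ m m' g, F ≤ m → m < m' → m' ≤ L → T m' g → lo m < hi m → ¬ P₁ m g

variable {J K : ℤ → ℤ} {A₁ A₂ F L : ℤ} {e₁ e₂ : RExp} {b₁ b₂ b₃ : BExp} {lo hi : ℤ → ℝ}
  {P₁ P₂ P₃ T : ℤ → ℤ → Prop}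

/-- The state during the scan for the pair number `m`. -/
structure AtPair (v : Fin n → Point) (J K : ℤ → ℤ) (A₁ : ℤ) (lo hi : ℤ → ℝ) (m : ℤ) (σ : State) :
    Prop where
  mem : Mem v σ
  j : σ.ireg 13 = J m
  k : σ.ireg 14 = K m
  a : σ.ireg 19 = A₁
  f : σ.ireg 17 = m
  lo : σ.rreg 4 = lo m
  hi : σ.rreg 5 = hi m

theorem AtPair.outs {m : ℤ} {σ σ' : State} (i : AtPair v J K A₁ lo hi m σ) (o : Outs v σ σ') :
    AtPair v J K A₁ lo hi m σ' :=
  ⟨i.mem.outs o, (o.ireg _ (by norm_num)).trans i.j, (o.ireg _ (by norm_num)).trans i.k,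
    (o.ireg _ (by norm_num)).trans i.a, (o.ireg _ (by norm_num)).trans i.f,
    (o.rreg _ (by norm_num)).trans i.lo, (o.rreg _ (by norm_num)).trans i.hi⟩

theorem AtPair.iset {m : ℤ} {σ : State} (i : AtPair v J K A₁ lo hi m σ) (z : ℤ) :
    AtPair v J K A₁ lo hi m (σ.iset 21 z) :=
  ⟨i.mem.iset (by norm_num) z, by rw [State.iset_ireg, if_neg (by norm_num), i.j],
    by rw [State.iset_ireg, if_neg (by norm_num), i.k],
    by rw [State.iset_ireg, if_neg (by norm_num), i.a],
    by rw [State.iset_ireg, if_neg (by norm_num), i.f], i.lo, i.hi⟩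

/-- The unit pointer moves backwards only. The budget charges every move to the part of the range
that it covers, and the final failing test to the pair. -/
theorem scan_inner (h : ConvSeq n (vert v))
    (D : ScanData v J K A₁ A₂ F L e₁ e₂ b₁ b₂ b₃ lo hi P₁ P₂ P₃ T) {m : ℤ} {σ₀ : State}
    (i₀ : AtPair v J K A₁ lo hi m σ₀) {B : ℕ}
    (hB : 20000 * max (σ₀.ireg 21 + 1 - 2 * A₁) 0 + 20000 ≤ (B : ℤ)) :
    Runs (.loop (.and (ile (I iA₁ + I iA₁) (I iX)) b₁) (block [
        when b₂ callEE,
        .iset iX (I iX - 1)])) σ₀ B (fun p σ => AtPair v J K A₁ lo hi m σ ∧ Scans v σ₀ σ ∧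
      σ.ireg 21 ≤ σ₀.ireg 21 ∧ (σ.ireg 21 < 2 * A₁ ∨ ¬ P₁ m (σ.ireg 21)) ∧
      (∀ x, σ.ireg 21 < x → x ≤ σ₀.ireg 21 → P₁ m x ∧ (P₂ m x → Listed v (J m) (K m) x σ)) ∧
      (B : ℤ) ≤ p + 20000 * (max (σ₀.ireg 21 + 1 - 2 * A₁) 0 - max (σ.ireg 21 + 1 - 2 * A₁) 0) +
        20000) := by
  obtain ⟨-, -, k1, k2, -⟩ := D.cost
  have free : (block [when b₂ callEE, .iset iX (I iX - 1)]).loopFree = true := by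
    show (callEE.loopFree && true) && true = true
    rw [callEE_free]; rfl
  have cost : (block [when b₂ callEE, .iset iX (I iX - 1)]).maxCost ≤ 15300 := by
    have := callEE_cost
    show b₂.cost + 1 + (callEE.maxCost + 1) + 4 ≤ _
    omega
  have cost' : (BExp.and (ile (I iA₁ + I iA₁) (I iX)) b₁).cost ≤ 300 := by
    show (6 + b₁.cost + 1) ≤ 300
    omega
  have ev : ∀ σ, AtPair v J K A₁ lo hi m σ → ((BExp.and (ile (I iA₁ + I iA₁) (I iX)) b₁).eval σ ↔
      2 * A₁ ≤ σ.ireg 21 ∧ P₁ m (σ.ireg 21)) := by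
    intro σ i
    rw [BExp.eval_and, D.iff₁ σ m i.mem i.j i.k i.lo i.hi, eval_ile, two_mul]
    simp [i.a]
  refine Runs.loop_free (fun p σ => AtPair v J K A₁ lo hi m σ ∧ Scans v σ₀ σ ∧
    σ.ireg 21 ≤ σ₀.ireg 21 ∧
    (∀ x, σ.ireg 21 < x → x ≤ σ₀.ireg 21 → P₁ m x ∧ (P₂ m x → Listed v (J m) (K m) x σ)) ∧
    (B : ℤ) ≤ p + 20000 * (max (σ₀.ireg 21 + 1 - 2 * A₁) 0 - max (σ.ireg 21 + 1 - 2 * A₁) 0))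
    20000 free (by omega) ?_ ?_ ?_
  · rintro p σ ⟨i, s, le, l, bud⟩ hb
    rw [ev σ i] at hb
    obtain ⟨X, hX⟩ : ∃ X, X = σ.ireg 21 := ⟨_, rfl⟩
    rw [← hX] at le l bud hb
    obtain ⟨σ₁, h₁⟩ : ∃ σ₁, σ₁ = (when b₂ callEE).run σ := ⟨_, rfl⟩
    have key : Outs v σ σ₁ ∧ (P₂ m X → Listed v (J m) (K m) X σ₁) := by
      have e := D.iff₂ σ m i.mem i.j i.k i.lo i.hi
      by_cases hp : P₂ m X
      · rw [h₁, when, Cmd.run_ite_pos (by rw [e, ← hX]; exact hp)]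
        obtain ⟨o, l⟩ := callEE_run h i.mem
        rw [i.j, i.k, ← hX] at l
        exact ⟨o, fun _ => l⟩
      · rw [h₁, when, Cmd.run_ite_neg (by rw [e, ← hX]; exact hp)]
        exact ⟨(Emits.refl v σ).outs, fun h => absurd h hp⟩
    obtain ⟨o, lX⟩ := key
    have X₁ : σ₁.ireg 21 = X := by rw [o.ireg 21 (by norm_num), hX]
    have e : (block [when b₂ callEE, .iset iX (I iX - 1)]).run σ = σ₁.iset 21 (X - 1) := by
      rw [← X₁, h₁]; rfl
    rw [e]
    have r : (σ₁.iset 21 (X - 1)).ireg 21 = X - 1 := by simp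
    have s₁ : Scans v σ (σ₁.iset 21 (X - 1)) := o.scans.trans (Scans.iset v _ (by norm_num) _)
    refine ⟨p - 20000, by omega, (i.outs o).iset _, s.trans s₁, by omega, ?_, ?_⟩
    · intro x h1 h2
      rw [r] at h1
      by_cases hx : x = X
      · subst hx
        exact ⟨hb.2, fun hp => (lX hp).scans (Scans.iset v _ (by norm_num) _)⟩
      · obtain ⟨l1, l2⟩ := l x (by omega) h2
        exact ⟨l1, fun hp => (l2 hp).scans s₁⟩
    · rw [r]; omega
  · rintro p σ ⟨i, s, le, l, bud⟩ hb
    rw [ev σ i] at hb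
    refine ⟨p - 20000, by omega, i, s, le, ?_, l, by omega⟩
    by_cases hc : σ.ireg 21 < 2 * A₁
    · exact .inl hc
    · exact .inr fun hp => hb ⟨not_lt.1 hc, hp⟩
  · exact ⟨i₀, Scans.refl v σ₀, le_rfl, fun x h1 h2 => absurd h1 (not_lt.2 h2), by omega⟩

/-- Every unit that a later pair needs is not passed during an earlier one (`stay`), and the scan
does not stop before it reaches a unit that the current pair needs (`go`). So the pointer never has
to return, and the cost is linear in the number of pairs plus the length of the range. -/
theorem scanBatch_spec (h : ConvSeq n (vert v)) {σ₀ : State} (m₀ : Mem v σ₀)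
    (D : ScanData v (σ₀.iarr 2) (σ₀.iarr 3) A₁ A₂ F L e₁ e₂ b₁ b₂ b₃ lo hi P₁ P₂ P₃ T)
    (hF : σ₀.ireg 17 = F) (hL : σ₀.ireg 18 = L) (hFL : F ≤ L) (h₁ : σ₀.ireg 19 = A₁)
    (hX : σ₀.ireg 21 = 2 * A₂) {B : ℕ}
    (hB : 100000 * (L + 1 - F) + 20000 * max (2 * A₂ + 1 - 2 * A₁) 0 + 1000 ≤ (B : ℤ)) :
    Runs (scanBatch e₁ e₂ b₁ b₂ b₃) σ₀ B (fun p σ => Scans v σ₀ σ ∧ σ.ireg 17 = L + 1 ∧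
      (∀ m g, F ≤ m → m ≤ L → T m g → Listed v (σ₀.iarr 2 m) (σ₀.iarr 3 m) g σ) ∧
      (B : ℤ) ≤ p + 100000 * (L + 1 - F) + 20000 * max (2 * A₂ + 1 - 2 * A₁) 0 + 1000) := by
  obtain ⟨k1, k2, k3, k4, k5⟩ := D.cost
  refine Runs.loop (fun p σ => Scans v σ₀ σ ∧ F ≤ σ.ireg 17 ∧ σ.ireg 17 ≤ L + 1 ∧
    σ.ireg 21 ≤ 2 * A₂ ∧
    (∀ m g, F ≤ m → m < σ.ireg 17 → T m g → Listed v (σ₀.iarr 2 m) (σ₀.iarr 3 m) g σ) ∧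
    (∀ m g, σ.ireg 17 ≤ m → m ≤ L → T m g → g ≤ σ.ireg 21) ∧
    (B : ℤ) ≤ p + 100000 * (σ.ireg 17 - F) +
      20000 * (max (2 * A₂ + 1 - 2 * A₁) 0 - max (σ.ireg 21 + 1 - 2 * A₁) 0)) 10 (by decide)
    ?_ ?_ ⟨Scans.refl v σ₀, hF.ge, by omega, hX.le, fun m g h1 h2 => by omega,
      fun m g h1 h2 t => by rw [hX]; exact (D.range m g (by omega) h2 t).2, by omega⟩
  · rintro p σ ⟨s, f1, f2, xle, dn, un, bud⟩ hb
    have r18 : σ.ireg 18 = L := by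
      rw [s.ireg 18 (by norm_num) (by norm_num) (by norm_num) (by norm_num) (by norm_num), hL]
    have r19 : σ.ireg 19 = A₁ := by
      rw [s.ireg 19 (by norm_num) (by norm_num) (by norm_num) (by norm_num) (by norm_num), h₁]
    obtain ⟨m, hm⟩ : ∃ m, m = σ.ireg 17 := ⟨_, rfl⟩
    obtain ⟨X, eX⟩ : ∃ X, X = σ.ireg 21 := ⟨_, rfl⟩
    have hmL : m ≤ L := by
      rw [← r18, hm]; simpa using hb
    rw [← hm] at f1 f2 dn un bud
    rw [← eX] at xle un bud
    refine ⟨p - 10, by omega, ?_⟩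
    refine Runs.split 4 (by decide) (by simp) ?_
    have cost : (block (List.take 4 [Cmd.iset iJ (.arr aEJ (I iFst)), .iset iK (.arr aEK (I iFst)),
        .rset rLo e₁, .rset rHi e₂])).maxCost ≤ 500 := by
      show 3 + (3 + ((e₁.cost + 1) + (e₂.cost + 1))) ≤ 500
      omega
    refine Runs.step 500 rfl cost (by omega) ?_
    obtain ⟨σ₁, q₁⟩ : ∃ σ₁, σ₁ = (σ.iset 13 (σ₀.iarr 2 m)).iset 14 (σ₀.iarr 3 m) := ⟨_, rfl⟩
    have s₁ : Scans v σ σ₁ := by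
      rw [q₁]; exact (Scans.iset v σ (by norm_num) _).trans (Scans.iset v _ (by norm_num) _)
    have m₁ : Mem v σ₁ := (m₀.scans s).scans s₁
    obtain ⟨σ₂, q₂⟩ : ∃ σ₂, σ₂ = (σ₁.rset 4 (lo m)).rset 5 (hi m) := ⟨_, rfl⟩
    have e : Cmd.run (block (List.take 4 [Cmd.iset iJ (.arr aEJ (I iFst)),
        .iset iK (.arr aEK (I iFst)), .rset rLo e₁, .rset rHi e₂])) σ = σ₂ := by
      rw [q₂, ← D.lo_eq σ₁ m m₁ (by simp [q₁]) (by simp [q₁]),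
        ← D.hi_eq (σ₁.rset 4 (e₁.eval σ₁)) m (m₁.rset _ _) (by simp [q₁]) (by simp [q₁]), q₁, hm,
        ← s.iarr]
      rfl
    change Runs _ (Cmd.run (block (List.take 4 [Cmd.iset iJ (.arr aEJ (I iFst)),
        .iset iK (.arr aEK (I iFst)), .rset rLo e₁, .rset rHi e₂])) σ) _ _
    rw [e]
    have s₂ : Scans v σ σ₂ := by
      rw [q₂]; exact (s₁.trans (Scans.rset v _ _ _)).trans (Scans.rset v _ _ _)
    have i₂ : AtPair v (σ₀.iarr 2) (σ₀.iarr 3) A₁ lo hi m σ₂ :=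
      ⟨(m₀.scans s).scans s₂, by simp [q₂, q₁], by simp [q₂, q₁], by simp [q₂, q₁, r19],
        by simp [q₂, q₁, hm], by simp [q₂], by simp [q₂]⟩
    have X₂ : σ₂.ireg 21 = X := by simp [q₂, q₁, eX]
    refine Runs.split 1 (by decide) (by simp) ?_
    suffices H : Runs (when (.rlt (R rLo) (R rHi)) (block [
        .loop (.and (ile (I iA₁ + I iA₁) (I iX)) b₁) (block [
          when b₂ callEE,
          .iset iX (I iX - 1)]),
        when (.and (ile (I iA₁ + I iA₁) (I iX)) b₃) callEE])) σ₂ (p - 10 - 500) (fun p' σ' =>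
          Scans v σ₂ σ' ∧ σ'.ireg 17 = m ∧ σ'.ireg 21 ≤ X ∧
          (∀ g, T m g → Listed v (σ₀.iarr 2 m) (σ₀.iarr 3 m) g σ') ∧
          (∀ m' g, m < m' → m' ≤ L → T m' g → g ≤ σ'.ireg 21) ∧
          (p : ℤ) ≤ p' + 60000 + 20000 * (max (X + 1 - 2 * A₁) 0 -
            max (σ'.ireg 21 + 1 - 2 * A₁) 0)) by
      refine Runs.mono H fun p' σ' ⟨s', r17, x', d', u', b'⟩ => ?_
      refine Runs.step 10 rfl (show 4 ≤ 10 by norm_num) (by omega) ?_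
      obtain ⟨σ₄, q₄⟩ : ∃ σ₄, σ₄ = Cmd.run (.iset iFst (I iFst + 1)) σ' := ⟨_, rfl⟩
      have e₄ : σ₄ = σ'.iset 17 (m + 1) := by rw [q₄, ← r17]; rfl
      change Scans v σ₀ (Cmd.run (.iset iFst (I iFst + 1)) σ') ∧
        F ≤ (Cmd.run (.iset iFst (I iFst + 1)) σ').ireg 17 ∧
        (Cmd.run (.iset iFst (I iFst + 1)) σ').ireg 17 ≤ L + 1 ∧
        (Cmd.run (.iset iFst (I iFst + 1)) σ').ireg 21 ≤ _ ∧
        (∀ m g, F ≤ m → m < (Cmd.run (.iset iFst (I iFst + 1)) σ').ireg 17 → T m g →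
          Listed v _ _ g (Cmd.run (.iset iFst (I iFst + 1)) σ')) ∧
        (∀ m g, (Cmd.run (.iset iFst (I iFst + 1)) σ').ireg 17 ≤ m → m ≤ L → T m g →
          g ≤ (Cmd.run (.iset iFst (I iFst + 1)) σ').ireg 21) ∧
        _ ≤ _ + 100000 * ((Cmd.run (.iset iFst (I iFst + 1)) σ').ireg 17 - F) + 20000 * (_ -
          max ((Cmd.run (.iset iFst (I iFst + 1)) σ').ireg 21 + 1 - 2 * A₁) 0)
      rw [← q₄]
      have a17 : σ₄.ireg 17 = m + 1 := by simp [e₄]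
      have a21 : σ₄.ireg 21 = σ'.ireg 21 := by simp [e₄]
      have s₄ : Scans v σ' σ₄ := by rw [e₄]; exact Scans.iset v _ (by norm_num) _
      rw [a17, a21]
      refine ⟨s.trans (s₂.trans (s'.trans s₄)), by omega, by omega, by omega, ?_, ?_, by omega⟩
      · intro m' g h1 h2 t
        by_cases he : m' = m
        · subst he
          exact (d' g t).scans s₄
        · exact (dn m' g h1 (by omega) t).scans (s₂.trans (s'.trans s₄))
      · exact fun m' g h1 h2 t => u' m' g (by omega) h2 t
    refine Runs.when 20 (by decide) (p - 600) (by omega) (fun hc => ?_) (fun hc => ?_)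
    · have hlt : lo m < hi m := by
        have := i₂.lo
        have := i₂.hi
        simp only [BExp.eval_rlt, RExp.eval_reg, rLo, rHi] at hc
        linarith
      refine Runs.split 1 (by decide) (by simp) ?_
      refine Runs.mono (scan_inner h D i₂ (by rw [X₂]; omega)) ?_
      rintro p₃ σ₃ ⟨i₃, s₃, le₃, halt₃, l₃, b₃'⟩
      rw [X₂] at le₃ l₃ b₃'
      have cost₃ : (when (.and (ile (I iA₁ + I iA₁) (I iX)) b₃) callEE).maxCost ≤ 16000 := by
        have := callEE_cost
        show (6 + b₃.cost + 1) + 1 + (callEE.maxCost + 1) ≤ _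
        omega
      have free₃ : (when (.and (ile (I iA₁ + I iA₁) (I iX)) b₃) callEE).loopFree = true := by
        show (callEE.loopFree && true) = true
        rw [callEE_free]; rfl
      refine Runs.step (c := when (.and (ile (I iA₁ + I iA₁) (I iX)) b₃) callEE) 16000 free₃ cost₃
        (by omega) ?_
      obtain ⟨σ₄, q₄⟩ : ∃ σ₄, σ₄ = (when (.and (ile (I iA₁ + I iA₁) (I iX)) b₃) callEE).run σ₃ :=
        ⟨_, rfl⟩
      rw [← q₄]
      have ev : (BExp.and (ile (I iA₁ + I iA₁) (I iX)) b₃).eval σ₃ ↔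
          2 * A₁ ≤ σ₃.ireg 21 ∧ P₃ m (σ₃.ireg 21) := by
        rw [BExp.eval_and, D.iff₃ σ₃ m i₃.mem i₃.j i₃.k i₃.lo i₃.hi, eval_ile, two_mul]
        simp [i₃.a]
      have key : Outs v σ₃ σ₄ ∧ (2 * A₁ ≤ σ₃.ireg 21 ∧ P₃ m (σ₃.ireg 21) →
          Listed v (σ₀.iarr 2 m) (σ₀.iarr 3 m) (σ₃.ireg 21) σ₄) := by
        by_cases hp : 2 * A₁ ≤ σ₃.ireg 21 ∧ P₃ m (σ₃.ireg 21)
        · rw [q₄, when, Cmd.run_ite_pos (ev.2 hp)]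
          obtain ⟨o, l⟩ := callEE_run h i₃.mem
          rw [i₃.j, i₃.k] at l
          exact ⟨o, fun _ => l⟩
        · rw [q₄, when, Cmd.run_ite_neg (mt ev.1 hp)]
          exact ⟨(Emits.refl v σ₃).outs, fun h => absurd h hp⟩
      obtain ⟨o, lX⟩ := key
      have a21 : σ₄.ireg 21 = σ₃.ireg 21 := o.ireg 21 (by norm_num)
      refine ⟨s₃.trans o.scans, by rw [o.ireg 17 (by norm_num), i₃.f], by omega, ?_, ?_, ?_⟩
      · intro g t
        obtain ⟨g1, g2⟩ := D.range m g f1 hmL t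
        -- Units after the halting place have been met by the inner loop. The unit at that place is
        -- tested after the loop; it is not passed, as a later pair may need it too. A unit before
        -- it would have kept the loop going.
        rcases lt_trichotomy (σ₃.ireg 21) g with hg | hg | hg
        · exact ((l₃ g hg (un m g le_rfl hmL t)).2 (D.test₂ m g f1 hmL t)).scans o.scans
        · rw [hg] at lX
          exact lX ⟨g1, D.test₃ m g f1 hmL t⟩
        · exfalso
          rcases halt₃ with st | st
          · omega
          · exact st (D.go m g _ f1 hmL t hg (by omega))
      · intro m' g h1 h2 t
        rw [a21]
        by_contra hg
        exact D.stay m m' g f1 h1 h2 t hlt (l₃ g (by omega) (un m' g h1.le h2 t)).1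
      · rw [a21]; omega
    · have hlt : ¬ lo m < hi m := by
        have := i₂.lo
        have := i₂.hi
        simp only [BExp.eval_rlt, RExp.eval_reg, rLo, rHi] at hc
        linarith
      refine ⟨Scans.refl v σ₂, i₂.f, X₂.le, fun g t => absurd (D.strip m g f1 hmL t) hlt, ?_, ?_⟩
      · exact fun m' g h1 h2 t => by rw [X₂]; exact un m' g h1.le h2 t
      · rw [X₂]; omega
  · rintro p σ ⟨s, f1, f2, xle, dn, un, bud⟩ hb
    have r18 : σ.ireg 18 = L := by
      rw [s.ireg 18 (by norm_num) (by norm_num) (by norm_num) (by norm_num) (by norm_num), hL]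
    have hmL : ¬ σ.ireg 17 ≤ L := by
      rw [← r18]; simpa using hb
    refine ⟨p - 10, by omega, s, by omega, fun m g h1 h2 => dn m g h1 (by omega), by omega⟩

end

/-! ### Monotonicity of the strips of a batch along its units. -/

section
variable {n : ℕ} {v : Fin n → Point}

/-- The unit `g` belongs to the third corner of a stable triangle. -/
def Third (v : Fin n → Point) (j k g : ℤ) : Prop :=
  ∃ b c a, TwoEdges n (vert v) j k b c a ∧ unitOf a = g

/-- A batch of edge pairs, from number `F` to number `L`, with the range of its units. -/
structure BatchOK (v : Fin n → Point) (σ : State) (F L A₁ A₂ : ℤ) : Prop where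
  list : EdgeList n σ
  zero_le : 0 ≤ F
  le : F ≤ L
  lt : L < σ.ireg 16
  up : UpTo n (vert v) (σ.iarr 2 F) (σ.iarr 3 F) A₁
  last : σ.iarr 3 L + 1 ≤ A₂
  last_le : A₂ ≤ σ.iarr 2 L + n
  halt : far (vert v (σ.iarr 2 L + 1)) (vert v (σ.iarr 3 L + 1)) (vert v (A₂ + 1)) <
    far (vert v (σ.iarr 2 L + 1)) (vert v (σ.iarr 3 L + 1)) (vert v A₂)
  climb : ∀ i, σ.iarr 3 L + 1 ≤ i → i < A₂ →
    far (vert v (σ.iarr 2 L + 1)) (vert v (σ.iarr 3 L + 1)) (vert v i) ≤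
      far (vert v (σ.iarr 2 L + 1)) (vert v (σ.iarr 3 L + 1)) (vert v (i + 1))

/-- The lower end is the first farthest vertex of the first pair, and it is not past that of any
later pair. The upper end is the last farthest vertex of a chord whose ends are beyond both edges of
every pair. -/
theorem BatchOK.range (h : ConvSeq n (vert v)) {σ : State} {F L A₁ A₂ : ℤ}
    (k : BatchOK v σ F L A₁ A₂) {m : ℤ} (hF : F ≤ m) (hL : m ≤ L) {b c a : ℝ}
    (t : TwoEdges n (vert v) (σ.iarr 2 m) (σ.iarr 3 m) b c a) : (A₁ : ℝ) ≤ a ∧ a ≤ A₂ := by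
  have h0 := k.zero_le
  have hl := k.lt
  obtain ⟨p1, p2, -⟩ := k.list.mono h0 hF (by omega)
  obtain ⟨q1, q2, -⟩ := k.list.mono (by omega) hL hl
  obtain ⟨-, gF, -⟩ := k.list.good F h0 (by omega)
  obtain ⟨-, gm, -⟩ := k.list.good m (by omega) (by omega)
  obtain ⟨-, gL, -⟩ := k.list.good L (by omega) hl
  exact ⟨t.le_a h (k.up.next h p1 p2 gF gm),
    t.a_le h (by omega) (by omega) (by omega) k.last k.halt⟩

theorem BatchOK.range_unit (h : ConvSeq n (vert v)) {σ : State} {F L A₁ A₂ : ℤ}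
    (k : BatchOK v σ F L A₁ A₂) {m g : ℤ} (hF : F ≤ m) (hL : m ≤ L)
    (t : Third v (σ.iarr 2 m) (σ.iarr 3 m) g) : 2 * A₁ ≤ g ∧ g ≤ 2 * A₂ := by
  obtain ⟨b, c, a, t, rfl⟩ := t
  obtain ⟨h1, h2⟩ := k.range h hF hL t
  refine ⟨even_le_unitOf.2 h1, ?_⟩
  rw [← unitOf_int]
  exact unitOf_mono h2

theorem TwoEdges.units {j k : ℤ} {b c a : ℝ} (t : TwoEdges n (vert v) j k b c a)
    (h : ConvSeq n (vert v)) : (k : ℝ) + 1 ≤ (unitOf a / 2 : ℤ) ∧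
      (((unitOf a + 1) / 2 : ℤ) : ℝ) ≤ j + (n : ℤ) := by
  constructor
  · have : 2 * (k + 1) ≤ unitOf a := even_le_unitOf.2 (by push_cast; exact (t.lt_a h).le)
    exact_mod_cast (show k + 1 ≤ unitOf a / 2 by omega)
  · have : unitOf a ≤ 2 * (j + n) := by
      rw [← unitOf_int]
      exact unitOf_mono (by push_cast; exact (t.a_lt h).le)
    exact_mod_cast (show (unitOf a + 1) / 2 ≤ j + n by omega)

theorem le_half_of_unitOf_lt {a : ℝ} {x : ℤ} (h : unitOf a < x) : a ≤ ((x / 2 : ℤ) : ℝ) :=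
  le_of_unitOf_le (by omega)

theorem Mem.eval_height (hn : 0 < n) {σ : State} (m : Mem v σ) (e x : IExp) :
    (height e x).eval σ = far (vert v (e.eval σ)) (vert v (e.eval σ + 1)) (vert v (x.eval σ)) :=
  m.eval_dist hn e (e + 1) x

/-- With a common first edge, the strips of later pairs lie higher, and heights do not increase from
a third corner to the end of the range. Backwards from that end, the scan runs while the vertex is
below the upper boundary of the strip; a unit needed later begins at a vertex above this boundary,
so the loop halts there at the latest. -/
theorem rowBatch_data (h : ConvSeq n (vert v)) {σ : State} {F L A₁ A₂ : ℤ}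
    (k : BatchOK v σ F L A₁ A₂) (row : ∀ m, F ≤ m → m ≤ L → σ.iarr 2 m = σ.iarr 2 F) :
    ScanData v (σ.iarr 2) (σ.iarr 3) A₁ A₂ F L (height (I iJ) (I iK)) (height (I iJ) (I iK + 1))
    (.rlt (height (I iJ) (I iX / 2)) (R rHi)) (.rlt (R rLo) (height (I iJ) (I iX / 2)))
    (.rlt (height (I iJ) ((I iX + 1) / 2)) (R rHi))
    (fun m => far (vert v (σ.iarr 2 m)) (vert v (σ.iarr 2 m + 1)) (vert v (σ.iarr 3 m)))
    (fun m => far (vert v (σ.iarr 2 m)) (vert v (σ.iarr 2 m + 1)) (vert v (σ.iarr 3 m + 1)))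
    (fun m x => far (vert v (σ.iarr 2 m)) (vert v (σ.iarr 2 m + 1)) (vert v (x / 2)) <
      far (vert v (σ.iarr 2 m)) (vert v (σ.iarr 2 m + 1)) (vert v (σ.iarr 3 m + 1)))
    (fun m x => far (vert v (σ.iarr 2 m)) (vert v (σ.iarr 2 m + 1)) (vert v (σ.iarr 3 m)) <
      far (vert v (σ.iarr 2 m)) (vert v (σ.iarr 2 m + 1)) (vert v (x / 2)))
    (fun m x => far (vert v (σ.iarr 2 m)) (vert v (σ.iarr 2 m + 1)) (vert v ((x + 1) / 2)) <
      far (vert v (σ.iarr 2 m)) (vert v (σ.iarr 2 m + 1)) (vert v (σ.iarr 3 m + 1)))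
    (fun m g => Third v (σ.iarr 2 m) (σ.iarr 3 m) g) where
  lo_eq σ' m mem h1 h2 := by
    have := h.three
    rw [mem.eval_height (by omega)]; simp [h1, h2]
  hi_eq σ' m mem h1 h2 := by
    have := h.three
    rw [mem.eval_height (by omega)]; simp [h1, h2]
  iff₁ σ' m mem h1 h2 h3 h4 := by
    have := h.three
    rw [BExp.eval_rlt, mem.eval_height (by omega)]; simp [h1, h4]
  iff₂ σ' m mem h1 h2 h3 h4 := by
    have := h.three
    rw [BExp.eval_rlt, mem.eval_height (by omega)]; simp [h1, h3]
  iff₃ σ' m mem h1 h2 h3 h4 := by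
    have := h.three
    rw [BExp.eval_rlt, mem.eval_height (by omega)]; simp [h1, h4]
  cost := by decide
  strip := by
    rintro m _ - - ⟨b, c, a, t, rfl⟩
    exact (t.strip h).1
  range m g hF hL t := k.range_unit h hF hL t
  go := by
    rintro m _ x hF hL ⟨b, c, a, t, rfl⟩ hx hx'
    have r := row m hF hL
    have r' := row L (by omega) le_rfl
    have q := t.row_after h (le_half_of_unitOf_lt hx) (by
      have := k.last_le
      exact_mod_cast (show x / 2 ≤ σ.iarr 2 m + n by omega))
    rw [curve_int] at q
    exact q.trans_lt (t.in_strip_j h).2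
  test₂ := by
    rintro m _ hF hL ⟨b, c, a, t, rfl⟩
    have q := t.row_before h (t.units h).1 (unitOf_half_le a)
    rw [curve_int] at q
    exact (t.in_strip_j h).1.trans_le q
  test₃ := by
    rintro m _ hF hL ⟨b, c, a, t, rfl⟩
    have q := t.row_after h (le_half_unitOf a) (t.units h).2
    rw [curve_int] at q
    exact q.trans_lt (t.in_strip_j h).2
  stay := by
    rintro m m' _ hF hm hL ⟨b, c, a, t, rfl⟩ - hp
    have q := t.row_before h (t.units h).1 (unitOf_half_le a)
    rw [curve_int] at q
    have q' := (t.in_strip_j h).1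
    have s := (t.strip h).1
    have h0 := k.zero_le
    have hl := k.lt
    have r : σ.iarr 2 m' = σ.iarr 2 m := (row m' (by omega) hL).trans (row m hF (by omega)).symm
    obtain ⟨-, -, mo⟩ := k.list.mono (m := m) (m' := m') (by omega) hm.le (by omega)
    have mo := mo hm
    obtain ⟨-, g1, g2, -⟩ := k.list.good m (by omega) (by omega)
    obtain ⟨-, g1', g2', -⟩ := k.list.good m' (by omega) (by omega)
    rw [r] at q q' s g1' g2' mo
    rcases (show σ.iarr 3 m + 1 ≤ σ.iarr 3 m' by omega).eq_or_lt with e | e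
    · rw [e] at hp; linarith
    · rcases h.quasi (j := σ.iarr 2 m) (k := σ.iarr 2 m + 1) (x := σ.iarr 3 m + 1)
        (y := σ.iarr 3 m') (z := σ.iarr 3 m' + 1) (by omega) (by omega) e (by omega) (by omega)
        with c | c <;> linarith

/-- With a common second edge everything is reversed: later strips lie lower, heights do not
decrease from a third corner to the end of the range, and the scan runs while the vertex is above
the lower boundary. -/
theorem columnBatch_data (h : ConvSeq n (vert v)) {σ : State} {F L A₁ A₂ : ℤ}
    (k : BatchOK v σ F L A₁ A₂) (column : ∀ m, F ≤ m → m ≤ L → σ.iarr 3 m = σ.iarr 3 F) :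
    ScanData v (σ.iarr 2) (σ.iarr 3) A₁ A₂ F L (height (I iK) (I iJ + 1)) (height (I iK) (I iJ))
    (.rlt (R rLo) (height (I iK) (I iX / 2))) (.rlt (height (I iK) (I iX / 2)) (R rHi))
    (.rlt (R rLo) (height (I iK) ((I iX + 1) / 2)))
    (fun m => far (vert v (σ.iarr 3 m)) (vert v (σ.iarr 3 m + 1)) (vert v (σ.iarr 2 m + 1)))
    (fun m => far (vert v (σ.iarr 3 m)) (vert v (σ.iarr 3 m + 1)) (vert v (σ.iarr 2 m)))
    (fun m x => far (vert v (σ.iarr 3 m)) (vert v (σ.iarr 3 m + 1)) (vert v (σ.iarr 2 m + 1)) <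
      far (vert v (σ.iarr 3 m)) (vert v (σ.iarr 3 m + 1)) (vert v (x / 2)))
    (fun m x => far (vert v (σ.iarr 3 m)) (vert v (σ.iarr 3 m + 1)) (vert v (x / 2)) <
      far (vert v (σ.iarr 3 m)) (vert v (σ.iarr 3 m + 1)) (vert v (σ.iarr 2 m)))
    (fun m x => far (vert v (σ.iarr 3 m)) (vert v (σ.iarr 3 m + 1)) (vert v (σ.iarr 2 m + 1)) <
      far (vert v (σ.iarr 3 m)) (vert v (σ.iarr 3 m + 1)) (vert v ((x + 1) / 2)))
    (fun m g => Third v (σ.iarr 2 m) (σ.iarr 3 m) g) where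
  lo_eq σ' m mem h1 h2 := by
    have := h.three
    rw [mem.eval_height (by omega)]; simp [h1, h2]
  hi_eq σ' m mem h1 h2 := by
    have := h.three
    rw [mem.eval_height (by omega)]; simp [h1, h2]
  iff₁ σ' m mem h1 h2 h3 h4 := by
    have := h.three
    rw [BExp.eval_rlt, mem.eval_height (by omega)]; simp [h2, h3]
  iff₂ σ' m mem h1 h2 h3 h4 := by
    have := h.three
    rw [BExp.eval_rlt, mem.eval_height (by omega)]; simp [h2, h4]
  iff₃ σ' m mem h1 h2 h3 h4 := by
    have := h.three
    rw [BExp.eval_rlt, mem.eval_height (by omega)]; simp [h2, h3]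
  cost := by decide
  strip := by
    rintro m _ - - ⟨b, c, a, t, rfl⟩
    exact (t.strip h).2
  range m g hF hL t := k.range_unit h hF hL t
  go := by
    rintro m _ x hF hL ⟨b, c, a, t, rfl⟩ hx hx'
    have h0 := k.zero_le
    have hl := k.lt
    have r := column m hF hL
    have r' := column L (by omega) le_rfl
    obtain ⟨q1, -⟩ := k.list.mono (show 0 ≤ m by omega) hL hl
    obtain ⟨-, gL, -⟩ := k.list.good L (by omega) hl
    -- The bound on the range in `BatchOK` refers to the last first edge of the column. For the
    -- earlier edge of this pair it has to be derived from the existence of the stable triangle.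
    have le := t.last_le h (j' := σ.iarr 2 L + 1) (A := A₂) (by omega) (by omega) (by
      rw [r, ← r']; exact k.climb)
    have q := t.column_after h (le_half_of_unitOf_lt hx) (by
      exact_mod_cast (show x / 2 ≤ σ.iarr 2 m + n by omega))
    rw [curve_int] at q
    exact (t.in_strip_k h).1.trans_le q
  test₂ := by
    rintro m _ hF hL ⟨b, c, a, t, rfl⟩
    have q := t.column_before h (t.units h).1 (unitOf_half_le a)
    rw [curve_int] at q
    exact q.trans_lt (t.in_strip_k h).2
  test₃ := by
    rintro m _ hF hL ⟨b, c, a, t, rfl⟩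
    have q := t.column_after h (le_half_unitOf a) (t.units h).2
    rw [curve_int] at q
    exact (t.in_strip_k h).1.trans_le q
  stay := by
    rintro m m' _ hF hm hL ⟨b, c, a, t, rfl⟩ hlt hp
    have q := t.column_before h (t.units h).1 (unitOf_half_le a)
    rw [curve_int] at q
    have q' := (t.in_strip_k h).2
    have h0 := k.zero_le
    have hl := k.lt
    have r : σ.iarr 3 m' = σ.iarr 3 m := (column m' (by omega) hL).trans (column m hF (by omega)).symm
    obtain ⟨-, -, mo⟩ := k.list.mono (m := m) (m' := m') (by omega) hm.le (by omega)
    have mo := mo hm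
    obtain ⟨-, g1, g2, -⟩ := k.list.good m (by omega) (by omega)
    obtain ⟨-, g1', g2', -⟩ := k.list.good m' (by omega) (by omega)
    rw [r] at q q' g1' g2' mo
    rcases (show σ.iarr 2 m + 1 ≤ σ.iarr 2 m' by omega).eq_or_lt with e | e
    · rw [← e] at q'; linarith
    · rcases h.quasi_edge (i := σ.iarr 3 m) (x := σ.iarr 2 m)
        (y := σ.iarr 2 m + 1) (z := σ.iarr 2 m') (by omega) (by omega) e (by omega)
        with c | c <;> linarith

end

/-! ### The end of a range, and the cost of one batch. -/

section
variable {n : ℕ} {v : Fin n → Point}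

/-- Weakly increasing distances up to `A`. -/
def WeaklyUpTo (n : ℤ) (V : ℤ → Point) (j k A : ℤ) : Prop :=
  A < j + n ∧ ∀ i, k ≤ i → i < A → far (V j) (V k) (V i) ≤ far (V j) (V k) (V (i + 1))

theorem WeaklyUpTo.next {n : ℤ} {V : ℤ → Point} (h : ConvSeq n V) {j k j' k' A : ℤ}
    (u : WeaklyUpTo n V j k A) (hj : j ≤ j') (hk : k ≤ k') (hjk : j < k) (hjk' : j' < k') :
    WeaklyUpTo n V j' k' A := by
  obtain ⟨u1, u2⟩ := u
  exact ⟨by omega, fun i h1 h2 => h.far_step_le (by omega) hj hk hjk hjk' h1 (u2 i (by omega) h2)⟩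

theorem WeaklyUpTo.climb {n : ℤ} {V : ℤ → Point} (h : ConvSeq n V) {j k A : ℤ} (hjk : j < k)
    (hkj : k + 1 < j + n) (u : WeaklyUpTo n V j k A) : ∃ A', max A k ≤ A' ∧ WeaklyUpTo n V j k A' ∧
      ¬ far (V j) (V k) (V A') ≤ far (V j) (V k) (V (A' + 1)) := by
  obtain ⟨u1, u2⟩ := u
  have hM : ¬ far (V j) (V k) (V (j + n - 1)) ≤ far (V j) (V k) (V (j + n - 1 + 1)) := by
    rw [sub_add_cancel, h.per, far_self_outer, not_le]
    exact h.pos _ _ _ hjk (by omega) (by omega)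
  obtain ⟨A', a1, a2, a3, a4⟩ := least_stop (fun i => far (V j) (V k) (V i) ≤
    far (V j) (V k) (V (i + 1))) (show max A k ≤ j + n - 1 by omega) hM
  refine ⟨A', a1, ⟨by omega, fun i h1 h2 => ?_⟩, a3⟩
  by_cases hi : i < A
  · exact u2 i h1 hi
  · exact a4 i (by omega) h2

/-- A plateau can occur only at the maximum, so only the last step up to `A` may fail to be strict.
-/
theorem WeaklyUpTo.strict {n : ℤ} {V : ℤ → Point} (h : ConvSeq n V) {j k A : ℤ} (hjk : j < k)
    (u : WeaklyUpTo n V j k A) : UpTo n V j k (A - 1) := by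
  obtain ⟨u1, u2⟩ := u
  refine ⟨by omega, fun i h1 h2 => ?_⟩
  have q1 := u2 i h1 (by omega)
  have q2 := u2 (i + 1) (by omega) (by omega)
  rcases h.quasi hjk h1 (show i < i + 1 by omega) (show i + 1 < i + 1 + 1 by omega) (by omega)
    with q | q
  · exact q
  · linarith

/-- Moving a counter up to a vertex. -/
theorem when_max_run {σ : State} {x : ℕ} (j k : ℤ) (e₁ e₂ : IExp) (h₁ : e₁.eval σ = j)
    (h₂ : e₂.eval (σ.iset 13 j) = k) (hx : x ≠ 13) (hx' : x ≠ 14) :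
    Cmd.run (block [.iset iJ e₁, .iset iK e₂, when (.ilt (I x) (I iK)) (.iset x (I iK))]) σ =
      ((σ.iset 13 j).iset 14 k).iset x (max (σ.ireg x) k) := by
  have r : ((σ.iset 13 j).iset 14 k).ireg x = σ.ireg x := by simp [hx, hx']
  have step : Cmd.run (block [.iset iJ e₁, .iset iK e₂, when (.ilt (I x) (I iK)) (.iset x (I iK))]) σ
      = Cmd.run (when (.ilt (I x) (I iK)) (.iset x (I iK))) ((σ.iset 13 j).iset 14 k) := by
    rw [← h₂, ← h₁]; rfl
  rw [step]
  by_cases hlt : σ.ireg x < k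
  · rw [when, Cmd.run_ite_pos (by simpa [hx, hx'] using hlt), max_eq_right hlt.le]
    simp [Cmd.run]
  · rw [when, Cmd.run_ite_neg (by simpa [hx, hx'] using hlt), max_eq_left (by omega), ← r,
      State.iset_self]
    rfl

theorem prepareBatch_spec (h : ConvSeq n (vert v)) {σ : State} (m₀ : Mem v σ) (l : EdgeList n σ)
    {F L : ℤ} (hF : σ.ireg 17 = F) (hL : σ.ireg 18 = L) (h₀ : 0 ≤ F) (hFL : F ≤ L)
    (hLN : L < σ.ireg 16) (u : UpTo n (vert v) (σ.iarr 2 F) (σ.iarr 3 F) (σ.ireg 19))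
    (w : WeaklyUpTo n (vert v) (σ.iarr 2 L + 1) (σ.iarr 3 L + 1) (σ.ireg 20)) {B : ℕ}
    (hB : 200 * (4 * n - σ.ireg 19) + 200 * (4 * n - σ.ireg 20) + 1000 ≤ (B : ℤ)) :
    Runs prepareBatch σ B (fun p σ' => ∃ A₁ A₂, BatchOK v σ F L A₁ A₂ ∧
      σ' = (((((((σ.iset 13 (σ.iarr 2 F)).iset 14 (σ.iarr 3 F)).iset 19 A₁).iset 13
        (σ.iarr 2 L + 1)).iset 14 (σ.iarr 3 L + 1)).iset 20 A₂).iset 21 (2 * A₂)) ∧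
      σ.ireg 19 ≤ A₁ ∧ σ.ireg 20 ≤ A₂ ∧ σ.iarr 3 F ≤ A₁ ∧
      ¬ far (vert v (σ.iarr 2 F)) (vert v (σ.iarr 3 F)) (vert v A₁) <
        far (vert v (σ.iarr 2 F)) (vert v (σ.iarr 3 F)) (vert v (A₁ + 1)) ∧
      WeaklyUpTo n (vert v) (σ.iarr 2 L + 1) (σ.iarr 3 L + 1) A₂ ∧
      (B : ℤ) ≤ p + 200 * (A₁ - σ.ireg 19) + 200 * (A₂ - σ.ireg 20) + 1000) := by
  have hn : 0 < n := by have := h.three; omega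
  obtain ⟨f1, f2, f3, f4⟩ := l.good F h₀ (by omega)
  obtain ⟨l1, l2, l3, l4⟩ := l.good L (by omega) hLN
  obtain ⟨A₁, a1, a2, a3⟩ := u.climb h f2 (by omega)
  obtain ⟨A₂, b1, b2, b3⟩ := w.climb h (by omega) (by omega)
  have a5 := a2.1
  have b5 := b2.1
  refine Runs.split 3 (by decide) (by decide) ?_
  refine Runs.step 100 rfl (by decide) (by omega) ?_
  obtain ⟨σ₁, q₁⟩ : ∃ σ₁, σ₁ = ((σ.iset 13 (σ.iarr 2 F)).iset 14 (σ.iarr 3 F)).iset 19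
    (max (σ.ireg 19) (σ.iarr 3 F)) := ⟨_, rfl⟩
  have e₁ := when_max_run (σ := σ) (x := 19) (σ.iarr 2 F) (σ.iarr 3 F) (.arr aEJ (I iFst))
    (.arr aEK (I iFst)) (by simp [hF]) (by simp [hF]) (by norm_num) (by norm_num)
  change Runs _ (Cmd.run (block [.iset iJ (.arr aEJ (I iFst)), .iset iK (.arr aEK (I iFst)),
    when (.ilt (I 19) (I iK)) (.iset 19 (I iK))]) σ) _ _
  rw [e₁, ← q₁]
  have m₁ : Mem v σ₁ := by
    rw [q₁]
    exact ((m₀.iset (by norm_num) _).iset (by norm_num) _).iset (by norm_num) _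
  have c19 : σ₁.ireg 19 = max (σ.ireg 19) (σ.iarr 3 F) := by simp [q₁]
  refine Runs.split 1 (by decide) (by decide) ?_
  refine Runs.scan (x := iA₁) (fun i => far (vert v (σ.iarr 2 F)) (vert v (σ.iarr 3 F)) (vert v i) <
    far (vert v (σ.iarr 2 F)) (vert v (σ.iarr 3 F)) (vert v (i + 1))) 150 (by decide) ?_ (a' := A₁)
    (by rw [show iA₁ = 19 from rfl, c19]; exact a1)
    (by rw [show iA₁ = 19 from rfl, c19]; exact fun i h1 h2 => a2.2 i (by omega) h2) a3
    (by rw [show iA₁ = 19 from rfl, c19]; omega) ?_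
  · intro z
    rw [(m₁.iset (x := iA₁) (by norm_num) z).eval_farther hn]
    simp [q₁]
  intro p₁ hp₁
  rw [show iA₁ = 19 from rfl, c19] at hp₁
  refine Runs.split 3 (by decide) (by decide) ?_
  refine Runs.step 100 rfl (by decide) (by omega) ?_
  obtain ⟨σ₂, q₂⟩ : ∃ σ₂, σ₂ = σ₁.iset 19 A₁ := ⟨_, rfl⟩
  change Runs _ (Cmd.run (block [.iset iJ (.arr aEJ (I iLst) + 1), .iset iK (.arr aEK (I iLst) + 1),
    when (.ilt (I 20) (I iK)) (.iset 20 (I iK))]) (σ₁.iset 19 A₁)) _ _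
  rw [← q₂]
  have r20 : σ₂.ireg 20 = σ.ireg 20 := by simp [q₂, q₁]
  have e₂ := when_max_run (σ := σ₂) (x := 20) (σ.iarr 2 L + 1) (σ.iarr 3 L + 1)
    (.arr aEJ (I iLst) + 1) (.arr aEK (I iLst) + 1) (by simp [q₂, q₁, hL]) (by simp [q₂, q₁, hL])
    (by norm_num) (by norm_num)
  rw [e₂, r20]
  obtain ⟨σ₃, q₃⟩ : ∃ σ₃, σ₃ = ((σ₂.iset 13 (σ.iarr 2 L + 1)).iset 14 (σ.iarr 3 L + 1)).iset 20
    (max (σ.ireg 20) (σ.iarr 3 L + 1)) := ⟨_, rfl⟩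
  rw [← q₃]
  have m₃ : Mem v σ₃ := by
    rw [q₃, q₂]
    exact (((m₁.iset (by norm_num) _).iset (by norm_num) _).iset (by norm_num) _).iset
      (by norm_num) _
  have c20 : σ₃.ireg 20 = max (σ.ireg 20) (σ.iarr 3 L + 1) := by simp [q₃]
  refine Runs.split 1 (by decide) (by decide) ?_
  refine Runs.scan (x := iA₂) (fun i => far (vert v (σ.iarr 2 L + 1)) (vert v (σ.iarr 3 L + 1))
    (vert v i) ≤ far (vert v (σ.iarr 2 L + 1)) (vert v (σ.iarr 3 L + 1)) (vert v (i + 1)))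
    150 (by decide) ?_ (a' := A₂)
    (by rw [show iA₂ = 20 from rfl, c20]; exact b1)
    (by rw [show iA₂ = 20 from rfl, c20]; exact fun i h1 h2 => b2.2 i (by omega) h2) b3
    (by rw [show iA₂ = 20 from rfl, c20]; omega) ?_
  · intro z
    have m₄ := m₃.iset (x := iA₂) (by norm_num) z
    rw [eval_rle, m₄.eval_dist hn, m₄.eval_dist hn]
    simp [q₃]
  intro p₂ hp₂
  rw [show iA₂ = 20 from rfl, c20] at hp₂
  refine Runs.step 10 rfl (by decide) (by omega) ?_
  refine ⟨A₁, A₂, ⟨l, h₀, hFL, hLN, a2, by omega, by omega, not_le.1 b3, b2.2⟩, ?_, by omega,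
    by omega, by omega, a3, b2, by omega⟩
  have e₃ : Cmd.run (.iset iX (I iA₂ + I iA₂)) (σ₃.iset 20 A₂) = (σ₃.iset 20 A₂).iset 21 (2 * A₂) := by
    have : (I iA₂ + I iA₂).eval (σ₃.iset 20 A₂) = 2 * A₂ := by simp; ring
    rw [← this]; rfl
  change Cmd.run (.iset iX (I iA₂ + I iA₂)) (σ₃.iset 20 A₂) = _
  rw [e₃, q₃, State.iset_iset, q₂, q₁, State.iset_iset]

/-- The part of the state that `edgePhase` preserves. -/
structure Phase (v : Fin n → Point) (σ σ' : State) : Prop where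
  num : σ'.ireg 0 = σ.ireg 0
  count : σ'.ireg 16 = σ.ireg 16
  iarr : σ'.iarr = σ.iarr
  rarr : σ'.rarr = σ.rarr
  keep : ∀ T ∈ σ.out, T ∈ σ'.out
  sound : ∀ T ∈ σ'.out, T ∈ σ.out ∨ IsGenOut v T

theorem Phase.trans {σ σ' σ'' : State} (h : Phase v σ σ') (h' : Phase v σ' σ'') : Phase v σ σ'' :=
  ⟨h'.num.trans h.num, h'.count.trans h.count, h'.iarr.trans h.iarr, h'.rarr.trans h.rarr,
    fun T hT => h'.keep T (h.keep T hT), fun T hT => (h'.sound T hT).elim (h.sound T) .inr⟩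

theorem Phase.iset (v : Fin n → Point) (σ : State) {x : ℕ} (h₀ : x ≠ 0) (h₁ : x ≠ 16) (z : ℤ) :
    Phase v σ (σ.iset x z) :=
  ⟨by rw [State.iset_ireg, if_neg h₀.symm], by rw [State.iset_ireg, if_neg h₁.symm], rfl, rfl,
    fun _ h => h, fun _ h => .inl h⟩

theorem Scans.phase {σ σ' : State} (s : Scans v σ σ') : Phase v σ σ' :=
  ⟨s.ireg 0 (by norm_num) (by norm_num) (by norm_num) (by norm_num) (by norm_num),
    s.ireg 16 (by norm_num) (by norm_num) (by norm_num) (by norm_num) (by norm_num), s.iarr, s.rarr,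
    s.keep, s.sound⟩

theorem Listed.phase {j k g : ℤ} {σ σ' : State} (l : Listed v j k g σ) (h : Phase v σ σ') :
    Listed v j k g σ' := fun a b c ha hb hc st => h.keep _ (l a b c ha hb hc st)

/-- Here `Q` is an earlier end of a range from which this batch is known to start at most one vertex
back. The scan is then paid by the advance from `Q` to the new end instead of by the polygon. -/
theorem batch_spec (h : ConvSeq n (vert v)) {σ : State} (m₀ : Mem v σ) (l : EdgeList n σ)
    {F L : ℤ} (hF : σ.ireg 17 = F) (hL : σ.ireg 18 = L) (h₀ : 0 ≤ F) (hFL : F ≤ L)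
    (hLN : L < σ.ireg 16) (u : UpTo n (vert v) (σ.iarr 2 F) (σ.iarr 3 F) (σ.ireg 19))
    (w : WeaklyUpTo n (vert v) (σ.iarr 2 L + 1) (σ.iarr 3 L + 1) (σ.ireg 20)) {Q : ℤ}
    (uQ : UpTo n (vert v) (σ.iarr 2 F) (σ.iarr 3 F) (Q - 1)) (hQ : Q ≤ σ.ireg 20) {c : Cmd}
    (hc : (c = rowBatch ∧ ∀ m, F ≤ m → m ≤ L → σ.iarr 2 m = σ.iarr 2 F) ∨
      (c = columnBatch ∧ ∀ m, F ≤ m → m ≤ L → σ.iarr 3 m = σ.iarr 3 F)) {B : ℕ}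
    (hB : 200000 * (L + 1 - F) + 200 * (4 * n - σ.ireg 19) + 40200 * (4 * n - σ.ireg 20) +
      40000 * (4 * n - Q) ≤ (B : ℤ)) :
    Runs (block [prepareBatch, c]) σ B (fun p σ' => Phase v σ σ' ∧ σ'.ireg 17 = L + 1 ∧
      (∀ m g, F ≤ m → m ≤ L → Third v (σ.iarr 2 m) (σ.iarr 3 m) g →
        Listed v (σ.iarr 2 m) (σ.iarr 3 m) g σ') ∧
      σ.ireg 19 ≤ σ'.ireg 19 ∧ σ.ireg 20 ≤ σ'.ireg 20 ∧
      UpTo n (vert v) (σ.iarr 2 F) (σ.iarr 3 F) (σ'.ireg 19) ∧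
      WeaklyUpTo n (vert v) (σ.iarr 2 L + 1) (σ.iarr 3 L + 1) (σ'.ireg 20) ∧
      (B : ℤ) ≤ p + 200000 * (L + 1 - F) + 200 * (σ'.ireg 19 - σ.ireg 19) +
        200 * (σ'.ireg 20 - σ.ireg 20) + 40000 * (σ'.ireg 20 - Q)) := by
  obtain ⟨f1, f2, f3, f4⟩ := l.good F h₀ (by omega)
  obtain ⟨l1, l2, l3, l4⟩ := l.good L (by omega) hLN
  have u1 := u.1
  have w1 := w.1
  refine Runs.split 1 (by decide) (by simp) ?_
  refine Runs.mono (prepareBatch_spec h m₀ l hF hL h₀ hFL hLN u w (by omega)) ?_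
  rintro p₁ σ₁ ⟨A₁, A₂, ok, q₁, a1, a2, a3, a4, a5, bud⟩
  have b1 := ok.up.1
  have b2 := ok.last_le
  -- The distances still increase strictly up to `Q - 1`, so the climb for `A₁` cannot stop earlier.
  have hA : Q - 1 ≤ A₁ := by
    by_contra hlt
    exact a4 (uQ.2 A₁ a3 (by omega))
  have m₁ : Mem v σ₁ := by
    rw [q₁]
    exact ((((((m₀.iset (by norm_num) _).iset (by norm_num) _).iset (by norm_num) _).iset
      (by norm_num) _).iset (by norm_num) _).iset (by norm_num) _).iset (by norm_num) _
  have ph : Phase v σ σ₁ :=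
    ⟨by simp [q₁], by simp [q₁], by rw [q₁]; rfl, by rw [q₁]; rfl, by rw [q₁]; exact fun _ h => h,
      by rw [q₁]; exact fun _ h => .inl h⟩
  have r17 : σ₁.ireg 17 = F := by simp [q₁, hF]
  have r18 : σ₁.ireg 18 = L := by simp [q₁, hL]
  have r19 : σ₁.ireg 19 = A₁ := by simp [q₁]
  have r20 : σ₁.ireg 20 = A₂ := by simp [q₁]
  have r21 : σ₁.ireg 21 = 2 * A₂ := by simp [q₁]
  have key : Runs c σ₁ p₁ (fun p σ' => Scans v σ₁ σ' ∧ σ'.ireg 17 = L + 1 ∧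
      (∀ m g, F ≤ m → m ≤ L → Third v (σ₁.iarr 2 m) (σ₁.iarr 3 m) g →
        Listed v (σ₁.iarr 2 m) (σ₁.iarr 3 m) g σ') ∧
      (p₁ : ℤ) ≤ p + 100000 * (L + 1 - F) + 20000 * max (2 * A₂ + 1 - 2 * A₁) 0 + 1000) := by
    rcases hc with ⟨rfl, hc⟩ | ⟨rfl, hc⟩
    · have D := rowBatch_data h ok hc
      rw [← ph.iarr] at D
      rw [rowBatch_eq]
      exact scanBatch_spec h m₁ D r17 r18 hFL r19 r21 (by omega)
    · have D := columnBatch_data h ok hc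
      rw [← ph.iarr] at D
      rw [columnBatch_eq]
      exact scanBatch_spec h m₁ D r17 r18 hFL r19 r21 (by omega)
  refine Runs.mono key ?_
  rintro p₂ σ₂ ⟨s, e17, dn, bud₂⟩
  have e19 : σ₂.ireg 19 = A₁ := by
    rw [s.ireg 19 (by norm_num) (by norm_num) (by norm_num) (by norm_num) (by norm_num), r19]
  have e20 : σ₂.ireg 20 = A₂ := by
    rw [s.ireg 20 (by norm_num) (by norm_num) (by norm_num) (by norm_num) (by norm_num), r20]
  rw [ph.iarr] at dn
  rw [e19, e20]
  exact ⟨ph.trans s.phase, e17, dn, a1, a2, ok.up, a5, by omega⟩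

end

/-! ### All batches, and the total length of their scans. -/

section
variable {n : ℕ} {v : Fin n → Point}

/-- Register 20 is the end of the last range and `Q` the end of the one before. `weak` serves the
batch after the next one: its first pair exceeds the current one in both indices, and for all such
pairs the distances increase up to register 20. -/
structure EdgeInv (v : Fin n → Point) (σ₀ : State) (Q : ℤ) (σ : State) : Prop where
  phase : Phase v σ₀ σ
  low : 0 ≤ σ.ireg 17
  high : σ.ireg 17 ≤ σ₀.ireg 16
  a₁ : σ.ireg 19 ≤ 4 * n
  a₂ : σ.ireg 20 ≤ 4 * n
  q : Q ≤ σ.ireg 20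
  done : ∀ m g, 0 ≤ m → m < σ.ireg 17 → Third v (σ₀.iarr 2 m) (σ₀.iarr 3 m) g →
    Listed v (σ₀.iarr 2 m) (σ₀.iarr 3 m) g σ
  up : σ.ireg 17 < σ₀.ireg 16 →
    UpTo n (vert v) (σ₀.iarr 2 (σ.ireg 17)) (σ₀.iarr 3 (σ.ireg 17)) (σ.ireg 19)
  upQ : σ.ireg 17 < σ₀.ireg 16 →
    UpTo n (vert v) (σ₀.iarr 2 (σ.ireg 17)) (σ₀.iarr 3 (σ.ireg 17)) (Q - 1)
  weak : σ.ireg 17 < σ₀.ireg 16 → ∀ j k, σ₀.iarr 2 (σ.ireg 17) < j → σ₀.iarr 3 (σ.ireg 17) < k →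
    j < k → WeaklyUpTo n (vert v) j k (σ.ireg 20)

/-- The roles shift by one batch. The old end becomes `Q`, for which `weak` gives strictness up to
`Q - 1`; the new end satisfies `weak`, because it was computed one step beyond the last pair of the
batch in both indices. -/
theorem EdgeInv.next (h : ConvSeq n (vert v)) {σ₀ σ σ' : State} {Q F L : ℤ} (l : EdgeList n σ₀)
    (i : EdgeInv v σ₀ Q σ) (hF : σ.ireg 17 = F) (hFL : F ≤ L) (hLN : L < σ₀.ireg 16)
    (far' : L + 1 < σ₀.ireg 16 → σ₀.iarr 2 F < σ₀.iarr 2 (L + 1) ∧ σ₀.iarr 3 F < σ₀.iarr 3 (L + 1))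
    (ph : Phase v σ σ') (hL : σ'.ireg 17 = L + 1)
    (dn : ∀ m g, F ≤ m → m ≤ L → Third v (σ₀.iarr 2 m) (σ₀.iarr 3 m) g →
        Listed v (σ₀.iarr 2 m) (σ₀.iarr 3 m) g σ')
    (a₂ : σ.ireg 20 ≤ σ'.ireg 20)
    (u : UpTo n (vert v) (σ₀.iarr 2 F) (σ₀.iarr 3 F) (σ'.ireg 19))
    (w : WeaklyUpTo n (vert v) (σ₀.iarr 2 L + 1) (σ₀.iarr 3 L + 1) (σ'.ireg 20)) :
    EdgeInv v σ₀ (σ.ireg 20) σ' := by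
  have h0 := i.low
  rw [hF] at h0
  obtain ⟨f1, f2, f3, f4⟩ := l.good F h0 (by omega)
  obtain ⟨l1, l2, l3, l4⟩ := l.good L (by omega) hLN
  have u1 := u.1
  have w1 := w.1
  have iw := i.weak
  rw [hF] at iw
  refine ⟨i.phase.trans ph, by omega, by omega, by omega, by omega, a₂, ?_, ?_, ?_, ?_⟩
  · intro m g h1 h2 t
    by_cases hm : m < F
    · exact (i.done m g h1 (by omega) t).phase ph
    · exact dn m g (by omega) (by omega) t
  · rw [hL]
    intro hlt
    obtain ⟨g1, g2, g3, g4⟩ := l.good (L + 1) (by omega) hlt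
    obtain ⟨q1, q2⟩ := far' hlt
    exact u.next h q1.le q2.le f2 g2
  · rw [hL]
    intro hlt
    obtain ⟨g1, g2, g3, g4⟩ := l.good (L + 1) (by omega) hlt
    obtain ⟨q1, q2⟩ := far' hlt
    exact (iw (by omega) _ _ q1 q2 g2).strict h g2
  · rw [hL]
    intro hlt j k hj hk hjk
    obtain ⟨q1, q2, -⟩ := l.mono (show 0 ≤ L by omega) (show L ≤ L + 1 by omega) hlt
    exact w.next h (by omega) (by omega) (by omega) hjk

/-- Looking for the last number of a batch. -/
theorem last_spec {σ : State} {F : ℤ} (a : ℕ) (hF : σ.ireg 17 = F) (hN : F < σ.ireg 16)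
    (hL : σ.ireg 18 = F) {B : ℕ} {R' : ℕ → State → Prop}
    (hB : 100 * (σ.ireg 16 - F) + 100 ≤ (B : ℤ))
    (hQ : ∀ (p : ℕ) L, F ≤ L → L < σ.ireg 16 → (∀ m, F ≤ m → m ≤ L → σ.iarr a m = σ.iarr a F) →
      (L + 1 < σ.ireg 16 → σ.iarr a (L + 1) ≠ σ.iarr a F) →
      (p : ℤ) = B - 100 * (L - F) - 100 → R' p (σ.iset 18 L)) :
    Runs (.loop (.and (.ilt (I iLst + 1) (I iNumE))
      (.ieq (.arr a (I iLst + 1)) (.arr a (I iFst)))) (.iset iLst (I iLst + 1))) σ B R' := by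
  obtain ⟨L, l1, l2, l3, l4⟩ := least_stop (fun i => i + 1 < σ.ireg 16 ∧
    σ.iarr a (i + 1) = σ.iarr a F) (show F ≤ σ.ireg 16 - 1 by omega) (by
      rintro ⟨h, -⟩; omega)
  refine Runs.scan (x := iLst) (fun i => i + 1 < σ.ireg 16 ∧ σ.iarr a (i + 1) = σ.iarr a F) 100
    (by show 3 + 1 + 1 + (3 + 1 + 2 + 1) + 1 + 5 ≤ 100; norm_num) ?_ (a' := L)
    (by rw [show iLst = 18 from rfl, hL]; exact l1)
    (by rw [show iLst = 18 from rfl, hL]; exact l4) l3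
    (by rw [show iLst = 18 from rfl, hL]; push_cast; omega) ?_
  · intro z
    simp [hF]
  · rw [show iLst = 18 from rfl, hL]
    intro p hp
    refine hQ p L l1 (by omega) ?_ (fun hlt he => l3 ⟨hlt, he⟩) (by push_cast at hp; omega)
    intro m h1 h2
    rcases h1.eq_or_lt with rfl | h1
    · rfl
    · have := (l4 (m - 1) (by omega) (by omega)).2
      rwa [sub_add_cancel] at this

/-- The potential counts the remaining pairs and the remaining ways of both pointers and of `Q`.
Each scan is paid by the distance between ends two batches apart; these distances overlap at most
twice, so their sum is linear. -/
theorem edgePhase_spec (h : ConvSeq n (vert v)) {σ₀ : State} (m₀ : Mem v σ₀) (l : EdgeList n σ₀)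
    (hlen : σ₀.ireg 16 ≤ 4 * n) :
    Runs edgePhase σ₀ (2000000 * n) (fun _ σ => Phase v σ₀ σ ∧ ∀ m g, 0 ≤ m → m < σ₀.ireg 16 →
      Third v (σ₀.iarr 2 m) (σ₀.iarr 3 m) g → Listed v (σ₀.iarr 2 m) (σ₀.iarr 3 m) g σ) := by
  have hn := h.three
  refine Runs.split 3 (by decide) (by decide) ?_
  refine Runs.step 10 rfl (by decide) (by omega) ?_
  obtain ⟨σ₁, q₁⟩ : ∃ σ₁, σ₁ = ((σ₀.iset 17 0).iset 19 0).iset 20 0 := ⟨_, rfl⟩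
  change Runs (.loop _ _) (((σ₀.iset 17 0).iset 19 0).iset 20 0) _ _
  rw [← q₁]
  have r17 : σ₁.ireg 17 = 0 := by simp [q₁]
  have r19 : σ₁.ireg 19 = 0 := by simp [q₁]
  have r20 : σ₁.ireg 20 = 0 := by simp [q₁]
  have num := l.num
  refine Runs.loop (fun p σ => ∃ Q, EdgeInv v σ₀ Q σ ∧ 300000 * (σ₀.ireg 16 - σ.ireg 17) +
    200 * (4 * n - σ.ireg 19) + 40200 * (4 * n - σ.ireg 20) + 40000 * (4 * n - Q) + 1000 ≤ (p : ℤ))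
    10 (by decide) ?_ ?_ ⟨0, ?_, ?_⟩
  · rintro p σ ⟨Q, i, bud⟩ hb
    have e16 := i.phase.count
    have eA := i.phase.iarr
    have i1 := i.a₁
    have i2 := i.a₂
    have i3 := i.q
    obtain ⟨F, hF⟩ : ∃ F, σ.ireg 17 = F := ⟨_, rfl⟩
    have hN : F < σ₀.ireg 16 := by
      rw [← e16, ← hF]; simpa using hb
    have i4 := i.low
    rw [hF] at bud i4
    have mem : Mem v σ := m₀.congr i.phase.num i.phase.rarr
    have up := i.up (by omega)
    have upQ := i.upQ (by omega)
    have wk := i.weak (by omega)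
    rw [hF] at up upQ wk
    refine ⟨p - 10, by omega, ?_⟩
    refine Runs.split 1 (by decide) (by simp) ?_
    refine Runs.step 10 rfl (by decide) (by omega) ?_
    have e₂ : Cmd.run (.iset iLst (I iFst)) σ = σ.iset 18 F := by rw [← hF]; rfl
    change Runs _ (Cmd.run (.iset iLst (I iFst)) σ) _ _
    rw [e₂]
    obtain ⟨σ₂, q₂⟩ : ∃ σ₂, σ₂ = σ.iset 18 F := ⟨_, rfl⟩
    rw [← q₂]
    have s16 : σ₂.ireg 16 = σ₀.ireg 16 := by simp [q₂, e16]
    have s17 : σ₂.ireg 17 = F := by simp [q₂, hF]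
    have sA : σ₂.iarr = σ₀.iarr := by rw [q₂]; exact eA
    refine Runs.split 1 (by decide) (by simp) ?_
    refine last_spec aEJ s17 (by omega) (by simp [q₂]) (by omega) ?_
    intro p₃ L hFL hLN row halt hp₃
    rw [s16] at hLN halt
    rw [sA] at row halt
    obtain ⟨σ₃, q₃⟩ : ∃ σ₃, σ₃ = σ.iset 18 L := ⟨_, rfl⟩
    rw [q₂, State.iset_iset, ← q₃]
    have t16 : σ₃.ireg 16 = σ₀.ireg 16 := by simp [q₃, e16]
    have t17 : σ₃.ireg 17 = F := by simp [q₃, hF]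
    have t18 : σ₃.ireg 18 = L := by simp [q₃]
    have t19 : σ₃.ireg 19 = σ.ireg 19 := by simp [q₃]
    have t20 : σ₃.ireg 20 = σ.ireg 20 := by simp [q₃]
    have tA : σ₃.iarr = σ₀.iarr := by rw [q₃]; exact eA
    have t : ∀ M c, F ≤ M → M < σ₀.ireg 16 →
        ((c = rowBatch ∧ ∀ m, F ≤ m → m ≤ M → σ₀.iarr 2 m = σ₀.iarr 2 F) ∨
          (c = columnBatch ∧ ∀ m, F ≤ m → m ≤ M → σ₀.iarr 3 m = σ₀.iarr 3 F)) →
        (M + 1 < σ₀.ireg 16 → σ₀.iarr 2 F < σ₀.iarr 2 (M + 1) ∧ σ₀.iarr 3 F < σ₀.iarr 3 (M + 1)) →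
        ∀ p' : ℕ, (p : ℤ) ≤ p' + 200 * (M - F) + 300 → Runs (block [prepareBatch, c]) (σ.iset 18 M) p'
          (fun p σ => ∃ Q, EdgeInv v σ₀ Q σ ∧ 300000 * (σ₀.ireg 16 - σ.ireg 17) +
            200 * (4 * n - σ.ireg 19) + 40200 * (4 * n - σ.ireg 20) + 40000 * (4 * n - Q) + 1000 ≤
              (p : ℤ)) := by
      intro M c hFM hMN hc hs p' hp'
      obtain ⟨τ, qτ⟩ : ∃ τ, τ = σ.iset 18 M := ⟨_, rfl⟩
      rw [← qτ]
      have x16 : τ.ireg 16 = σ₀.ireg 16 := by simp [qτ, e16]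
      have x17 : τ.ireg 17 = F := by simp [qτ, hF]
      have x18 : τ.ireg 18 = M := by simp [qτ]
      have x19 : τ.ireg 19 = σ.ireg 19 := by simp [qτ]
      have x20 : τ.ireg 20 = σ.ireg 20 := by simp [qτ]
      have xA : τ.iarr = σ₀.iarr := by rw [qτ]; exact eA
      have lτ : EdgeList n τ := by
        obtain ⟨z1, z2, z3⟩ := l
        constructor <;> rw [x16] <;> try rw [xA]
        · exact z1
        · exact z2
        · exact z3
      have phτ : Phase v σ τ := by rw [qτ]; exact Phase.iset v σ (by norm_num) (by norm_num) _
      obtain ⟨o1, o2, -⟩ := l.mono i4 hFM hMN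
      obtain ⟨g1, g2, g3, g4⟩ := l.good M (by omega) hMN
      have spec := batch_spec h (Q := Q) (c := c) (B := p') (mem.congr phτ.num phτ.rarr) lτ x17 x18
        i4 hFM (by omega) (by rw [xA, x19]; exact up)
        (by rw [xA, x20]; exact wk _ _ (by omega) (by omega) (by omega))
        (by rw [xA]; exact upQ) (by omega) (by rw [xA]; exact hc) (by rw [x19, x20]; omega)
      refine Runs.mono spec ?_
      rintro p₄ σ₄ ⟨ph, y17, dn, y1, y2, uu, ww, bud'⟩
      rw [xA] at dn uu ww
      rw [x19, x20] at bud'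
      rw [x19] at y1
      rw [x20] at y2
      exact ⟨σ.ireg 20, i.next h l hF hFM hMN hs (phτ.trans ph) y17 dn y2 uu ww, by omega⟩
    refine Runs.ite 10 (by decide) (p₃ - 10) (by omega) (fun hc => ?_) (fun hc => ?_)
    · have hLF : L = F := by
        simp only [BExp.eval_ieq, IExp.eval_reg, iLst, iFst, t17, t18] at hc
        exact hc
      subst hLF
      refine Runs.split 1 (by decide) (by simp) ?_
      refine last_spec aEK t17 (by omega) t18 (by omega) ?_
      intro p₅ M hFM hMN column halt' hp₅
      rw [t16] at hMN halt'
      rw [tA] at column halt'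
      rw [q₃, State.iset_iset]
      -- The first index already grows with the second pair, where the row stopped, and the second
      -- index grows where the column stops.
      refine t M _ hFM hMN (.inr ⟨rfl, column⟩) (fun hlt => ?_) p₅ (by omega)
      obtain ⟨z1, z2, -⟩ := l.mono (m := L + 1) (m' := M + 1) (by omega) (by omega) hlt
      obtain ⟨z3, z4, -⟩ := l.mono (m := L) (m' := L + 1) (by omega) (by omega) (by omega)
      have z5 := halt (by omega)
      have z6 := halt' hlt
      simp only [aEJ] at z5
      simp only [aEK] at z6
      omega
    · have hLF : L ≠ F := by
        simp only [BExp.eval_ieq, IExp.eval_reg, iLst, iFst, t17, t18] at hc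
        exact hc
      rw [q₃]
      -- The second index has grown within the row, which has more than one pair, and the first
      -- index grows where the row stops.
      refine t L _ hFL hLN (.inl ⟨rfl, row⟩) (fun hlt => ?_) (p₃ - 10) (by omega)
      obtain ⟨z1, z2, z2'⟩ := l.mono (m := F) (m' := L) (by omega) (by omega) hLN
      obtain ⟨z3, z4, -⟩ := l.mono (m := L) (m' := L + 1) (by omega) (by omega) (by omega)
      have z5 := halt hlt
      have z6 := row L hFL le_rfl
      simp only [aEJ] at z5 z6
      omega
  · rintro p σ ⟨Q, i, bud⟩ hb
    have hN : ¬ σ.ireg 17 < σ₀.ireg 16 := by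
      rw [← i.phase.count]; simpa using hb
    have := i.a₁
    have := i.a₂
    have := i.q
    have := i.high
    exact ⟨0, by omega, i.phase, fun m g h1 h2 t => i.done m g h1 (by omega) t⟩
  · have up0 : ∀ A j k : ℤ, 0 ≤ j → j < k → A ≤ 0 → UpTo n (vert v) j k A := fun A j k h1 h2 h3 =>
      ⟨by omega, fun i h4 h5 => by omega⟩
    refine ⟨?_, by omega, by omega, by omega, by omega, by omega, ?_, ?_, ?_, ?_⟩
    · rw [q₁]
      exact ((Phase.iset v _ (by norm_num) (by norm_num) _).trans
        (Phase.iset v _ (by norm_num) (by norm_num) _)).trans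
        (Phase.iset v _ (by norm_num) (by norm_num) _)
    · intro m g h1 h2; omega
    · rw [r17, r19]
      intro hlt
      obtain ⟨g1, g2, -⟩ := l.good 0 le_rfl hlt
      exact up0 _ _ _ g1 g2 le_rfl
    · rw [r17]
      intro hlt
      obtain ⟨g1, g2, -⟩ := l.good 0 le_rfl hlt
      exact up0 _ _ _ g1 g2 (by omega)
    · rw [r17, r20]
      intro hlt j k hj hk hjk
      obtain ⟨g1, g2, -⟩ := l.good 0 le_rfl hlt
      exact ⟨by omega, fun i h4 h5 => by omega⟩
  · rw [r17, r19, r20]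
    omega

end

/-! ### Moving a triangle around the polygon -/

/-- A triangle whose area is not smaller than that of any triangle rooted at vertex 0, and does not
increase if a corner moves back. -/
structure Bounded (n : ℤ) (V : ℤ → Point) (M : ℝ) (A B C : ℤ) : Prop where
  zero : 0 ≤ A
  lt₁ : A < B
  lt₂ : B < C
  lt₃ : C < n
  back₁ : far (V B) (V C) (V (A - 1)) ≤ far (V B) (V C) (V A)
  back₂ : far (V C) (V A) (V (B - 1)) ≤ far (V C) (V A) (V B)
  back₃ : far (V A) (V B) (V (C - 1)) ≤ far (V A) (V B) (V C)
  large : M ≤ far (V A) (V B) (V C)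
  best : ∀ b c, 0 ≤ b → b ≤ c → c ≤ n → far (V 0) (V b) (V c) ≤ M

namespace Bounded
variable {n : ℤ} {V : ℤ → Point} {M : ℝ} {A B C : ℤ}

theorem pos (g : Bounded n V M A B C) (h : ConvSeq n V) : 0 < far (V A) (V B) (V C) := by
  obtain ⟨g0, g1, g2, g3, -⟩ := g
  exact h.pos _ _ _ g1 g2 (by omega)

/-- A step forward that is not a descent remains one when the chord moves clockwise. Hence a corner
that cannot gain by moving back keeps this property while the others move forward. -/
theorem back_step (h : ConvSeq n V) {i j k j' k' : ℤ} (hj : i - n ≤ j) (hjj : j ≤ j')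
    (hkk : k ≤ k') (hjk : j < k) (hjk' : j' < k') (hk : k' < i)
    (hle : far (V j) (V k) (V (i - 1)) ≤ far (V j) (V k) (V i)) :
    far (V j') (V k') (V (i - 1)) ≤ far (V j') (V k') (V i) := by
  have := h.far_step_le (i := i - 1) (j := j) (k := k) (j' := j') (k' := k') (by omega) hjj hkk hjk
    hjk' (by omega)
  rw [sub_add_cancel] at this
  exact this hle

theorem step₁ (g : Bounded n V M A B C) (h : ConvSeq n V)
    (hlt : far (V B) (V C) (V A) < far (V B) (V C) (V (A + 1))) : Bounded n V M (A + 1) B C := by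
  have p := g.pos h
  obtain ⟨g0, g1, g2, g3, g4, g5, g6, g7, g8⟩ := g
  rw [far_rotate] at p g7
  have hAB : A + 1 < B := by
    rcases (show A + 1 ≤ B by omega).eq_or_lt with e | e
    · rw [e, far_self_outer] at hlt; linarith
    · exact e
  refine ⟨by omega, hAB, g2, g3, ?_, ?_, ?_, ?_, g8⟩
  · rw [add_sub_cancel_right]; exact hlt.le
  · have := back_step h (i := B) (j := C - n) (k := A) (j' := C - n) (k' := A + 1) (by omega) le_rfl
      (by omega) (by omega) (by omega) (by omega)
    rw [h.per_neg] at this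
    exact this g5
  · exact back_step h (by omega) (by omega) le_rfl g1 hAB g2 g6
  · rw [far_rotate]; linarith

theorem step₂ (g : Bounded n V M A B C) (h : ConvSeq n V)
    (hlt : far (V C) (V A) (V B) < far (V C) (V A) (V (B + 1))) : Bounded n V M A (B + 1) C := by
  have p := g.pos h
  obtain ⟨g0, g1, g2, g3, g4, g5, g6, g7, g8⟩ := g
  rw [← far_rotate] at p g7
  have hBC : B + 1 < C := by
    rcases (show B + 1 ≤ C by omega).eq_or_lt with e | e
    · rw [e, far_self_outer] at hlt; linarith
    · exact e
  refine ⟨g0, by omega, hBC, g3, ?_, ?_, ?_, ?_, g8⟩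
  · have := back_step h (i := A + n) (j := B) (k := C) (j' := B + 1) (k' := C) (by omega) (by omega)
      le_rfl g2 hBC (by omega)
    rw [h.per, show A + n - 1 = A - 1 + n by ring, h.per] at this
    exact this g4
  · rw [add_sub_cancel_right]; exact hlt.le
  · exact back_step h (by omega) le_rfl (by omega) g1 (by omega) hBC g6
  · rw [← far_rotate]; linarith

theorem step₃ (g : Bounded n V M A B C) (h : ConvSeq n V)
    (hlt : far (V A) (V B) (V C) < far (V A) (V B) (V (C + 1))) : Bounded n V M A B (C + 1) := by
  obtain ⟨g0, g1, g2, g3, g4, g5, g6, g7, g8⟩ := g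
  -- At `n` the corner would be at vertex 0, and the triangle rooted there would be larger than the
  -- largest one.
  have hCn : C + 1 < n := by
    rcases (show C + 1 ≤ n by omega).eq_or_lt with e | e
    · have := h.per 0
      rw [zero_add] at this
      rw [e, this, ← far_rotate (V 0) (V A) (V B)] at hlt
      have := g8 A B g0 g1.le (by omega)
      linarith
    · exact e
  refine ⟨g0, g1, by omega, hCn, ?_, ?_, ?_, by linarith, g8⟩
  · have := back_step h (i := A + n) (j := B) (k := C) (j' := B) (k' := C + 1) (by omega) le_rfl
      (by omega) g2 (by omega) (by omega)
    rw [h.per, show A + n - 1 = A - 1 + n by ring, h.per] at this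
    exact this g4
  · have := back_step h (i := B) (j := C - n) (k := A) (j' := C + 1 - n) (k' := A) (by omega)
      (by omega) le_rfl (by omega) (by omega) g1
    rw [h.per_neg, h.per_neg] at this
    exact this g5
  · rw [add_sub_cancel_right]; exact hlt.le

end Bounded

/-- A triangle that moves in direction `d`. -/
def Turning (n : ℤ) (V : ℤ → Point) (M : ℝ) (d A B C : ℤ) : Prop :=
  (d = 1 ∧ Bounded n V M A B C) ∨ (d = -1 ∧ Bounded n (ConvSeq.mirror V) M (-A) (n - C) (n - B))

namespace Turning
variable {n : ℤ} {V : ℤ → Point} {M : ℝ} {d A B C : ℤ}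

/-- In the mirror image the triangle `A B C` becomes `-A`, `n - C`, `n - B`. The shift by `n` keeps
the corners in increasing order within one period, and the corners `B` and `C` exchange their roles.
-/
theorem mirror₁ (h : ConvSeq n V) (B C x y : ℤ) (hy : y = -x) :
    far (ConvSeq.mirror V (n - C)) (ConvSeq.mirror V (n - B)) (ConvSeq.mirror V x) = far (V B) (V C) (V y) := by
  rw [ConvSeq.far_mirror, neg_sub, neg_sub, h.per_neg, h.per_neg, hy]

theorem mirror₂ (h : ConvSeq n V) (A B x y : ℤ) (hy : y = n - x) :
    far (ConvSeq.mirror V (n - B)) (ConvSeq.mirror V (-A)) (ConvSeq.mirror V x) = far (V A) (V B) (V y) := by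
  rw [ConvSeq.far_mirror, neg_sub, neg_neg, h.per_neg, hy, ← h.per (-x)]
  congr 2; ring

theorem mirror₃ (h : ConvSeq n V) (A C x y : ℤ) (hy : y = n - x) :
    far (ConvSeq.mirror V (-A)) (ConvSeq.mirror V (n - C)) (ConvSeq.mirror V x) = far (V C) (V A) (V y) := by
  rw [ConvSeq.far_mirror, neg_sub, neg_neg, h.per_neg, hy, ← h.per (-x)]
  congr 2; ring

theorem sq (t : Turning n V M d A B C) : d * d = 1 := by
  rcases t with ⟨rfl, -⟩ | ⟨rfl, -⟩ <;> norm_num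

theorem bound (t : Turning n V M d A B C) :
    -(3 * n) ≤ d * (A + B + C) ∧ d * (A + B + C) ≤ 3 * n := by
  rcases t with ⟨rfl, ⟨_, _, _, _, _, _, _, _, _⟩⟩ | ⟨rfl, ⟨_, _, _, _, _, _, _, _, _⟩⟩ <;>
    constructor <;> omega

theorem step₁ (t : Turning n V M d A B C) (h : ConvSeq n V)
    (hlt : far (V B) (V C) (V A) < far (V B) (V C) (V (A + d))) : Turning n V M d (A + d) B C := by
  rcases t with ⟨rfl, g⟩ | ⟨rfl, g⟩
  · exact .inl ⟨rfl, g.step₁ h hlt⟩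
  · rw [← mirror₁ h B C (-A) A (by ring), ← mirror₁ h B C (-A + 1) _ (by ring)] at hlt
    have := g.step₁ h.mirror_conv hlt
    rw [show -A + 1 = -(A + -1) by ring] at this
    exact .inr ⟨rfl, this⟩

theorem step₂ (t : Turning n V M d A B C) (h : ConvSeq n V)
    (hlt : far (V C) (V A) (V B) < far (V C) (V A) (V (B + d))) : Turning n V M d A (B + d) C := by
  rcases t with ⟨rfl, g⟩ | ⟨rfl, g⟩
  · exact .inl ⟨rfl, g.step₂ h hlt⟩
  · rw [← mirror₃ h A C (n - B) B (by ring), ← mirror₃ h A C (n - B + 1) _ (by ring)] at hlt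
    have := g.step₃ h.mirror_conv hlt
    rw [show n - B + 1 = n - (B + -1) by ring] at this
    exact .inr ⟨rfl, this⟩

theorem step₃ (t : Turning n V M d A B C) (h : ConvSeq n V)
    (hlt : far (V A) (V B) (V C) < far (V A) (V B) (V (C + d))) : Turning n V M d A B (C + d) := by
  rcases t with ⟨rfl, g⟩ | ⟨rfl, g⟩
  · exact .inl ⟨rfl, g.step₃ h hlt⟩
  · rw [← mirror₂ h A B (n - C) C (by ring), ← mirror₂ h A B (n - C + 1) _ (by ring)] at hlt
    have := g.step₂ h.mirror_conv hlt
    rw [show n - C + 1 = n - (C + -1) by ring] at this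
    exact .inr ⟨rfl, this⟩

/-- Neither `B` nor `C` of a largest rooted triangle can improve in any direction. The direction is
chosen such that `A` cannot gain by moving the other way; in the forward case this is
quasi-concavity around vertex 0. -/
theorem start (h : ConvSeq n V) (hB : 1 ≤ B) (hBC : B < C) (hC : C < n)
    (best : ∀ b c, 0 ≤ b → b ≤ c → c ≤ n → far (V 0) (V b) (V c) ≤ far (V 0) (V B) (V C))
    (hd : (d = 1 ∧ far (V B) (V C) (V 0) < far (V B) (V C) (V 1)) ∨
      (d = -1 ∧ ¬ far (V B) (V C) (V 0) < far (V B) (V C) (V 1))) :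
    Turning n V (far (V 0) (V B) (V C)) d 0 B C := by
  rcases hd with ⟨rfl, hlt⟩ | ⟨rfl, hlt⟩
  · refine .inl ⟨rfl, le_rfl, by omega, hBC, hC, ?_, ?_, ?_, le_rfl, best⟩
    · have q := h.quasi hBC (x := 0 - 1 + n) (y := 0 + n) (z := 1 + n) (by omega) (by omega)
        (by omega) (by omega)
      rw [h.per, h.per, h.per] at q
      rcases q with q | q <;> linarith
    · rw [far_rotate, far_rotate (V C)]
      exact best _ _ (by omega) (by omega) (by omega)
    · exact best _ _ (by omega) (by omega) (by omega)
  · have e0 := mirror₁ h B C (-0) 0 (by ring)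
    have e1 := mirror₁ h B C (-0 - 1) 1 (by ring)
    have e2 := mirror₂ h 0 B (n - C) C (by ring)
    have e3 := mirror₂ h 0 B (n - C - 1) (C + 1) (by ring)
    have e4 := mirror₃ h 0 C (n - B) B (by ring)
    have e5 := mirror₃ h 0 C (n - B - 1) (B + 1) (by ring)
    refine .inr ⟨rfl, by omega, by omega, by omega, by omega, ?_, ?_, ?_, ?_, ?_⟩
    · rw [e0, e1]; exact not_lt.1 hlt
    · rw [e2, e3]; exact best _ _ (by omega) (by omega) (by omega)
    · rw [e4, e5, far_rotate, far_rotate (V C)]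
      exact best _ _ (by omega) (by omega) (by omega)
    · rw [e4, far_rotate (V C)]
    · intro b c hb hbc hc
      have := best (n - c) (n - b) (by omega) (by omega) (by omega)
      rw [ConvSeq.far_mirror, ← h.per (-b), ← h.per (-c), far_rotate, neg_zero]
      rwa [show -b + n = n - b by ring, show -c + n = n - c by ring]

/-- The invariant excludes gains against the direction of movement, the three halting conditions
exclude gains along it. -/
theorem finish (t : Turning n V M d A B C) (h : ConvSeq n V)
    (h₁ : ¬ far (V B) (V C) (V A) < far (V B) (V C) (V (A + d)))
    (h₂ : ¬ far (V C) (V A) (V B) < far (V C) (V A) (V (B + d)))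
    (h₃ : ¬ far (V A) (V B) (V C) < far (V A) (V B) (V (C + d))) :
    A < B ∧ B < C ∧ C < A + n ∧
    (far (V B) (V C) (V (A - 1)) ≤ far (V B) (V C) (V A) ∧
      far (V B) (V C) (V (A + 1)) ≤ far (V B) (V C) (V A)) ∧
    (far (V C) (V A) (V (B - 1)) ≤ far (V C) (V A) (V B) ∧
      far (V C) (V A) (V (B + 1)) ≤ far (V C) (V A) (V B)) ∧
    (far (V A) (V B) (V (C - 1)) ≤ far (V A) (V B) (V C) ∧
      far (V A) (V B) (V (C + 1)) ≤ far (V A) (V B) (V C)) := by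
  rcases t with ⟨rfl, g⟩ | ⟨rfl, g⟩
  · obtain ⟨g0, g1, g2, g3, g4, g5, g6, g7, g8⟩ := g
    exact ⟨g1, g2, by omega, ⟨g4, not_lt.1 h₁⟩, ⟨g5, not_lt.1 h₂⟩, ⟨g6, not_lt.1 h₃⟩⟩
  · obtain ⟨g0, g1, g2, g3, g4, g5, g6, g7, g8⟩ := g
    rw [mirror₁ h B C (-A) A (by ring), mirror₁ h B C (-A - 1) (A + 1) (by ring)] at g4
    rw [mirror₂ h A B (n - C) C (by ring), mirror₂ h A B (n - C - 1) (C + 1) (by ring)] at g5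
    rw [mirror₃ h A C (n - B) B (by ring), mirror₃ h A C (n - B - 1) (B + 1) (by ring)] at g6
    exact ⟨by omega, by omega, by omega, ⟨not_lt.1 h₁, g4⟩, ⟨not_lt.1 h₂, g6⟩, ⟨not_lt.1 h₃, g5⟩⟩

end Turning

theorem allStable_of_local {n : ℕ} {v : Fin n → Point} (h : ConvSeq n (vert v)) {A B C : ℤ}
    (h₁ : A < B) (h₂ : B < C) (h₃ : C < A + n)
    (m₁ : far (vert v B) (vert v C) (vert v (A - 1)) ≤ far (vert v B) (vert v C) (vert v A) ∧
      far (vert v B) (vert v C) (vert v (A + 1)) ≤ far (vert v B) (vert v C) (vert v A))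
    (m₂ : far (vert v C) (vert v A) (vert v (B - 1)) ≤ far (vert v C) (vert v A) (vert v B) ∧
      far (vert v C) (vert v A) (vert v (B + 1)) ≤ far (vert v C) (vert v A) (vert v B))
    (m₃ : far (vert v A) (vert v B) (vert v (C - 1)) ≤ far (vert v A) (vert v B) (vert v C) ∧
      far (vert v A) (vert v B) (vert v (C + 1)) ≤ far (vert v A) (vert v B) (vert v C)) :
    AllStable v (vert v A) (vert v B) (vert v C) := by
  have q₁ := h.le_of_local (j := B) (k := C) (m := A + n) h₂ (by omega) (by omega)
    (by rw [show A + n + 1 = A + 1 + n by ring, h.per, h.per]; exact m₁.2)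
    (.inr (by rw [show A + n - 1 = A - 1 + n by ring, h.per, h.per]; exact m₁.1))
  have q₂ := h.le_of_local (j := C - n) (k := A) (m := B) (by omega) (by omega) (by omega)
    (by rw [h.per_neg]; exact m₂.2) (.inr (by rw [h.per_neg]; exact m₂.1))
  have q₃ := h.le_of_local h₁ h₂.le h₃ m₃.2 (.inr m₃.1)
  rw [h.per] at q₁
  rw [h.per_neg] at q₂
  have s := stab_of_far (a := A) (b := B) (c := C) (by exact_mod_cast h₁) (by exact_mod_cast h₂)
    (by exact_mod_cast h₃) (by simpa only [curve_int] using h.pos _ _ _ h₁ h₂ h₃)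
    (by simpa only [curve_int] using q₁) (by simpa only [curve_int] using q₂)
    (by simpa only [curve_int] using q₃)
  simpa only [curve_int] using allStable_of_stab h s

/-! ### Running time and result of the search for one 3-stable triangle. -/

section
variable {n : ℕ} {v : Fin n → Point}

/-- The state while the triangle moves in direction `d`. -/
structure Moving (v : Fin n → Point) (M : ℝ) (d : ℤ) (out : List OutTri) (σ : State) : Prop where
  mem : Mem v σ
  out_eq : σ.out = out
  dir : σ.ireg 7 = d
  turn : Turning n (vert v) M d (σ.ireg 4) (σ.ireg 5) (σ.ireg 6)

/-- How far the corners have moved. -/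
def travel (d : ℤ) (σ : State) : ℤ := d * (σ.ireg 4 + σ.ireg 5 + σ.ireg 6)

/-- The step of a corner improves the triangle. -/
def Improves (v : Fin n → Point) (d : ℤ) (b c x : ℕ) (σ : State) : Prop :=
  far (vert v (σ.ireg b)) (vert v (σ.ireg c)) (vert v (σ.ireg x)) <
    far (vert v (σ.ireg b)) (vert v (σ.ireg c)) (vert v (σ.ireg x + d))

variable {M : ℝ} {d : ℤ} {out : List OutTri}

theorem Moving.eval (h : ConvSeq n (vert v)) {σ : State} (s : Moving v M d out σ) (b c x : ℕ) :
    (farther (I b) (I c) (I x + I iDir) (I x)).eval σ ↔ Improves v d b c x σ := by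
  have := h.three
  rw [s.mem.eval_farther (by omega)]
  simp [Improves, s.dir]

theorem Moving.step (h : ConvSeq n (vert v)) {σ : State} (s : Moving v M d out σ) {b c x : ℕ}
    (hx : (b = 5 ∧ c = 6 ∧ x = 4) ∨ (b = 6 ∧ c = 4 ∧ x = 5) ∨ (b = 4 ∧ c = 5 ∧ x = 6))
    (imp : Improves v d b c x σ) : Moving v M d out (σ.iset x (σ.ireg x + d)) ∧
      travel d (σ.iset x (σ.ireg x + d)) = travel d σ + 1 := by
  have sq := s.turn.sq
  obtain ⟨s1, s2, s3, s4⟩ := s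
  unfold Improves at imp
  rcases hx with ⟨rfl, rfl, rfl⟩ | ⟨rfl, rfl, rfl⟩ | ⟨rfl, rfl, rfl⟩
  · refine ⟨⟨s1.iset (by norm_num) _, s2, by simpa using s3, ?_⟩, ?_⟩
    · simpa using s4.step₁ h imp
    · simp only [travel, State.iset_ireg, if_true]; norm_num; linear_combination sq
  · refine ⟨⟨s1.iset (by norm_num) _, s2, by simpa using s3, ?_⟩, ?_⟩
    · simpa using s4.step₂ h imp
    · simp only [travel, State.iset_ireg, if_true]; norm_num; linear_combination sq
  · refine ⟨⟨s1.iset (by norm_num) _, s2, by simpa using s3, ?_⟩, ?_⟩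
    · simpa using s4.step₃ h imp
    · simp only [travel, State.iset_ireg, if_true]; norm_num; linear_combination sq

theorem Moving.travel_le {σ : State} (s : Moving v M d out σ) : travel d σ ≤ 3 * n := s.turn.bound.2

/-- A pass of one corner. -/
theorem pass_spec (h : ConvSeq n (vert v)) {σ : State} (s : Moving v M d out σ) {b c x : ℕ}
    (hx : (b = 5 ∧ c = 6 ∧ x = 4) ∨ (b = 6 ∧ c = 4 ∧ x = 5) ∨ (b = 4 ∧ c = 5 ∧ x = 6)) {B : ℕ}
    (hB : 150 * (3 * n - travel d σ) + 150 ≤ (B : ℤ)) :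
    Runs (.loop (farther (I b) (I c) (I x + I iDir) (I x)) (.iset x (I x + I iDir))) σ B
      (fun p σ' => Moving v M d out σ' ∧ ¬ Improves v d b c x σ' ∧
        (σ' = σ ∨ travel d σ < travel d σ') ∧
        (B : ℤ) ≤ p + 150 * (travel d σ' - travel d σ) + 150) := by
  refine Runs.loop_free (fun p σ' => Moving v M d out σ' ∧ (σ' = σ ∨ travel d σ < travel d σ') ∧
    (B : ℤ) ≤ p + 150 * (travel d σ' - travel d σ)) 150 rfl (by
      show (farther (I b) (I c) (I x + I iDir) (I x)).cost + 1 + 4 ≤ 150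
      rcases hx with ⟨rfl, rfl, rfl⟩ | ⟨rfl, rfl, rfl⟩ | ⟨rfl, rfl, rfl⟩ <;> decide)
    ?_ ?_ ⟨s, .inl rfl, by omega⟩
  · rintro p σ₁ ⟨s₁, t₁, b₁⟩ hb
    rw [s₁.eval h] at hb
    obtain ⟨s₂, t₂⟩ := s₁.step h hx hb
    have e : Cmd.run (.iset x (I x + I iDir)) σ₁ = σ₁.iset x (σ₁.ireg x + d) := by
      rw [← s₁.dir]; rfl
    have le := s₂.travel_le
    rw [e]
    refine ⟨p - 150, by omega, s₂, .inr ?_, by omega⟩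
    rcases t₁ with rfl | t₁ <;> omega
  · rintro p σ₁ ⟨s₁, t₁, b₁⟩ hb
    rw [s₁.eval h] at hb
    have le := s₁.travel_le
    exact ⟨p - 150, by omega, s₁, hb, t₁, by omega⟩

/-- If `B` or `C` could improve beforehand, at least one corner moves during the two passes. Each
repetition is therefore paid by the distance travelled. -/
theorem adjustBC_spec (h : ConvSeq n (vert v)) {σ : State} (s : Moving v M d out σ) {B : ℕ}
    (hB : 150 * (3 * n - travel d σ) + 300 ≤ (B : ℤ)) :
    Runs adjustBC σ B (fun p σ' => Moving v M d out σ' ∧ travel d σ ≤ travel d σ' ∧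
      (Improves v d 6 4 5 σ ∨ Improves v d 4 5 6 σ → travel d σ < travel d σ') ∧
      (B : ℤ) ≤ p + 150 * (travel d σ' - travel d σ) + 300) := by
  refine Runs.seq (Runs.mono (pass_spec h s (b := 6) (c := 4) (x := 5) (by simp) (by omega)) ?_)
  rintro p₁ σ₁ ⟨s₁, n₁, t₁, b₁⟩
  have le₁ := s₁.travel_le
  have t₁' : travel d σ ≤ travel d σ₁ := by rcases t₁ with rfl | t₁ <;> omega
  refine Runs.mono (pass_spec h s₁ (b := 4) (c := 5) (x := 6) (by simp) (by omega)) ?_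
  rintro p₂ σ₂ ⟨s₂, n₂, t₂, b₂⟩
  have t₂' : travel d σ₁ ≤ travel d σ₂ := by rcases t₂ with rfl | t₂ <;> omega
  refine ⟨s₂, by omega, fun imp => ?_, by omega⟩
  rcases t₁ with rfl | t₁
  · rcases t₂ with rfl | t₂
    · exact (imp.elim n₁ n₂).elim
    · exact t₂
  · omega

/-- The movement of the triangle. -/
def turnCmd : Cmd :=
  .loop (farther (I iB) (I iC) (I iA + I iDir) (I iA)) (block [
    .iset iA (I iA + I iDir),
    adjustBC,
    .loop (.or (farther (I iC) (I iA) (I iB + I iDir) (I iB))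
        (farther (I iA) (I iB) (I iC + I iDir) (I iC))) adjustBC])

/-- The total distance travelled ranges between `-3n` and `3n`, and every iteration of either loop
increases it. The two bounds in the inner invariant pay for that loop and for the rest of the outer
one. -/
theorem turn_spec (h : ConvSeq n (vert v)) {σ : State} (s : Moving v M d out σ)
    (n₅ : ¬ Improves v d 6 4 5 σ) (n₆ : ¬ Improves v d 4 5 6 σ) :
    Runs turnCmd σ (13000 * n) (fun _ σ' => Moving v M d out σ' ∧ ¬ Improves v d 5 6 4 σ' ∧
      ¬ Improves v d 6 4 5 σ' ∧ ¬ Improves v d 4 5 6 σ') := by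
  have hn := h.three
  refine Runs.loop (fun p σ => Moving v M d out σ ∧ ¬ Improves v d 6 4 5 σ ∧
    ¬ Improves v d 4 5 6 σ ∧ 2000 * (3 * n - travel d σ) + 200 ≤ (p : ℤ)) 150 (by decide) ?_ ?_
    ⟨s, n₅, n₆, ?_⟩
  · rintro p σ ⟨s, -, -, bud⟩ hb
    have hb := (s.eval h 5 6 4).1 hb
    obtain ⟨s₁, t₁⟩ := s.step h (by simp) hb
    have le₁ := s₁.travel_le
    refine ⟨p - 150, by omega, ?_⟩
    refine Runs.split 1 (by decide) (by decide) ?_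
    refine Runs.step 10 rfl (by decide) (by omega) ?_
    have e : Cmd.run (.iset iA (I iA + I iDir)) σ = σ.iset 4 (σ.ireg 4 + d) := by
      rw [← s.dir]; rfl
    change Runs _ (Cmd.run (.iset iA (I iA + I iDir)) σ) _ _
    rw [e]
    generalize σ.iset 4 (σ.ireg 4 + d) = σ₁ at *
    refine Runs.split 1 (by decide) (by decide) ?_
    refine Runs.mono (adjustBC_spec h s₁ (by omega)) ?_
    rintro p₂ σ₂ ⟨s₂, t₂, -, b₂⟩
    refine Runs.loop (fun p σ => Moving v M d out σ ∧ 1000 * (3 * n - travel d σ) + 500 ≤ (p : ℤ) ∧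
      2000 * (3 * n - travel d σ) + 700 ≤ (p : ℤ)) 300 (by decide) ?_ ?_ ?_
    · rintro q τ ⟨r, b, b'⟩ hc
      have le := r.travel_le
      refine ⟨q - 300, by omega, Runs.mono (adjustBC_spec h r (by omega)) ?_⟩
      rintro q' τ' ⟨r', t', imp, b''⟩
      have := imp (hc.imp (r.eval h 6 4 5).1 (r.eval h 4 5 6).1)
      have le' := r'.travel_le
      exact ⟨r', by omega, by omega⟩
    · rintro q τ ⟨r, b, b'⟩ hc
      have le := r.travel_le
      exact ⟨q - 300, by omega, r, fun i => hc (.inl ((r.eval h 6 4 5).2 i)),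
        fun i => hc (.inr ((r.eval h 4 5 6).2 i)), by omega⟩
    · have := s₂.travel_le
      exact ⟨s₂, by omega, by omega⟩
  · rintro p σ ⟨s, n₅, n₆, bud⟩ hb
    have le := s.travel_le
    exact ⟨0, by omega, s, fun i => hb ((s.eval h 5 6 4).2 i), n₅, n₆⟩
  · have := s.turn.bound.1
    change -(3 * (n : ℤ)) ≤ travel d σ at this
    push_cast
    omega

/-- The largest triangle rooted at vertex 0 whose second corner is before `B`. -/
structure RootInv (v : Fin n → Point) (out : List OutTri) (σ : State) : Prop where
  mem : Mem v σ
  out_eq : σ.out = out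
  low : 1 ≤ σ.ireg 5
  high : σ.ireg 5 + 1 ≤ n
  up : UpTo n (vert v) 0 (σ.ireg 5) (σ.ireg 6)
  nonneg : 0 ≤ σ.rreg 0
  best : ∀ b c, 0 ≤ b → b < σ.ireg 5 → b ≤ c → c ≤ n →
    far (vert v 0) (vert v b) (vert v c) ≤ σ.rreg 0
  first : σ.ireg 5 = 1 → σ.rreg 0 = 0
  found : 1 < σ.ireg 5 → 1 ≤ σ.ireg 8 ∧ σ.ireg 8 < σ.ireg 9 ∧ σ.ireg 9 < n ∧
    σ.rreg 0 = far (vert v 0) (vert v (σ.ireg 8)) (vert v (σ.ireg 9))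

/-- Recording a larger triangle. -/
def recordCmd : Cmd := block [
  when (.rlt (R rBest) (dist 0 (I iB) (I iC))) (block [
    .rset rBest (dist 0 (I iB) (I iC)),
    .iset iB₀ (I iB),
    .iset iC₀ (I iC)]),
  .iset iB (I iB + 1)]

theorem record_run (h : ConvSeq n (vert v)) {σ : State} (i : RootInv v out σ) {B C : ℤ}
    (hB : σ.ireg 5 = B) (hBn : B + 1 < n) (hBC : B < C) (u : UpTo n (vert v) 0 B C)
    (halt : far (vert v 0) (vert v B) (vert v (C + 1)) ≤ far (vert v 0) (vert v B) (vert v C)) :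
    RootInv v out (recordCmd.run (σ.iset 6 C)) ∧ (recordCmd.run (σ.iset 6 C)).ireg 5 = B + 1 ∧
      (recordCmd.run (σ.iset 6 C)).ireg 6 = C := by
  have hn : 0 < n := by have := h.three; omega
  obtain ⟨i1, i2, i3, i4, i5, i6, i7, i0, i8⟩ := i
  rw [hB] at i3 i4 i5 i7 i0 i8
  have u1 := u.1
  obtain ⟨D, hD⟩ : ∃ D, D = far (vert v 0) (vert v B) (vert v C) := ⟨_, rfl⟩
  have pos : 0 < D := by rw [hD]; exact h.pos _ _ _ (by omega) hBC (by omega)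
  have mx : ∀ c, B ≤ c → c ≤ n → far (vert v 0) (vert v B) (vert v c) ≤ D := by
    intro c h1 h2
    rw [hD]
    by_cases hc : C ≤ c
    · exact h.le_of_step (by omega) hBC.le halt hc (by omega)
    · have := u.2 (C - 1) (by omega) (by omega)
      rw [sub_add_cancel] at this
      exact h.le_of_step_back (by omega) hBC (by omega) this.le h1 (by omega)
  obtain ⟨σ₁, q₁⟩ : ∃ σ₁, σ₁ = σ.iset 6 C := ⟨_, rfl⟩
  have m₁ : Mem v σ₁ := by rw [q₁]; exact i1.iset (by norm_num) _
  have ev : ∀ τ, Mem v τ → τ.ireg 5 = B → τ.ireg 6 = C → (dist 0 (I iB) (I iC)).eval τ = D := by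
    intro τ m t5 t6
    rw [m.eval_dist hn]
    simp [t5, t6, hD]
  have c5 : σ₁.ireg 5 = B := by simp [q₁, hB]
  have c6 : σ₁.ireg 6 = C := by simp [q₁]
  obtain ⟨σ₂, q₂⟩ : ∃ σ₂, σ₂ = if σ.rreg 0 < D then ((σ₁.rset 0 D).iset 8 B).iset 9 C else σ₁ :=
    ⟨_, rfl⟩
  have e : recordCmd.run σ₁ = σ₂.iset 5 (B + 1) := by
    have c₂ : σ₂.ireg 5 = B := by rw [q₂]; split_ifs <;> simp [c5]
    have : recordCmd.run σ₁ = Cmd.run (.iset iB (I iB + 1)) (Cmd.run (when (.rlt (R rBest)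
      (dist 0 (I iB) (I iC))) (block [.rset rBest (dist 0 (I iB) (I iC)), .iset iB₀ (I iB),
        .iset iC₀ (I iC)])) σ₁) := rfl
    rw [this]
    have hc : (BExp.rlt (R rBest) (dist 0 (I iB) (I iC))).eval σ₁ ↔ σ.rreg 0 < D := by
      rw [BExp.eval_rlt, ev σ₁ m₁ c5 c6, q₁]; rfl
    have e₂ : Cmd.run (when (.rlt (R rBest) (dist 0 (I iB) (I iC))) (block [.rset rBest
        (dist 0 (I iB) (I iC)), .iset iB₀ (I iB), .iset iC₀ (I iC)])) σ₁ = σ₂ := by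
      rw [q₂]
      by_cases hlt : σ.rreg 0 < D
      · rw [when, Cmd.run_ite_pos (hc.2 hlt), if_pos hlt]
        change ((σ₁.rset 0 ((dist 0 (I iB) (I iC)).eval σ₁)).iset 8 (σ₁.ireg 5)).iset 9
          (((σ₁.rset 0 ((dist 0 (I iB) (I iC)).eval σ₁)).iset 8 (σ₁.ireg 5)).ireg 6) = _
        rw [ev σ₁ m₁ c5 c6, c5, State.iset_ireg, if_neg (by norm_num)]
        rw [show (σ₁.rset 0 D).ireg 6 = C from c6]
      · rw [when, Cmd.run_ite_neg (mt hc.1 hlt), if_neg hlt]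
        rfl
    rw [e₂, ← c₂]
    rfl
  rw [← q₁, e]
  have r₂ : σ₂.rreg 0 = max (σ.rreg 0) D := by
    rw [q₂]
    split_ifs with hlt
    · simp [max_eq_right hlt.le]
    · simp [q₁, max_eq_left (not_lt.1 hlt)]
  have m₂ : Mem v σ₂ := by
    rw [q₂]
    split_ifs
    · exact ((m₁.rset _ _).iset (by norm_num) _).iset (by norm_num) _
    · exact m₁
  have o₂ : σ₂.out = out := by rw [q₂, q₁, ← i2]; split_ifs <;> rfl
  have d6 : σ₂.ireg 6 = C := by rw [q₂]; split_ifs <;> simp [c6]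
  refine ⟨⟨m₂.iset (by norm_num) _, o₂, ?_, ?_, ?_, ?_, ?_, ?_, ?_⟩, by simp, by simp [d6]⟩
  · simp; omega
  · simp; omega
  · simp only [State.iset_ireg]
    norm_num
    rw [d6]
    exact u.next h le_rfl (by omega) (by omega) (by omega)
  · rw [State.iset_rreg, r₂]; exact le_max_of_le_left i6
  · intro b c h1 h2 h3 h4
    rw [State.iset_rreg, r₂]
    have h2 : b < B + 1 := by simpa using h2
    by_cases hb : b = B
    · subst hb; exact le_max_of_le_right (mx c h3 h4)
    · exact le_max_of_le_left (i7 b c h1 (by omega) h3 h4)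
  · intro h1
    have : B + 1 = 1 := by simpa using h1
    omega
  · intro _
    have s8 : (σ₂.iset 5 (B + 1)).ireg 8 = σ₂.ireg 8 := by simp
    have s9 : (σ₂.iset 5 (B + 1)).ireg 9 = σ₂.ireg 9 := by simp
    rw [s8, s9, State.iset_rreg, r₂]
    by_cases hlt : σ.rreg 0 < D
    · rw [if_pos hlt] at q₂
      have e8 : σ₂.ireg 8 = B := by simp [q₂]
      have e9 : σ₂.ireg 9 = C := by simp [q₂]
      rw [e8, e9, max_eq_right hlt.le]
      exact ⟨i3, hBC, by omega, hD⟩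
    · rw [if_neg hlt] at q₂
      have e8 : σ₂.ireg 8 = σ.ireg 8 := by simp [q₂, q₁]
      have e9 : σ₂.ireg 9 = σ.ireg 9 := by simp [q₂, q₁]
      rw [e8, e9, max_eq_left (not_lt.1 hlt)]
      refine i8 ?_
      by_contra hB1
      refine hlt (lt_of_le_of_lt ?_ pos)
      exact (i0 (by omega)).le

end

section
variable {n : ℕ} {v : Fin n → Point} {out : List OutTri}

/-- The search for the largest triangle rooted at vertex 0. -/
def rootLoop : Cmd :=
  .loop (.ilt (I iB) (I iN - 1)) (block [
    when (ile (I iC) (I iB)) (.iset iC (I iB + 1)),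
    .loop (farther 0 (I iB) (I iC + 1) (I iC)) (.iset iC (I iC + 1)),
    when (.rlt (R rBest) (dist 0 (I iB) (I iC))) (block [
      .rset rBest (dist 0 (I iB) (I iC)),
      .iset iB₀ (I iB),
      .iset iC₀ (I iC)]),
    .iset iB (I iB + 1)])

/-- The vertex farthest from the chord of vertex 0 and `B` moves clockwise with `B`, so one pointer
`C` finds the largest rooted triangle in linear time. -/
theorem rootLoop_spec (h : ConvSeq n (vert v)) {σ : State} (i : RootInv v out σ)
    (h₅ : σ.ireg 5 = 1) (h₆ : σ.ireg 6 = 2) :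
    Runs rootLoop σ (1000 * n) (fun _ σ' => RootInv v out σ' ∧ σ'.ireg 5 + 1 = n) := by
  have hn := h.three
  refine Runs.loop (fun p σ => RootInv v out σ ∧ σ.ireg 6 ≤ n ∧ 0 ≤ σ.ireg 6 ∧
    600 * (n - σ.ireg 5) + 300 * (n - σ.ireg 6) ≤ (p : ℤ)) 10 (by decide) ?_ ?_
    ⟨i, by omega, by omega, by rw [h₅, h₆]; push_cast; omega⟩
  · rintro p σ ⟨i, le, ge, bud⟩ hb
    obtain ⟨B, hB⟩ : ∃ B, B = σ.ireg 5 := ⟨_, rfl⟩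
    have low : 1 ≤ B := hB ▸ i.low
    have hb : B < n - 1 := by
      have : σ.ireg 5 < σ.ireg 0 - 1 := hb
      rw [i.mem.num] at this
      omega
    have up : UpTo n (vert v) 0 B (σ.ireg 6) := hB ▸ i.up
    rw [← hB] at bud
    have up' : UpTo n (vert v) 0 B (max (σ.ireg 6) (B + 1)) := by
      refine ⟨by have := up.1; omega, fun x h1 h2 => ?_⟩
      by_cases hx : x < σ.ireg 6
      · exact up.2 x h1 hx
      · obtain rfl : x = B := by omega
        rw [far_self_right]
        exact h.pos _ _ _ (by omega) (by omega) (by omega)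
    obtain ⟨C, c1, c2, c3⟩ := up'.climb h (by omega) (by omega)
    have c4 := c2.1
    obtain ⟨i', r5, r6⟩ := record_run h i hB.symm (by omega) (by omega) c2 (not_lt.1 c3)
    refine ⟨p - 10, by omega, ?_⟩
    refine Runs.split 1 (by decide) (by decide) ?_
    refine Runs.step 20 rfl (by decide) (by omega) ?_
    change Runs _ (Cmd.run (when (ile (I iC) (I iB)) (.iset iC (I iB + 1))) σ) _ _
    have e : Cmd.run (when (ile (I iC) (I iB)) (.iset iC (I iB + 1))) σ =
        σ.iset 6 (max (σ.ireg 6) (B + 1)) := by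
      rw [when]
      by_cases hc : σ.ireg 6 ≤ B
      · rw [Cmd.run_ite_pos (show (ile (I iC) (I iB)).eval σ from show ¬ σ.ireg 5 < σ.ireg 6 by omega), max_eq_right (by omega), hB]
        rfl
      · rw [Cmd.run_ite_neg (show ¬ (ile (I iC) (I iB)).eval σ from show ¬¬ σ.ireg 5 < σ.ireg 6 by omega), max_eq_left (by omega)]
        exact (σ.iset_self 6).symm
    rw [e]
    refine Runs.split 1 (by decide) (by decide) ?_
    refine Runs.scan (x := 6) (fun y => far (vert v 0) (vert v B) (vert v y) <
      far (vert v 0) (vert v B) (vert v (y + 1))) 100 (by decide) ?_ (a' := C) ?_ ?_ c3 ?_ ?_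
    · intro y
      rw [State.iset_iset, (i.mem.iset (by norm_num) y).eval_farther (by omega)]
      simp [hB]
    · simp; omega
    · simp only [State.iset_ireg, if_true]
      exact fun y h1 h2 => c2.2 y (by omega) h2
    · simp only [State.iset_ireg, if_true]
      omega
    · simp only [State.iset_ireg, if_true, State.iset_iset]
      intro q hq
      refine Runs.step 250 rfl (by decide) (by omega) ?_
      change RootInv v out (recordCmd.run (σ.iset 6 C)) ∧
        (recordCmd.run (σ.iset 6 C)).ireg 6 ≤ n ∧ 0 ≤ (recordCmd.run (σ.iset 6 C)).ireg 6 ∧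
        600 * (n - (recordCmd.run (σ.iset 6 C)).ireg 5) +
          300 * (n - (recordCmd.run (σ.iset 6 C)).ireg 6) ≤ _
      rw [r5, r6]
      exact ⟨i', by omega, by omega, by omega⟩
  · rintro p σ ⟨i, le, ge, bud⟩ hb
    have hb : ¬ σ.ireg 5 < σ.ireg 0 - 1 := hb
    rw [i.mem.num] at hb
    have := i.high
    exact ⟨0, by omega, i, by omega⟩

theorem findOne_spec (h : ConvSeq n (vert v)) {σ : State} (m : Mem v σ) :
    Runs findOne σ (20000 * n) (fun _ σ' => Mem v σ' ∧ σ'.out = σ.out ∧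
      (0 ≤ σ'.ireg 1 ∧ σ'.ireg 1 < n) ∧ (0 ≤ σ'.ireg 2 ∧ σ'.ireg 2 < n) ∧
      (0 ≤ σ'.ireg 3 ∧ σ'.ireg 3 < n) ∧
      AllStable v (vert v (σ'.ireg 1)) (vert v (σ'.ireg 2)) (vert v (σ'.ireg 3))) := by
  have hn := h.three
  refine Runs.split 3 (by decide) (by decide) ?_
  refine Runs.step 20 rfl (by decide) (by omega) ?_
  change Runs _ (((σ.rset 0 ((0 : ℤ) : ℝ)).iset 6 2).iset 5 1) _ _
  refine Runs.split 1 (by decide) (by decide) ?_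
  refine Runs.call (rootLoop_spec (out := σ.out) h ⟨((m.rset 0 _).iset (by norm_num) _).iset
    (by norm_num) _, rfl, by simp, by simp; omega, ⟨by simp; omega, ?_⟩, by simp, ?_, by simp,
    by simp⟩ (by simp) (by simp)) (15000 * n) (by omega) ?_
  · simp only [State.iset_ireg]
    norm_num
    intro x h1 h2
    obtain rfl : x = 1 := by omega
    rw [far_self_right]
    exact h.pos _ _ _ (by omega) (by omega) (by omega)
  · intro b c h1 h2 _ _
    obtain rfl : b = 0 := by simp at h2; omega
    rw [far_self_left]
    simp
  rintro σ₁ ⟨⟨i1, i2, i3, i4, i5, i6, i7, -, i8⟩, hlast⟩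
  obtain ⟨g1, g2, g3, g4⟩ := i8 (by omega)
  obtain ⟨B, hB⟩ : ∃ B, B = σ₁.ireg 8 := ⟨_, rfl⟩
  obtain ⟨C, hC⟩ : ∃ C, C = σ₁.ireg 9 := ⟨_, rfl⟩
  rw [← hB] at g1 g2
  rw [← hC] at g2 g3
  rw [← hB, ← hC] at g4
  have best : ∀ b c : ℤ, 0 ≤ b → b ≤ c → c ≤ n →
      far (vert v 0) (vert v b) (vert v c) ≤ far (vert v 0) (vert v B) (vert v C) := by
    intro b c h1 h2 h3
    -- The loop ends at `B = n - 1`. The remaining rooted triangles are degenerate and have area 0.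
    by_cases hb : b + 1 < n
    · rw [← g4]; exact i7 b c h1 (by omega) h2 h3
    · refine le_trans (le_of_eq ?_) (g4 ▸ i6)
      rcases h2.eq_or_lt with rfl | h2
      · exact far_self_right _ _
      · obtain rfl : c = 0 + n := by omega
        rw [h.per, far_self_outer]
  refine Runs.split 3 (by decide) (by decide) ?_
  refine Runs.step 20 rfl (by decide) (by omega) ?_
  obtain ⟨σ₂, q₂⟩ : ∃ σ₂, σ₂ = ((σ₁.iset 4 0).iset 5 B).iset 6 C := ⟨_, rfl⟩
  have e : Cmd.run (block [.iset iA 0, .iset iB (I iB₀), .iset iC (I iC₀)]) σ₁ = σ₂ := by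
    rw [q₂, hB, hC]; rfl
  change Runs _ (Cmd.run (block [.iset iA 0, .iset iB (I iB₀), .iset iC (I iC₀)]) σ₁) _ _
  rw [e]
  have m₂ : Mem v σ₂ := by
    rw [q₂]
    exact ((i1.iset (by norm_num) _).iset (by norm_num) _).iset (by norm_num) _
  have t4 : σ₂.ireg 4 = 0 := by simp [q₂]
  have t5 : σ₂.ireg 5 = B := by simp [q₂]
  have t6 : σ₂.ireg 6 = C := by simp [q₂]
  have o₂ : σ₂.out = σ.out := by rw [q₂, ← i2]; rfl
  refine Runs.split 1 (by decide) (by decide) ?_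
  refine Runs.step 100 rfl (by decide) (by omega) ?_
  obtain ⟨d, σ₃, q₃, hd, run⟩ : ∃ d σ₃, σ₃ = σ₂.iset 7 d ∧
      ((d = 1 ∧ far (vert v B) (vert v C) (vert v 0) < far (vert v B) (vert v C) (vert v 1)) ∨
      (d = -1 ∧ ¬ far (vert v B) (vert v C) (vert v 0) < far (vert v B) (vert v C) (vert v 1))) ∧
      Cmd.run (.ite (farther (I iB) (I iC) (I iA + 1) (I iA)) (.iset iDir 1)
        (.iset iDir (0 - 1))) σ₂ = σ₃ := by
    have hc : (farther (I iB) (I iC) (I iA + 1) (I iA)).eval σ₂ ↔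
        far (vert v B) (vert v C) (vert v 0) < far (vert v B) (vert v C) (vert v 1) := by
      rw [m₂.eval_farther (by omega)]
      simp [t4, t5, t6]
    by_cases hlt : far (vert v B) (vert v C) (vert v 0) < far (vert v B) (vert v C) (vert v 1)
    · exact ⟨1, _, rfl, .inl ⟨rfl, hlt⟩, Cmd.run_ite_pos (hc.2 hlt)⟩
    · exact ⟨-1, _, rfl, .inr ⟨rfl, hlt⟩, Cmd.run_ite_neg (mt hc.1 hlt)⟩
  change Runs _ (Cmd.run (.ite (farther (I iB) (I iC) (I iA + 1) (I iA)) (.iset iDir 1)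
    (.iset iDir (0 - 1))) σ₂) _ _
  rw [run]
  have u4 : σ₃.ireg 4 = 0 := by simp [q₃, t4]
  have u5 : σ₃.ireg 5 = B := by simp [q₃, t5]
  have u6 : σ₃.ireg 6 = C := by simp [q₃, t6]
  have mv : Moving v (far (vert v 0) (vert v B) (vert v C)) d σ.out σ₃ := by
    refine ⟨q₃ ▸ m₂.iset (by norm_num) _, by rw [q₃, ← o₂]; rfl, by simp [q₃], ?_⟩
    rw [u4, u5, u6]
    exact Turning.start h g1 g2 g3 best hd
  have hd' : d = 1 ∨ d = -1 := hd.imp And.left And.left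
  refine Runs.split 1 (by decide) (by decide) ?_
  refine Runs.call (turn_spec h mv ?_ ?_) (1000 * n) (by omega) ?_
  · unfold Improves
    rw [u4, u5, u6, not_lt, far_rotate (vert v C), far_rotate (vert v C)]
    exact best _ _ (by omega) (by omega) (by omega)
  · unfold Improves
    rw [u4, u5, u6, not_lt]
    exact best _ _ (by omega) (by omega) (by omega)
  clear run mv e q₂ q₃
  rintro σ₄ ⟨⟨s1, s2, -, s4⟩, n₁, n₂, n₃⟩
  obtain ⟨l1, l2, l3, f1, f2, f3⟩ := s4.finish h n₁ n₂ n₃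
  have st := allStable_of_local h l1 l2 l3 f1 f2 f3
  refine Runs.step 20 rfl (by decide) (by omega) ?_
  have hn' : (0 : ℤ) < n := by omega
  obtain ⟨σ₅, q₅⟩ : ∃ σ₅, σ₅ = ((σ₄.iset 1 (σ₄.ireg 4 % n)).iset 2 (σ₄.ireg 5 % n)).iset 3
    (σ₄.ireg 6 % n) := ⟨_, rfl⟩
  have e : Cmd.run (block [.iset iR (I iA % I iN), .iset iS (I iB % I iN),
      .iset iT (I iC % I iN)]) σ₄ = σ₅ := by
    rw [q₅, ← s1.num]; rfl
  have red : ∀ x : ℤ, vert v (x % n) = vert v x := fun x => by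
    rw [← h.per_mul (x % n) (x / n), mul_comm, Int.emod_add_mul_ediv]
  have w1 : σ₅.ireg 1 = σ₄.ireg 4 % n := by simp [q₅]
  have w2 : σ₅.ireg 2 = σ₄.ireg 5 % n := by simp [q₅]
  have w3 : σ₅.ireg 3 = σ₄.ireg 6 % n := by simp [q₅]
  have res : Mem v σ₅ ∧ σ₅.out = σ.out ∧ (0 ≤ σ₅.ireg 1 ∧ σ₅.ireg 1 < n) ∧
      (0 ≤ σ₅.ireg 2 ∧ σ₅.ireg 2 < n) ∧ (0 ≤ σ₅.ireg 3 ∧ σ₅.ireg 3 < n) ∧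
      AllStable v (vert v (σ₅.ireg 1)) (vert v (σ₅.ireg 2)) (vert v (σ₅.ireg 3)) := by
    rw [w1, w2, w3, red, red, red]
    refine ⟨?_, by rw [q₅, ← s2]; rfl, ?_, ?_, ?_, st⟩
    · rw [q₅]
      exact ((s1.iset (by norm_num) _).iset (by norm_num) _).iset (by norm_num) _
    all_goals exact ⟨Int.emod_nonneg _ hn'.ne', Int.emod_lt_of_pos _ hn'⟩
  rw [← e] at res
  exact res

end

/-! ### Completeness of the output and the entire algorithm. -/

section
variable {n : ℕ} {v : Fin n → Point}

/-- The visited pairs of vertices, and of edges, have been treated. -/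
structure Treated (v : Fin n → Point) (σ : State) (out : List OutTri) : Prop where
  vertices : ∀ j k, VisAt σ (2 * j) (2 * k) → ∀ X, GenThreeStable v X (vert v j) (vert v k) →
    coords X (vert v j) (vert v k) ∈ out
  edges : ∀ j k b c a, VisAt σ (2 * j + 1) (2 * k + 1) → TwoEdges n (vert v) j k b c a →
    unitOf b = 2 * j + 1 → unitOf c = 2 * k + 1 → coords (curve (vert v) a) (curve (vert v) b) (curve (vert v) c) ∈ out

theorem GenThreeStable.rotate {A B C : Point} (g : GenThreeStable v A B C) :
    GenThreeStable v B C A := ⟨g.1.rotate, g.2.2.1, g.2.2.2, g.2.1⟩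

/-- The visited pair may be a shift of the two corners by a multiple of the period, so the whole
triangle is shifted accordingly; its points do not change. -/
theorem Treated.mem_out (h : ConvSeq n (vert v)) {σ : State} {out : List OutTri}
    (t : Treated v σ out) (vis : Visited n σ) {a b c : ℝ} (s : Stab n (vert v) a b c)
    (seen : Seen n σ b c) (par : unitOf b % 2 = unitOf c % 2)
    (g : GenThreeStable v (curve (vert v) a) (curve (vert v) b) (curve (vert v) c)) :
    coords (curve (vert v) a) (curve (vert v) b) (curve (vert v) c) ∈ out := by
  obtain ⟨z, hz⟩ := seen
  have s := s.shift h z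
  have pb : unitOf (b + z * (n : ℤ)) = unitOf b + 2 * (z * n) := by
    rw [← unitOf_shift]; push_cast; rfl
  have pc : unitOf (c + z * (n : ℤ)) = unitOf c + 2 * (z * n) := by
    rw [← unitOf_shift]; push_cast; rfl
  have par : unitOf (b + z * (n : ℤ)) % 2 = unitOf (c + z * (n : ℤ)) % 2 := by
    rw [pb, pc]; omega
  rw [← h.curve_per_mul a z, ← h.curve_per_mul b z, ← h.curve_per_mul c z] at g ⊢
  clear pb pc
  generalize a + z * (n : ℤ) = a at *
  generalize b + z * (n : ℤ) = b at *
  generalize c + z * (n : ℤ) = c at *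
  rcases Int.emod_two_eq_zero_or_one (unitOf b) with e | e
  · obtain ⟨j, hj⟩ : ∃ j, unitOf b = 2 * j := ⟨unitOf b / 2, by omega⟩
    obtain ⟨k, hk⟩ : ∃ k, unitOf c = 2 * k := ⟨unitOf c / 2, by omega⟩
    rw [hj, hk] at hz
    rw [unitOf_even hj, unitOf_even hk, curve_int, curve_int] at g ⊢
    exact t.vertices j k hz _ g
  · obtain ⟨j, hj⟩ : ∃ j, unitOf b = 2 * j + 1 := ⟨unitOf b / 2, by omega⟩
    obtain ⟨k, hk⟩ : ∃ k, unitOf c = 2 * k + 1 := ⟨unitOf c / 2, by omega⟩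
    rw [hj, hk] at hz
    obtain ⟨m, m1, m2, m3, m4⟩ := id hz
    obtain ⟨g1, g2, g3, g4⟩ := vis.good m m1 m2
    rw [m3, m4] at g2 g3
    obtain ⟨b1, b2⟩ := unitOf_odd hj
    obtain ⟨c1, c2⟩ := unitOf_odd hk
    rw [← h.curve_per a]
    exact t.edges j k b c _ hz ⟨s.rotate h, b1, b2, c1, c2, by omega, by omega⟩ hj hk

/-- Two of the three corners have units of the same parity, and the corresponding pair of units is
visited. The triangle is listed starting from the remaining corner, whence the three rotations. -/
theorem Treated.complete (h : ConvSeq n (vert v)) {σ : State} {out₀ out : List OutTri}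
    (t : Treated v σ out) (ok : VisitOK v out₀ σ) {A B C : Point} (g : GenThreeStable v A B C) :
    coords A B C ∈ out ∨ coords B C A ∈ out ∨ coords C A B ∈ out := by
  obtain ⟨a, rfl⟩ := (mem_boundary h).1 g.1.mem₁
  obtain ⟨b, rfl⟩ := (mem_boundary h).1 g.1.mem₂
  obtain ⟨c, rfl⟩ := (mem_boundary h).1 g.1.mem₃
  obtain ⟨y, z, s⟩ := stab_of_allStable h g.1
  rw [← h.curve_per_mul b y, ← h.curve_per_mul c z] at g ⊢
  generalize b + y * (n : ℤ) = b at *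
  generalize c + z * (n : ℤ) = c at *
  obtain ⟨s1, s2, s3⟩ := ok.complete a b c s
  have pa : unitOf (a + (n : ℤ)) = unitOf a + 2 * n := unitOf_shift a n
  rcases (show unitOf b % 2 = unitOf c % 2 ∨ unitOf c % 2 = unitOf (a + (n : ℤ)) % 2 ∨
    unitOf a % 2 = unitOf b % 2 by omega) with e | e | e
  · exact .inl (t.mem_out h ok.vis s s2 e g)
  · have := t.mem_out h ok.vis (s.rotate h) s3 e
    rw [h.curve_per] at this
    exact .inr (.inl (this g.rotate))
  · have := t.mem_out h ok.vis (s.rotate_back h) s1 e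
    rw [← h.curve_per (c - (n : ℤ)), sub_add_cancel] at this
    exact .inr (.inr (this g.rotate.rotate))

theorem finalStep_spec (h : ConvSeq n (vert v)) {σ : State} (ok : VisitOK v [] σ) :
    Runs finalStep σ (2400000 * n) (fun _ σ' => ListsAll v σ'.out) := by
  refine Runs.split 1 (by decide) (by decide) ?_
  refine Runs.call (vertexPhase_spec h ok.mem ok.vis ok.len) (2100000 * n) (by omega) ?_
  rintro σ₁ ⟨i, hM⟩
  have vis : Visited n σ₁ := ⟨by rw [i.len]; exact ok.vis.len,
    by rw [i.len, i.iarr]; exact ok.vis.good, by rw [i.len, i.iarr]; exact ok.vis.step⟩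
  refine Runs.split 1 (by decide) (by decide) ?_
  refine Runs.call (collectEdgePairs_spec (by exact_mod_cast h.three) vis (i.len ▸ ok.len)) (2000000 * n) (by omega) ?_
  intro σ₂ co
  refine Runs.call (edgePhase_spec h (i.mem.congr (co.ireg 0 (by norm_num)) co.rarr) co.list
    (co.len.trans (i.len ▸ ok.len))) 0 (by omega) ?_
  rintro σ₃ ⟨ph, ls⟩
  have t : Treated v σ σ₃.out := by
    constructor
    · rintro j k ⟨m, m1, m2, m3, m4⟩ X g
      exact ph.keep _ (co.out ▸ i.done m m1 (hM ▸ m2) j k m3 m4 X g)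
    · rintro j k b c a ⟨m, m1, m2, m3, m4⟩ te ub uc
      rw [← i.iarr] at m3 m4
      obtain ⟨e, e1, e2, rfl, rfl⟩ := co.all m m1 (i.len ▸ m2) j k m3 m4
      have st := allStable_of_stab h te.stab
      exact ls e _ e1 e2 ⟨b, c, a, te, rfl⟩ a b c rfl ub uc st.rotate.rotate
  refine ⟨fun T hT => ?_, fun A B C g => t.complete h ok g⟩
  rcases ph.sound T hT with hT | hT
  · rw [co.out] at hT
    rcases i.sound T hT with hT | hT
    · rw [ok.out] at hT
      simp at hT
    · exact hT
  · exact hT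

theorem entireAlgorithm_spec (hv : IsConvexPolygon v) :
    Runs entireAlgorithm (inputState v) (3000000 * n) (fun _ σ => ListsAll v σ.out) := by
  have h := vert_conv hv
  refine Runs.split 1 (by decide) (by decide) ?_
  refine Runs.call (findOne_spec h ⟨rfl, rfl⟩) (2900000 * n) (by omega) ?_
  rintro σ₁ ⟨m, o, ⟨a1, a2⟩, ⟨b1, b2⟩, ⟨c1, c2⟩, st⟩
  refine Runs.split 1 (by decide) (by decide) ?_
  refine Runs.call (visitPairs_spec hv m a1 a2 b1 b2 c1 c2 st) (2500000 * n) (by omega) ?_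
  intro σ₂ ok
  rw [show σ₁.out = [] from o] at ok
  exact (finalStep_spec h ok).budget (by omega)

end

end StableTri

end


theorem mainTheorem4 :
    ∃ c : ℕ, ∀ (n : ℕ) (v : Fin n → StableTri.Point), StableTri.IsConvexPolygon v →
      (∀ r s t : Fin n, StableTri.ThreeStable v (v r) (v s) (v t) →
        ∃ (τ₁ τ₂ : ℕ) (σ₁ σ₂ : StableTri.State),
          StableTri.Exec StableTri.visitPairs (StableTri.inputStateWith v r s t) τ₁ σ₁ ∧
          StableTri.Exec StableTri.finalStep σ₁ τ₂ σ₂ ∧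
          τ₂ ≤ c * n ∧ StableTri.ListsAll v σ₂.out) ∧
      (∃ (τ : ℕ) (σ : StableTri.State),
        StableTri.Exec StableTri.entireAlgorithm (StableTri.inputState v) τ σ ∧
        τ ≤ c * n ∧ StableTri.ListsAll v σ.out) := by
  -- The constant covers the budgets of the entire algorithm; the final step alone stays below it.
  refine ⟨3000000, fun n v hv => ⟨fun r s t hst => ?_, ?_⟩⟩
  · have h := StableTri.vert_conv hv
    have m : StableTri.Mem v (StableTri.inputStateWith v r s t) := ⟨rfl, rfl⟩
    have e₁ : (StableTri.inputStateWith v r s t).ireg 1 = r.val := rfl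
    have e₂ : (StableTri.inputStateWith v r s t).ireg 2 = s.val := rfl
    have e₃ : (StableTri.inputStateWith v r s t).ireg 3 = t.val := rfl
    obtain ⟨τ₁, _, σ₁, x₁, -, ok⟩ := StableTri.visitPairs_spec hv m (by omega) (by omega) (by omega)
      (by omega) (by omega) (by omega) (by
        rw [e₁, e₂, e₃, StableTri.vert_val, StableTri.vert_val, StableTri.vert_val]; exact hst.1)
    obtain ⟨τ₂, _, σ₂, x₂, le, res⟩ := StableTri.finalStep_spec h ok
    exact ⟨τ₁, τ₂, σ₁, σ₂, x₁, x₂, by omega, res⟩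
  · obtain ⟨τ, _, σ, x, le, res⟩ := StableTri.entireAlgorithm_spec hv
    exact ⟨τ, σ, x, by omega, res⟩
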